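/- **Setting.** Let $\Sigma$ be the fan in $N=\mathbb Z^n$ of a projective toric manifold $Y$ (a smooth complete fan carrying a strictly convex integral piecewise linear function), with primitive ray generators $\rho_1,\dots,\rho_d$. Let $s:\mathbb Z^d\to N$, $e_i\mapsto\rho_i$, put $A_1(Y,\mathbb Z)=\ker s$, let $P\subset A_1(Y,\mathbb Z)$ be the monoid of lattice points of the cone of curves of $Y$ (the dual of the nef cone), and let $\pi:\mathbb Z^d\to A_1(Y,\mathbb Z)$ be any splitting. Let $\tilde\varphi:N\to\mathbb Z^d$ be the $\Sigma$-piecewise linear map with $\tilde\varphi(\rho_i)=e_i$, and let $P_\varphi=\{\tilde\varphi(m)+p : m\in N,\ p\in P\}\subset\mathbb Z^d$ (which $(s,\pi)$ identifies with $\{(m,\pi\tilde\varphi(m)+p)\}\subset N\times A_1(Y,\mathbb Z)$); write $z_i=z^{e_i}\in\mathbb C[P_\varphi]$. Let $\sigma_1,\dots,\sigma_\mu$ be an ordering of the maximal cones of $\Sigma$ such that, $\tau_i$ being the intersection of $\sigma_i$ with all $\sigma_j$, $j>i$, with $\dim(\sigma_i\cap\sigma_j)=n-1$, one has: $\tau_i\subset\sigma_j$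 implies $i\le j$. Let $\varphi_i=\prod_{\rho_k\in\tau_i}z_k$ and $\deg\varphi_i=2\dim\tau_i$; thus $\varphi_1=1$. Put $\mathscr R=\mathbb C[P]\otimes\mathbb C[t_i:\deg\varphi_i\ne2]$, $\mathcal I\subset\mathscr R$ the ideal generated by all $z^p$ ($0\ne p\in P$) and all $t_i$, $\mathscr R_k=\mathscr R/\mathcal I^{k+1}$, $\hat{\mathscr R}=\varprojlim\mathscr R_k$, $\mathcal O=\mathbb C[P_\varphi]\otimes\mathbb C[t_i]$, $\mathcal O_k=\mathcal O/\mathcal I^{k+1}\mathcal O$, $f=z_1+\dots+z_d$ and $F=f+\sum_{\deg\varphi_i\neq2}t_i\varphi_i\in\mathcal O$. In this statement rings and modules of series in $u$ over $\hat{\mathscr R}$ are formed order by order in $\mathcal I$: $\hat{\mathscr R}[[u]]$, $\hat{\mathscr R}[u^{-1}]$ and $\hat{\mathscr R}((u))$ denote $\varprojlim\mathscr R_k[[u]]$, $\varprojlim\mathscr R_k[u^{-1}]$ and $\varprojlim\mathscr R_k((u))$, and similarly for $\mathcal O$. Let $\tilde\theta_1,\dots,\tilde\theta_n$ be the relative logarithmic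 derivations $\tilde\theta_iz^a=s(a)_iz^a$ of $\mathcal O$ over $\mathscr R$, and $\theta_j z^a=a_jz^a$ for $1\le j\le d$. Let $$Q_F=\{F,-\}+u\partial=\sum_i(\tilde\theta_i(F)+u\tilde\theta_i)\frac{\partial}{\partial\tilde\theta_i}$$ on the relative logarithmic polyvector fields $\bigwedge^\bullet\langle\tilde\theta_1,\dots,\tilde\theta_n\rangle$ with coefficients in functions; $\mathcal H_F$ and $\mathcal H_{F,\pm}$ are its (total) cohomology with coefficients in $\varprojlim\mathcal O_k[[u]]$ and $\varprojlim\mathcal O_k((u))$ respectively, and $\mathcal H_{f,\pm}$ is the analogous cohomology on the central fibre, with $f$ and coefficients in $(\mathcal O/\mathcal I\mathcal O)((u))$. Let $\Theta^1=\mathrm{Hom}(A_1(Y,\mathbb Z),\hat{\mathscr R})\oplus\bigoplus_i\hat{\mathscr R}\,\partial_{t_i}$ be the module of logarithmic vector fields on the base. The Gauss–Manin connection is $\nabla_v=\tilde v+u^{-1}\tilde v(F)$ for the lift $\tilde v=\sum_j\nu(\pi(e_j))\theta_j+\sum_i\tau_i\partial_{t_i}$ of $v=(\nu,\tau)$. On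 $\mathcal H_{f,\pm}$ the residue $\nabla^{(0)}_\nu$, $\nu\in\mathrm{Hom}(A_1(Y,\mathbb Z),\mathbb C)$, is given by the same formula with $f$ for $F$, and the residue in the directions $\partial_{t_i}$ is $0$. The grading operator $E_F$ is determined by $\deg z_j=2$, $\deg t_i=2-\deg\varphi_i$, $\deg u=2$, $\deg\tilde\theta_i=2$; it commutes with $Q_F$. A *Deligne extension* is a degree-preserving $\mathbb C((u))$-linear map $DE:\mathcal H_{f,\pm}\to\mathcal H_{F,\pm}$ with $DE(\varphi)\equiv\varphi$ modulo $\mathcal I$ and $\nabla_v\circ DE=DE\circ\nabla_v^{(0)}$ for $v\in\mathrm{Hom}(A_1(Y,\mathbb Z),\mathbb C)$ and for $v=\partial_{t_i}$. Given $DE$, let $\mathcal H_{F,-}\subset\mathcal H_{F,\pm}$ be the $\hat{\mathscr R}[u^{-1}]$-submodule generated by $u^{-1}DE(\varphi_1),\dots,u^{-1}DE(\varphi_\mu)$. A *Birkhoff factorization* is a pair of $\mu\times\mu$ matrices, $B\in\mathrm{Id}+u^{-1}\mathrm{Mat}(\hat{\mathscr R}[u^{-1}])$ and $C\in\mathrm{Mat}(\hat{\mathscr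 R}[[u]])$, with $$(DE(\varphi_1),\dots,DE(\varphi_\mu))\,B=(\varphi_1,\dots,\varphi_\mu)\,C=:(\tilde\varphi_1,\dots,\tilde\varphi_\mu).$$ **Proposition.** The natural map $\mathcal H_F\to\mathcal H_{F,\pm}$ is injective, a Deligne extension exists, and every Deligne extension has a Birkhoff factorization. For every Deligne extension and every Birkhoff factorization of it, $\zeta:=\tilde\varphi_1$ is a primitive form, that is: (a) $\zeta\in\mathcal H_F\cap u\mathcal H_{F,-}$; (b) $\nabla_v\zeta$ vanishes in $u\mathcal H_{F,-}/\mathcal H_{F,-}$, i.e. $\nabla_v\zeta\in\mathcal H_{F,-}$, for every $v\in\Theta^1$; (c) $\zeta$ is homogeneous: $E_F\zeta=w\zeta$ for some $w\in\mathbb Z$; (d) the Kodaira–Spencer map $KS:\Theta^1\to\mathcal H_F/u\mathcal H_F$, $KS(v)=u\nabla_v\zeta\bmod u\mathcal H_F$, is an isomorphism of $\hat{\mathscr R}$-modules. -/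

import Mathlib

noncomputable section

/-! ### Inverse limits of Laurent series rings -/

/-- For an ideal `J` of `A`, the ring `lim_k (A / J^(k+1))((u))`: compatible families of formal
Laurent series in `u` with coefficients in the quotients `A / J^(k+1)`. -/
def laurentTowerSubring (A : Type*) [CommRing A] (J : Ideal A) :
    Subring (∀ k : ℕ, LaurentSeries (A ⧸ J ^ (k + 1))) where
  carrier := {x | ∀ k, (x (k + 1)).map
    (Ideal.Quotient.factor (Ideal.pow_le_pow_right (I := J) (Nat.le_succ (k + 1)))) = x k}
  zero_mem' k := by ext; simp
  one_mem' k := by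
    have h := HahnSeries.map_one (Γ := ℤ) (Ideal.Quotient.factor
      (Ideal.pow_le_pow_right (I := J) (Nat.le_succ (k + 1)))).toMonoidWithZeroHom
    exact h
  add_mem' {x y} hx hy k := by
    have h1 := hx k
    have h2 := hy k
    ext j
    have h1 := congrArg (fun z => HahnSeries.coeff z j) h1
    have h2 := congrArg (fun z => HahnSeries.coeff z j) h2
    simp only [HahnSeries.map_coeff, Pi.add_apply, HahnSeries.coeff_add, map_add] at *
    rw [h1, h2]
  neg_mem' {x} hx k := by
    ext j
    have h1 := congrArg (fun z => HahnSeries.coeff z j) (hx k)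
    simp only [HahnSeries.map_coeff, Pi.neg_apply, HahnSeries.coeff_neg, map_neg] at *
    rw [h1]
  mul_mem' {x y} hx hy k := by
    have h := HahnSeries.map_mul (Γ := ℤ) (Ideal.Quotient.factor
      (Ideal.pow_le_pow_right (I := J) (Nat.le_succ (k + 1)))).toNonUnitalRingHom
      (x := x (k + 1)) (y := y (k + 1))
    have h1 := hx k
    have h2 := hy k
    calc _ = _ := h
      _ = x k * y k := by rw [← h1, ← h2]; rfl

/-- The ring `lim_k (A / J^(k+1))((u))`. -/
def laurentTower (A : Type*) [CommRing A] (J : Ideal A) : Type _ := laurentTowerSubring A J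

instance (A : Type*) [CommRing A] (J : Ideal A) : CommRing (laurentTower A J) :=
  inferInstanceAs (CommRing (laurentTowerSubring A J))

namespace laurentTower

variable {A : Type*} [CommRing A] {J : Ideal A}

theorem ext_coeff {x y : laurentTower A J}
    (h : ∀ k j, (x.1 k).coeff j = (y.1 k).coeff j) : x = y :=
  Subtype.ext (funext fun k => HahnSeries.ext (funext fun j => h k j))

theorem factor_coeff (x : laurentTower A J) (k : ℕ) (j : ℤ) :
    Ideal.Quotient.factor (Ideal.pow_le_pow_right (I := J) (Nat.le_succ (k + 1)))
      ((x.1 (k + 1)).coeff j) = (x.1 k).coeff j :=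
  congrArg (fun z => HahnSeries.coeff z j) (x.2 k)

/-- The monomial `a u^j`. -/
def monomial (j : ℤ) (a : A) : laurentTower A J :=
  ⟨fun _ => HahnSeries.single j (Ideal.Quotient.mk _ a), fun k => by
    ext i
    by_cases h : i = j
    · subst h; simp
    · simp [HahnSeries.coeff_single_of_ne h]⟩

/-- The formal variable `u`. -/
def u : laurentTower A J := monomial 1 1

/-- The inverse `u⁻¹` of the formal variable. -/
def uInv : laurentTower A J := monomial (-1) 1

/-- Elements of `A` as constants in `u`. -/
def const (a : A) : laurentTower A J := monomial 0 a

theorem coeff_monomial_mul (j : ℤ) (a : A) (x : laurentTower A J) (k : ℕ) (i : ℤ) :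
    ((monomial j a * x).1 k).coeff i = Ideal.Quotient.mk _ a * (x.1 k).coeff (i - j) :=
  HahnSeries.coeff_single_mul

/-- The subring of those families all of whose coefficients sit in `u`-degrees from `S`. -/
def supportedIn (A : Type*) [CommRing A] (J : Ideal A) (S : AddSubmonoid ℤ) :
    Subring (laurentTower A J) where
  carrier := {x | ∀ k j, j ∉ S → (x.1 k).coeff j = 0}
  zero_mem' := fun _ _ _ => rfl
  one_mem' := fun k j hj => HahnSeries.coeff_single_of_ne fun h => hj (h ▸ S.zero_mem)
  add_mem' {x y} hx hy := fun k j hj => by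
    change (x.1 k).coeff j + (y.1 k).coeff j = 0
    rw [hx k j hj, hy k j hj, add_zero]
  neg_mem' {x} hx := fun k j hj => by
    change -(x.1 k).coeff j = 0
    rw [hx k j hj, neg_zero]
  mul_mem' {x y} hx hy := fun k j hj => by
    change (x.1 k * y.1 k).coeff j = 0
    rw [HahnSeries.coeff_mul]
    refine Finset.sum_eq_zero fun p hp => ?_
    have hp := Finset.mem_antidiagonal.1 hp
    by_cases h : p.1 ∈ S
    · rw [hy k p.2 fun h' => hj (hp.2.2 ▸ S.add_mem h h'), mul_zero]
    · rw [hx k _ h, zero_mul]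

/-- The subring `lim_k (A / J^(k+1))[[u]]`. -/
abbrev plus (A : Type*) [CommRing A] (J : Ideal A) : Subring (laurentTower A J) :=
  supportedIn A J (AddSubmonoid.nonneg ℤ)

/-- The subring `lim_k (A / J^(k+1))[u⁻¹]`. -/
abbrev minus (A : Type*) [CommRing A] (J : Ideal A) : Subring (laurentTower A J) :=
  supportedIn A J ((AddSubmonoid.nonneg ℤ).comap (negAddMonoidHom : ℤ →+ ℤ))

/-- The completion `lim_k A / J^(k+1)`, as the subring of the families of series constant
in `u`. -/
abbrev hat (A : Type*) [CommRing A] (J : Ideal A) : Subring (plus A J) :=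
  (supportedIn A J ⊥).comap (plus A J).subtype

/-- A ring homomorphism `f : A → B` with `f J ⊆ J'` induces a map of towers. -/
def mapHom {B : Type*} [CommRing B] {J' : Ideal B} (f : A →+* B) (hf : J.map f ≤ J') :
    laurentTower A J →+* laurentTower B J' :=
  have h (k : ℕ) : J ^ (k + 1) ≤ (J' ^ (k + 1)).comap f := by
    rw [← Ideal.map_le_iff_le_comap, Ideal.map_pow]
    exact Ideal.pow_right_mono hf _
  { toFun := fun x => ⟨fun k => (x.1 k).map (Ideal.quotientMap _ f (h k)), fun k => by
      ext j
      simp only [HahnSeries.map_coeff]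
      rw [← factor_coeff x k j]
      obtain ⟨a, ha⟩ := Ideal.Quotient.mk_surjective ((x.1 (k + 1)).coeff j)
      rw [← ha]
      rfl⟩
    map_one' := Subtype.ext <| funext fun k =>
      HahnSeries.map_one (Ideal.quotientMap _ f (h k)).toMonoidWithZeroHom
    map_zero' := ext_coeff fun k j => map_zero (Ideal.quotientMap _ f (h k))
    map_add' := fun x y => ext_coeff fun k j => map_add (Ideal.quotientMap _ f (h k)) _ _
    map_mul' := fun x y => Subtype.ext <| funext fun k =>
      HahnSeries.map_mul (Ideal.quotientMap _ f (h k)).toNonUnitalRingHom }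

/-- Laurent series with coefficients in `ℂ`, as constant families. -/
def ofLaurent [Algebra ℂ A] : LaurentSeries ℂ →+* laurentTower A J where
  toFun g := ⟨fun k => g.map (algebraMap ℂ (A ⧸ J ^ (k + 1))), fun k => by ext j; rfl⟩
  map_one' := Subtype.ext <| funext fun k =>
    HahnSeries.map_one (algebraMap ℂ (A ⧸ J ^ (k + 1))).toMonoidWithZeroHom
  map_zero' := ext_coeff fun k j => map_zero (algebraMap ℂ (A ⧸ J ^ (k + 1)))
  map_add' x y := ext_coeff fun k j => map_add (algebraMap ℂ (A ⧸ J ^ (k + 1))) _ _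
  map_mul' x y := Subtype.ext <| funext fun k =>
    HahnSeries.map_mul (algebraMap ℂ (A ⧸ J ^ (k + 1))).toNonUnitalRingHom

theorem deriv_mem_pow [Algebra ℂ A] (D : Derivation ℂ A A) (k : ℕ) {a : A}
    (ha : a ∈ J ^ (k + 1)) : D a ∈ J ^ k := by
  induction k generalizing a with
  | zero => simp
  | succ k ih =>
    rw [pow_succ] at ha
    refine Submodule.mul_induction_on ha (fun x hx y hy => ?_) fun x y hx hy => ?_
    · rw [D.leibniz, smul_eq_mul, smul_eq_mul]
      refine Ideal.add_mem _ (Ideal.mul_mem_right _ _ hx) ?_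
      rw [mul_comm, pow_succ]
      exact Ideal.mul_mem_mul (ih hx) hy
    · rw [map_add]
      exact Ideal.add_mem _ hx hy

/-- An additive map carrying `I` into `I'` descends to the quotients. -/
def quotMap (D : A →+ A) (I I' : Ideal A) (h : ∀ a ∈ I, D a ∈ I') : A ⧸ I →+ A ⧸ I' :=
  QuotientAddGroup.map I.toAddSubgroup I'.toAddSubgroup D h

@[simp]
theorem quotMap_mk (D : A →+ A) (I I' : Ideal A) (h : ∀ a ∈ I, D a ∈ I') (a : A) :
    quotMap D I I' h (Ideal.Quotient.mk I a) = Ideal.Quotient.mk I' (D a) :=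
  rfl

/-- The extension of a derivation `D` of `A` to the tower, acting on the coefficients. It lowers the
`J`-adic order by at most one, so that it is computed modulo `J^(k+1)` from the series
modulo `J^(k+2)`. -/
def deriv [Algebra ℂ A] (D : Derivation ℂ A A) : laurentTower A J →+ laurentTower A J where
  toFun x := ⟨fun k => (x.1 (k + 1)).map (quotMap (D : A →+ A) (J ^ (k + 1 + 1)) (J ^ (k + 1))
      fun _ ha => deriv_mem_pow D _ ha), fun k => by
    ext j
    simp only [HahnSeries.map_coeff]
    rw [← factor_coeff x (k + 1) j]
    obtain ⟨a, ha⟩ := Ideal.Quotient.mk_surjective ((x.1 (k + 1 + 1)).coeff j)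
    rw [← ha]
    rfl⟩
  map_zero' := ext_coeff fun k j => map_zero (quotMap (D : A →+ A) _ _ _)
  map_add' x y := ext_coeff fun k j => map_add (quotMap (D : A →+ A) _ _ _) _ _

theorem coeff_deriv [Algebra ℂ A] (D : Derivation ℂ A A) (x : laurentTower A J) (k : ℕ) (j : ℤ)
    (a : A) (ha : Ideal.Quotient.mk _ a = (x.1 (k + 1)).coeff j) :
    ((deriv D x).1 k).coeff j = Ideal.Quotient.mk _ (D a) := by
  change quotMap (D : A →+ A) _ _ _ ((x.1 (k + 1)).coeff j) = _
  rw [← ha]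
  rfl

theorem deriv_monomial_mul [Algebra ℂ A] (D : Derivation ℂ A A) (j : ℤ) (b : A)
    (x : laurentTower A J) :
    deriv D (monomial j b * x) = monomial j (D b) * x + monomial j b * deriv D x := by
  refine ext_coeff fun k i => ?_
  obtain ⟨a, ha⟩ := Ideal.Quotient.mk_surjective ((x.1 (k + 1)).coeff (i - j))
  change _ = ((monomial j (D b) * x).1 k).coeff i + ((monomial j b * deriv D x).1 k).coeff i
  rw [coeff_deriv D _ k i (b * a), coeff_monomial_mul, coeff_monomial_mul, coeff_deriv D x k _ a ha,
    ← factor_coeff x, ← ha]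
  · rw [Ideal.Quotient.factor_mk, ← map_mul, ← map_mul, ← map_add, D.leibniz]
    congr 1
    simp only [smul_eq_mul]
    ring
  · rw [coeff_monomial_mul, ← ha, map_mul]

theorem deriv_comm [Algebra ℂ A] (D D' : Derivation ℂ A A) (h : ∀ a, D (D' a) = D' (D a))
    (x : laurentTower A J) : deriv D (deriv D' x) = deriv D' (deriv D x) := by
  refine ext_coeff fun k i => ?_
  obtain ⟨a, ha⟩ := Ideal.Quotient.mk_surjective ((x.1 (k + 1 + 1)).coeff i)
  rw [coeff_deriv D _ k i (D' a) (coeff_deriv D' x (k + 1) i a ha).symm,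
    coeff_deriv D' _ k i (D a) (coeff_deriv D x (k + 1) i a ha).symm, h]

/-- A derivation that vanishes on the image of `f` is linear over the tower of the source. -/
theorem deriv_mapHom_mul {B : Type*} [CommRing B] [Algebra ℂ B] {J' : Ideal B} (f : A →+* B)
    (hf : J.map f ≤ J') (D : Derivation ℂ B B) (hD : ∀ a, D (f a) = 0) (r : laurentTower A J)
    (x : laurentTower B J') :
    deriv D (mapHom f hf r * x) = mapHom f hf r * deriv D x := by
  refine ext_coeff fun k i => ?_
  change quotMap (D : B →+ B) _ _ _ (((mapHom f hf r).1 (k + 1) * x.1 (k + 1)).coeff i) =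
    ((mapHom f hf r).1 k * (deriv D x).1 k).coeff i
  have hs : ((mapHom f hf r).1 k).support ⊆ ((mapHom f hf r).1 (k + 1)).support := by
    intro j hj h0
    apply hj
    rw [← factor_coeff, h0, map_zero]
  have ht : ((deriv D x).1 k).support ⊆ (x.1 (k + 1)).support := by
    intro j hj h0
    apply hj
    change quotMap (D : B →+ B) _ _ _ ((x.1 (k + 1)).coeff j) = 0
    rw [h0, map_zero]
  rw [HahnSeries.coeff_mul, map_sum, HahnSeries.coeff_mul]
  symm
  refine (Finset.sum_subset (s₂ := Finset.antidiagonal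
    ((mapHom f hf r).1 (k + 1)).isPWO_support (x.1 (k + 1)).isPWO_support i) ?_ ?_).trans ?_
  · intro p hp
    have hp := Finset.mem_antidiagonal.1 hp
    exact Finset.mem_antidiagonal.2 ⟨hs hp.1, ht hp.2.1, hp.2.2⟩
  · intro p hp hp'
    have hp := Finset.mem_antidiagonal.1 hp
    by_contra hne
    exact hp' (Finset.mem_antidiagonal.2
      ⟨left_ne_zero_of_mul hne, right_ne_zero_of_mul hne, hp.2.2⟩)
  · refine Finset.sum_congr rfl fun p _ => ?_
    obtain ⟨b, hb⟩ := Ideal.Quotient.mk_surjective ((x.1 (k + 1)).coeff p.2)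
    obtain ⟨a, ha⟩ := Ideal.Quotient.mk_surjective ((r.1 (k + 1)).coeff p.1)
    have h1 : ((mapHom f hf r).1 (k + 1)).coeff p.1 = Ideal.Quotient.mk _ (f a) := by
      change Ideal.quotientMap _ f _ ((r.1 (k + 1)).coeff p.1) = _
      rw [← ha]
      rfl
    have h2 : ((mapHom f hf r).1 k).coeff p.1 = Ideal.Quotient.mk _ (f a) := by
      rw [← factor_coeff, h1]
      rfl
    rw [h1, h2, coeff_deriv D x k p.2 b hb, ← hb, ← map_mul, ← map_mul]
    change Ideal.Quotient.mk _ (f a * D b) = Ideal.Quotient.mk _ (D (f a * b))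
    congr 1
    rw [D.leibniz, hD, smul_zero, add_zero, smul_eq_mul]

/-- The operator `u ∂/∂u`. -/
def uDeriv : laurentTower A J →+ laurentTower A J where
  toFun x := ⟨fun k => ⟨fun j => j • (x.1 k).coeff j, (x.1 k).isPWO_support.mono fun j hj h0 =>
      hj (by simp only [h0, smul_zero])⟩, fun k => by
    ext j
    simp only [HahnSeries.map_coeff, map_zsmul]
    rw [factor_coeff]⟩
  map_zero' := ext_coeff fun k j => smul_zero j
  map_add' x y := ext_coeff fun k j => smul_add j _ _

theorem uDeriv_monomial_mul (j : ℤ) (b : A) (x : laurentTower A J) :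
    uDeriv (monomial j b * x) = j • (monomial j b * x) + monomial j b * uDeriv x := by
  refine ext_coeff fun k i => ?_
  change i • ((monomial j b * x).1 k).coeff i =
    j • ((monomial j b * x).1 k).coeff i + ((monomial j b * uDeriv x).1 k).coeff i
  rw [coeff_monomial_mul, coeff_monomial_mul]
  change _ = _ + _ * ((i - j) • (x.1 k).coeff (i - j))
  rw [mul_smul_comm, ← add_smul]
  congr 1
  ring

theorem deriv_uDeriv [Algebra ℂ A] (D : Derivation ℂ A A) (x : laurentTower A J) :
    deriv D (uDeriv x) = uDeriv (deriv D x) := by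
  refine ext_coeff fun k i => ?_
  exact map_zsmul (quotMap (D : A →+ A) _ _ _) i _

theorem monomial_mem (S : AddSubmonoid ℤ) (j : ℤ) (hj : j ∈ S) (a : A) :
    (monomial j a : laurentTower A J) ∈ supportedIn A J S :=
  fun _ _ hi => HahnSeries.coeff_single_of_ne fun h => hi (h ▸ hj)

theorem deriv_mem [Algebra ℂ A] (S : AddSubmonoid ℤ) (D : Derivation ℂ A A)
    {x : laurentTower A J} (hx : x ∈ supportedIn A J S) : deriv D x ∈ supportedIn A J S := by
  intro k j hj
  change quotMap (D : A →+ A) _ _ _ ((x.1 (k + 1)).coeff j) = 0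
  rw [hx _ j hj, map_zero]

theorem uDeriv_mem (S : AddSubmonoid ℤ) {x : laurentTower A J} (hx : x ∈ supportedIn A J S) :
    uDeriv x ∈ supportedIn A J S := by
  intro k j hj
  change j • (x.1 k).coeff j = 0
  rw [hx _ j hj, smul_zero]

theorem mapHom_mem {B : Type*} [CommRing B] {J' : Ideal B} (f : A →+* B) (hf : J.map f ≤ J')
    (S : AddSubmonoid ℤ) {x : laurentTower A J} (hx : x ∈ supportedIn A J S) :
    mapHom f hf x ∈ supportedIn B J' S := by
  intro k j hj
  change Ideal.quotientMap _ f _ ((x.1 k).coeff j) = 0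
  rw [hx _ j hj, map_zero]

end laurentTower

/-! ### Derivations acting on Laurent series -/

/-- A derivation acting on the coefficients of Laurent series in `u`. -/
def laurentDeriv {B : Type*} [CommRing B] [Algebra ℂ B] (D : Derivation ℂ B B) :
    LaurentSeries B →+ LaurentSeries B where
  toFun x := x.map (D : B →+ B)
  map_zero' := HahnSeries.ext <| funext fun _ => map_zero D
  map_add' _ _ := HahnSeries.ext <| funext fun _ => map_add D _ _

/-- The operator `u ∂/∂u` on Laurent series in `u`. -/
def laurentUDeriv {B : Type*} [CommRing B] : LaurentSeries B →+ LaurentSeries B where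
  toFun x := ⟨fun j => j • x.coeff j, x.isPWO_support.mono fun j hj h0 =>
    hj (by simp only [h0, smul_zero])⟩
  map_zero' := HahnSeries.ext <| funext fun j => smul_zero j
  map_add' _ _ := HahnSeries.ext <| funext fun j => smul_add j _ _

theorem laurentDeriv_single_mul {B : Type*} [CommRing B] [Algebra ℂ B] (D : Derivation ℂ B B)
    (j : ℤ) (b : B) (x : LaurentSeries B) :
    laurentDeriv D (HahnSeries.single j b * x) =
      HahnSeries.single j (D b) * x + HahnSeries.single j b * laurentDeriv D x := by
  ext i
  change D ((HahnSeries.single j b * x).coeff i) = (HahnSeries.single j (D b) * x).coeff i +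
    (HahnSeries.single j b * laurentDeriv D x).coeff i
  rw [HahnSeries.coeff_single_mul, HahnSeries.coeff_single_mul, HahnSeries.coeff_single_mul,
    D.leibniz, smul_eq_mul, smul_eq_mul, add_comm, mul_comm]
  rfl

theorem laurentUDeriv_single_mul {B : Type*} [CommRing B] (j : ℤ) (b : B) (x : LaurentSeries B) :
    laurentUDeriv (HahnSeries.single j b * x) =
      j • (HahnSeries.single j b * x) + HahnSeries.single j b * laurentUDeriv x := by
  ext i
  change i • (HahnSeries.single j b * x).coeff i = j • (HahnSeries.single j b * x).coeff i +
    (HahnSeries.single j b * laurentUDeriv x).coeff i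
  rw [HahnSeries.coeff_single_mul, HahnSeries.coeff_single_mul]
  change _ = _ + _ * ((i - j) • x.coeff (i - j))
  rw [mul_smul_comm, ← add_smul]
  congr 1
  ring

/-- Derivations act linearly over the Laurent series with coefficients in `ℂ`. -/
theorem laurentDeriv_map_mul {B : Type*} [CommRing B] [Algebra ℂ B] (D : Derivation ℂ B B)
    (g : LaurentSeries ℂ) (x : LaurentSeries B) :
    laurentDeriv D ((g.map (algebraMap ℂ B) : LaurentSeries B) * x) =
      (g.map (algebraMap ℂ B) : LaurentSeries B) * laurentDeriv D x := by
  ext i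
  change D (((g.map (algebraMap ℂ B) : LaurentSeries B) * x).coeff i) = _
  have hy : (laurentDeriv D x).support ⊆ x.support := fun j hj h0 => hj (by
    change D (x.coeff j) = 0
    rw [h0, map_zero])
  rw [HahnSeries.coeff_mul, map_sum, HahnSeries.coeff_mul_right' x.isPWO_support hy]
  refine Finset.sum_congr rfl fun p _ => ?_
  change D (algebraMap ℂ B (g.coeff p.1) * x.coeff p.2) =
    algebraMap ℂ B (g.coeff p.1) * D (x.coeff p.2)
  rw [← Algebra.smul_def, ← Algebra.smul_def, D.map_smul]

/-- A derivation preserving an ideal descends to the quotient ring. -/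
def quotDerivation {A : Type*} [CommRing A] [Algebra ℂ A] (D : Derivation ℂ A A) (J : Ideal A)
    (h : ∀ a ∈ J, D a ∈ J) : Derivation ℂ (A ⧸ J) (A ⧸ J) :=
  Derivation.mk'
    { toFun := laurentTower.quotMap (D : A →+ A) J J h
      map_add' := map_add _
      map_smul' := fun c x => by
        obtain ⟨a, rfl⟩ := Ideal.Quotient.mk_surjective x
        change Ideal.Quotient.mk J (D (c • a)) = c • Ideal.Quotient.mk J (D a)
        rw [D.map_smul]
        rfl }
    fun x y => by
      obtain ⟨a, rfl⟩ := Ideal.Quotient.mk_surjective x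
      obtain ⟨b, rfl⟩ := Ideal.Quotient.mk_surjective y
      change Ideal.Quotient.mk J (D (a * b)) = Ideal.Quotient.mk J a * Ideal.Quotient.mk J (D b) +
        Ideal.Quotient.mk J b * Ideal.Quotient.mk J (D a)
      rw [D.leibniz, smul_eq_mul, smul_eq_mul, map_add, map_mul, map_mul]

/-! ### Polyvector fields in a frame, and cohomology -/

/-- Polyvector fields `∑_I α_I θ_I` in a frame `θ_1, …, θ_n` are families `α` indexed by the subsets
`I` of `Fin n`, `θ_I` being the increasing wedge product. For commuting operators `q_i` on the
coefficients, this is the differential `∑_i q_i ∂/∂θ_i`. -/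
def koszul {n : ℕ} {S M : Type*} [CommRing S] [AddCommGroup M] [Module S M]
    (q : Fin n → M →ₗ[S] M) : (Finset (Fin n) → M) →ₗ[S] (Finset (Fin n) → M) :=
  LinearMap.pi fun I => ∑ i : Fin n, if i ∈ I then 0 else
    ((-1 : ℤ) ^ (I.filter (· < i)).card) • (q i ∘ₗ LinearMap.proj (insert i I))

theorem koszul_apply {n : ℕ} {S M : Type*} [CommRing S] [AddCommGroup M] [Module S M]
    (q : Fin n → M →ₗ[S] M) (α : Finset (Fin n) → M) (I : Finset (Fin n)) :
    koszul q α I = ∑ i : Fin n, if i ∈ I then 0 else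
      ((-1 : ℤ) ^ (I.filter (· < i)).card) • q i (α (insert i I)) := by
  simp only [koszul, LinearMap.pi_apply, LinearMap.sum_apply]
  refine Finset.sum_congr rfl fun i _ => ?_
  split_ifs <;> rfl

/-- An additive map acting on the coefficients of polyvector fields. -/
def onCoeffs (n : ℕ) {M M' : Type*} [AddCommGroup M] [AddCommGroup M'] (T : M →+ M') :
    (Finset (Fin n) → M) →+ (Finset (Fin n) → M') where
  toFun α I := T (α I)
  map_zero' := funext fun _ => map_zero T
  map_add' _ _ := funext fun _ => map_add T _ _

theorem onCoeffs_koszul {n : ℕ} {S S' M M' : Type*} [CommRing S] [AddCommGroup M] [Module S M]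
    [CommRing S'] [AddCommGroup M'] [Module S' M'] (T : M →+ M') (q : Fin n → M →ₗ[S] M)
    (q' : Fin n → M' →ₗ[S'] M') (h : ∀ i x, T (q i x) = q' i (T x)) (α : Finset (Fin n) → M) :
    onCoeffs n T (koszul q α) = koszul q' (onCoeffs n T α) := by
  funext I
  change T (koszul q α I) = _
  rw [koszul_apply, koszul_apply, map_sum]
  refine Finset.sum_congr rfl fun i _ => ?_
  split_ifs
  · exact map_zero T
  · rw [map_zsmul, h]
    rfl

/-- The grading operator on polyvector fields: `E` on the coefficients, and every frame vector `θ_i`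
has weight `2`. -/
def polyEuler (n : ℕ) {M : Type*} [AddCommGroup M] (E : M →+ M) :
    (Finset (Fin n) → M) →+ (Finset (Fin n) → M) where
  toFun α I := E (α I) + (2 * (I.card : ℤ)) • α I
  map_zero' := funext fun _ => by simp
  map_add' _ _ := funext fun _ => by
    simp only [Pi.add_apply, map_add, smul_add]
    abel

theorem polyEuler_koszul {n : ℕ} {S M : Type*} [CommRing S] [AddCommGroup M] [Module S M]
    (E : M →+ M) (q : Fin n → M →ₗ[S] M) (h : ∀ i x, E (q i x) = q i (E x) + (2 : ℤ) • q i x)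
    (α : Finset (Fin n) → M) : polyEuler n E (koszul q α) = koszul q (polyEuler n E α) := by
  funext I
  change E (koszul q α I) + (2 * (I.card : ℤ)) • koszul q α I = _
  rw [koszul_apply, koszul_apply, map_sum, Finset.smul_sum, ← Finset.sum_add_distrib]
  refine Finset.sum_congr rfl fun i _ => ?_
  split_ifs with hi
  · simp
  · change _ = _ • q i (E (α (insert i I)) + (2 * ((insert i I).card : ℤ)) • α (insert i I))
    rw [map_zsmul, h, Finset.card_insert_of_notMem hi, map_add, map_zsmul, smul_comm _ (_ ^ _),
      ← smul_add, add_assoc, ← add_smul]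
    push_cast
    congr 3
    ring

/-- The cohomology `ker Q / im Q` of the subcomplex `W` (in all degrees at once). -/
def Coh {S K : Type*} [CommRing S] [AddCommGroup K] [Module S K] (Q : K →ₗ[S] K)
    (W : Submodule S K) : Type _ :=
  ↥(LinearMap.ker Q ⊓ W) ⧸ (W.map Q).submoduleOf (LinearMap.ker Q ⊓ W)

instance {S K : Type*} [CommRing S] [AddCommGroup K] [Module S K] (Q : K →ₗ[S] K)
    (W : Submodule S K) : AddCommGroup (Coh Q W) :=
  inferInstanceAs (AddCommGroup (↥(LinearMap.ker Q ⊓ W) ⧸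
    (W.map Q).submoduleOf (LinearMap.ker Q ⊓ W)))

instance {S K : Type*} [CommRing S] [AddCommGroup K] [Module S K] (Q : K →ₗ[S] K)
    (W : Submodule S K) : Module S (Coh Q W) :=
  inferInstanceAs (Module S (↥(LinearMap.ker Q ⊓ W) ⧸
    (W.map Q).submoduleOf (LinearMap.ker Q ⊓ W)))

/-- The class of a cocycle. -/
def Coh.mk {S K : Type*} [CommRing S] [AddCommGroup K] [Module S K] (Q : K →ₗ[S] K)
    (W : Submodule S K) (z : K) (hz : Q z = 0) (hW : z ∈ W) : Coh Q W :=
  Submodule.Quotient.mk (p := (W.map Q).submoduleOf (LinearMap.ker Q ⊓ W)) ⟨z, hz, hW⟩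

/-- An additive cochain map induces a map on cohomology. -/
def Coh.hom {S K S' K' : Type*} [CommRing S] [AddCommGroup K] [Module S K] [CommRing S']
    [AddCommGroup K'] [Module S' K'] (Q : K →ₗ[S] K) (W : Submodule S K) (Q' : K' →ₗ[S'] K')
    (W' : Submodule S' K') (T : K →+ K') (hW : ∀ x ∈ W, T x ∈ W')
    (hQ : ∀ x, T (Q x) = Q' (T x)) : Coh Q W →+ Coh Q' W' :=
  QuotientAddGroup.map ((W.map Q).submoduleOf (LinearMap.ker Q ⊓ W)).toAddSubgroup
    ((W'.map Q').submoduleOf (LinearMap.ker Q' ⊓ W')).toAddSubgroup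
    { toFun := fun z => ⟨T z.1, by
          change Q' (T z.1) = 0
          rw [← hQ, show Q z.1 = 0 from z.2.1, map_zero], hW _ z.2.2⟩
      map_zero' := Subtype.ext (map_zero T)
      map_add' := fun x y => Subtype.ext (map_add T x.1 y.1) }
    (by
      rintro z ⟨w, hw, hz⟩
      refine ⟨T w, hW w hw, ?_⟩
      rw [← hQ, hz]
      rfl)

theorem twisted_comm {B : Type*} [CommRing B] (u h g g' : B) (θ δ : B →+ B)
    (hθu : ∀ x, θ (u * x) = u * θ x) (hδu : ∀ x, δ (u * x) = u * δ x)
    (hθ : ∀ x, θ (g * x) = g' * x + g * θ x) (hδ : ∀ x, δ (h * x) = g' * x + h * δ x)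
    (hc : ∀ x, δ (θ x) = θ (δ x)) (x : B) :
    u * δ (h * x + u * θ x) + g * (h * x + u * θ x) =
      h * (u * δ x + g * x) + u * θ (u * δ x + g * x) := by
  rw [map_add, map_add, hδ, hδu, hθu, hθ, hc]
  ring

/-! ### Derivations of monoid algebras -/

/-- The linear endomorphism of `ℂ[M]` with `z^x ↦ c(x) z^(g(x))`. -/
def monomialMap {M : Type*} (c : M → ℂ) (g : M → M) :
    AddMonoidAlgebra ℂ M →ₗ[ℂ] AddMonoidAlgebra ℂ M :=
  (Finsupp.lsum ℂ fun x : M => c x • AddMonoidAlgebra.lsingle (g x)).comp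
    (AddMonoidAlgebra.coeffLinearEquiv ℂ).toLinearMap

theorem monomialMap_single {M : Type*} (c : M → ℂ) (g : M → M) (x : M) (a : ℂ) :
    monomialMap c g (AddMonoidAlgebra.single x a) = AddMonoidAlgebra.single (g x) (c x * a) := by
  simp [monomialMap, AddMonoidAlgebra.coeffLinearEquiv]

/-- The logarithmic derivation `z^x ↦ ℓ(x) z^x` of `ℂ[M]` attached to an additive map `ℓ`. -/
def logDerivation {M : Type*} [AddCommMonoid M] (ℓ : M →+ ℂ) :
    Derivation ℂ (AddMonoidAlgebra ℂ M) (AddMonoidAlgebra ℂ M) :=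
  Derivation.mk'
    (monomialMap (fun x => ℓ x) fun x => x)
    fun a b => by
      induction a using AddMonoidAlgebra.induction_linear with
      | zero => simp
      | add a a' h h' =>
        rw [add_mul, map_add, h, h', map_add]
        simp only [smul_eq_mul]
        ring
      | single x c =>
        induction b using AddMonoidAlgebra.induction_linear with
        | zero => simp
        | add b b' h h' =>
          rw [mul_add, map_add, h, h', map_add]
          simp only [smul_eq_mul]
          ring
        | single y d =>
          simp only [AddMonoidAlgebra.single_mul_single, monomialMap_single, smul_eq_mul, map_add]
          rw [add_comm y x, ← AddMonoidAlgebra.single_add]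
          congr 1
          ring

@[simp]
theorem logDerivation_single {M : Type*} [AddCommMonoid M] (ℓ : M →+ ℂ) (x : M) (c : ℂ) :
    logDerivation ℓ (AddMonoidAlgebra.single x c) = AddMonoidAlgebra.single x (ℓ x * c) := by
  exact monomialMap_single _ _ x c

theorem logDerivation_comm {M : Type*} [AddCommMonoid M] (ℓ ℓ' : M →+ ℂ)
    (a : AddMonoidAlgebra ℂ M) :
    logDerivation ℓ (logDerivation ℓ' a) = logDerivation ℓ' (logDerivation ℓ a) := by
  induction a using AddMonoidAlgebra.induction_linear with
  | zero => simp
  | add a b h h' => simp only [map_add, h, h']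
  | single x c =>
    simp only [logDerivation_single]
    congr 1
    ring

/-- The derivation `∂/∂t_i` of `ℂ[M × ℕ^T] = ℂ[M][t]`. -/
def tDerivation {M T : Type*} [AddCommMonoid M] [DecidableEq T] (i : T) :
    Derivation ℂ (AddMonoidAlgebra ℂ (M × (T →₀ ℕ))) (AddMonoidAlgebra ℂ (M × (T →₀ ℕ))) :=
  Derivation.mk'
    (monomialMap (fun x => (x.2 i : ℂ)) fun x => (x.1, x.2 - Finsupp.single i 1))
    fun a b => by
      induction a using AddMonoidAlgebra.induction_linear with
      | zero => simp
      | add a a' h h' =>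
        rw [add_mul, map_add, h, h', map_add]
        simp only [smul_eq_mul]
        ring
      | single x c =>
        induction b using AddMonoidAlgebra.induction_linear with
        | zero => simp
        | add b b' h h' =>
          rw [mul_add, map_add, h, h', map_add]
          simp only [smul_eq_mul]
          ring
        | single y d =>
          have key : ∀ l l' : T →₀ ℕ, l i ≠ 0 →
              l + l' - Finsupp.single i 1 = l - Finsupp.single i 1 + l' := by
            intro l l' h
            rw [tsub_add_eq_add_tsub]
            exact Finsupp.single_le_iff.2 (Nat.one_le_iff_ne_zero.2 h)
          have e1 : AddMonoidAlgebra.single (x.1 + y.1, x.2 + y.2 - Finsupp.single i 1)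
              ((x.2 i : ℂ) * (c * d)) = AddMonoidAlgebra.single
              (x.1 + y.1, x.2 - Finsupp.single i 1 + y.2) ((x.2 i : ℂ) * (c * d)) := by
            by_cases h : x.2 i = 0
            · simp [h]
            · rw [key _ _ h]
          have e2 : AddMonoidAlgebra.single (x.1 + y.1, x.2 + y.2 - Finsupp.single i 1)
              ((y.2 i : ℂ) * (c * d)) = AddMonoidAlgebra.single
              (x.1 + y.1, x.2 + (y.2 - Finsupp.single i 1)) ((y.2 i : ℂ) * (c * d)) := by
            by_cases h : y.2 i = 0
            · simp [h]
            · rw [add_comm x.2 y.2, key _ _ h, add_comm x.2]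
          simp only [AddMonoidAlgebra.single_mul_single, monomialMap_single, smul_eq_mul,
            Prod.fst_add, Prod.snd_add, Finsupp.add_apply, Nat.cast_add]
          rw [add_mul, AddMonoidAlgebra.single_add, e1, e2, add_comm]
          congr 1
          · congr 1
            ring
          · rw [add_comm y]
            congr 1
            ring

@[simp]
theorem tDerivation_single {M T : Type*} [AddCommMonoid M] [DecidableEq T] (i : T)
    (x : M × (T →₀ ℕ)) (c : ℂ) :
    tDerivation i (AddMonoidAlgebra.single x c) =
      AddMonoidAlgebra.single (x.1, x.2 - Finsupp.single i 1) (x.2 i * c) := by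
  exact monomialMap_single _ _ x c

theorem tDerivation_logDerivation_comm {M T : Type*} [AddCommMonoid M] [DecidableEq T] (i : T)
    (ℓ : M →+ ℂ) (a : AddMonoidAlgebra ℂ (M × (T →₀ ℕ))) :
    tDerivation i (logDerivation (ℓ.comp (AddMonoidHom.fst M (T →₀ ℕ))) a) =
      logDerivation (ℓ.comp (AddMonoidHom.fst M (T →₀ ℕ))) (tDerivation i a) := by
  induction a using AddMonoidAlgebra.induction_linear with
  | zero => simp
  | add a b h h' => simp only [map_add, h, h']
  | single x c =>
    simp only [logDerivation_single, tDerivation_single]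
    congr 1
    simp only [AddMonoidHom.comp_apply, AddMonoidHom.coe_fst]
    ring

/-! ### Smooth complete fans -/

/-- The real cone spanned by the vectors `ρ_i`, `i ∈ S`. -/
def rayCone {n d : ℕ} (ρ : Fin d → Fin n → ℤ) (S : Finset (Fin d)) :
    PointedCone ℝ (Fin n → ℝ) :=
  PointedCone.hull ℝ ((fun i k => (ρ i k : ℝ)) '' (S : Set (Fin d)))

/-- A complete smooth fan in the lattice `ℤ^n`, with primitive ray generators `ρ_1, …, ρ_d`. Cones
are recorded by the sets of indices of their generators; the cones of the fan are the faces of the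
given `n`-dimensional cones, that is, the cones over the subsets of the members of `maxCones`. -/
structure SmoothCompleteFan (n d : ℕ) where
  /-- the primitive generators of the rays -/
  ray : Fin d → Fin n → ℤ
  /-- the `n`-dimensional cones -/
  maxCones : Finset (Finset (Fin d))
  /-- the generators of every `n`-dimensional cone form a basis of the lattice -/
  linearIndependent : ∀ σ ∈ maxCones, LinearIndependent ℤ fun i : σ => ray i
  span_eq_top : ∀ σ ∈ maxCones, Submodule.span ℤ (ray '' (σ : Set (Fin d))) = ⊤
  /-- cones meet along common faces -/
  inter : ∀ σ ∈ maxCones, ∀ τ ∈ maxCones,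
    rayCone ray σ ⊓ rayCone ray τ = rayCone ray (σ ∩ τ)
  /-- the cones cover the space -/
  complete : ∀ x : Fin n → ℝ, ∃ σ ∈ maxCones, x ∈ rayCone ray σ
  /-- every `ρ_i` generates a cone of the fan -/
  ray_mem : ∀ i, ∃ σ ∈ maxCones, i ∈ σ

namespace SmoothCompleteFan

variable {n d : ℕ} (Δ : SmoothCompleteFan n d)

/-- The map `s : ℤ^d → N = ℤ^n` sending the `i`-th basis vector to `ρ_i`. -/
def rayMap : (Fin d → ℤ) →+ (Fin n → ℤ) where
  toFun a := ∑ i, a i • Δ.ray i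
  map_zero' := by simp
  map_add' a b := by simp [add_smul, Finset.sum_add_distrib]

/-- The lattice `A_1(Y, ℤ) = ker s` of curve classes; the `i`-th coordinate of a class is its
intersection number with the `i`-th toric divisor. -/
def curveLattice : AddSubgroup (Fin d → ℤ) := Δ.rayMap.ker

/-- The piecewise linear function with integral slopes and value `h_i` at `ρ_i` is convex: on every
maximal cone it is given by a linear function which is nowhere larger than it. Equivalently, the
divisor `∑ h_i D_i` is nef. -/
def IsConvex (h : Fin d → ℤ) : Prop :=
  ∀ σ ∈ Δ.maxCones, ∃ m : Fin n → ℤ,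
    (∀ i ∈ σ, ∑ k, m k * Δ.ray i k = h i) ∧ ∀ i, ∑ k, m k * Δ.ray i k ≤ h i

/-- The piecewise linear function with value `h_i` at `ρ_i` is strictly convex. -/
def IsStrictlyConvex (h : Fin d → ℤ) : Prop :=
  ∀ σ ∈ Δ.maxCones, ∃ m : Fin n → ℤ,
    (∀ i ∈ σ, ∑ k, m k * Δ.ray i k = h i) ∧ ∀ i ∉ σ, ∑ k, m k * Δ.ray i k < h i

/-- The toric manifold of the fan is projective: there is a strictly convex piecewise linear
function with integral slopes. -/
def IsProjective : Prop := ∃ h, Δ.IsStrictlyConvex h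

/-- The monoid `P` of integral points of the cone of curves, the cone of curve classes that are
nonnegative on all nef divisors. -/
def curveMonoid : AddSubmonoid (Fin d → ℤ) where
  carrier := {p | p ∈ Δ.curveLattice ∧ ∀ h, Δ.IsConvex h → 0 ≤ ∑ i, h i * p i}
  zero_mem' := ⟨Δ.curveLattice.zero_mem, by simp⟩
  add_mem' {p q} hp hq := ⟨Δ.curveLattice.add_mem hp.1 hq.1, fun h hh => by
    simp only [Pi.add_apply, mul_add, Finset.sum_add_distrib]
    exact add_nonneg (hp.2 h hh) (hq.2 h hh)⟩

/-- The vectors `φ̃(m) ∈ ℤ^d`, `m ∈ N`, where `φ̃` is the piecewise linear map with `φ̃(ρ_i) = e_i`: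
nonnegative integral vectors supported on the generators of a cone. -/
def IsConeVector (b : Fin d → ℤ) : Prop :=
  (∀ i, 0 ≤ b i) ∧ ∃ σ ∈ Δ.maxCones, ∀ i ∉ σ, b i = 0

theorem exists_coneVector (m : Fin n → ℤ) : ∃ b, Δ.IsConeVector b ∧ Δ.rayMap b = m := by
  obtain ⟨σ, hσ, hx⟩ := Δ.complete fun k => (m k : ℝ)
  let β : Module.Basis σ ℤ (Fin n → ℤ) := Module.Basis.mk (Δ.linearIndependent σ hσ) (by
    rw [← Δ.span_eq_top σ hσ, Set.range_comp' Δ.ray Subtype.val]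
    simp)
  have hβ : ∀ i, β i = Δ.ray i := fun i => by simp [β]
  let c : Fin d → ℤ := fun i => if h : i ∈ σ then β.coord ⟨i, h⟩ m else 0
  have key : ∀ i : σ, ∃ w : Fin n → ℤ, ∀ v, β.coord i v = ∑ k, v k * w k := fun i =>
    ⟨fun k => β.coord i (Pi.single k 1), fun v => by
      conv_lhs => rw [pi_eq_sum_univ' v]
      rw [map_sum]
      refine Finset.sum_congr rfl fun k _ => ?_
      rw [map_smul, smul_eq_mul]⟩
  refine ⟨c, ⟨fun i => ?_, σ, hσ, fun i hi => dif_neg hi⟩, ?_⟩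
  · by_cases hi : i ∈ σ
    · obtain ⟨w, hw⟩ := key ⟨i, hi⟩
      have hpos : ∀ x ∈ rayCone Δ.ray σ, 0 ≤ ∑ k, x k * (w k : ℝ) := by
        intro x hx
        refine Submodule.span_induction ?_ (by simp) ?_ ?_ hx
        · rintro _ ⟨j, hj, rfl⟩
          have h1 := hw (Δ.ray j)
          rw [← hβ ⟨j, hj⟩, Module.Basis.coord_apply, Module.Basis.repr_self] at h1
          rw [hβ] at h1
          have h2 : (0 : ℤ) ≤ ∑ k, Δ.ray j k * w k := by
            rw [← h1, Finsupp.single_apply]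
            split_ifs <;> norm_num
          change (0 : ℝ) ≤ ∑ k, (Δ.ray j k : ℝ) * (w k : ℝ)
          exact_mod_cast h2
        · intro x y _ _ hx hy
          simp only [Pi.add_apply, add_mul, Finset.sum_add_distrib]
          exact add_nonneg hx hy
        · intro a x _ hx
          have : ∑ k, (a • x) k * (w k : ℝ) = (a : ℝ) * ∑ k, x k * (w k : ℝ) := by
            rw [Finset.mul_sum]
            refine Finset.sum_congr rfl fun k _ => ?_
            change ((a : ℝ) * x k) * _ = _
            ring
          rw [this]
          exact mul_nonneg a.2 hx
      have h3 := hpos _ hx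
      change 0 ≤ c i
      rw [show c i = ∑ k, m k * w k from (dif_pos hi).trans (hw m)]
      exact_mod_cast h3
    · simp [c, hi]
  · change ∑ i, c i • Δ.ray i = m
    conv_rhs => rw [← β.sum_repr m]
    rw [← Finset.sum_subset (Finset.subset_univ σ) fun i _ hi => by simp [c, hi],
      ← Finset.sum_coe_sort]
    refine Finset.sum_congr rfl fun i _ => ?_
    rw [hβ]
    simp [c]

/-- The monoid `P_φ = {φ̃(m) + p : m ∈ N, p ∈ P}`, realised in `ℤ^d`. A splitting `π` of
`0 → A_1(Y, ℤ) → ℤ^d → N → 0` identifies it with `{(m, φ(m) + p)} ⊆ N × A_1(Y, ℤ)`,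
`φ = π ∘ φ̃`, by means of `a ↦ (s(a), π(a))`. -/
def totalMonoid : AddSubmonoid (Fin d → ℤ) where
  carrier := {a | ∃ b p, Δ.IsConeVector b ∧ p ∈ Δ.curveMonoid ∧ a = b + p}
  zero_mem' := by
    obtain ⟨σ, hσ, -⟩ := Δ.complete 0
    exact ⟨0, 0, ⟨fun _ => le_rfl, σ, hσ, fun _ _ => rfl⟩, zero_mem _, (add_zero 0).symm⟩
  add_mem' := by
    rintro _ _ ⟨b, p, hb, hp, rfl⟩ ⟨b', p', hb', hp', rfl⟩
    obtain ⟨b'', hb'', hs⟩ := Δ.exists_coneVector (Δ.rayMap (b + b'))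
    refine ⟨b'', (b + b' - b'') + (p + p'), hb'', add_mem ⟨?_, fun h hh => ?_⟩ (add_mem hp hp'),
      by abel⟩
    · change Δ.rayMap _ = 0
      rw [map_sub, hs, sub_self]
    · obtain ⟨σ, hσ, hσb⟩ := hb''.2
      obtain ⟨m, hm, hle⟩ := hh σ hσ
      have lin : ∀ a : Fin d → ℤ, ∑ i, (∑ k, m k * Δ.ray i k) * a i = ∑ k, m k * Δ.rayMap a k := by
        intro a
        change _ = ∑ k, m k * (∑ i, a i • Δ.ray i) k
        simp only [Finset.sum_apply, Pi.smul_apply, smul_eq_mul, Finset.mul_sum, Finset.sum_mul]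
        rw [Finset.sum_comm]
        refine Finset.sum_congr rfl fun k _ => Finset.sum_congr rfl fun i _ => ?_
        ring
      have h1 : ∑ i, h i * b'' i = ∑ k, m k * Δ.rayMap (b + b') k := by
        rw [← hs, ← lin]
        refine Finset.sum_congr rfl fun i _ => ?_
        by_cases hi : i ∈ σ
        · rw [hm i hi]
        · rw [hσb i hi, mul_zero, mul_zero]
      have h2 : ∑ k, m k * Δ.rayMap (b + b') k ≤ ∑ i, h i * (b + b') i := by
        rw [← lin]
        refine Finset.sum_le_sum fun i _ => mul_le_mul_of_nonneg_right (hle i) ?_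
        exact add_nonneg (hb.1 i) (hb'.1 i)
      simp only [Pi.sub_apply, mul_sub, Finset.sum_sub_distrib]
      linarith

theorem curveMonoid_le_totalMonoid : Δ.curveMonoid ≤ Δ.totalMonoid := fun p hp => by
  obtain ⟨σ, hσ, -⟩ := Δ.complete 0
  exact ⟨0, p, ⟨fun _ => le_rfl, σ, hσ, fun _ _ => rfl⟩, hp, (zero_add p).symm⟩

/-- The exponent of the monomial `P(τ) = ∏_{i ∈ τ} z_i`. -/
def exponent (τ : Finset (Fin d)) : Fin d → ℤ := fun i => if i ∈ τ then 1 else 0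

theorem exponent_mem {τ σ : Finset (Fin d)} (hσ : σ ∈ Δ.maxCones) (h : τ ⊆ σ) :
    exponent τ ∈ Δ.totalMonoid :=
  ⟨exponent τ, 0, ⟨fun i => by unfold exponent; split_ifs <;> norm_num,
    σ, hσ, fun _ hi => if_neg fun h' => hi (h h')⟩, zero_mem _, (add_zero _).symm⟩

/-- An ordering `σ_0, …, σ_r` of the maximal cones such that, `τ_i` being the intersection of `σ_i`
with the cones `σ_j`, `j > i`, that meet it in dimension `n - 1`, a cone `σ_j` contains `τ_i` only
if `i ≤ j`. -/
structure ConeOrder (r : ℕ) where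
  /-- the enumeration of the maximal cones -/
  cone : Fin (r + 1) ≃ Δ.maxCones
  le_of_subset : ∀ i j : Fin (r + 1),
    ((cone i).1.filter fun x => ∀ k, i < k → ((cone i).1 ∩ (cone k).1).card + 1 = n →
      x ∈ (cone k).1) ⊆ (cone j).1 → i ≤ j

end SmoothCompleteFan

namespace SmoothCompleteFan.ConeOrder

open laurentTower

variable {n d r : ℕ} {Δ : SmoothCompleteFan n d} (o : Δ.ConeOrder r)

/-- The cone `τ_i`: the intersection of `σ_i` with all cones `σ_k`, `k > i`, for which
`dim (σ_i ∩ σ_k) = n - 1`. -/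
def tau (i : Fin (r + 1)) : Finset (Fin d) :=
  (o.cone i).1.filter fun x => ∀ k, i < k → ((o.cone i).1 ∩ (o.cone k).1).card + 1 = n →
    x ∈ (o.cone k).1

theorem tau_subset (i : Fin (r + 1)) : o.tau i ⊆ (o.cone i).1 := Finset.filter_subset _ _

/-- The weight degree of `φ_i = P(τ_i)`. -/
def phiDeg (i : Fin (r + 1)) : ℤ := 2 * (o.tau i).card

/-- The indices `i` with `deg φ_i ≠ 2`, which carry a deformation parameter `t_i`. -/
abbrev BigIndex : Type := {i : Fin (r + 1) // o.phiDeg i ≠ 2}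

/-- The ring `𝓡 = ℂ[P] ⊗ ℂ[t]`. -/
abbrev BaseRing : Type := AddMonoidAlgebra ℂ (Δ.curveMonoid × (o.BigIndex →₀ ℕ))

/-- The ring `ℂ[P_φ] ⊗ ℂ[t]` of functions on the total space of the family. -/
abbrev TotalRing : Type := AddMonoidAlgebra ℂ (Δ.totalMonoid × (o.BigIndex →₀ ℕ))

/-- The map `𝓡 → ℂ[P_φ] ⊗ ℂ[t]`. -/
def structureMap : o.BaseRing →+* o.TotalRing :=
  AddMonoidAlgebra.mapDomainRingHom ℂ
    ((AddSubmonoid.inclusion Δ.curveMonoid_le_totalMonoid).prodMap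
      (AddMonoidHom.id (o.BigIndex →₀ ℕ)))

/-- The maximal ideal `𝓘` of `𝓡`, spanned by the nontrivial monomials `z^p t^l`. -/
def baseIdeal : Ideal o.BaseRing :=
  Ideal.span {a | ∃ x, x ≠ 0 ∧ a = AddMonoidAlgebra.single x 1}

/-- The extension of `𝓘` to the ring of functions on the total space. -/
def totalIdeal : Ideal o.TotalRing := o.baseIdeal.map o.structureMap

/-! #### Functions and derivations on the total space -/

/-- The monomial `P(τ_i)`, or more generally `∏_{x ∈ S} z_x` for a set `S` of generators of a
cone. -/
def coneMonomial {S σ : Finset (Fin d)} (hσ : σ ∈ Δ.maxCones) (h : S ⊆ σ) : o.TotalRing :=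
  AddMonoidAlgebra.single (⟨exponent S, Δ.exponent_mem hσ h⟩, 0) 1

/-- The coordinate function `z_j`. -/
def z (j : Fin d) : o.TotalRing :=
  o.coneMonomial (Δ.ray_mem j).choose_spec.1
    (Finset.singleton_subset_iff.2 (Δ.ray_mem j).choose_spec.2)

/-- The monomial `φ_i = P(τ_i)`. -/
def phi (i : Fin (r + 1)) : o.TotalRing :=
  o.coneMonomial (o.cone i).2 (o.tau_subset i)

/-- The deformation parameter `t_i`, as an element of `𝓡`. -/
def t (i : o.BigIndex) : o.BaseRing := AddMonoidAlgebra.single (0, Finsupp.single i 1) 1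

/-- The superpotential `f = z_1 + ⋯ + z_d`. -/
def f : o.TotalRing := ∑ j, o.z j

/-- The unfolding `F = f + ∑_{deg φ_i ≠ 2} t_i φ_i`. -/
def F : o.TotalRing := o.f + ∑ i : o.BigIndex, o.structureMap (o.t i) * o.phi i

/-- The logarithmic derivation `θ_j = z_j ∂/∂z_j` of `ℂ[P_φ] ⊗ ℂ[t]`. -/
def theta (j : Fin d) : Derivation ℂ o.TotalRing o.TotalRing :=
  logDerivation (((Int.castAddHom ℂ).comp ((Pi.evalAddMonoidHom (fun _ : Fin d => ℤ) j).comp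
    Δ.totalMonoid.subtype)).comp (AddMonoidHom.fst _ _))

/-- The frame `θ̃_i = ∑_j ⟨ρ_j, e^i⟩ θ_j` of the relative logarithmic derivations, with
`θ̃_i z^a = s(a)_i z^a`. -/
def thetaRel (i : Fin n) : Derivation ℂ o.TotalRing o.TotalRing :=
  logDerivation (((Int.castAddHom ℂ).comp ((Pi.evalAddMonoidHom (fun _ : Fin n => ℤ) i).comp
    (Δ.rayMap.comp Δ.totalMonoid.subtype))).comp (AddMonoidHom.fst _ _))

/-- The derivation `∂/∂t_i`. -/
def partialT (i : o.BigIndex) : Derivation ℂ o.TotalRing o.TotalRing := tDerivation i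

/-- The weight degree of the monomial `z^a t^l`: `deg z_j = 2` and `deg t_i = 2 - deg φ_i`. -/
def weight : Δ.totalMonoid × (o.BigIndex →₀ ℕ) →+ ℂ where
  toFun x := ((2 * ∑ j, x.1.1 j + ∑ i, (x.2 i : ℤ) * (2 - o.phiDeg i) : ℤ) : ℂ)
  map_zero' := by simp
  map_add' x y := by
    rw [← Int.cast_add]
    congr 1
    simp only [Prod.fst_add, Prod.snd_add, AddSubmonoid.coe_add, Pi.add_apply, Finsupp.add_apply,
      Nat.cast_add, add_mul, Finset.sum_add_distrib, mul_add]
    ring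

/-- The derivation multiplying every monomial `z^a t^l` by its weight degree. -/
def weightDerivation : Derivation ℂ o.TotalRing o.TotalRing := logDerivation o.weight

theorem thetaRel_structureMap (i : Fin n) (a : o.BaseRing) :
    o.thetaRel i (o.structureMap a) = 0 := by
  induction a using AddMonoidAlgebra.induction_linear with
  | zero => simp
  | add a b h h' => rw [map_add, map_add, h, h', add_zero]
  | single x c =>
    have hx : Δ.rayMap x.1.1 = 0 := x.1.2.1
    simp [structureMap, thetaRel, hx]

theorem logDerivation_mem_totalIdeal (ℓ : Δ.totalMonoid × (o.BigIndex →₀ ℕ) →+ ℂ)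
    {a : o.TotalRing} (ha : a ∈ o.totalIdeal) : logDerivation ℓ a ∈ o.totalIdeal := by
  have hspan : o.totalIdeal = Ideal.span (o.structureMap ''
      {a | ∃ x, x ≠ 0 ∧ a = AddMonoidAlgebra.single x 1}) := Ideal.map_span _ _
  rw [hspan] at ha ⊢
  refine Submodule.span_induction ?_ ?_ ?_ ?_ ha
  · rintro _ ⟨_, ⟨x, hx, rfl⟩, rfl⟩
    have h1 : o.structureMap (AddMonoidAlgebra.single x 1) = AddMonoidAlgebra.single
        (((AddSubmonoid.inclusion Δ.curveMonoid_le_totalMonoid).prodMap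
          (AddMonoidHom.id (o.BigIndex →₀ ℕ))) x) 1 := by
      simp [structureMap]
    have h2 : logDerivation ℓ (o.structureMap (AddMonoidAlgebra.single x 1)) =
        AddMonoidAlgebra.single 0 (ℓ (((AddSubmonoid.inclusion
          Δ.curveMonoid_le_totalMonoid).prodMap (AddMonoidHom.id (o.BigIndex →₀ ℕ))) x)) *
        o.structureMap (AddMonoidAlgebra.single x 1) := by
      rw [h1, logDerivation_single, AddMonoidAlgebra.single_mul_single, zero_add]
    rw [h2]
    exact Ideal.mul_mem_left _ _ (Ideal.subset_span ⟨_, ⟨x, hx, rfl⟩, rfl⟩)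
  · rw [map_zero]
    exact zero_mem _
  · intro x y _ _ hx hy
    rw [map_add]
    exact add_mem hx hy
  · intro b x hx hx'
    rw [smul_eq_mul, Derivation.leibniz, smul_eq_mul, smul_eq_mul]
    exact add_mem (Ideal.mul_mem_left _ _ hx') (Ideal.mul_mem_right _ _ hx)

theorem F_sub_f_mem : o.F - o.f ∈ o.totalIdeal := by
  rw [F, add_sub_cancel_left]
  refine Ideal.sum_mem _ fun i _ => Ideal.mul_mem_right _ _ (Ideal.mem_map_of_mem _ ?_)
  refine Ideal.subset_span ⟨_, fun h => ?_, rfl⟩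
  have := congrArg (fun x => x.2 i) h
  simp at this

theorem sum_exponent (S : Finset (Fin d)) : ∑ j, exponent S j = S.card := by
  simp [exponent]

theorem weight_coneMonomial {S σ : Finset (Fin d)} (hσ : σ ∈ Δ.maxCones) (h : S ⊆ σ) :
    o.weightDerivation (o.coneMonomial hσ h) = (2 * S.card : ℤ) • o.coneMonomial hσ h := by
  rw [coneMonomial, weightDerivation, logDerivation_single, AddMonoidAlgebra.smul_single]
  congr 1
  change ((2 * ∑ j, exponent S j + ∑ i : o.BigIndex, ((0 : ℕ) : ℤ) * (2 - o.phiDeg i) : ℤ) : ℂ) * 1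
    = (2 * S.card : ℤ) • (1 : ℂ)
  rw [sum_exponent]
  simp

theorem weight_f : o.weightDerivation o.f = (2 : ℤ) • o.f := by
  rw [f, map_sum, Finset.smul_sum]
  refine Finset.sum_congr rfl fun j _ => ?_
  rw [z, weight_coneMonomial]
  rfl

theorem weight_F : o.weightDerivation o.F = (2 : ℤ) • o.F := by
  rw [F, map_add, weight_f, smul_add, map_sum, Finset.smul_sum]
  congr 1
  refine Finset.sum_congr rfl fun i _ => ?_
  rw [Derivation.leibniz, phi, weight_coneMonomial]
  have h : o.weightDerivation (o.structureMap (o.t i)) =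
      (2 - o.phiDeg i : ℤ) • o.structureMap (o.t i) := by
    have h1 : o.structureMap (o.t i) = AddMonoidAlgebra.single (0, Finsupp.single i 1) 1 := by
      simp [structureMap, t]
    rw [h1, weightDerivation, logDerivation_single, AddMonoidAlgebra.smul_single]
    congr 1
    simp [weight, Finsupp.single_apply]
  rw [h, smul_eq_mul, smul_eq_mul, mul_smul_comm, mul_smul_comm, mul_comm (o.coneMonomial _ _),
    ← add_smul]
  congr 1
  simp [phiDeg]

theorem thetaRel_comm_theta (i : Fin n) (j : Fin d) (a : o.TotalRing) :
    o.theta j (o.thetaRel i a) = o.thetaRel i (o.theta j a) :=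
  logDerivation_comm _ _ a

theorem thetaRel_comm_partialT (i : Fin n) (j : o.BigIndex) (a : o.TotalRing) :
    o.partialT j (o.thetaRel i a) = o.thetaRel i (o.partialT j a) :=
  tDerivation_logDerivation_comm _ _ a

theorem thetaRel_comm_weight (i : Fin n) (a : o.TotalRing) :
    o.weightDerivation (o.thetaRel i a) = o.thetaRel i (o.weightDerivation a) :=
  logDerivation_comm _ _ a

/-! #### The twisted de Rham complexes -/

/-- The ring `lim_k 𝓡_k((u))`, where `𝓡_k = 𝓡 / 𝓘^(k+1)`. -/
abbrev RPM : Type := laurentTower o.BaseRing o.baseIdeal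

/-- The ring `lim_k 𝓡_k[[u]]`. -/
abbrev RPlus : Subring o.RPM := plus o.BaseRing o.baseIdeal

/-- The ring `lim_k 𝓡_k[u⁻¹]`. -/
abbrev RMinus : Subring o.RPM := minus o.BaseRing o.baseIdeal

/-- The completed ring `lim_k 𝓡_k`. -/
abbrev RHat : Subring o.RPlus := hat o.BaseRing o.baseIdeal

/-- The functions `lim_k 𝒪_k((u))`, where `𝒪_k` is the ring of functions on the family over
`Spec 𝓡_k`. -/
abbrev OPM : Type := laurentTower o.TotalRing o.totalIdeal

/-- The map `lim_k 𝓡_k((u)) → lim_k 𝒪_k((u))`. -/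
def towerMap : o.RPM →+* o.OPM := mapHom o.structureMap (J' := o.totalIdeal) le_rfl

instance : Module o.RPM o.OPM := Module.compHom o.OPM o.towerMap

theorem smul_eq (a : o.RPM) (x : o.OPM) : a • x = o.towerMap a * x := rfl

theorem deriv_towerMap_mul (i : Fin n) (a : o.RPM) (x : o.OPM) :
    deriv (o.thetaRel i) (o.towerMap a * x) = o.towerMap a * deriv (o.thetaRel i) x :=
  deriv_mapHom_mul o.structureMap le_rfl (o.thetaRel i) (o.thetaRel_structureMap i) a x

/-- The coefficient `θ̃_i(F) + u θ̃_i` of `∂/∂θ̃_i` in the differential `{F, -} + u ∂`. -/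
def qOp (i : Fin n) : o.OPM →ₗ[o.RPM] o.OPM where
  toFun x := const (o.thetaRel i o.F) * x + u * deriv (o.thetaRel i) x
  map_add' x y := by
    rw [map_add]
    ring
  map_smul' a x := by
    rw [smul_eq, deriv_towerMap_mul, RingHom.id_apply, smul_eq]
    ring

/-- Relative logarithmic polyvector fields, in the frame `θ̃_1, …, θ̃_n`, with coefficients in
`lim_k 𝒪_k((u))`. -/
abbrev PolyPM : Type := Finset (Fin n) → o.OPM

/-- The differential `Q_F = {F, -} + u ∂`. -/
def QF : o.PolyPM →ₗ[o.RPM] o.PolyPM := koszul o.qOp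

/-- The polyvector fields with coefficients in `lim_k 𝒪_k[[u]]`. -/
def polyPlus : Submodule o.RPlus o.PolyPM where
  carrier := {α | ∀ I, α I ∈ plus o.TotalRing o.totalIdeal}
  zero_mem' _ := zero_mem _
  add_mem' hα hβ I := add_mem (hα I) (hβ I)
  smul_mem' c _ hα I := mul_mem (mapHom_mem _ le_rfl _ c.2) (hα I)

/-- The module `ℋ_{F,±}`, the cohomology of `Q_F` with coefficients in Laurent series in `u`. -/
abbrev HPM : Type := Coh o.QF ⊤

/-- The Hodge module `ℋ_F`, the cohomology of `Q_F` with coefficients in power series in `u`. -/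
abbrev HF : Type := Coh (o.QF.restrictScalars o.RPlus) o.polyPlus

/-- The natural map `ℋ_F → ℋ_{F,±}`. -/
def incl : o.HF →+ o.HPM :=
  Coh.hom _ _ _ _ (AddMonoidHom.id _) (fun _ _ => Submodule.mem_top) fun _ => rfl

/-- The operator `u D + D(F)` on functions, for a derivation `D` of the total space. -/
def twist (D : Derivation ℂ o.TotalRing o.TotalRing) : o.OPM →+ o.OPM where
  toFun x := u * deriv D x + const (D o.F) * x
  map_zero' := by simp
  map_add' x y := by
    rw [map_add]
    ring

theorem deriv_u_mul (D : Derivation ℂ o.TotalRing o.TotalRing) (x : o.OPM) :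
    deriv D (u * x) = u * deriv D x := by
  rw [u, deriv_monomial_mul, D.map_one_eq_zero]
  have : (monomial 1 0 : o.OPM) = 0 := ext_coeff fun k j => by
    simp [monomial]
    rfl
  rw [this, zero_mul, zero_add]

theorem twist_qOp (D : Derivation ℂ o.TotalRing o.TotalRing)
    (hD : ∀ i a, D (o.thetaRel i a) = o.thetaRel i (D a)) (i : Fin n) (x : o.OPM) :
    o.twist D (o.qOp i x) = o.qOp i (o.twist D x) :=
  twisted_comm u (const (o.thetaRel i o.F)) (const (D o.F)) (const (o.thetaRel i (D o.F)))
    (deriv (o.thetaRel i)) (deriv D) (o.deriv_u_mul _) (o.deriv_u_mul _)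
    (fun x => deriv_monomial_mul _ _ _ _)
    (fun x => (deriv_monomial_mul _ _ _ _).trans (by rw [hD]; rfl))
    (deriv_comm _ _ (hD i)) x

theorem twist_mem (D : Derivation ℂ o.TotalRing o.TotalRing) (α : o.PolyPM)
    (hα : α ∈ o.polyPlus) : onCoeffs n (o.twist D) α ∈ o.polyPlus := fun I =>
  add_mem (mul_mem (monomial_mem _ _ (by simp) _) (deriv_mem _ D (hα I)))
    (mul_mem (monomial_mem _ _ (zero_mem _) _) (hα I))

/-- The operator induced by `u D + D(F)` on `ℋ_F`. -/
def twistHF (D : Derivation ℂ o.TotalRing o.TotalRing)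
    (hD : ∀ i a, D (o.thetaRel i a) = o.thetaRel i (D a)) : o.HF →+ o.HF :=
  Coh.hom _ _ _ _ (onCoeffs n (o.twist D)) (o.twist_mem D) fun α =>
    onCoeffs_koszul (o.twist D) o.qOp o.qOp (o.twist_qOp D hD) α

/-- The operator induced by `u D + D(F)` on `ℋ_{F,±}`. -/
def twistHPM (D : Derivation ℂ o.TotalRing o.TotalRing)
    (hD : ∀ i a, D (o.thetaRel i a) = o.thetaRel i (D a)) : o.HPM →+ o.HPM :=
  Coh.hom _ _ _ _ (onCoeffs n (o.twist D)) (fun _ _ => Submodule.mem_top) fun α =>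
    onCoeffs_koszul (o.twist D) o.qOp o.qOp (o.twist_qOp D hD) α

/-! #### The Gauss-Manin connection -/

/-- The logarithmic vector fields on the base, `Hom(A_1(Y, ℤ), 𝓡^) ⊕ ⨁_i 𝓡^ ∂/∂t_i`, where
`A_1(Y, ℤ) = P^gp`. The pair `(ν, τ)` acts by `z^p ↦ ν(p) z^p` and `t_i ↦ τ_i`. -/
abbrev LogFields : Type := (Δ.curveLattice →+ o.RHat) × (o.BigIndex → o.RHat)

variable (π : (Fin d → ℤ) →+ Δ.curveLattice)

/-- The operator `u ∇_v` on `ℋ_F`. Given the splitting `π`, the logarithmic vector field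
`v = (ν, τ)` on the base is lifted to `∑_j ν(π(e_j)) θ_j + ∑_i τ_i ∂/∂t_i` on the total space. -/
def uNablaHF (v : o.LogFields) (x : o.HF) : o.HF :=
  ∑ j, v.1 (π (Pi.single j 1)) • o.twistHF (o.theta j) (fun i => o.thetaRel_comm_theta i j) x +
    ∑ j, v.2 j • o.twistHF (o.partialT j) (fun i => o.thetaRel_comm_partialT i j) x

/-- The Gauss-Manin connection `∇_v` on `ℋ_{F,±}`. -/
def nabla (v : o.LogFields) (x : o.HPM) : o.HPM :=
  (uInv : o.RPM) •
    (∑ j, ((v.1 (π (Pi.single j 1)) : o.RPlus) : o.RPM) •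
      o.twistHPM (o.theta j) (fun i => o.thetaRel_comm_theta i j) x +
    ∑ j, ((v.2 j : o.RPlus) : o.RPM) •
      o.twistHPM (o.partialT j) (fun i => o.thetaRel_comm_partialT i j) x)

/-- Complex numbers as elements of `𝓡^`. -/
def scalar : ℂ →+ o.RHat where
  toFun c := ⟨⟨const (algebraMap ℂ o.BaseRing c), monomial_mem _ _ (zero_mem _) _⟩,
    monomial_mem _ _ (zero_mem _) _⟩
  map_zero' := Subtype.ext <| Subtype.ext <| ext_coeff fun k j => by
    simp [const, monomial]
    rfl
  map_add' c c' := Subtype.ext <| Subtype.ext <| ext_coeff fun k j => by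
    change (HahnSeries.single 0 (Ideal.Quotient.mk _ (algebraMap ℂ o.BaseRing (c + c')))).coeff j =
      (HahnSeries.single 0 (Ideal.Quotient.mk _ (algebraMap ℂ o.BaseRing c))).coeff j +
      (HahnSeries.single 0 (Ideal.Quotient.mk _ (algebraMap ℂ o.BaseRing c'))).coeff j
    rw [map_add, map_add, HahnSeries.single_add, HahnSeries.coeff_add]

/-- The vector field `z^p ↦ ν(p) z^p` with constant coefficients. -/
def constField (ν : Δ.curveLattice →+ ℂ) : o.LogFields := (o.scalar.comp ν, 0)

/-- The vector field `∂/∂t_i`. -/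
def tField (i : o.BigIndex) : o.LogFields := (0, Pi.single i 1)

/-! #### The grading -/

/-- The operator `2 u ∂/∂u` plus the weight derivation, on functions. -/
def eulerFun : o.OPM →+ o.OPM where
  toFun x := (2 : ℤ) • uDeriv x + deriv o.weightDerivation x
  map_zero' := by simp
  map_add' x y := by
    rw [map_add, map_add, smul_add]
    abel

theorem euler_aux {A : Type*} [AddCommGroup A] (p q p' q' : A) :
    ((2 * 0 + 2 : ℤ) • p + p') + ((2 * 1 + 0 : ℤ) • q + q') = p' + q' + (2 : ℤ) • (p + q) := by
  norm_num
  abel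

theorem eulerFun_monomial_mul (j : ℤ) (b : o.TotalRing) (w : ℤ)
    (hb : o.weightDerivation b = w • b) (x : o.OPM) :
    o.eulerFun (monomial j b * x) = (2 * j + w) • (monomial j b * x) +
      monomial j b * o.eulerFun x := by
  change (2 : ℤ) • uDeriv (monomial j b * x) + deriv o.weightDerivation (monomial j b * x) =
    _ + monomial j b * ((2 : ℤ) • uDeriv x + deriv o.weightDerivation x)
  have h : (monomial j (w • b) : o.OPM) = w • monomial j b := ext_coeff fun k i => by
    change (HahnSeries.single j (Ideal.Quotient.mk _ (w • b))).coeff i =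
      w • (HahnSeries.single j (Ideal.Quotient.mk _ b)).coeff i
    rw [map_zsmul]
    by_cases hi : i = j
    · subst hi; simp
    · simp [HahnSeries.coeff_single_of_ne hi]
  rw [uDeriv_monomial_mul, deriv_monomial_mul, hb, h, smul_mul_assoc, add_smul, mul_smul, smul_add,
    mul_add, mul_smul_comm]
  abel

theorem qOp_apply (i : Fin n) (x : o.OPM) : o.qOp i x =
    monomial 0 (o.thetaRel i o.F) * x + monomial 1 1 * deriv (o.thetaRel i) x := rfl

theorem eulerFun_qOp (i : Fin n) (x : o.OPM) :
    o.eulerFun (o.qOp i x) = o.qOp i (o.eulerFun x) + (2 : ℤ) • o.qOp i x := by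
  rw [qOp_apply, qOp_apply]
  have hc : deriv (o.thetaRel i) (o.eulerFun x) = o.eulerFun (deriv (o.thetaRel i) x) := by
    change deriv (o.thetaRel i) ((2 : ℤ) • uDeriv x + deriv o.weightDerivation x) =
      (2 : ℤ) • uDeriv (deriv (o.thetaRel i) x) + deriv o.weightDerivation (deriv (o.thetaRel i) x)
    rw [map_add, map_zsmul, deriv_uDeriv, deriv_comm _ _ (o.thetaRel_comm_weight i)]
  rw [map_add, o.eulerFun_monomial_mul 0 _ 2 (by
      rw [thetaRel_comm_weight, weight_F, map_zsmul]), o.eulerFun_monomial_mul 1 1 0 (by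
      rw [Derivation.map_one_eq_zero, zero_smul]), hc]
  exact euler_aux _ _ _ _

theorem eulerFun_mem (α : o.PolyPM) (hα : α ∈ o.polyPlus) :
    polyEuler n o.eulerFun α ∈ o.polyPlus := fun I =>
  add_mem (add_mem (zsmul_mem (uDeriv_mem _ (hα I)) _) (deriv_mem _ _ (hα I)))
    (zsmul_mem (hα I) _)

/-- The grading operator `E_F` on `ℋ_F`. -/
def eulerHF : o.HF →+ o.HF :=
  Coh.hom _ _ _ _ (polyEuler n o.eulerFun) o.eulerFun_mem fun α =>
    polyEuler_koszul o.eulerFun o.qOp o.eulerFun_qOp α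

/-- The grading operator `E_F` on `ℋ_{F,±}`. -/
def eulerHPM : o.HPM →+ o.HPM :=
  Coh.hom _ _ _ _ (polyEuler n o.eulerFun) (fun _ _ => Submodule.mem_top) fun α =>
    polyEuler_koszul o.eulerFun o.qOp o.eulerFun_qOp α

/-! #### The central fibre -/

/-- The ring of functions `ℂ[P_φ] ⊗ ℂ[t] / 𝓘` on the central fibre `X`, the Stanley-Reisner ring of
the fan. -/
abbrev FiberRing : Type := o.TotalRing ⧸ o.totalIdeal

/-- The functions on the central fibre with coefficients in Laurent series in `u`. -/
def FiberPM : Type := LaurentSeries o.FiberRing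

instance : CommRing o.FiberPM := inferInstanceAs (CommRing (LaurentSeries o.FiberRing))

/-- The monomial `b u^j`. -/
def fiberMonomial (j : ℤ) (b : o.FiberRing) : o.FiberPM :=
  (HahnSeries.single j b : LaurentSeries o.FiberRing)

/-- A derivation of the ring of functions on the central fibre, acting on coefficients. -/
def fiberDeriv (D : Derivation ℂ o.FiberRing o.FiberRing) : o.FiberPM →+ o.FiberPM :=
  laurentDeriv D

theorem fiberDeriv_monomial_mul (D : Derivation ℂ o.FiberRing o.FiberRing) (j : ℤ)
    (b : o.FiberRing) (x : o.FiberPM) :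
    o.fiberDeriv D (o.fiberMonomial j b * x) =
      o.fiberMonomial j (D b) * x + o.fiberMonomial j b * o.fiberDeriv D x :=
  laurentDeriv_single_mul D j b x

/-- The operator `u ∂/∂u`. -/
def fiberUDeriv : o.FiberPM →+ o.FiberPM := laurentUDeriv (B := o.FiberRing)

theorem fiberUDeriv_monomial_mul (j : ℤ) (b : o.FiberRing) (x : o.FiberPM) :
    o.fiberUDeriv (o.fiberMonomial j b * x) =
      j • (o.fiberMonomial j b * x) + o.fiberMonomial j b * o.fiberUDeriv x :=
  laurentUDeriv_single_mul j b x

/-- Complex Laurent series as series of functions on the central fibre. -/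
def fiberScalar : LaurentSeries ℂ →+* o.FiberPM where
  toFun g := (g.map (algebraMap ℂ o.FiberRing) : LaurentSeries o.FiberRing)
  map_one' := HahnSeries.map_one (algebraMap ℂ o.FiberRing).toMonoidWithZeroHom
  map_zero' := HahnSeries.ext <| funext fun _ => map_zero (algebraMap ℂ o.FiberRing)
  map_add' _ _ := HahnSeries.ext <| funext fun _ => map_add (algebraMap ℂ o.FiberRing) _ _
  map_mul' _ _ := HahnSeries.map_mul (algebraMap ℂ o.FiberRing).toNonUnitalRingHom

instance : Module (LaurentSeries ℂ) o.FiberPM := Module.compHom o.FiberPM o.fiberScalar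

theorem fiber_smul_eq (g : LaurentSeries ℂ) (x : o.FiberPM) : g • x = o.fiberScalar g * x := rfl

/-- The derivation `θ_j` of the central fibre. -/
def fiberTheta (j : Fin d) : Derivation ℂ o.FiberRing o.FiberRing :=
  quotDerivation (o.theta j) o.totalIdeal fun _ ha => o.logDerivation_mem_totalIdeal _ ha

/-- The derivation `θ̃_i` of the central fibre. -/
def fiberThetaRel (i : Fin n) : Derivation ℂ o.FiberRing o.FiberRing :=
  quotDerivation (o.thetaRel i) o.totalIdeal fun _ ha => o.logDerivation_mem_totalIdeal _ ha

/-- The weight derivation of the central fibre. -/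
def fiberWeight : Derivation ℂ o.FiberRing o.FiberRing :=
  quotDerivation o.weightDerivation o.totalIdeal fun _ ha => o.logDerivation_mem_totalIdeal _ ha

/-- The superpotential `f` on the central fibre. -/
def fiberf : o.FiberRing := Ideal.Quotient.mk _ o.f

/-- The coefficient `θ̃_i(f) + u θ̃_i` of `∂/∂θ̃_i` in the differential `{f, -} + u ∂`. -/
def fiberQOp (i : Fin n) : o.FiberPM →ₗ[LaurentSeries ℂ] o.FiberPM where
  toFun x := o.fiberMonomial 0 (o.fiberThetaRel i o.fiberf) * x +
    o.fiberMonomial 1 1 * o.fiberDeriv (o.fiberThetaRel i) x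
  map_add' x y := by
    rw [map_add]
    ring
  map_smul' g x := by
    have h : o.fiberDeriv (o.fiberThetaRel i) (o.fiberScalar g * x) =
      o.fiberScalar g * o.fiberDeriv (o.fiberThetaRel i) x := laurentDeriv_map_mul _ g x
    rw [fiber_smul_eq, h, RingHom.id_apply, fiber_smul_eq]
    ring

/-- The differential `Q_f = {f, -} + u ∂` on polyvector fields of the central fibre. -/
def Qf : (Finset (Fin n) → o.FiberPM) →ₗ[LaurentSeries ℂ] (Finset (Fin n) → o.FiberPM) :=
  koszul o.fiberQOp

/-- The `ℂ((u))`-vector space `ℋ_{f,±}`. -/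
abbrev HfPM : Type := Coh o.Qf ⊤

/-- Restriction of functions to the central fibre, `lim_k 𝒪_k((u)) → 𝒪_X((u))`. -/
def restrictFun : o.OPM →+ o.FiberPM where
  toFun x := ((x.1 0).map (Ideal.Quotient.factor (Ideal.pow_le_self (I := o.totalIdeal)
    (Nat.succ_ne_zero 0))) : LaurentSeries o.FiberRing)
  map_zero' := HahnSeries.ext <| funext fun _ => map_zero (Ideal.Quotient.factor _)
  map_add' _ _ := HahnSeries.ext <| funext fun _ => map_add (Ideal.Quotient.factor _) _ _

theorem restrictFun_monomial_mul (j : ℤ) (b : o.TotalRing) (x : o.OPM) :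
    o.restrictFun (monomial j b * x) =
      o.fiberMonomial j (Ideal.Quotient.mk o.totalIdeal b) * o.restrictFun x := by
  refine HahnSeries.ext (funext fun i => ?_)
  refine Eq.trans ?_ (HahnSeries.coeff_single_mul (R := o.FiberRing)).symm
  change Ideal.Quotient.factor _ (((monomial j b * x).1 0).coeff i) = _
  rw [coeff_monomial_mul, map_mul]
  rfl

theorem restrictFun_deriv (D : Derivation ℂ o.TotalRing o.TotalRing)
    (hD : ∀ a ∈ o.totalIdeal, D a ∈ o.totalIdeal) (x : o.OPM) :
    o.restrictFun (deriv D x) = o.fiberDeriv (quotDerivation D o.totalIdeal hD)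
      (o.restrictFun x) := by
  refine HahnSeries.ext (funext fun i => ?_)
  obtain ⟨a, ha⟩ := Ideal.Quotient.mk_surjective ((x.1 (0 + 1)).coeff i)
  change Ideal.Quotient.factor _ (((deriv D x).1 0).coeff i) =
    quotDerivation D o.totalIdeal hD (Ideal.Quotient.factor _ ((x.1 0).coeff i))
  rw [coeff_deriv D x 0 i a ha, ← factor_coeff, ← ha]
  rfl

theorem restrictFun_qOp (i : Fin n) (x : o.OPM) :
    o.restrictFun (o.qOp i x) = o.fiberQOp i (o.restrictFun x) := by
  change o.restrictFun (monomial 0 (o.thetaRel i o.F) * x +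
    monomial 1 1 * deriv (o.thetaRel i) x) = _
  have h2 := o.restrictFun_deriv (o.thetaRel i)
    (fun _ ha => o.logDerivation_mem_totalIdeal _ ha) x
  rw [map_add, restrictFun_monomial_mul, restrictFun_monomial_mul, h2]
  have h : Ideal.Quotient.mk o.totalIdeal (o.thetaRel i o.F) =
      Ideal.Quotient.mk o.totalIdeal (o.thetaRel i o.f) := by
    rw [Ideal.Quotient.eq, ← map_sub]
    exact o.logDerivation_mem_totalIdeal _ o.F_sub_f_mem
  rw [h]
  rfl

/-- Reduction modulo `𝓘`, `ℋ_{F,±} → ℋ_{f,±}`. -/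
def reduce : o.HPM →+ o.HfPM :=
  Coh.hom _ _ _ _ (onCoeffs n o.restrictFun) (fun _ _ => Submodule.mem_top) fun α =>
    onCoeffs_koszul o.restrictFun o.qOp o.fiberQOp o.restrictFun_qOp α

/-- The operator `u θ_j + θ_j(f)` on functions on the central fibre. -/
def fiberTwist (j : Fin d) : o.FiberPM →+ o.FiberPM where
  toFun x := o.fiberMonomial 1 1 * o.fiberDeriv (o.fiberTheta j) x +
    o.fiberMonomial 0 (o.fiberTheta j o.fiberf) * x
  map_zero' := by simp
  map_add' x y := by
    rw [map_add]
    ring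

theorem fiberTheta_comm (i : Fin n) (j : Fin d) (a : o.FiberRing) :
    o.fiberTheta j (o.fiberThetaRel i a) = o.fiberThetaRel i (o.fiberTheta j a) := by
  obtain ⟨b, rfl⟩ := Ideal.Quotient.mk_surjective a
  exact congrArg (Ideal.Quotient.mk _) (o.thetaRel_comm_theta i j b)

theorem fiberWeight_comm (i : Fin n) (a : o.FiberRing) :
    o.fiberWeight (o.fiberThetaRel i a) = o.fiberThetaRel i (o.fiberWeight a) := by
  obtain ⟨b, rfl⟩ := Ideal.Quotient.mk_surjective a
  exact congrArg (Ideal.Quotient.mk _) (o.thetaRel_comm_weight i b)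

theorem fiberTwist_qOp (j : Fin d) (i : Fin n) (x : o.FiberPM) :
    o.fiberTwist j (o.fiberQOp i x) = o.fiberQOp i (o.fiberTwist j x) := by
  have hu : ∀ (D : Derivation ℂ o.FiberRing o.FiberRing) (x : o.FiberPM),
      o.fiberDeriv D (o.fiberMonomial 1 1 * x) = o.fiberMonomial 1 1 * o.fiberDeriv D x := by
    intro D x
    have h0 : o.fiberMonomial 1 0 = 0 := HahnSeries.single_eq_zero (R := o.FiberRing)
    rw [fiberDeriv_monomial_mul, D.map_one_eq_zero, h0, zero_mul, zero_add]
  exact twisted_comm (o.fiberMonomial 1 1) (o.fiberMonomial 0 (o.fiberThetaRel i o.fiberf))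
    (o.fiberMonomial 0 (o.fiberTheta j o.fiberf))
    (o.fiberMonomial 0 (o.fiberThetaRel i (o.fiberTheta j o.fiberf)))
    (o.fiberDeriv (o.fiberThetaRel i)) (o.fiberDeriv (o.fiberTheta j)) (hu _) (hu _)
    (fun x => o.fiberDeriv_monomial_mul _ _ _ _)
    (fun x => (o.fiberDeriv_monomial_mul _ _ _ _).trans (by rw [fiberTheta_comm]))
    (fun x => HahnSeries.ext <| funext fun k => o.fiberTheta_comm i j _) x

/-- The operator induced by `u θ_j + θ_j(f)` on `ℋ_{f,±}`. -/
def twistHf (j : Fin d) : o.HfPM →+ o.HfPM :=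
  Coh.hom _ _ _ _ (onCoeffs n (o.fiberTwist j)) (fun _ _ => Submodule.mem_top) fun α =>
    onCoeffs_koszul (o.fiberTwist j) o.fiberQOp o.fiberQOp (o.fiberTwist_qOp j) α

/-- The residue `∇_ν^{(0)}` of the Gauss-Manin connection on `ℋ_{f,±}`. -/
def residue (ν : Δ.curveLattice →+ ℂ) (x : o.HfPM) : o.HfPM :=
  (HahnSeries.single (-1) 1 : LaurentSeries ℂ) •
    ∑ j, (HahnSeries.single 0 (ν (π (Pi.single j 1))) : LaurentSeries ℂ) • o.twistHf j x

/-- The operator `2 u ∂/∂u` plus the weight derivation, on functions on the central fibre. -/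
def fiberEulerFun : o.FiberPM →+ o.FiberPM where
  toFun x := (2 : ℤ) • o.fiberUDeriv x + o.fiberDeriv o.fiberWeight x
  map_zero' := by simp
  map_add' x y := by
    rw [map_add, map_add, smul_add]
    abel

theorem fiberEulerFun_single_mul (j : ℤ) (b : o.FiberRing) (w : ℤ)
    (hb : o.fiberWeight b = w • b) (x : o.FiberPM) :
    o.fiberEulerFun (o.fiberMonomial j b * x) = (2 * j + w) • (o.fiberMonomial j b * x) +
      o.fiberMonomial j b * o.fiberEulerFun x := by
  change (2 : ℤ) • o.fiberUDeriv (o.fiberMonomial j b * x) +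
    o.fiberDeriv o.fiberWeight (o.fiberMonomial j b * x) =
    _ + o.fiberMonomial j b * ((2 : ℤ) • o.fiberUDeriv x + o.fiberDeriv o.fiberWeight x)
  have h : o.fiberMonomial j (w • b) = w • o.fiberMonomial j b :=
    map_zsmul (HahnSeries.single.addMonoidHom (R := o.FiberRing) j) w b
  rw [fiberUDeriv_monomial_mul, fiberDeriv_monomial_mul, hb, h, smul_mul_assoc, add_smul, mul_smul,
    smul_add, mul_add, mul_smul_comm]
  abel

theorem fiberEulerFun_qOp (i : Fin n) (x : o.FiberPM) :
    o.fiberEulerFun (o.fiberQOp i x) =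
      o.fiberQOp i (o.fiberEulerFun x) + (2 : ℤ) • o.fiberQOp i x := by
  change o.fiberEulerFun (o.fiberMonomial 0 (o.fiberThetaRel i o.fiberf) * x +
      o.fiberMonomial 1 1 * o.fiberDeriv (o.fiberThetaRel i) x) =
    o.fiberMonomial 0 (o.fiberThetaRel i o.fiberf) * o.fiberEulerFun x +
      o.fiberMonomial 1 1 * o.fiberDeriv (o.fiberThetaRel i) (o.fiberEulerFun x) +
      (2 : ℤ) • (o.fiberMonomial 0 (o.fiberThetaRel i o.fiberf) * x +
        o.fiberMonomial 1 1 * o.fiberDeriv (o.fiberThetaRel i) x)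
  have hc : o.fiberDeriv (o.fiberThetaRel i) (o.fiberEulerFun x) =
      o.fiberEulerFun (o.fiberDeriv (o.fiberThetaRel i) x) := by
    refine HahnSeries.ext (funext fun k => ?_)
    change o.fiberThetaRel i ((2 : ℤ) • (k • x.coeff k) + o.fiberWeight (x.coeff k)) =
      (2 : ℤ) • (k • o.fiberThetaRel i (x.coeff k)) + o.fiberWeight (o.fiberThetaRel i (x.coeff k))
    rw [map_add, map_zsmul, map_zsmul, fiberWeight_comm]
  have hf : o.fiberWeight o.fiberf = (2 : ℤ) • o.fiberf :=
    congrArg (Ideal.Quotient.mk o.totalIdeal) o.weight_f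
  rw [map_add, o.fiberEulerFun_single_mul 0 _ 2 (by
      rw [fiberWeight_comm, hf, map_zsmul]), o.fiberEulerFun_single_mul 1 1 0 (by
      rw [Derivation.map_one_eq_zero, zero_smul]), hc, smul_add]
  norm_num
  abel

/-- The grading operator `E_f` on `ℋ_{f,±}`. -/
def eulerHf : o.HfPM →+ o.HfPM :=
  Coh.hom _ _ _ _ (polyEuler n o.fiberEulerFun) (fun _ _ => Submodule.mem_top) fun α =>
    polyEuler_koszul o.fiberEulerFun o.fiberQOp o.fiberEulerFun_qOp α

/-! #### Classes of functions -/

/-- A function, as a polyvector field of degree zero. -/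
def degreeZero (n : ℕ) {M : Type*} [AddCommGroup M] (x : M) : Finset (Fin n) → M :=
  fun I => if I = ∅ then x else 0

theorem koszul_degreeZero {n : ℕ} {S M : Type*} [CommRing S] [AddCommGroup M] [Module S M]
    (q : Fin n → M →ₗ[S] M) (x : M) : koszul q (degreeZero n x) = 0 := by
  funext I
  rw [koszul_apply]
  refine Finset.sum_eq_zero fun i _ => ?_
  split_ifs
  · rfl
  · rw [degreeZero, if_neg (Finset.insert_ne_empty i I), map_zero, smul_zero]

/-- The class of `φ_i` in `ℋ_F`. -/
def phiHF (i : Fin (r + 1)) : o.HF :=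
  Coh.mk _ _ (degreeZero n (const (o.phi i))) (koszul_degreeZero o.qOp _) fun I => by
    unfold degreeZero
    split_ifs
    · exact monomial_mem _ _ (zero_mem _) _
    · exact zero_mem _

/-- The class of `φ_i` in `ℋ_{f,±}`. -/
def phiHf (i : Fin (r + 1)) : o.HfPM :=
  Coh.mk _ _ (degreeZero n (o.fiberMonomial 0 (Ideal.Quotient.mk _ (o.phi i))))
    (koszul_degreeZero o.fiberQOp _) Submodule.mem_top

/-! #### Deligne extension, Birkhoff factorization, primitive forms -/

/-- `DE : ℋ_{f,±} → ℋ_{F,±}` is the Deligne extension: a degree preserving `ℂ((u))`-linear map,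
equal to the identity modulo `𝓘`, that intertwines the Gauss-Manin connection with its residue. The
residue vanishes in the directions `∂/∂t_i`, which are not logarithmic. -/
structure IsDeligneExtension (DE : o.HfPM →ₛₗ[(ofLaurent : LaurentSeries ℂ →+* o.RPM)] o.HPM) :
    Prop where
  reduce_eq : ∀ x, o.reduce (DE x) = x
  nabla_const : ∀ (ν : Δ.curveLattice →+ ℂ) x,
    o.nabla π (o.constField ν) (DE x) = DE (o.residue π ν x)
  nabla_t : ∀ i x, o.nabla π (o.tField i) (DE x) = 0
  euler : ∀ x, o.eulerHPM (DE x) = DE (o.eulerHf x)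

variable (DE : o.HfPM →ₛₗ[(ofLaurent : LaurentSeries ℂ →+* o.RPM)] o.HPM)

/-- The opposite filtration `ℋ_{F,-}`, the `lim_k 𝓡_k[u⁻¹]`-submodule generated by the
`u⁻¹ DE(φ_i)`. -/
def HMinus : Submodule o.RMinus o.HPM :=
  Submodule.span o.RMinus (Set.range fun i => (uInv : o.RPM) • DE (o.phiHf i))

/-- The Birkhoff factorization `(DE(φ_0), …, DE(φ_r)) B = (φ_0, …, φ_r) C`, with `C` a matrix over
`lim_k 𝓡_k[[u]]` and `B - 1` a matrix over `u⁻¹ lim_k 𝓡_k[u⁻¹]`. -/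
structure IsBirkhoff (B : Matrix (Fin (r + 1)) (Fin (r + 1)) o.RPM)
    (C : Matrix (Fin (r + 1)) (Fin (r + 1)) o.RPlus) : Prop where
  minus : ∀ i k, ∃ y ∈ o.RMinus, B i k = (1 : Matrix (Fin (r + 1)) (Fin (r + 1)) o.RPM) i k +
    uInv * y
  eq : ∀ k, ∑ i, B i k • DE (o.phiHf i) = ∑ i, (C i k : o.RPM) • o.incl (o.phiHF i)

/-- The element `φ̃_k` of the factorized basis. -/
def phiTilde (B : Matrix (Fin (r + 1)) (Fin (r + 1)) o.RPM) (k : Fin (r + 1)) : o.HPM :=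
  ∑ i, B i k • DE (o.phiHf i)

/-- The variable `u` in `lim_k 𝓡_k[[u]]`. -/
def uPlus : o.RPlus := ⟨u, monomial_mem _ _ (by simp) _⟩

/-- The submodule `u ℋ_F` of `ℋ_F`. -/
def uHF : Submodule o.RPlus o.HF := LinearMap.range (LinearMap.lsmul o.RPlus o.HF o.uPlus)

/-- `ζ` is a primitive form with respect to the opposite filtration `ℋ_{F,-}`. -/
structure IsPrimitiveForm (ζ : o.HF) : Prop where
  mem : ∃ y ∈ o.HMinus DE, o.incl ζ = (u : o.RPM) • y
  nabla_mem : ∀ v, o.nabla π v (o.incl ζ) ∈ o.HMinus DE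
  homogeneous : ∃ w : ℤ, o.eulerHF ζ = w • ζ
  kodairaSpencer : ∃ KS : o.LogFields ≃ₗ[o.RHat] (o.HF ⧸ o.uHF),
    ∀ v, KS v = Submodule.Quotient.mk (o.uNablaHF π v ζ)

end SmoothCompleteFan.ConeOrder

end

noncomputable section

/-! ### Complete filtrations -/

/-! Everything is decided on the central fibre and then spread over the family by geometric series,
which converge because an error term raises the order in `𝓘` or the exponent of `u`.

Central fibre. Its ring of functions is the Stanley-Reisner ring of the fan: `z^b z^b'` is
`z^(b+b')` if `b + b'` is supported on a cone, and zero otherwise. The ordering of the maximal cones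
cuts the fan into the intervals `[τ_i, σ_i]` (`exists_interval`), and this shelling makes the ring
free, with basis the `φ_i`, over the polynomial ring in the linear forms `θ̃_1(f), …, θ̃_n(f)`
(`polyMap_injective`, `polyMap_surjective`). The linear forms are therefore a regular sequence, and
their Koszul complex contracts, by a homotopy `h`, onto the complex span of the `φ_i`.

Family. The functions are free over `𝓡` on the monomials `z^b`, `b` a cone vector, so `h` and the
Koszul differential extend linearly over `𝓡`. The extended differential `Q₀` differs from `Q_F` by
terms of higher order in `𝓘` or in `u`. Hence `1 + (Q_F - Q₀) h` is invertible (`geom_bijective`),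
and it conjugates `Q₀` to `Q_F` (`perturbation_comm`). Carried out relative to vanishing conditions
on coefficients (`cohomology_QF`), this shows at once that the `φ_i` are a frame of `ℋ_{F,±}`, that
they generate `ℋ_F` over power series in `u`, so that `ℋ_F` embeds in `ℋ_{F,±}`, and that reduction
to the central fibre is reduction of coordinates modulo `𝓘`.

Deligne extension. On `ℋ_{f,±}` the operators `u θ_j + θ_j(f)` carry the integral span of the
squarefree monomials of degree `k` into that of degree `k + 1`, which is zero beyond degree `n`;
their integral combinations are thus nilpotent. For a strictly convex `h` let `L` be the connection
along the derivation of weight `⟨h, p⟩ + |l|` on `z^p t^l`. This weight is a positive integer on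
every nonconstant monomial of the base, and the matrix of `L` is nilpotent modulo `𝓘`, so `L` is
bijective on the classes that vanish on the central fibre. Every class of `ℋ_{f,±}` has therefore
exactly one lift killed by `L^(n+1)`, and this lift is the Deligne extension. Whatever commutes with
`L` respects it by uniqueness; since `∂/∂t_i` lowers the weight by one and `L + 1` is injective, the
lifts are flat in the `t_i`.

Birkhoff factorization. In the frame of the `φ_i` the map `DE` has a matrix `1 + M` with `M`
divisible by `𝓘`. The condition that `(1 + M)(e + v)` have no negative powers of `u`, with `v`
purely negative, reads `v = -(M (e + v))_-`, a contraction in the `𝓘`-adic topology. It has exactly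
one solution.

Primitive form. Write `ζ = ∑ b_i DE(φ_i)`, with `b - e_0` purely negative. Differentiating the `b_i`
gives multiples of `u⁻¹`, and the residue of `φ_i` is `u⁻¹` times a complex combination of the
`φ_k`; hence `∇_v ζ` lies in `ℋ_{F,-}`. The coefficients of `E_F ζ` are purely negative while `E_F
ζ` lies in `ℋ_F`, so uniqueness in the factorization forces `E_F ζ = 0`. Modulo `𝓘` the form `ζ` is
`φ_0 = 1`, and the Kodaira-Spencer map sends a suitable frame of the logarithmic fields to the
`φ_k`: `∂/∂t_k` to `φ_k`, and the coordinate field of a ray outside `σ_0` to the corresponding `φ_k`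
of degree two. Its matrix is the identity modulo `𝓘`, hence invertible. -/

/-- A complete and separated descending filtration of an abelian group by subgroups. -/
structure FiltComplete {X : Type*} [AddCommGroup X] (F : ℕ → AddSubgroup X) : Prop where
  zero : F 0 = ⊤
  anti : Antitone F
  sep : ∀ x, (∀ k, x ∈ F k) → x = 0
  lim : ∀ y : ℕ → X, (∀ k, y (k + 1) - y k ∈ F k) → ∃ x, ∀ k, x - y k ∈ F k

namespace FiltComplete

variable {X : Type*} [AddCommGroup X] {F : ℕ → AddSubgroup X}

theorem pow_mem (hF : FiltComplete F) {ν : AddMonoid.End X} (hν : ∀ k, ∀ x ∈ F k, ν x ∈ F (k + 1))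
    (k : ℕ) (x : X) : (ν ^ k) x ∈ F k := by
  induction k with
  | zero => rw [hF.zero]; trivial
  | succ k ih => rw [pow_succ']; exact hν _ _ ih

/-- A fixed vector equals `(ν ^ k) x` for every `k`, so it lies in the whole filtration. -/
theorem eq_zero_of_fixed (hF : FiltComplete F) {ν : AddMonoid.End X}
    (hν : ∀ k, ∀ x ∈ F k, ν x ∈ F (k + 1)) {x : X} (hx : ν x = x) : x = 0 := by
  refine hF.sep _ fun k => ?_
  have h : ∀ k, (ν ^ k) x = x := fun k => by
    induction k with
    | zero => rfl
    | succ k ih => rw [pow_succ']; change ν ((ν ^ k) x) = x; rw [ih, hx]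
  rw [← h k]
  exact hF.pow_mem hν k x

theorem sum_pow_sub (ν : AddMonoid.End X) (S : ℕ) (y : X) :
    (∑ s ∈ Finset.range S, (ν ^ s) y) - ν (∑ s ∈ Finset.range S, (ν ^ s) y) = y - (ν ^ S) y := by
  induction S with
  | zero => simp
  | succ S ih =>
    rw [Finset.sum_range_succ, map_add, add_sub_add_comm, ih, pow_succ' ν S]
    change y - (ν ^ S) y + ((ν ^ S) y - ν ((ν ^ S) y)) = y - ν ((ν ^ S) y)
    abel

/-- If `ν` raises the filtration, then `1 - ν` is onto, the preimage being the sum of the geometric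
series. -/
theorem exists_sub_eq (hF : FiltComplete F) {ν : AddMonoid.End X}
    (hν : ∀ k, ∀ x ∈ F k, ν x ∈ F (k + 1)) (y : X) :
    ∃ x, x - ν x = y ∧ ∀ k, x - ∑ s ∈ Finset.range k, (ν ^ s) y ∈ F k := by
  obtain ⟨x, hx⟩ := hF.lim (fun k => ∑ s ∈ Finset.range k, (ν ^ s) y) fun k => by
    rw [Finset.sum_range_succ, add_sub_cancel_left]
    exact hF.pow_mem hν k y
  refine ⟨x, ?_, hx⟩
  rw [← sub_eq_zero]
  refine hF.sep _ fun k => ?_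
  have h1 : x - ν x - y = (x - ∑ s ∈ Finset.range k, (ν ^ s) y) -
      ν (x - ∑ s ∈ Finset.range k, (ν ^ s) y) - (ν ^ k) y := by
    have := sum_pow_sub ν k y
    rw [map_sub, sub_sub_sub_comm, this]
    abel
  rw [h1]
  exact sub_mem (sub_mem (hx k) (hF.anti (Nat.le_succ k) (hν k _ (hx k)))) (hF.pow_mem hν k y)

/-- If some power of `ν` raises the filtration, then `1 - ν` is bijective. -/
theorem bijective_of_pow (hF : FiltComplete F) {ν : AddMonoid.End X} {m : ℕ}
    (hν : ∀ k, ∀ x ∈ F k, (ν ^ m) x ∈ F (k + 1)) :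
    (∀ x, ν x = x → x = 0) ∧ ∀ y, ∃ x, x - ν x = y := by
  refine ⟨fun x hx => hF.eq_zero_of_fixed (ν := ν ^ m) hν ?_, fun y => ?_⟩
  · clear hν
    induction m with
    | zero => rfl
    | succ k ih => rw [pow_succ']; change ν ((ν ^ k) x) = x; rw [ih, hx]
  · obtain ⟨w, hw, -⟩ := hF.exists_sub_eq (ν := ν ^ m) hν y
    exact ⟨_, (sum_pow_sub ν m w).trans hw⟩

theorem pi (hF : FiltComplete F) (ι : Type*) :
    FiltComplete fun k => (AddSubgroup.pi (Set.univ : Set ι) fun _ => F k) where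
  zero := by ext x; simp [AddSubgroup.mem_pi, hF.zero]
  anti k l h x hx i _ := hF.anti h (hx i trivial)
  sep x hx := funext fun i => hF.sep _ fun k => hx k i trivial
  lim y hy := by
    choose x hx using fun i => hF.lim (fun k => y k i) fun k => hy k i trivial
    exact ⟨x, fun k i _ => hx i k⟩

end FiltComplete

/-! ### Coefficients and maps of towers -/

namespace laurentTower

variable {A B C : Type*} [CommRing A] [CommRing B] [CommRing C] {J : Ideal A} {J' : Ideal B}
  {J'' : Ideal C}

/-- The coefficient of `u^j` modulo `J^(k+1)`. -/
def cf (k : ℕ) (j : ℤ) : laurentTower A J →+ A ⧸ J ^ (k + 1) where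
  toFun x := (x.1 k).coeff j
  map_zero' := rfl
  map_add' _ _ := rfl

theorem ext_cf {x y : laurentTower A J} (h : ∀ k j, cf k j x = cf k j y) : x = y := ext_coeff h

theorem factor_cf (x : laurentTower A J) (k : ℕ) (j : ℤ) :
    Ideal.Quotient.factor (Ideal.pow_le_pow_right (I := J) (Nat.le_succ (k + 1)))
      (cf (k + 1) j x) = cf k j x := factor_coeff x k j

theorem cf_eq_zero_of_le {x : laurentTower A J} {k l : ℕ} {j : ℤ} (h : k ≤ l)
    (hx : cf l j x = 0) : cf k j x = 0 := by
  induction l, h using Nat.le_induction with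
  | base => exact hx
  | succ l _ ih => exact ih (by rw [← factor_cf, hx, map_zero])

theorem cf_eq_of_le {x y : laurentTower A J} {k l : ℕ} {j : ℤ} (h : k ≤ l)
    (hx : cf l j x = cf l j y) : cf k j x = cf k j y := by
  rw [← sub_eq_zero, ← map_sub] at hx ⊢
  exact cf_eq_zero_of_le h hx

theorem exists_cf_lt (x : laurentTower A J) (k : ℕ) : ∃ N : ℤ, ∀ j < N, cf k j x = 0 :=
  ⟨(x.1 k).order, fun _ hj => HahnSeries.coeff_eq_zero_of_lt_order hj⟩

theorem exists_cf_lt_pi {ι : Type*} [Finite ι] (x : ι → laurentTower A J) (k : ℕ) :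
    ∃ N : ℤ, ∀ j < N, ∀ i, cf k j (x i) = 0 := by
  choose N hN using fun i => exists_cf_lt (x i) k
  obtain ⟨M, hM⟩ := (Set.finite_range N).bddBelow
  exact ⟨M, fun j hj i => hN i j (hj.trans_le (hM ⟨i, rfl⟩))⟩

theorem isPWO_of_lt {M : Type*} [Zero M] {c : ℤ → M} (h : ∃ N, ∀ j < N, c j = 0) :
    (Function.support c).IsPWO := by
  obtain ⟨N, hN⟩ := h
  have : BddBelow (Function.support c) := ⟨N, fun j hj => not_lt.1 fun h => hj (hN j h)⟩
  exact this.isWF.isPWO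

/-- A family of coefficients, as an element of the tower. -/
def ofCoeff (c : ∀ k : ℕ, ℤ → A ⧸ J ^ (k + 1)) (hb : ∀ k, ∃ N, ∀ j < N, c k j = 0)
    (hc : ∀ k j, Ideal.Quotient.factor (Ideal.pow_le_pow_right (I := J) (Nat.le_succ (k + 1)))
      (c (k + 1) j) = c k j) : laurentTower A J :=
  ⟨fun k => ⟨c k, isPWO_of_lt (hb k)⟩, fun k => HahnSeries.ext (funext fun j => hc k j)⟩

@[simp]
theorem cf_ofCoeff (c : ∀ k : ℕ, ℤ → A ⧸ J ^ (k + 1)) (hb) (hc) (k : ℕ) (j : ℤ) :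
    cf k j (ofCoeff (J := J) c hb hc) = c k j := rfl

theorem cf_monomial_mul (i : ℤ) (a : A) (x : laurentTower A J) (k : ℕ) (j : ℤ) :
    cf k j (monomial i a * x) = Ideal.Quotient.mk _ a * cf k (j - i) x :=
  coeff_monomial_mul i a x k j

theorem cf_u_mul (x : laurentTower A J) (k : ℕ) (j : ℤ) : cf k j (u * x) = cf k (j - 1) x := by
  rw [u, cf_monomial_mul, map_one, one_mul]

theorem cf_const_mul (a : A) (x : laurentTower A J) (k : ℕ) (j : ℤ) :
    cf k j (const a * x) = Ideal.Quotient.mk _ a * cf k j x := by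
  rw [const, cf_monomial_mul, sub_zero]

theorem cf_monomial (i : ℤ) (a : A) (k : ℕ) (j : ℤ) :
    cf k j (monomial i a : laurentTower A J) = if j = i then Ideal.Quotient.mk _ a else 0 := by
  change (HahnSeries.single i (Ideal.Quotient.mk _ a)).coeff j = _
  rw [HahnSeries.coeff_single]
  congr

theorem monomial_mul_monomial (i j : ℤ) (a b : A) :
    (monomial i a * monomial j b : laurentTower A J) = monomial (i + j) (a * b) := by
  refine ext_cf fun k l => ?_
  rw [cf_monomial_mul, cf_monomial, cf_monomial]
  by_cases h : l = i + j
  · rw [if_pos h, if_pos (by omega), map_mul]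
  · rw [if_neg h, if_neg (by omega), mul_zero]

theorem const_one : (const 1 : laurentTower A J) = 1 := rfl

theorem u_mul_uInv : (u * uInv : laurentTower A J) = 1 := by
  rw [u, uInv, monomial_mul_monomial, mul_one]
  rfl

theorem uInv_mul_u : (uInv * u : laurentTower A J) = 1 := by rw [mul_comm, u_mul_uInv]

theorem mem_supportedIn {S : AddSubmonoid ℤ} {x : laurentTower A J} :
    x ∈ supportedIn A J S ↔ ∀ k j, j ∉ S → cf k j x = 0 := Iff.rfl

theorem mem_plus {x : laurentTower A J} : x ∈ plus A J ↔ ∀ k, ∀ j < 0, cf k j x = 0 := by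
  rw [mem_supportedIn]
  simp

theorem mem_minus {x : laurentTower A J} : x ∈ minus A J ↔ ∀ k, ∀ j > 0, cf k j x = 0 := by
  rw [mem_supportedIn]
  simp

/-- The filtration of the tower by powers of `J`. -/
def fil (A : Type*) [CommRing A] (J : Ideal A) (k : ℕ) : AddSubgroup (laurentTower A J) where
  carrier := {x | ∀ i < k, ∀ j, cf i j x = 0}
  zero_mem' _ _ _ := map_zero _
  add_mem' hx hy i hi j := by rw [map_add, hx i hi, hy i hi, add_zero]
  neg_mem' hx i hi j := by rw [map_neg, hx i hi, neg_zero]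

theorem mem_fil {k : ℕ} {x : laurentTower A J} :
    x ∈ fil A J k ↔ ∀ i < k, ∀ j, cf i j x = 0 := Iff.rfl

theorem mem_fil_succ {k : ℕ} {x : laurentTower A J} :
    x ∈ fil A J (k + 1) ↔ ∀ j, cf k j x = 0 :=
  ⟨fun h => h k (Nat.lt_succ_self k), fun h _ hi j => cf_eq_zero_of_le (Nat.lt_succ_iff.1 hi) (h j)⟩

theorem filtComplete : FiltComplete (fil A J) where
  zero := by ext x; simp [mem_fil]
  anti _ _ h _ hx i hi := hx i (hi.trans_le h)
  sep x hx := ext_cf fun k j => by rw [hx (k + 1) k (Nat.lt_succ_self k), map_zero]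
  lim y hy := by
    have key : ∀ k l, k ≤ l → ∀ i < k, ∀ j, cf i j (y l) = cf i j (y k) := by
      intro k l h
      induction l, h using Nat.le_induction with
      | base => intros; rfl
      | succ l hl ih =>
        intro i hi j
        rw [← ih i hi j, ← sub_eq_zero, ← map_sub]
        exact hy l i (hi.trans_le hl) j
    -- `cf k` reads coefficients modulo `J^(k+1)`, and these are stable only from `y (k + 1)` on.
    refine ⟨ofCoeff (fun k j => cf k j (y (k + 1))) (fun k => exists_cf_lt _ k) fun k j => ?_, ?_⟩
    · rw [factor_cf]
      exact key _ _ (Nat.le_succ _) k (Nat.lt_succ_self k) j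
    · intro k i hi j
      rw [map_sub, cf_ofCoeff, sub_eq_zero]
      exact (key (i + 1) k hi i (Nat.lt_succ_self i) j).symm

/-- The negative part of a series in `u`. -/
def negPart : laurentTower A J →+ laurentTower A J where
  toFun x := ofCoeff (fun k j => if j < 0 then cf k j x else 0)
    (fun k => by
      obtain ⟨N, hN⟩ := exists_cf_lt x k
      exact ⟨N, fun j hj => by rw [hN j hj, ite_self]⟩)
    fun k j => by split_ifs; exacts [factor_cf x k j, map_zero _]
  map_zero' := ext_cf fun k j => by simp
  map_add' x y := ext_cf fun k j => by
    rw [map_add, cf_ofCoeff, cf_ofCoeff, cf_ofCoeff]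
    split_ifs <;> simp

theorem cf_negPart (x : laurentTower A J) (k : ℕ) (j : ℤ) :
    cf k j (negPart x) = if j < 0 then cf k j x else 0 := rfl

theorem negPart_eq_zero_iff {x : laurentTower A J} : negPart x = 0 ↔ x ∈ plus A J := by
  rw [mem_plus]
  constructor
  · intro h k j hj
    have := congrArg (cf k j) h
    rwa [cf_negPart, if_pos hj, map_zero] at this
  · intro h
    refine ext_cf fun k j => ?_
    rw [cf_negPart, map_zero]
    split_ifs with hj
    exacts [h k j hj, rfl]

/-- The series with purely negative exponents are the multiples of `u⁻¹` by `minus`. -/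
theorem negPart_eq_self_iff {x : laurentTower A J} :
    negPart x = x ↔ ∃ y ∈ minus A J, x = uInv * y := by
  constructor
  · intro h
    refine ⟨u * x, ?_, by rw [← mul_assoc, uInv_mul_u, one_mul]⟩
    rw [mem_minus]
    intro k j hj
    rw [cf_u_mul, ← h, cf_negPart, if_neg (by omega)]
  · rintro ⟨y, hy, rfl⟩
    rw [mem_minus] at hy
    refine ext_cf fun k j => ?_
    rw [cf_negPart]
    split_ifs with hj
    · rfl
    · rw [uInv, cf_monomial_mul, hy k _ (by omega), mul_zero]

theorem negPart_fil {k : ℕ} {x : laurentTower A J} (hx : x ∈ fil A J k) :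
    negPart x ∈ fil A J k := fun i hi j => by
  rw [cf_negPart, hx i hi, ite_self]

/-- Conditions on the exponents of `u` are closed in the `J`-adic topology; limits of geometric
series therefore inherit them. -/
theorem fil_closed_supportedIn {S : AddSubmonoid ℤ} {x : laurentTower A J}
    (h : ∀ k, ∃ y ∈ supportedIn A J S, x - y ∈ fil A J k) : x ∈ supportedIn A J S := by
  intro k j hj
  obtain ⟨y, hy, hxy⟩ := h (k + 1)
  have h1 := hxy k (Nat.lt_succ_self k) j
  rw [map_sub, sub_eq_zero] at h1
  exact h1.trans (hy k j hj)

/-! #### Products -/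

theorem mul_mem_fil {k l : ℕ} {x y : laurentTower A J} (hx : x ∈ fil A J k) (hy : y ∈ fil A J l) :
    x * y ∈ fil A J (k + l) := by
  -- At every truncation the coefficients of an element of order `k` have representatives in `J ^
  -- k`: zero below that order, and otherwise because they vanish modulo `J ^ k`.
  have key : ∀ {k} {x : laurentTower A J}, x ∈ fil A J k → ∀ m j,
      ∃ a ∈ J ^ k, Ideal.Quotient.mk _ a = cf m j x := by
    intro k x hx m j
    obtain ⟨a, ha⟩ := Ideal.Quotient.mk_surjective (cf m j x)
    by_cases hmk : m < k
    · exact ⟨0, zero_mem _, by rw [map_zero, hx m hmk]⟩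
    refine ⟨a, ?_, ha⟩
    cases k with
    | zero => simp
    | succ k =>
      have hk : k ≤ m := by omega
      have h2 : Ideal.Quotient.factor (Ideal.pow_le_pow_right (I := J)
          (Nat.succ_le_succ hk)) (cf m j x) = cf k j x := by
        clear ha a hmk
        induction m, hk using Nat.le_induction with
        | base =>
          obtain ⟨a, ha⟩ := Ideal.Quotient.mk_surjective (cf k j x)
          rw [← ha, Ideal.Quotient.factor_mk]
        | succ m hm ih =>
          rw [← ih, ← factor_cf x m j]
          obtain ⟨a, ha⟩ := Ideal.Quotient.mk_surjective (cf (m + 1) j x)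
          rw [← ha, Ideal.Quotient.factor_mk, Ideal.Quotient.factor_mk, Ideal.Quotient.factor_mk]
      rw [← ha, Ideal.Quotient.factor_mk, hx k (Nat.lt_succ_self k)] at h2
      exact Ideal.Quotient.eq_zero_iff_mem.1 h2
  intro m hm j
  change (x.1 m * y.1 m).coeff j = 0
  rw [HahnSeries.coeff_mul]
  refine Finset.sum_eq_zero fun p _ => ?_
  obtain ⟨a, ha, ha'⟩ := key hx m p.1
  obtain ⟨b, hb, hb'⟩ := key hy m p.2
  change cf m p.1 x * cf m p.2 y = 0
  rw [← ha', ← hb', ← map_mul, Ideal.Quotient.eq_zero_iff_mem]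
  exact Ideal.pow_le_pow_right (show m + 1 ≤ k + l by omega)
    (pow_add J k l ▸ Ideal.mul_mem_mul ha hb)

theorem mul_mem_fil_right {k : ℕ} (x : laurentTower A J) {y : laurentTower A J}
    (hy : y ∈ fil A J k) : x * y ∈ fil A J k := by
  have := mul_mem_fil (k := 0) (x := x) (by rw [filtComplete.zero]; trivial) hy
  rwa [zero_add] at this

theorem cf_mul_eq_sum (x y : laurentTower A J) (k : ℕ) (j : ℤ) {s t : Set ℤ} (hs : s.IsPWO)
    (ht : t.IsPWO) (hx : (x.1 k).support ⊆ s) (hy : (y.1 k).support ⊆ t) :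
    cf k j (x * y) = ∑ p ∈ Finset.antidiagonal hs ht j, cf k p.1 x * cf k p.2 y := by
  change (x.1 k * y.1 k).coeff j = _
  rw [HahnSeries.coeff_mul]
  refine Finset.sum_subset (fun p hp => ?_) fun p hp hp' => ?_
  · have hp := Finset.mem_antidiagonal.1 hp
    exact Finset.mem_antidiagonal.2 ⟨hx hp.1, hy hp.2.1, hp.2.2⟩
  · have hp := Finset.mem_antidiagonal.1 hp
    by_contra hne
    exact hp' (Finset.mem_antidiagonal.2
      ⟨left_ne_zero_of_mul hne, right_ne_zero_of_mul hne, hp.2.2⟩)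

theorem support_subset_succ (x : laurentTower A J) (k : ℕ) :
    (x.1 k).support ⊆ (x.1 (k + 1)).support := fun j hj h0 =>
  hj (by rw [← factor_coeff, h0, map_zero])

theorem support_deriv_subset [Algebra ℂ A] (D : Derivation ℂ A A) (x : laurentTower A J) (k : ℕ) :
    ((deriv D x).1 k).support ⊆ (x.1 (k + 1)).support := fun j hj h0 => hj (by
  change quotMap (D : A →+ A) _ _ _ ((x.1 (k + 1)).coeff j) = 0
  rw [h0, map_zero])

theorem deriv_mul [Algebra ℂ A] (D : Derivation ℂ A A) (x y : laurentTower A J) :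
    deriv D (x * y) = deriv D x * y + x * deriv D y := by
  refine ext_cf fun k i => ?_
  -- A derivation modulo `J^(k+1)` needs its argument modulo `J^(k+2)`. All products are expanded
  -- over the supports at the higher level, so that the three sums have the same index set.
  have hs := (x.1 (k + 1)).isPWO_support
  have ht := (y.1 (k + 1)).isPWO_support
  rw [map_add, cf_mul_eq_sum _ _ k i hs ht (support_deriv_subset D x k) (support_subset_succ y k),
    cf_mul_eq_sum _ _ k i hs ht (support_subset_succ x k) (support_deriv_subset D y k),
    ← Finset.sum_add_distrib]
  change quotMap (D : A →+ A) _ _ (fun _ ha => deriv_mem_pow D _ ha) (cf (k + 1) i (x * y)) = _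
  rw [cf_mul_eq_sum _ _ (k + 1) i hs ht subset_rfl subset_rfl, map_sum]
  refine Finset.sum_congr rfl fun p _ => ?_
  obtain ⟨a, ha⟩ := Ideal.Quotient.mk_surjective (cf (k + 1) p.1 x)
  obtain ⟨b, hb⟩ := Ideal.Quotient.mk_surjective (cf (k + 1) p.2 y)
  have h1 : cf k p.1 (deriv D x) = _ := coeff_deriv D x k p.1 a ha
  have h2 : cf k p.2 (deriv D y) = _ := coeff_deriv D y k p.2 b hb
  have h3 : cf k p.1 x = Ideal.Quotient.mk _ a := by rw [← factor_cf, ← ha]; rfl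
  have h4 : cf k p.2 y = Ideal.Quotient.mk _ b := by rw [← factor_cf, ← hb]; rfl
  rw [h1, h2, h3, h4, ← ha, ← hb, ← map_mul, ← map_mul, ← map_mul, ← map_add]
  change Ideal.Quotient.mk _ (D (a * b)) = _
  congr 1
  rw [D.leibniz, smul_eq_mul, smul_eq_mul]
  ring

theorem cf_uDeriv (x : laurentTower A J) (k : ℕ) (j : ℤ) : cf k j (uDeriv x) = j • cf k j x := rfl

theorem uDeriv_one : uDeriv (1 : laurentTower A J) = 0 :=
  ext_cf fun k j => by
    rw [cf_uDeriv, ← const_one, const, cf_monomial, map_zero]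
    split_ifs with hj
    · rw [hj, zero_smul]
    · rw [smul_zero]

theorem uDeriv_mul (x y : laurentTower A J) : uDeriv (x * y) = uDeriv x * y + x * uDeriv y := by
  refine ext_cf fun k i => ?_
  have hs := (x.1 k).isPWO_support
  have ht := (y.1 k).isPWO_support
  have h1 : ∀ z : laurentTower A J, ((uDeriv z).1 k).support ⊆ (z.1 k).support := fun z j hj h0 =>
    hj (by change j • (z.1 k).coeff j = 0; rw [h0, smul_zero])
  rw [map_add, cf_mul_eq_sum _ _ k i hs ht (h1 x) subset_rfl,
    cf_mul_eq_sum _ _ k i hs ht subset_rfl (h1 y), cf_uDeriv,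
    cf_mul_eq_sum _ _ k i hs ht subset_rfl subset_rfl, ← Finset.sum_add_distrib, Finset.smul_sum]
  refine Finset.sum_congr rfl fun p hp => ?_
  rw [cf_uDeriv, cf_uDeriv, ← (Finset.mem_antidiagonal.1 hp).2.2, smul_mul_assoc, mul_smul_comm,
    ← add_smul]

/-! #### Additive maps compatible with the filtrations -/

/-- An additive map compatible with the filtrations by the powers of the ideals. -/
def Filtered (J : Ideal A) (J' : Ideal B) (g : A →+ B) : Prop :=
  ∀ k, ∀ a ∈ J ^ k, g a ∈ (J' ^ k : Ideal B)

/-- The map of quotients induced by an additive map. -/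
def qmap (g : A →+ B) (I : Ideal A) (I' : Ideal B) (h : ∀ a ∈ I, g a ∈ I') : A ⧸ I →+ B ⧸ I' :=
  QuotientAddGroup.map I.toAddSubgroup I'.toAddSubgroup g h

theorem qmap_mk (g : A →+ B) (I : Ideal A) (I' : Ideal B) (h : ∀ a ∈ I, g a ∈ I') (a : A) :
    qmap g I I' h (Ideal.Quotient.mk I a) = Ideal.Quotient.mk I' (g a) := rfl

/-- The map of towers induced by a filtered additive map. -/
def tmap (g : A →+ B) (hg : Filtered J J' g) : laurentTower A J →+ laurentTower B J' :=
  let q (k : ℕ) : A ⧸ J ^ (k + 1) →+ B ⧸ J' ^ (k + 1) :=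
    qmap g (J ^ (k + 1)) (J' ^ (k + 1)) (hg (k + 1))
  { toFun := fun x => ofCoeff (fun k j => q k (cf k j x))
      (fun k => by
        obtain ⟨N, hN⟩ := exists_cf_lt x k
        exact ⟨N, fun j hj => by rw [hN j hj, map_zero]⟩)
      fun k j => by
        rw [← factor_cf x k j]
        obtain ⟨a, ha⟩ := Ideal.Quotient.mk_surjective (cf (k + 1) j x)
        rw [← ha]
        rfl
    map_zero' := ext_cf fun k j => by
      rw [cf_ofCoeff, map_zero, map_zero, map_zero]
    map_add' := fun x y => ext_cf fun k j => by
      rw [map_add, cf_ofCoeff, cf_ofCoeff, cf_ofCoeff, map_add, map_add] }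

theorem cf_tmap (g : A →+ B) (hg : Filtered J J' g) (x : laurentTower A J) (k : ℕ) (j : ℤ) {a : A}
    (ha : Ideal.Quotient.mk _ a = cf k j x) :
    cf k j (tmap g hg x) = Ideal.Quotient.mk _ (g a) := by
  change qmap g _ _ (hg (k + 1)) (cf k j x) = _
  rw [← ha, qmap_mk]

theorem cf_tmap_eq_zero (g : A →+ B) (hg : Filtered J J' g) {x : laurentTower A J} {k : ℕ} {j : ℤ}
    (hx : cf k j x = 0) : cf k j (tmap g hg x) = 0 := by
  rw [cf_tmap g hg x k j (a := 0) (by rw [map_zero, hx]), map_zero, map_zero]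

theorem tmap_mem_fil (g : A →+ B) (hg : Filtered J J' g) {x : laurentTower A J} {k : ℕ}
    (hx : x ∈ fil A J k) : tmap g hg x ∈ fil B J' k := fun i hi j =>
  cf_tmap_eq_zero g hg (hx i hi j)

theorem tmap_mem_supportedIn (g : A →+ B) (hg : Filtered J J' g) {x : laurentTower A J}
    {S : AddSubmonoid ℤ} (hx : x ∈ supportedIn A J S) : tmap g hg x ∈ supportedIn B J' S :=
  fun k j hj => cf_tmap_eq_zero g hg (hx k j hj)

/-- Identities between compositions of filtered maps carry over to towers. -/
theorem tmap_comp (g : A →+ B) (hg : Filtered J J' g) (g' : B →+ C) (hg' : Filtered J' J'' g')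
    (g'' : A →+ C) (hg'' : Filtered J J'' g'') (h : ∀ a, g' (g a) = g'' a)
    (x : laurentTower A J) : tmap g' hg' (tmap g hg x) = tmap g'' hg'' x := by
  refine ext_cf fun k j => ?_
  obtain ⟨a, ha⟩ := Ideal.Quotient.mk_surjective (cf k j x)
  rw [cf_tmap g' hg' _ k j (cf_tmap g hg x k j ha).symm, cf_tmap g'' hg'' x k j ha, h]

theorem tmap_add (g g' : A →+ B) (hg : Filtered J J' g) (hg' : Filtered J J' g')
    (g'' : A →+ B) (hg'' : Filtered J J' g'') (h : ∀ a, g a + g' a = g'' a)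
    (x : laurentTower A J) : tmap g hg x + tmap g' hg' x = tmap g'' hg'' x := by
  refine ext_cf fun k j => ?_
  obtain ⟨a, ha⟩ := Ideal.Quotient.mk_surjective (cf k j x)
  rw [map_add, cf_tmap g hg x k j ha, cf_tmap g' hg' x k j ha, cf_tmap g'' hg'' x k j ha, ← map_add,
    h]

theorem tmap_id (g : A →+ A) (hg : Filtered J J g) (h : ∀ a, g a = a) (x : laurentTower A J) :
    tmap g hg x = x := by
  refine ext_cf fun k j => ?_
  obtain ⟨a, ha⟩ := Ideal.Quotient.mk_surjective (cf k j x)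
  rw [cf_tmap g hg x k j ha, h, ha]

theorem tmap_monomial (g : A →+ B) (hg : Filtered J J' g) (i : ℤ) (a : A) :
    tmap g hg (monomial i a) = monomial i (g a) := by
  refine ext_cf fun k j => ?_
  rw [cf_monomial]
  split_ifs with h
  · exact cf_tmap g hg _ k j (by rw [cf_monomial, if_pos h])
  · exact cf_tmap_eq_zero g hg (by rw [cf_monomial, if_neg h])

theorem tmap_mul_left (a : A) (g : A →+ A) (hg : Filtered J J g) (h : ∀ b, g b = a * b)
    (x : laurentTower A J) : tmap g hg x = const a * x := by
  refine ext_cf fun k j => ?_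
  obtain ⟨b, hb⟩ := Ideal.Quotient.mk_surjective (cf k j x)
  rw [cf_tmap g hg x k j hb, cf_const_mul, ← hb, h, map_mul]

/-- A general derivation loses one power of `J`. When it preserves all powers, nothing is lost and
it may be treated as a filtered map. -/
theorem deriv_eq_tmap [Algebra ℂ A] (D : Derivation ℂ A A) (hg : Filtered J J (D : A →+ A))
    (x : laurentTower A J) : deriv D x = tmap (D : A →+ A) hg x := by
  refine ext_cf fun k j => ?_
  obtain ⟨a, ha⟩ := Ideal.Quotient.mk_surjective (cf (k + 1) j x)
  rw [cf_tmap _ hg x k j (a := a) (by rw [← factor_cf, ← ha]; rfl)]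
  exact coeff_deriv D x k j a ha

theorem cf_mapHom (f : A →+* B) (hf : J.map f ≤ J') (x : laurentTower A J) (k : ℕ) (j : ℤ) {a : A}
    (ha : Ideal.Quotient.mk _ a = cf k j x) :
    cf k j (mapHom f hf x) = Ideal.Quotient.mk _ (f a) := by
  have h : J ^ (k + 1) ≤ (J' ^ (k + 1)).comap f := by
    rw [← Ideal.map_le_iff_le_comap, Ideal.map_pow]
    exact Ideal.pow_right_mono hf _
  change Ideal.quotientMap _ f h (cf k j x) = _
  rw [← ha, Ideal.quotientMap_mk]

theorem mapHom_monomial (f : A →+* B) (hf : J.map f ≤ J') (i : ℤ) (a : A) :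
    mapHom f hf (monomial i a) = monomial i (f a) := by
  refine ext_cf fun k j => ?_
  rw [cf_monomial]
  split_ifs with h
  · exact cf_mapHom f hf _ k j (by rw [cf_monomial, if_pos h])
  · rw [cf_mapHom f hf _ k j (a := 0) (by rw [cf_monomial, if_neg h, map_zero]), map_zero, map_zero]

theorem support_mapHom (f : A →+* B) (hf : J.map f ≤ J') (x : laurentTower A J) (k : ℕ) :
    ((mapHom f hf x).1 k).support ⊆ (x.1 k).support := fun j hj h0 => hj (by
  change Ideal.quotientMap _ f _ ((x.1 k).coeff j) = 0
  rw [h0, map_zero])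

theorem support_tmap (g : A →+ B) (hg : Filtered J J' g) (x : laurentTower A J) (k : ℕ) :
    ((tmap g hg x).1 k).support ⊆ (x.1 k).support := fun _ hj h0 =>
  hj (cf_tmap_eq_zero g hg h0)

/-- Maps linear over a base ring induce maps linear over the tower of the base ring. -/
theorem tmap_mapHom_mul {R : Type*} [CommRing R] {I : Ideal R} (f : R →+* A) (hf : I.map f ≤ J)
    (f' : R →+* B) (hf' : I.map f' ≤ J') (g : A →+ B) (hg : Filtered J J' g)
    (h : ∀ r a, g (f r * a) = f' r * g a) (r : laurentTower R I) (x : laurentTower A J) :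
    tmap g hg (mapHom f hf r * x) = mapHom f' hf' r * tmap g hg x := by
  refine ext_cf fun k i => ?_
  have hs := (r.1 k).isPWO_support
  have ht := (x.1 k).isPWO_support
  change qmap g _ _ (hg (k + 1)) (cf k i _) = _
  rw [cf_mul_eq_sum _ _ k i hs ht (support_mapHom f hf r k) subset_rfl,
    cf_mul_eq_sum _ _ k i hs ht (support_mapHom f' hf' r k) (support_tmap g hg x k)]
  rw [map_sum]
  refine Finset.sum_congr rfl fun p _ => ?_
  obtain ⟨b, hb⟩ := Ideal.Quotient.mk_surjective (cf k p.1 r)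
  obtain ⟨a, ha⟩ := Ideal.Quotient.mk_surjective (cf k p.2 x)
  rw [cf_mapHom f hf r k _ hb, cf_mapHom f' hf' r k _ hb, cf_tmap g hg x k _ ha, ← ha, ← map_mul,
    ← map_mul, ← h, qmap_mk]

/-- Derivations compatible with a ring homomorphism. -/
theorem deriv_mapHom [Algebra ℂ A] [Algebra ℂ B] (f : A →+* B) (hf : J.map f ≤ J')
    (D : Derivation ℂ A A) (D' : Derivation ℂ B B) (h : ∀ a, D' (f a) = f (D a))
    (x : laurentTower A J) : deriv D' (mapHom f hf x) = mapHom f hf (deriv D x) := by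
  refine ext_cf fun k j => ?_
  obtain ⟨a, ha⟩ := Ideal.Quotient.mk_surjective (cf (k + 1) j x)
  have h1 : cf k j (deriv D x) = _ := coeff_deriv D x k j a ha
  have h2 : cf k j (deriv D' (mapHom f hf x)) = _ :=
    coeff_deriv D' (mapHom f hf x) k j (f a) (cf_mapHom f hf x (k + 1) j ha).symm
  rw [h2, cf_mapHom f hf _ k j h1.symm, h]

theorem uDeriv_mapHom (f : A →+* B) (hf : J.map f ≤ J') (x : laurentTower A J) :
    uDeriv (mapHom f hf x) = mapHom f hf (uDeriv x) := by
  refine ext_cf fun k j => ?_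
  obtain ⟨a, ha⟩ := Ideal.Quotient.mk_surjective (cf k j x)
  rw [cf_uDeriv, cf_mapHom f hf x k j ha, cf_mapHom f hf _ k j (a := j • a)
    (by rw [cf_uDeriv, map_zsmul, ha]), map_zsmul, map_zsmul]

/-! #### Geometric series in `u` and the ideal -/

/-- If `ν` raises the order in `J` or in `u`, then `1 - ν` is bijective. -/
theorem geom_bijective {ι : Type*} [Finite ι] (ν : AddMonoid.End (ι → laurentTower A J))
    (hν : ∀ x k j, (∀ k', k' + 1 = k → ∀ i, cf k' j (x i) = 0) →
      (∀ i, cf k (j - 1) (x i) = 0) → ∀ i, cf k j (ν x i) = 0) :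
    (∀ x, ν x = x → x = 0) ∧ ∀ y, ∃ x, x - ν x = y ∧
      ∀ k j, ∃ S, ∀ i, cf k j (x i) = cf k j ((∑ s ∈ Finset.range S, (ν ^ s) y) i) := by
  -- Whether `ν x` vanishes at order `k` and exponent `j` depends on `x` at `(k - 1, j)` and `(k, j
  -- - 1)` only. Each application thus advances the region of vanishing by one: `(ν ^ s) y` vanishes
  -- where `j + k' < N + s`.
  have van : ∀ (y : ι → laurentTower A J) (k : ℕ) (N : ℤ), (∀ j < N, ∀ i, cf k j (y i) = 0) →
      ∀ (s k' : ℕ), k' ≤ k → ∀ j : ℤ, j < N + s - k' → ∀ i, cf k' j ((ν ^ s) y i) = 0 := by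
    intro y k N hN s
    induction s with
    | zero =>
      intro k' hk' j hj i
      exact cf_eq_zero_of_le hk' (hN j (by push_cast at hj; omega) i)
    | succ s ih =>
      intro k' hk' j hj
      rw [pow_succ' ν s]
      refine hν ((ν ^ s) y) k' j (fun k'' h i => ?_) fun i => ?_
      · exact ih k'' (by omega) j (by push_cast at hj; omega) i
      · exact ih k' hk' (j - 1) (by push_cast at hj; omega) i
  constructor
  · intro x hx
    have hp : ∀ s : ℕ, (ν ^ s) x = x := fun s => by
      induction s with
      | zero => rfl
      | succ k ih => rw [pow_succ']; change ν ((ν ^ k) x) = x; rw [ih, hx]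
    funext i
    refine ext_cf fun k j => ?_
    obtain ⟨N, hN⟩ := exists_cf_lt_pi x k
    rw [← hp (j - N + k + 1).toNat]
    exact van x k N hN _ k le_rfl j (by omega) i
  · intro y
    choose N hN using exists_cf_lt_pi y
    let P : ℕ → ι → laurentTower A J := fun S => ∑ s ∈ Finset.range S, (ν ^ s) y
    -- The least `S` with `j + k < N k + S`: from this power on, the terms of the series do not
    -- contribute at `(k, j)`.
    let S₀ : ℕ → ℤ → ℕ := fun k j => (j - N k + k + 1).toNat
    have stab : ∀ k j S, S₀ k j ≤ S → ∀ i, cf k j (P S i) = cf k j (P (S₀ k j) i) := by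
      intro k j S hS i
      induction S, hS using Nat.le_induction with
      | base => rfl
      | succ S hS ih =>
        have hS : (j - N k + k + 1).toNat ≤ S := hS
        change cf k j ((∑ s ∈ Finset.range (S + 1), (ν ^ s) y) i) = _
        rw [Finset.sum_range_succ, Pi.add_apply, map_add,
          van y k (N k) (hN k) S k le_rfl j (by omega) i, add_zero]
        exact ih
    let x : ι → laurentTower A J := fun i => ofCoeff (fun k j => cf k j (P (S₀ k j) i))
      -- Below `N k - k` the relevant partial sum is empty, which bounds the exponents of the limit
      -- from below.
      (fun k => ⟨N k - k, fun j hj => by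
        have : S₀ k j = 0 := by change (j - N k + k + 1).toNat = 0; omega
        rw [this]
        simp [P]⟩)
      (fun k j => by
        rw [factor_cf, ← stab k j (max (S₀ k j) (S₀ (k + 1) j)) (le_max_left _ _) i]
        exact cf_eq_of_le (Nat.le_succ k) (stab (k + 1) j _ (le_max_right _ _) i).symm)
    have hx : ∀ k j S, S₀ k j ≤ S → ∀ i, cf k j (x i) = cf k j (P S i) := fun k j S hS i =>
      (stab k j S hS i).symm
    refine ⟨x, ?_, fun k j => ⟨S₀ k j, hx k j _ le_rfl⟩⟩
    funext i
    refine ext_cf fun k j => ?_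
    -- Large enough at the three positions involved in the hypothesis on `ν`. For `k = 0` the
    -- truncated `k - 1` is harmless, as no `k'` satisfies `k' + 1 = 0`.
    let S := S₀ k j + S₀ k (j - 1) + S₀ (k - 1) j
    have h1 : x - ν x = (x - P S) - ν (x - P S) + (y - (ν ^ S) y) := by
      rw [← FiltComplete.sum_pow_sub ν S y, map_sub]
      change _ = (x - P S) - (ν x - ν (P S)) + (P S - ν (P S))
      abel
    have h2 : cf k j ((x - P S) i) = 0 := by
      rw [Pi.sub_apply, map_sub, sub_eq_zero]
      exact hx k j S (by omega) i
    have h3 : cf k j (ν (x - P S) i) = 0 := by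
      refine hν _ k j (fun k' hk' i => ?_) (fun i => ?_) i
      · obtain rfl : k' = k - 1 := by omega
        rw [Pi.sub_apply, map_sub, sub_eq_zero]
        exact hx _ j S (by omega) i
      · rw [Pi.sub_apply, map_sub, sub_eq_zero]
        exact hx k _ S (by omega) i
    have h4 : cf k j ((ν ^ S) y i) = 0 :=
      van y k (N k) (hN k) S k le_rfl j (by
        have : (j - N k + k + 1).toNat ≤ S := by change S₀ k j ≤ S; omega
        omega) i
    rw [h1, Pi.add_apply, map_add, Pi.sub_apply, map_sub, h2, h3, Pi.sub_apply, map_sub, h4]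
    simp

end laurentTower

/-! ### Combinatorics of smooth complete fans -/

namespace SmoothCompleteFan

variable {n d : ℕ} (Δ : SmoothCompleteFan n d) {σ : Finset (Fin d)}

theorem exists_dual (hσ : σ ∈ Δ.maxCones) : ∃ m : Fin d → Fin n → ℤ,
    (∀ j ∈ σ, ∀ k ∈ σ, m j ⬝ᵥ Δ.ray k = if k = j then 1 else 0) ∧
      ∀ v, ∑ j ∈ σ, (m j ⬝ᵥ v) • Δ.ray j = v := by
  let β : Module.Basis σ ℤ (Fin n → ℤ) := Module.Basis.mk (Δ.linearIndependent σ hσ) (by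
    rw [← Δ.span_eq_top σ hσ, Set.range_comp' Δ.ray Subtype.val]
    simp)
  have hβ : ∀ i, β i = Δ.ray i := fun i => by simp [β]
  have key : ∀ (i : σ) v, (fun k => β.coord i (Pi.single k 1)) ⬝ᵥ v = β.coord i v := fun i v => by
    conv_rhs => rw [pi_eq_sum_univ' v]
    rw [map_sum]
    refine Finset.sum_congr rfl fun k _ => ?_
    rw [map_smul, smul_eq_mul, mul_comm]
  refine ⟨fun j => if h : j ∈ σ then fun k => β.coord ⟨j, h⟩ (Pi.single k 1) else 0,
    fun j hj k hk => ?_, fun v => ?_⟩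
  · beta_reduce
    rw [dif_pos hj, key, ← hβ ⟨k, hk⟩, Module.Basis.coord_apply, Module.Basis.repr_self,
      Finsupp.single_apply]
    simp
  · conv_rhs => rw [← β.sum_repr v]
    rw [← Finset.sum_coe_sort]
    refine Finset.sum_congr rfl fun i _ => ?_
    beta_reduce
    rw [dif_pos i.2, key, hβ]
    rfl

/-- The basis dual to the generators of a maximal cone. -/
def dual (hσ : σ ∈ Δ.maxCones) : Fin d → Fin n → ℤ := (Δ.exists_dual hσ).choose

theorem dual_ray (hσ : σ ∈ Δ.maxCones) {j k : Fin d} (hj : j ∈ σ) (hk : k ∈ σ) :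
    Δ.dual hσ j ⬝ᵥ Δ.ray k = if k = j then 1 else 0 :=
  (Δ.exists_dual hσ).choose_spec.1 j hj k hk

theorem sum_dual (hσ : σ ∈ Δ.maxCones) (v : Fin n → ℤ) :
    ∑ j ∈ σ, (Δ.dual hσ j ⬝ᵥ v) • Δ.ray j = v :=
  (Δ.exists_dual hσ).choose_spec.2 v

theorem card_cone (hσ : σ ∈ Δ.maxCones) : σ.card = n := by
  let β : Module.Basis σ ℤ (Fin n → ℤ) := Module.Basis.mk (Δ.linearIndependent σ hσ) (by
    rw [← Δ.span_eq_top σ hσ, Set.range_comp' Δ.ray Subtype.val]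
    simp)
  have h := Module.finrank_eq_card_basis β
  rw [Module.finrank_fin_fun, Fintype.card_coe] at h
  exact h.symm

theorem rayMap_apply (a : Fin d → ℤ) : Δ.rayMap a = ∑ i, a i • Δ.ray i := rfl

theorem dotProduct_rayMap (m : Fin n → ℤ) (a : Fin d → ℤ) :
    m ⬝ᵥ Δ.rayMap a = ∑ i, a i * (m ⬝ᵥ Δ.ray i) := by
  rw [rayMap_apply, dotProduct_sum]
  exact Finset.sum_congr rfl fun i _ => by rw [dotProduct_smul, smul_eq_mul]

theorem dual_rayMap (hσ : σ ∈ Δ.maxCones) {a : Fin d → ℤ} (ha : ∀ i ∉ σ, a i = 0) {j : Fin d}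
    (hj : j ∈ σ) : Δ.dual hσ j ⬝ᵥ Δ.rayMap a = a j := by
  rw [dotProduct_rayMap, Finset.sum_eq_single j]
  · rw [Δ.dual_ray hσ hj hj, if_pos rfl, mul_one]
  · intro i _ hij
    by_cases hi : i ∈ σ
    · rw [Δ.dual_ray hσ hj hi, if_neg hij, mul_zero]
    · rw [ha i hi, zero_mul]
  · simp

/-- The signs of the coefficients are dropped: inside a maximal cone the generators are independent,
so supports and linear expressions suffice for uniqueness. -/
theorem exists_of_mem_rayCone {S : Finset (Fin d)} {x : Fin n → ℝ} (hx : x ∈ rayCone Δ.ray S) :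
    ∃ c : Fin d → ℝ, (∀ i ∉ S, c i = 0) ∧ ∀ k, x k = ∑ i, c i * Δ.ray i k := by
  refine Submodule.span_induction ?_ ⟨0, by simp, by simp⟩ ?_ ?_ hx
  · rintro _ ⟨j, hj, rfl⟩
    refine ⟨Pi.single j 1, fun i hi => Pi.single_eq_of_ne (by rintro rfl; exact hi hj) _,
      fun k => ?_⟩
    simp [Pi.single_apply]
  · rintro x y _ _ ⟨c, hc, hx⟩ ⟨c', hc', hy⟩
    refine ⟨c + c', fun i hi => by simp [hc i hi, hc' i hi], fun k => ?_⟩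
    simp [hx, hy, add_mul, Finset.sum_add_distrib]
  · rintro a x _ ⟨c, hc, hx⟩
    refine ⟨fun i => (a : ℝ) * c i, fun i hi => by simp [hc i hi], fun k => ?_⟩
    change (a : ℝ) * x k = _
    rw [hx, Finset.mul_sum]
    exact Finset.sum_congr rfl fun i _ => by ring

theorem rayMap_mem_rayCone {S : Finset (Fin d)} {b : Fin d → ℤ} (h0 : ∀ i, 0 ≤ b i)
    (hb : ∀ i ∉ S, b i = 0) : (fun k => (Δ.rayMap b k : ℝ)) ∈ rayCone Δ.ray S := by
  have h : (fun k => (Δ.rayMap b k : ℝ)) = ∑ i ∈ S,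
      (⟨(b i : ℝ), by exact_mod_cast h0 i⟩ : {c : ℝ // 0 ≤ c}) • fun k => (Δ.ray i k : ℝ) := by
    funext k
    rw [rayMap_apply, Finset.sum_apply, Finset.sum_apply, Int.cast_sum]
    symm
    refine (Finset.sum_subset (Finset.subset_univ S) fun i _ hi => ?_).trans
      (Finset.sum_congr rfl fun i _ => ?_)
    · change (b i : ℝ) * _ = 0
      rw [hb i hi, Int.cast_zero, zero_mul]
    · change (b i : ℝ) * (Δ.ray i k : ℝ) = ((b i * Δ.ray i k : ℤ) : ℝ)
      rw [Int.cast_mul]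
  rw [h]
  exact Submodule.sum_mem _ fun i hi => Submodule.smul_mem _ _
    (Submodule.subset_span ⟨i, hi, rfl⟩)

/-- Cone vectors are determined by their images in the lattice. -/
theorem IsConeVector.ext {b b' : Fin d → ℤ} (hb : Δ.IsConeVector b) (hb' : Δ.IsConeVector b')
    (h : Δ.rayMap b = Δ.rayMap b') : b = b' := by
  obtain ⟨h0, σ, hσ, hs⟩ := hb
  obtain ⟨h0', σ', hσ', hs'⟩ := hb'
  -- Both vectors have the same image, which therefore lies in the intersection of the two cones,
  -- that is in their common face.
  have hx : (fun k => (Δ.rayMap b k : ℝ)) ∈ rayCone Δ.ray (σ ∩ σ') := by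
    rw [← Δ.inter σ hσ σ' hσ']
    exact ⟨Δ.rayMap_mem_rayCone h0 hs, h ▸ Δ.rayMap_mem_rayCone h0' hs'⟩
  obtain ⟨c, hc, hxc⟩ := Δ.exists_of_mem_rayCone hx
  -- Pairing with the dual basis of a maximal cone that contains the face recovers every coordinate,
  -- so both vectors agree with the real coefficients `c`.
  have key : ∀ (τ : Finset (Fin d)) (hτ : τ ∈ Δ.maxCones) (e : Fin d → ℤ), (∀ i ∉ τ, e i = 0) →
      Δ.rayMap e = Δ.rayMap b → σ ∩ σ' ⊆ τ → ∀ j, (e j : ℝ) = c j := by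
    intro τ hτ e he heb hsub j
    by_cases hj : j ∈ τ
    · have h1 : ((Δ.dual hτ j ⬝ᵥ Δ.rayMap e : ℤ) : ℝ) = c j := by
        rw [heb]
        simp only [dotProduct, Int.cast_sum, Int.cast_mul]
        simp only [hxc, Finset.mul_sum]
        rw [Finset.sum_comm, Finset.sum_eq_single j]
        · have := Δ.dual_ray hτ hj hj
          rw [if_pos rfl] at this
          have h2 : ∑ k, (Δ.dual hτ j k : ℝ) * (Δ.ray j k : ℝ) = 1 := by exact_mod_cast this
          calc _ = c j * ∑ k, (Δ.dual hτ j k : ℝ) * (Δ.ray j k : ℝ) := by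
                rw [Finset.mul_sum]
                exact Finset.sum_congr rfl fun k _ => by ring
            _ = c j := by rw [h2, mul_one]
        · intro i _ hij
          by_cases hi : i ∈ τ
          · have := Δ.dual_ray hτ hj hi
            rw [if_neg hij] at this
            have h2 : ∑ k, (Δ.dual hτ j k : ℝ) * (Δ.ray i k : ℝ) = 0 := by exact_mod_cast this
            calc _ = c i * ∑ k, (Δ.dual hτ j k : ℝ) * (Δ.ray i k : ℝ) := by
                  rw [Finset.mul_sum]
                  exact Finset.sum_congr rfl fun k _ => by ring
              _ = 0 := by rw [h2, mul_zero]
          · rw [hc i fun h => hi (hsub h)]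
            simp
        · simp
      rw [← h1, Δ.dual_rayMap hτ he hj]
    · rw [he j hj, hc j fun h => hj (hsub h), Int.cast_zero]
  funext j
  have := (key σ hσ b hs rfl Finset.inter_subset_left j).trans
    (key σ' hσ' b' hs' h.symm Finset.inter_subset_right j).symm
  exact_mod_cast this

/-- Every facet of a maximal cone lies in a second maximal cone. -/
theorem exists_adjacent (hσ : σ ∈ Δ.maxCones) {x : Fin d} (hx : x ∈ σ) :
    ∃ σ' ∈ Δ.maxCones, σ.erase x ⊆ σ' ∧ x ∉ σ' ∧ (σ ∩ σ').card + 1 = n := by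
  let y : Fin d → ℤ := exponent (σ.erase x)
  have hy : ∀ i ∉ σ, y i = 0 := fun i hi => if_neg fun h => hi (Finset.mem_of_mem_erase h)
  -- With `y` the sum of the generators of the facet, the points `N y - ρ_x` lie beyond the facet
  -- and approach the direction of `y`.
  choose b hb hbs using fun N : ℕ => Δ.exists_coneVector ((N : ℤ) • Δ.rayMap y - Δ.ray x)
  choose τ hτ hbτ using fun N => (hb N).2
  -- There are finitely many maximal cones, so one of them contains these points for arbitrarily
  -- large `N`.
  obtain ⟨⟨σ', hσ'⟩, hinf⟩ := Finite.exists_infinite_fiber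
    (fun N : ℕ => (⟨τ N, hτ N⟩ : Δ.maxCones))
  have hfreq : ∀ M : ℕ, ∃ N ≥ M, τ N = σ' := by
    intro M
    have := Set.infinite_coe_iff.1 hinf
    obtain ⟨N, hN, hMN⟩ := this.exists_gt M
    exact ⟨N, hMN.le, congrArg Subtype.val hN⟩
  have hcoord : ∀ N, τ N = σ' → ∀ j ∈ σ',
      (N : ℤ) * (Δ.dual hσ' j ⬝ᵥ Δ.rayMap y) - Δ.dual hσ' j ⬝ᵥ Δ.ray x = b N j := by
    intro N hN j hj
    rw [← Δ.dual_rayMap hσ' (a := b N) (hN ▸ hbτ N) hj, hbs, dotProduct_sub, dotProduct_smul,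
      smul_eq_mul]
  -- A negative coordinate of `y` in the basis of `σ'` would make that of `N y - ρ_x` negative for
  -- large `N`.
  have hnn : ∀ j ∈ σ', 0 ≤ Δ.dual hσ' j ⬝ᵥ Δ.rayMap y := by
    intro j hj
    by_contra hneg
    obtain ⟨N, hN, hNσ⟩ := hfreq (1 + (-(Δ.dual hσ' j ⬝ᵥ Δ.ray x)).toNat)
    have h1 := hcoord N hNσ j hj
    have h2 := (hb N).1 j
    have h3 : (N : ℤ) * (Δ.dual hσ' j ⬝ᵥ Δ.rayMap y) ≤ -N := by nlinarith
    omega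
  -- Thus `y` lies in the cone `σ'` as well, and uniqueness of cone vectors puts the support of `y`,
  -- the facet, into `σ'`.
  have hyσ' : ∀ i ∉ σ', y i = 0 := by
    let y' : Fin d → ℤ := fun j => if j ∈ σ' then Δ.dual hσ' j ⬝ᵥ Δ.rayMap y else 0
    have : y = y' := by
      refine IsConeVector.ext Δ ⟨fun i => ?_, σ, hσ, hy⟩
        ⟨fun i => ?_, σ', hσ', fun i hi => if_neg hi⟩ ?_
      · simp only [y, exponent]; split_ifs <;> norm_num
      · simp only [y']; split_ifs with h; exacts [hnn i h, le_rfl]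
      · conv_lhs => rw [← Δ.sum_dual hσ' (Δ.rayMap y)]
        rw [Δ.rayMap_apply y', ← Finset.sum_subset (Finset.subset_univ σ') fun i _ hi => by
          simp [y', hi]]
        exact Finset.sum_congr rfl fun i hi => by simp [y', hi]
    intro i hi
    rw [this]
    exact if_neg hi
  have hsub : σ.erase x ⊆ σ' := by
    intro i hi
    by_contra h
    have := hyσ' i h
    simp only [y, exponent, if_pos hi] at this
    exact one_ne_zero this
  -- Otherwise `σ' = σ`, and the coordinate of `N y - ρ_x` at `x` would be `-1`.
  have hxσ' : x ∉ σ' := by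
    intro hx'
    have hss : σ ⊆ σ' := by
      intro i hi
      by_cases h : i = x
      · rwa [h]
      · exact hsub (Finset.mem_erase.2 ⟨h, hi⟩)
    obtain rfl := Finset.eq_of_subset_of_card_le hss (by rw [Δ.card_cone hσ, Δ.card_cone hσ'])
    obtain ⟨N, -, hN⟩ := hfreq 0
    have h1 := hcoord N hN x hx
    have h2 : Δ.dual hσ' x ⬝ᵥ Δ.rayMap y = 0 := by
      rw [Δ.dual_rayMap hσ' hy hx]
      exact if_neg (Finset.notMem_erase x σ)
    have h3 := Δ.dual_ray hσ' hx hx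
    rw [if_pos rfl] at h3
    have := (hb N).1 x
    rw [h2, h3] at h1
    omega
  refine ⟨σ', hσ', hsub, hxσ', ?_⟩
  have : σ ∩ σ' = σ.erase x := by
    ext i
    rw [Finset.mem_inter, Finset.mem_erase]
    constructor
    · rintro ⟨h1, h2⟩
      exact ⟨fun h => hxσ' (h ▸ h2), h1⟩
    · rintro ⟨h1, h2⟩
      exact ⟨h2, hsub (Finset.mem_erase.2 ⟨h1, h2⟩)⟩
  rw [this, Finset.card_erase_of_mem hx, Δ.card_cone hσ]
  have : 0 < σ.card := Finset.card_pos.2 ⟨x, hx⟩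
  rw [Δ.card_cone hσ] at this
  omega

/-- Strictly convex functions are positive on nontrivial curve classes. -/
theorem IsStrictlyConvex.pos {h : Fin d → ℤ} (hh : Δ.IsStrictlyConvex h) {p : Fin d → ℤ}
    (hp : p ∈ Δ.curveMonoid) (hp0 : p ≠ 0) : 0 < ∑ i, h i * p i := by
  choose! m hm hlt using hh
  -- On each cone let `q` be the linear function with values `-p_i` at its generators. There are
  -- finitely many cones and rays, so one `N` bounds all excesses `q(ρ_i) + p_i`.
  have key : ∃ N : ℤ, 0 ≤ N ∧ ∀ (σ : Finset (Fin d)) (hσ : σ ∈ Δ.maxCones) (i : Fin d),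
      (∑ j ∈ σ, (-p j) • Δ.dual hσ j) ⬝ᵥ Δ.ray i + p i ≤ N := by
    let g : Δ.maxCones × Fin d → ℤ := fun x =>
      (∑ j ∈ x.1.1, (-p j) • Δ.dual x.1.2 j) ⬝ᵥ Δ.ray x.2 + p x.2
    obtain ⟨N, hN⟩ := (Set.finite_range g).bddAbove
    exact ⟨max N 0, le_max_right _ _, fun σ hσ i =>
      (hN ⟨(⟨σ, hσ⟩, i), rfl⟩).trans (le_max_left _ _)⟩
  obtain ⟨N, hN0, hN⟩ := key
  -- The class `p`, read as a piecewise linear function, is subtracted from a large multiple of `h`.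
  -- By integrality strict convexity of `h` gains at least `1` off the cone, which pays for the
  -- excess.
  have hconv : Δ.IsConvex fun i => N * h i - p i := by
    intro σ hσ
    let q := ∑ j ∈ σ, (-p j) • Δ.dual hσ j
    have hq : ∀ i ∈ σ, q ⬝ᵥ Δ.ray i = -p i := by
      intro i hi
      rw [sum_dotProduct, Finset.sum_eq_single i]
      · rw [smul_dotProduct, Δ.dual_ray hσ hi hi, if_pos rfl, smul_eq_mul, mul_one]
      · intro j hj hji
        rw [smul_dotProduct, Δ.dual_ray hσ hj hi, if_neg (Ne.symm hji), smul_zero]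
      · exact fun h => absurd hi h
    have hlin : ∀ i, ∑ k, (N • m σ + q) k * Δ.ray i k =
        N * ∑ k, m σ k * Δ.ray i k + q ⬝ᵥ Δ.ray i := by
      intro i
      change (N • m σ + q) ⬝ᵥ Δ.ray i = N * (m σ ⬝ᵥ Δ.ray i) + _
      rw [add_dotProduct, smul_dotProduct, smul_eq_mul]
    refine ⟨N • m σ + q, fun i hi => ?_, fun i => ?_⟩
    · rw [hlin, hq i hi, hm σ hσ i hi]
      ring
    · rw [hlin]
      by_cases hi : i ∈ σ
      · rw [hq i hi, hm σ hσ i hi]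
        linarith
      · have h1 := hlt σ hσ i hi
        have h2 := hN σ hσ i
        have h3 : N * ∑ k, m σ k * Δ.ray i k ≤ N * (h i - 1) :=
          mul_le_mul_of_nonneg_left (by omega) hN0
        have h4 : q ⬝ᵥ Δ.ray i + p i ≤ N := h2
        linarith
  -- Nefness of `N h - p` paired with `p` itself gives `N ⟨h, p⟩ ≥ ⟨p, p⟩ > 0`.
  have h1 := hp.2 _ hconv
  have h2 : 0 < ∑ i, p i * p i := by
    refine lt_of_le_of_ne (Finset.sum_nonneg fun i _ => mul_self_nonneg _) fun h0 => hp0 ?_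
    funext i
    have := (Finset.sum_eq_zero_iff_of_nonneg fun i _ => mul_self_nonneg (p i)).1 h0.symm i
      (Finset.mem_univ i)
    exact mul_self_eq_zero.1 this
  have h3 : ∑ i, (N * h i - p i) * p i = N * ∑ i, h i * p i - ∑ i, p i * p i := by
    rw [Finset.mul_sum, ← Finset.sum_sub_distrib]
    exact Finset.sum_congr rfl fun i _ => by ring
  rw [h3] at h1
  by_contra hle
  have : N * ∑ i, h i * p i ≤ 0 := mul_nonpos_of_nonneg_of_nonpos hN0 (not_lt.1 hle)
  linarith

namespace ConeOrder

variable {Δ} {r : ℕ} (o : Δ.ConeOrder r)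

theorem le_of_tau_subset {i j : Fin (r + 1)} (h : o.tau i ⊆ (o.cone j).1) : i ≤ j :=
  o.le_of_subset i j h

/-- The fan is the disjoint union of the intervals `[τ_i, σ_i]`. -/
theorem exists_interval {γ : Finset (Fin d)} {j : Fin (r + 1)} (h : γ ⊆ (o.cone j).1) :
    ∃ i, o.tau i ⊆ γ ∧ γ ⊆ (o.cone i).1 := by
  classical
  have hne : (Finset.univ.filter fun i : Fin (r + 1) => γ ⊆ (o.cone i).1).Nonempty :=
    ⟨j, Finset.mem_filter.2 ⟨Finset.mem_univ _, h⟩⟩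
  -- The right interval is that of the first maximal cone containing `γ`.
  let i : Fin (r + 1) := Finset.min' _ hne
  have hi : γ ⊆ (o.cone i).1 := by
    have := Finset.min'_mem _ hne
    rw [Finset.mem_filter] at this
    exact this.2
  refine ⟨i, fun x hx => ?_, hi⟩
  by_contra hxγ
  have hx' := Finset.mem_filter.1 hx
  -- If `x ∈ τ_i` were missing from `γ`, the neighbour of `σ_i` across the facet opposite to `x`
  -- would still contain `γ`. By minimality it comes later in the order, so `τ_i` is contained in
  -- it, although `x` is not.
  obtain ⟨σ', hσ', hsub, hxσ', hcard⟩ := Δ.exists_adjacent (o.cone i).2 hx'.1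
  let k := o.cone.symm ⟨σ', hσ'⟩
  have hk : (o.cone k).1 = σ' := by simp [k]
  have hγ : γ ⊆ (o.cone k).1 := fun y hy => by
    rw [hk]
    exact hsub (Finset.mem_erase.2 ⟨fun h => hxγ (h ▸ hy), hi hy⟩)
  have hik : i ≤ k := Finset.min'_le (Finset.univ.filter fun i : Fin (r + 1) => γ ⊆ (o.cone i).1) k
    (Finset.mem_filter.2 ⟨Finset.mem_univ _, hγ⟩)
  have hne : i ≠ k := fun h => hxσ' (by rw [← hk, ← h]; exact hx'.1)
  have := hx'.2 k (lt_of_le_of_ne hik hne) (by rw [hk]; exact hcard)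
  rw [hk] at this
  exact hxσ' this

/-- The empty face lies in some interval `[τ_i, σ_i]`, so `τ_i` is empty; it is then contained in
`σ_0`, which forces `i = 0`. -/
theorem tau_zero : o.tau 0 = ∅ := by
  obtain ⟨i, h1, -⟩ := o.exists_interval (Finset.empty_subset (o.cone 0).1)
  have h2 := Finset.subset_empty.1 h1
  have : i ≤ 0 := o.le_of_tau_subset (h2 ▸ Finset.empty_subset _)
  rw [← Fin.le_zero_iff.1 this]
  exact h2

end ConeOrder

end SmoothCompleteFan

/-! ### Koszul complexes of regular sequences -/

section Koszul

variable {n : ℕ} {S M : Type*} [CommRing S] [AddCommGroup M] [Module S M]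
  (q : Fin n → M →ₗ[S] M)

/-- The terms for `(i, j)` and `(j, i)` cancel: the operators commute, and inserting the smaller
index first changes the sign of the larger one but not conversely. -/
theorem koszul_koszul (hq : ∀ i j x, q i (q j x) = q j (q i x)) (α : Finset (Fin n) → M) :
    koszul q (koszul q α) = 0 := by
  funext I
  let f : Fin n × Fin n → M := fun p => if p.1 ∈ I ∨ p.2 ∈ I ∨ p.1 = p.2 then 0 else
    ((-1 : ℤ) ^ (I.filter (· < p.1)).card * (-1 : ℤ) ^ ((insert p.1 I).filter (· < p.2)).card) •
      q p.1 (q p.2 (α (insert p.2 (insert p.1 I))))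
  have h1 : koszul q (koszul q α) I = ∑ p, f p := by
    rw [koszul_apply, Fintype.sum_prod_type]
    refine Finset.sum_congr rfl fun i _ => ?_
    split_ifs with hi
    · exact (Finset.sum_eq_zero fun j _ => if_pos (Or.inl hi)).symm
    · rw [koszul_apply, map_sum, Finset.smul_sum]
      refine Finset.sum_congr rfl fun j _ => ?_
      by_cases hj : j ∈ insert i I
      · rw [if_pos hj, map_zero, smul_zero]
        refine (if_pos ?_).symm
        rcases Finset.mem_insert.1 hj with h | h
        exacts [Or.inr (Or.inr h.symm), Or.inr (Or.inl h)]
      · rw [if_neg hj, map_zsmul, ← mul_smul]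
        rw [Finset.mem_insert, not_or] at hj
        refine (if_neg ?_).symm
        rintro (h | h | h)
        exacts [hi h, hj.2 h, hj.1 h.symm]
  rw [h1]
  have hsgn : ∀ i j, i < j → i ∉ I → ((insert i I).filter (· < j)).card =
      (I.filter (· < j)).card + 1 ∧ ((insert j I).filter (· < i)) = I.filter (· < i) := by
    intro i j hij hi
    constructor
    · rw [Finset.filter_insert, if_pos hij, Finset.card_insert_of_notMem]
      exact fun h => hi (Finset.mem_filter.1 h).1
    · rw [Finset.filter_insert, if_neg (not_lt.2 hij.le)]
  have hanti : ∀ i j, i < j → f (i, j) + f (j, i) = 0 := by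
    intro i j hij
    by_cases h : i ∈ I ∨ j ∈ I
    · have e1 : f (i, j) = 0 := if_pos (by tauto)
      have e2 : f (j, i) = 0 := if_pos (by tauto)
      rw [e1, e2, add_zero]
    · rw [not_or] at h
      have e1 : f (i, j) = _ := if_neg (by
        rintro (h' | h' | h'); exacts [h.1 h', h.2 h', hij.ne h'])
      have e2 : f (j, i) = _ := if_neg (by
        rintro (h' | h' | h'); exacts [h.2 h', h.1 h', hij.ne' h'])
      rw [e1, e2]
      dsimp only
      rw [(hsgn i j hij h.1).1, (hsgn i j hij h.1).2, hq j i, Finset.insert_comm i j I, ← add_smul,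
        pow_succ]
      have : ∀ a b : ℤ, a * (b * -1) + b * a = 0 := fun a b => by ring
      rw [this, zero_smul]
  refine Finset.sum_involution (fun p _ => (p.2, p.1)) ?_ ?_ (fun _ _ => Finset.mem_univ _)
    fun _ _ => rfl
  · rintro ⟨i, j⟩ _
    rcases lt_trichotomy i j with h | rfl | h
    · exact hanti i j h
    · have : f (i, i) = 0 := if_pos (Or.inr (Or.inr rfl))
      rw [this, add_zero]
    · rw [add_comm]
      exact hanti j i h
  · rintro ⟨i, j⟩ _ hne heq
    refine hne (if_pos (Or.inr (Or.inr ?_)))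
    exact (congrArg Prod.snd heq)

theorem koszul_empty (α : Finset (Fin n) → M) : koszul q α ∅ = ∑ i, q i (α {i}) := by
  rw [koszul_apply]
  refine Finset.sum_congr rfl fun i _ => ?_
  simp

/-- When `k` is the largest index that occurs, `θ_k` stands last in every wedge product and
contributes no sign. Taking the coefficient of `θ_k` therefore commutes with the differential. -/
theorem koszul_insert {k : Fin n} {α : Finset (Fin n) → M}
    (hα : ∀ I : Finset (Fin n), (∃ i ∈ I, k < i) → α I = 0) {I : Finset (Fin n)} (hk : k ∉ I) :
    koszul q α (insert k I) = koszul q (fun I => if k ∈ I then 0 else α (insert k I)) I := by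
  rw [koszul_apply, koszul_apply]
  refine Finset.sum_congr rfl fun i _ => ?_
  by_cases hik : i = k
  · subst hik
    simp
  by_cases hi : i ∈ I
  · rw [if_pos hi, if_pos (Finset.mem_insert_of_mem hi)]
  rw [if_neg hi, if_neg (by simp [hik, hi]), if_neg (by simp [Ne.symm hik, hk]),
    Finset.insert_comm]
  by_cases hlt : k < i
  · rw [hα _ ⟨i, by simp, hlt⟩, map_zero, smul_zero, smul_zero]
  · rw [Finset.filter_insert, if_neg fun h => hlt (lt_of_le_of_ne h.le (Ne.symm hik))]

/-- Commuting operators form a regular sequence: `q_m` is injective modulo the images of the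
preceding ones. -/
def KoszulRegular : Prop :=
  ∀ (m : Fin n) (a : M) (b : Fin n → M), q m a = ∑ i with i < m, q i (b i) →
    ∃ b' : Fin n → M, a = ∑ i with i < m, q i (b' i)

/-- Induction on the number `m` of frame vectors in use. Coboundaries are subtracted until the last
vector `θ_k` no longer occurs: the induction hypothesis clears its coefficient in positive degree,
and regularity of `q_k` clears the remaining one in degree zero. -/
theorem exists_koszul_of_lt (hq : ∀ i j x, q i (q j x) = q j (q i x)) (hr : KoszulRegular q)
    (m : ℕ) (hm : m ≤ n) (α : Finset (Fin n) → M)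
    (hα : ∀ I : Finset (Fin n), (∃ i ∈ I, m ≤ i.1) → α I = 0) (h0 : koszul q α = 0) :
    ∃ β : Finset (Fin n) → M, (∀ I : Finset (Fin n), (∃ i ∈ I, m ≤ i.1) → β I = 0) ∧
      ∀ I, I ≠ ∅ → α I = koszul q β I := by
  induction m generalizing α with
  | zero =>
    refine ⟨0, fun _ _ => rfl, fun I hI => ?_⟩
    obtain ⟨i, hi⟩ := Finset.nonempty_iff_ne_empty.2 hI
    rw [map_zero, hα I ⟨i, hi, Nat.zero_le _⟩]
    rfl
  | succ m ih =>
    let k : Fin n := ⟨m, hm⟩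
    have hk : ∀ {β : Finset (Fin n) → M}, (∀ I : Finset (Fin n), (∃ i ∈ I, m + 1 ≤ i.1) → β I = 0) →
        ∀ I : Finset (Fin n), (∃ i ∈ I, k < i) → β I = 0 := fun h I ⟨i, hi, hki⟩ =>
      h I ⟨i, hi, hki⟩
    -- The coefficient of `θ_k`, a cocycle in the preceding frame vectors.
    let α' : Finset (Fin n) → M := fun I => if k ∈ I then 0 else α (insert k I)
    have hα' : ∀ I : Finset (Fin n), (∃ i ∈ I, m ≤ i.1) → α' I = 0 := by
      rintro I ⟨i, hi, him⟩
      by_cases hkI : k ∈ I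
      · exact if_pos hkI
      · refine (if_neg hkI).trans (hα _ ⟨i, Finset.mem_insert_of_mem hi, ?_⟩)
        exact Nat.lt_of_le_of_ne him fun h => hkI (by rwa [show k = i from Fin.ext h])
    have hQα' : koszul q α' = 0 := by
      funext I
      by_cases hkI : k ∈ I
      · rw [koszul_apply]
        refine Finset.sum_eq_zero fun i _ => ?_
        split_ifs
        · rfl
        · rw [show α' (insert i I) = 0 from if_pos (Finset.mem_insert_of_mem hkI), map_zero,
            smul_zero]
      · rw [← koszul_insert q (hk hα) hkI, h0]
        rfl
    obtain ⟨β', hβ', hβα⟩ := ih (Nat.le_of_succ_le hm) α' hα' hQα'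
    -- The wedge product with `θ_k` on the right.
    let w : (Finset (Fin n) → M) → Finset (Fin n) → M := fun β I =>
      if k ∈ I then β (I.erase k) else 0
    have hw : ∀ {β}, (∀ I : Finset (Fin n), (∃ i ∈ I, m ≤ i.1) → β I = 0) →
        (∀ I : Finset (Fin n), (∃ i ∈ I, m + 1 ≤ i.1) → w β I = 0) ∧
        ∀ I, k ∉ I → koszul q (w β) (insert k I) = koszul q β I := by
      intro β hβ
      have h1 : ∀ I : Finset (Fin n), (∃ i ∈ I, m + 1 ≤ i.1) → w β I = 0 := by
        rintro I ⟨i, hi, him⟩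
        change (if _ then _ else _) = _
        split_ifs
        · refine hβ _ ⟨i, Finset.mem_erase.2 ⟨fun h => ?_, hi⟩, by omega⟩
          rw [h] at him
          exact absurd him (Nat.not_succ_le_self m)
        · rfl
      refine ⟨h1, fun I hI => ?_⟩
      rw [koszul_insert q (hk h1) hI]
      have hcong : (fun I => if k ∈ I then 0 else w β (insert k I)) = β := by
        funext I'
        by_cases hkI : k ∈ I'
        · rw [if_pos hkI, hβ I' ⟨k, hkI, le_rfl⟩]
        · rw [if_neg hkI]
          change (if _ then _ else _) = _
          rw [if_pos (Finset.mem_insert_self _ _), Finset.erase_insert hkI]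
      rw [hcong]
    -- All that is left of the coefficient of `θ_k` after subtracting the coboundary of `w β'`.
    let a := α' ∅ - koszul q β' ∅
    let α₁ := α - koszul q (w β')
    have hα₁k : α₁ {k} = a := by
      change α {k} - koszul q (w β') {k} = _
      have h1 := (hw hβ').2 ∅ (Finset.notMem_empty k)
      have h2 : α' ∅ = α (insert k ∅) := if_neg (Finset.notMem_empty k)
      rw [show ({k} : Finset (Fin n)) = insert k ∅ from rfl, h1, ← h2]
    have hsupp : ∀ {β}, (∀ I : Finset (Fin n), (∃ i ∈ I, m + 1 ≤ i.1) → β I = 0) →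
        ∀ I : Finset (Fin n), (∃ i ∈ I, m + 1 ≤ i.1) → koszul q β I = 0 := by
      rintro β hβ I ⟨i, hi, him⟩
      rw [koszul_apply]
      refine Finset.sum_eq_zero fun j _ => ?_
      split_ifs
      · rfl
      · rw [hβ _ ⟨i, Finset.mem_insert_of_mem hi, him⟩, map_zero, smul_zero]
    have hα₁ : ∀ I : Finset (Fin n), (∃ i ∈ I, m + 1 ≤ i.1) → α₁ I = 0 := fun I hI => by
      change α I - koszul q (w β') I = 0
      rw [hα I hI, hsupp (hw hβ').1 I hI, sub_zero]
    have hQα₁ : koszul q α₁ = 0 := by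
      rw [map_sub, h0, koszul_koszul q hq, sub_zero]
    -- The degree zero part of the cocycle condition: `q_k a` is a combination of the images of the
    -- earlier operators.
    have hreg : q k a = ∑ i with i < k, q i (-α₁ {i}) := by
      have h1 := congrFun hQα₁ ∅
      rw [koszul_empty, ← Finset.sum_filter_add_sum_filter_not _ (fun i => i < k)] at h1
      have h2 : ∑ i with ¬ i < k, q i (α₁ {i}) = q k a := by
        rw [Finset.sum_eq_single k, hα₁k]
        · intro i hi hik
          have hki : k < i := lt_of_le_of_ne (not_lt.1 (Finset.mem_filter.1 hi).2) (Ne.symm hik)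
          rw [hα₁ {i} ⟨i, Finset.mem_singleton_self i, hki⟩, map_zero]
        · intro h
          exact absurd (Finset.mem_filter.2 ⟨Finset.mem_univ k, lt_irrefl k⟩) h
      rw [h2] at h1
      simp only [map_neg, Finset.sum_neg_distrib]
      exact eq_neg_of_add_eq_zero_right h1
    obtain ⟨b, hb⟩ := hr k a _ hreg
    -- The vector field `∑_{i<k} b_i θ_i`. Its coboundary is `a`, so the coboundary of `γ ∧ θ_k`
    -- removes the last occurrence of `θ_k`.
    let γ : Finset (Fin n) → M := fun I => ∑ i with i < k, if I = {i} then b i else 0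
    have hγ : ∀ I : Finset (Fin n), (∃ i ∈ I, m ≤ i.1) → γ I = 0 := by
      rintro I ⟨i, hi, him⟩
      refine Finset.sum_eq_zero fun j hj => if_neg ?_
      rintro rfl
      rw [Finset.mem_singleton] at hi
      subst hi
      exact absurd (Finset.mem_filter.1 hj).2 (not_lt.2 him)
    have hγ0 : koszul q γ ∅ = a := by
      rw [koszul_empty, hb, Finset.sum_filter]
      refine Finset.sum_congr rfl fun i _ => ?_
      split_ifs with hi
      · congr 1
        change ∑ j with j < k, (if ({i} : Finset (Fin n)) = {j} then b j else 0) = _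
        rw [Finset.sum_eq_single i]
        · rw [if_pos rfl]
        · intro j _ hji
          exact if_neg fun h => hji (Finset.singleton_injective h).symm
        · intro h
          exact absurd (Finset.mem_filter.2 ⟨Finset.mem_univ i, hi⟩) h
      · rw [hγ {i} ⟨i, Finset.mem_singleton_self i, not_lt.1 hi⟩, map_zero]
    have hγ1 : ∀ I, I ≠ ∅ → koszul q γ I = 0 := by
      intro I hI
      rw [koszul_apply]
      refine Finset.sum_eq_zero fun i _ => ?_
      split_ifs with hi
      · rfl
      · have : γ (insert i I) = 0 := Finset.sum_eq_zero fun j _ => if_neg fun h => by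
          have h1 := congrArg Finset.card h
          rw [Finset.card_insert_of_notMem hi, Finset.card_singleton] at h1
          exact hI (Finset.card_eq_zero.1 (by omega))
        rw [this, map_zero, smul_zero]
    let α₂ := α₁ - koszul q (w γ)
    have hα₂ : ∀ I : Finset (Fin n), (∃ i ∈ I, m ≤ i.1) → α₂ I = 0 := by
      rintro I ⟨i, hi, him⟩
      change α₁ I - koszul q (w γ) I = 0
      rcases Nat.lt_or_eq_of_le him with hlt | heq
      · rw [hα₁ I ⟨i, hi, hlt⟩, hsupp (hw hγ).1 I ⟨i, hi, hlt⟩, sub_zero]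
      · obtain rfl : k = i := Fin.ext heq
        obtain ⟨I', hI', rfl⟩ : ∃ I', k ∉ I' ∧ insert k I' = I :=
          ⟨I.erase k, Finset.notMem_erase _ _, Finset.insert_erase hi⟩
        rw [(hw hγ).2 I' hI']
        by_cases hI0 : I' = ∅
        · subst hI0
          rw [hγ0, sub_eq_zero]
          exact hα₁k
        · rw [hγ1 I' hI0, sub_zero]
          change α (insert k I') - koszul q (w β') (insert k I') = 0
          rw [(hw hβ').2 I' hI', ← hβα I' hI0, sub_eq_zero]
          exact (if_neg hI').symm
    obtain ⟨β₃, hβ₃, hβ₃α⟩ := ih (Nat.le_of_succ_le hm) α₂ hα₂ (by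
      rw [map_sub, hQα₁, koszul_koszul q hq, sub_zero])
    refine ⟨w β' + w γ + β₃, fun I hI => ?_, fun I hI => ?_⟩
    · have h3 : β₃ I = 0 := hβ₃ I (by
        obtain ⟨i, hi, him⟩ := hI
        exact ⟨i, hi, by omega⟩)
      change w β' I + w γ I + β₃ I = 0
      rw [(hw hβ').1 I hI, (hw hγ).1 I hI, h3]
      simp
    · have h3 := hβ₃α I hI
      rw [map_add, map_add, Pi.add_apply, ← h3]
      change α I = koszul q (w β') I + koszul q (w γ) I +
        (α I - koszul q (w β') I - koszul q (w γ) I)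
      abel

/-- Cocycles of the Koszul complex of a regular sequence are cohomologous to cocycles of degree
zero. -/
theorem exists_koszul_of_regular (hq : ∀ i j x, q i (q j x) = q j (q i x)) (hr : KoszulRegular q)
    (α : Finset (Fin n) → M) (h0 : koszul q α = 0) :
    ∃ β : Finset (Fin n) → M, ∀ I, I ≠ ∅ → α I = koszul q β I := by
  obtain ⟨β, -, hβ⟩ := exists_koszul_of_lt q hq hr n le_rfl α
    (fun I ⟨i, _, hi⟩ => absurd i.2 (not_lt.2 hi)) h0
  exact ⟨β, hβ⟩

end Koszul

/-! ### Contractions and perturbations -/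

/-- Over a field, a complex with cohomology `V` admits a contraction onto `V`. -/
theorem exists_contraction {k K V : Type*} [Field k] [AddCommGroup K] [Module k K]
    [AddCommGroup V] [Module k V] (Q : K →ₗ[k] K) (p : K →ₗ[k] V) (ι : V →ₗ[k] K)
    (hQ : ∀ x, Q (Q x) = 0) (hpι : ∀ v, p (ι v) = v) (hpQ : ∀ x, p (Q x) = 0)
    (hQι : ∀ v, Q (ι v) = 0) (hex : ∀ x, Q x = 0 → p x = 0 → ∃ y, Q y = x) :
    ∃ h : K →ₗ[k] K, (∀ x, Q (h x) + h (Q x) = x - ι (p x)) ∧ ∀ v, h (ι v) = 0 := by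
  obtain ⟨s, hs⟩ := Q.rangeRestrict.exists_rightInverse_of_surjective
    (LinearMap.range_eq_top.2 Q.surjective_rangeRestrict)
  obtain ⟨g₀, hg₀⟩ := LinearMap.exists_extend s
  have hg₀' : ∀ x, Q (g₀ (Q x)) = Q x := fun x => by
    have h1 : g₀ (Q x) = s ⟨Q x, x, rfl⟩ := LinearMap.congr_fun hg₀ ⟨Q x, x, rfl⟩
    have h2 := LinearMap.congr_fun hs ⟨Q x, x, rfl⟩
    rw [h1]
    exact congrArg Subtype.val h2
  -- The correction makes `p g = 0` and does not affect `Q g Q = Q`.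
  let g : K →ₗ[k] K := g₀ - ι ∘ₗ p ∘ₗ g₀
  have hgd : ∀ x, g x = g₀ x - ι (p (g₀ x)) := fun x => rfl
  have hQg : ∀ x, Q (g (Q x)) = Q x := fun x => by rw [hgd, map_sub, hQι, sub_zero, hg₀']
  have hpg : ∀ x, p (g x) = 0 := fun x => by rw [hgd, map_sub, hpι, sub_self]
  let e : K →ₗ[k] K := LinearMap.id - ι ∘ₗ p
  have hed : ∀ x, e x = x - ι (p x) := fun x => rfl
  let c : K →ₗ[k] K := LinearMap.id - g ∘ₗ Q
  have hcd : ∀ x, c x = x - g (Q x) := fun x => rfl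
  -- The factor `1 - g Q` lands in the cocycles and `1 - ι p` then in the kernel of `p`, that is in
  -- the boundaries, where `g` inverts `Q`. The factor `1 - ι p` also gives `h ι = 0`.
  refine ⟨g ∘ₗ e ∘ₗ c, fun x => ?_, fun v => ?_⟩
  · change Q (g (e (c x))) + g (e (c (Q x))) = _
    obtain ⟨y, hy⟩ := hex (e (c x)) (by
      rw [hed, map_sub, hQι, sub_zero, hcd, map_sub, hQg, sub_self])
      (by rw [hed, map_sub, hpι, sub_self])
    have h1 : e (c (Q x)) = Q x := by
      rw [hcd, hQ, map_zero, sub_zero, hed, hpQ, map_zero, sub_zero]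
    rw [← hy, hQg, hy, h1, hed, hcd, map_sub, hpg, sub_zero]
    abel
  · change g (e (c (ι v))) = 0
    rw [hcd, hQι, map_zero, sub_zero, hed, hpι, sub_self, map_zero]

/-- The perturbation of a contraction: if `1 + (Q - Q₀) h` is invertible, it conjugates `Q₀`
to `Q`. -/
theorem perturbation_comm {X : Type*} [AddCommGroup X] (Q Q₀ h e : AddMonoid.End X)
    (hQ : ∀ x, Q (Q x) = 0) (hQ₀ : ∀ x, Q₀ (Q₀ x) = 0)
    (hh : ∀ x, Q₀ (h x) + h (Q₀ x) = x - e x) (hQe : ∀ x, Q (e x) = 0) (hQ₀e : ∀ x, Q₀ (e x) = 0)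
    (x : X) : Q (x + (Q (h x) - Q₀ (h x))) = Q₀ x + (Q (h (Q₀ x)) - Q₀ (h (Q₀ x))) := by
  have h1 : h (Q₀ x) = x - e x - Q₀ (h x) := by rw [← hh x]; abel
  rw [h1]
  simp only [map_add, map_sub, hQ, hQ₀, hQe, hQ₀e]
  abel

/-! ### Elements of `P_φ` as sums of a curve class and a cone vector -/

namespace SmoothCompleteFan

variable {n d : ℕ} (Δ : SmoothCompleteFan n d)

theorem IsConeVector.mem {Δ : SmoothCompleteFan n d} {b : Fin d → ℤ} (hb : Δ.IsConeVector b) :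
    b ∈ Δ.totalMonoid :=
  ⟨b, 0, hb, zero_mem _, (add_zero b).symm⟩

/-- The cone vector over a lattice point. -/
def coneVec (m : Fin n → ℤ) : Fin d → ℤ := (Δ.exists_coneVector m).choose

theorem isConeVector_coneVec (m : Fin n → ℤ) : Δ.IsConeVector (Δ.coneVec m) :=
  (Δ.exists_coneVector m).choose_spec.1

theorem rayMap_coneVec (m : Fin n → ℤ) : Δ.rayMap (Δ.coneVec m) = m :=
  (Δ.exists_coneVector m).choose_spec.2

theorem coneVec_rayMap {b : Fin d → ℤ} (hb : Δ.IsConeVector b) : Δ.coneVec (Δ.rayMap b) = b :=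
  IsConeVector.ext Δ (Δ.isConeVector_coneVec _) hb (Δ.rayMap_coneVec _)

theorem sub_coneVec_mem {a : Fin d → ℤ} (ha : a ∈ Δ.totalMonoid) :
    a - Δ.coneVec (Δ.rayMap a) ∈ Δ.curveMonoid := by
  obtain ⟨b, p, hb, hp, rfl⟩ := ha
  have : Δ.rayMap p = 0 := hp.1
  rw [map_add, this, add_zero, Δ.coneVec_rayMap hb, add_sub_cancel_left]
  exact hp

/-- The component in `P` of an element of `P_φ`. -/
def curvePart (a : Δ.totalMonoid) : Δ.curveMonoid := ⟨_, Δ.sub_coneVec_mem a.2⟩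

/-- The cone vector of an element of `P_φ`. -/
def conePart (a : Δ.totalMonoid) : Fin d → ℤ := Δ.coneVec (Δ.rayMap a.1)

theorem isConeVector_conePart (a : Δ.totalMonoid) : Δ.IsConeVector (Δ.conePart a) :=
  Δ.isConeVector_coneVec _

theorem curvePart_add_conePart (a : Δ.totalMonoid) : (Δ.curvePart a).1 + Δ.conePart a = a.1 :=
  sub_add_cancel _ _

theorem conePart_add (p : Δ.curveMonoid) (a : Δ.totalMonoid) :
    Δ.conePart (AddSubmonoid.inclusion Δ.curveMonoid_le_totalMonoid p + a) = Δ.conePart a := by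
  have : Δ.rayMap p.1 = 0 := p.2.1
  change Δ.coneVec (Δ.rayMap (p.1 + a.1)) = _
  rw [map_add, this, zero_add]
  rfl

theorem curvePart_add (p : Δ.curveMonoid) (a : Δ.totalMonoid) :
    Δ.curvePart (AddSubmonoid.inclusion Δ.curveMonoid_le_totalMonoid p + a) =
      p + Δ.curvePart a := by
  refine Subtype.ext ?_
  have h := Δ.conePart_add p a
  change p.1 + a.1 - Δ.conePart (AddSubmonoid.inclusion _ p + a) = p.1 + (a.1 - Δ.conePart a)
  rw [h, add_sub_assoc]

theorem conePart_of_isConeVector {b : Fin d → ℤ} (hb : Δ.IsConeVector b) :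
    Δ.conePart ⟨b, hb.mem⟩ = b := Δ.coneVec_rayMap hb

theorem curvePart_of_isConeVector {b : Fin d → ℤ} (hb : Δ.IsConeVector b) :
    Δ.curvePart ⟨b, hb.mem⟩ = 0 :=
  Subtype.ext (by
    change b - Δ.conePart ⟨b, hb.mem⟩ = 0
    rw [Δ.conePart_of_isConeVector hb, sub_self])

theorem curvePart_eq_zero_iff (a : Δ.totalMonoid) :
    Δ.curvePart a = 0 ↔ Δ.IsConeVector a.1 := by
  constructor
  · intro h
    rw [← Δ.curvePart_add_conePart a, h]
    change Δ.IsConeVector (0 + _)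
    rw [zero_add]
    exact Δ.isConeVector_conePart a
  · exact fun h => Δ.curvePart_of_isConeVector h

variable {Δ}

/-- A strictly convex function is positive on every nonzero element of `P`, so `P` has no nontrivial
units. This is what keeps constants and the central fibre from being destroyed by the ideal `𝓘`. -/
theorem IsProjective.add_eq_zero (hΔ : Δ.IsProjective) {p q : Δ.curveMonoid} (h : p + q = 0) :
    p = 0 := by
  obtain ⟨h₀, hh⟩ := hΔ
  by_contra hp
  have h1 := hh.pos Δ p.2 fun h => hp (Subtype.ext h)
  have h2 : 0 ≤ ∑ i, h₀ i * q.1 i := by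
    by_cases hq : q = 0
    · subst hq; simp
    · exact (hh.pos Δ q.2 fun h => hq (Subtype.ext h)).le
  have h3 : ∑ i, h₀ i * p.1 i + ∑ i, h₀ i * q.1 i = 0 := by
    rw [← Finset.sum_add_distrib]
    refine Finset.sum_eq_zero fun i _ => ?_
    have : p.1 i + q.1 i = 0 := congrFun (congrArg Subtype.val h) i
    rw [← mul_add, this, mul_zero]
  omega

theorem IsConeVector.sub {b : Fin d → ℤ} (hb : Δ.IsConeVector b) {c : Fin d → ℤ}
    (h0 : ∀ i, 0 ≤ c i) (hc : ∀ i, c i ≤ b i) : Δ.IsConeVector c := by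
  obtain ⟨h, σ, hσ, hs⟩ := hb
  exact ⟨h0, σ, hσ, fun i hi => le_antisymm ((hc i).trans (hs i hi).le) (h0 i)⟩

theorem isConeVector_exponent {τ σ : Finset (Fin d)} (hσ : σ ∈ Δ.maxCones) (h : τ ⊆ σ) :
    Δ.IsConeVector (exponent τ) :=
  ⟨fun i => by unfold exponent; split_ifs <;> norm_num,
    σ, hσ, fun _ hi => if_neg fun h' => hi (h h')⟩

namespace ConeOrder

open laurentTower

variable {r : ℕ} (o : Δ.ConeOrder r)

/-! ### The ring of functions over the base -/

/-- The monomial `z^b` for a cone vector `b`, and zero otherwise. -/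
def coneE (b : Fin d → ℤ) : o.TotalRing :=
  open Classical in if h : Δ.IsConeVector b then AddMonoidAlgebra.single (⟨b, h.mem⟩, 0) 1 else 0

theorem coneE_of (b : Fin d → ℤ) (h : Δ.IsConeVector b) :
    o.coneE b = AddMonoidAlgebra.single (⟨b, h.mem⟩, 0) 1 := dif_pos h

theorem coneE_of_not (b : Fin d → ℤ) (h : ¬ Δ.IsConeVector b) : o.coneE b = 0 := dif_neg h

/-- The class of `z^b` in the ring of the central fibre. -/
def fiberE (b : Fin d → ℤ) : o.FiberRing := Ideal.Quotient.mk _ (o.coneE b)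

theorem fiberE_of_not (b : Fin d → ℤ) (h : ¬ Δ.IsConeVector b) : o.fiberE b = 0 := by
  rw [fiberE, coneE_of_not _ _ h, map_zero]

theorem structureMap_single (x : Δ.curveMonoid × (o.BigIndex →₀ ℕ)) (c : ℂ) :
    o.structureMap (AddMonoidAlgebra.single x c) = AddMonoidAlgebra.single
      (AddSubmonoid.inclusion Δ.curveMonoid_le_totalMonoid x.1, x.2) c := by
  simp only [structureMap, AddMonoidAlgebra.mapDomainRingHom_apply,
    AddMonoidAlgebra.mapDomain_single]
  rfl

/-- Splitting the exponent into curve class and cone vector exhibits the monomials `z^b`, `b` a cone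
vector, as generators over the base; linear maps over `𝓡` are determined by their values on them. -/
theorem single_eq (x : Δ.totalMonoid × (o.BigIndex →₀ ℕ)) (c : ℂ) :
    (AddMonoidAlgebra.single x c : o.TotalRing) =
      o.structureMap (AddMonoidAlgebra.single (Δ.curvePart x.1, x.2) c) *
        o.coneE (Δ.conePart x.1) := by
  rw [structureMap_single, coneE_of _ _ (Δ.isConeVector_conePart _),
    AddMonoidAlgebra.single_mul_single, mul_one]
  congr 1
  exact Prod.ext (Subtype.ext (Δ.curvePart_add_conePart x.1).symm) (add_zero _).symm

theorem structureMap_mem {a : o.BaseRing} (ha : a ∈ o.baseIdeal) :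
    o.structureMap a ∈ o.totalIdeal := Ideal.mem_map_of_mem _ ha

theorem single_mem_baseIdeal {x : Δ.curveMonoid × (o.BigIndex →₀ ℕ)} (hx : x ≠ 0) (c : ℂ) :
    AddMonoidAlgebra.single x c ∈ o.baseIdeal := by
  have : (AddMonoidAlgebra.single x c : o.BaseRing) =
      AddMonoidAlgebra.single 0 c * AddMonoidAlgebra.single x 1 := by
    rw [AddMonoidAlgebra.single_mul_single, zero_add, mul_one]
  rw [this]
  exact Ideal.mul_mem_left _ _ (Ideal.subset_span ⟨x, hx, rfl⟩)

theorem mk_single_of_ne (a : Δ.totalMonoid) {l : o.BigIndex →₀ ℕ} (hl : l ≠ 0) (c : ℂ) :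
    Ideal.Quotient.mk o.totalIdeal (AddMonoidAlgebra.single (a, l) c) = 0 := by
  rw [single_eq, Ideal.Quotient.eq_zero_iff_mem]
  exact Ideal.mul_mem_right _ _ (o.structureMap_mem (o.single_mem_baseIdeal
    (fun h => hl (congrArg Prod.snd h)) c))

/-- If the exponent is not a cone vector, its curve part is nonzero and the monomial is a multiple
of an element of `𝓘`. -/
theorem mk_single (a : Δ.totalMonoid) (c : ℂ) :
    Ideal.Quotient.mk o.totalIdeal (AddMonoidAlgebra.single (a, 0) c) = c • o.fiberE a.1 := by
  by_cases h : Δ.IsConeVector a.1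
  · rw [fiberE, coneE_of _ _ h]
    change _ = Ideal.Quotient.mk _ (c • _)
    rw [AddMonoidAlgebra.smul_single, smul_eq_mul, mul_one]
  · rw [fiberE_of_not _ _ h, smul_zero, single_eq, Ideal.Quotient.eq_zero_iff_mem]
    exact Ideal.mul_mem_right _ _ (o.structureMap_mem (o.single_mem_baseIdeal
      (fun h' => h ((Δ.curvePart_eq_zero_iff a).1 (congrArg Prod.fst h'))) c))

theorem mk_coneMonomial {S σ : Finset (Fin d)} (hσ : σ ∈ Δ.maxCones) (h : S ⊆ σ) :
    Ideal.Quotient.mk o.totalIdeal (o.coneMonomial hσ h) = o.fiberE (exponent S) := by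
  rw [coneMonomial, mk_single, one_smul]

theorem mk_z (j : Fin d) : Ideal.Quotient.mk o.totalIdeal (o.z j) = o.fiberE (exponent {j}) :=
  o.mk_coneMonomial _ _

theorem mk_phi (i : Fin (r + 1)) :
    Ideal.Quotient.mk o.totalIdeal (o.phi i) = o.fiberE (exponent (o.tau i)) :=
  o.mk_coneMonomial _ _

/-- The multiplication of the Stanley-Reisner ring: when `b + b'` is not supported on a cone the
right hand side is zero by the convention for `coneE`. -/
theorem fiberE_mul {b b' : Fin d → ℤ} (hb : Δ.IsConeVector b) (hb' : Δ.IsConeVector b') :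
    o.fiberE b * o.fiberE b' = o.fiberE (b + b') := by
  rw [fiberE, fiberE, coneE_of _ _ hb, coneE_of _ _ hb', ← map_mul,
    AddMonoidAlgebra.single_mul_single, mul_one, Prod.mk_add_mk, add_zero, mk_single, one_smul]
  rfl

theorem isConeVector_singleton (j : Fin d) : Δ.IsConeVector (exponent {j}) :=
  isConeVector_exponent (Δ.ray_mem j).choose_spec.1
    (Finset.singleton_subset_iff.2 (Δ.ray_mem j).choose_spec.2)

theorem mk_z_mul (j : Fin d) {b : Fin d → ℤ} (hb : Δ.IsConeVector b) :
    Ideal.Quotient.mk o.totalIdeal (o.z j) * o.fiberE b = o.fiberE (b + exponent {j}) := by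
  rw [mk_z, o.fiberE_mul (isConeVector_singleton j) hb, add_comm]

theorem fiberRing_induction {p : o.FiberRing → Prop} (s : o.FiberRing)
    (h0 : p 0) (hadd : ∀ s t, p s → p t → p (s + t))
    (he : ∀ b (c : ℂ), Δ.IsConeVector b → p (c • o.fiberE b)) : p s := by
  obtain ⟨a, rfl⟩ := Ideal.Quotient.mk_surjective s
  induction a using AddMonoidAlgebra.induction_linear with
  | zero => rwa [map_zero]
  | add a b ha hb => rw [map_add]; exact hadd _ _ ha hb
  | single x c =>
    obtain ⟨a, l⟩ := x
    by_cases hl : l = 0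
    · subst hl
      rw [mk_single]
      by_cases h : Δ.IsConeVector a.1
      · exact he _ _ h
      · rwa [fiberE_of_not _ _ h, smul_zero]
    · rwa [mk_single_of_ne _ _ hl]

open Classical in
/-- The projection of the functions onto the span of the `z^b`, `b` a cone vector. -/
def coneProj : o.TotalRing →ₗ[ℂ] o.TotalRing :=
  monomialMap (fun x => if Δ.IsConeVector x.1.1 ∧ x.2 = 0 then 1 else 0) id

/-- A multiple of a nontrivial base monomial can be a pure `z^b` only if curve classes or exponents
of the `t_i` cancel, which pointedness of `P` excludes. -/
theorem coneProj_eq_zero (hΔ : Δ.IsProjective) {a : o.TotalRing} (ha : a ∈ o.totalIdeal) :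
    o.coneProj a = 0 := by
  have hspan : o.totalIdeal = Ideal.span (o.structureMap ''
      {a | ∃ x, x ≠ 0 ∧ a = AddMonoidAlgebra.single x 1}) := Ideal.map_span _ _
  rw [hspan] at ha
  refine Submodule.closure_induction (p := fun a _ => o.coneProj a = 0) (map_zero _)
    (fun x y _ _ hx hy => by rw [map_add, hx, hy, add_zero]) ?_ ha
  rintro a _ ⟨_, ⟨x, hx, rfl⟩, rfl⟩
  induction a using AddMonoidAlgebra.induction_linear with
  | zero => simp
  | add a b ha hb => rw [add_smul, map_add, ha, hb, add_zero]
  | single y c =>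
    rw [smul_eq_mul, structureMap_single, AddMonoidAlgebra.single_mul_single, coneProj,
      monomialMap_single, if_neg, zero_mul, AddMonoidAlgebra.single_zero]
    rintro ⟨h1, h2⟩
    have h2 : y.2 + x.2 = 0 := h2
    have hx2 : x.2 = 0 := by
      ext i
      have := DFunLike.congr_fun h2 i
      simp at this
      simp [this.2]
    have h3 : x.1 + Δ.curvePart y.1 = 0 := by
      rw [← Δ.curvePart_add, Δ.curvePart_eq_zero_iff, add_comm]
      exact h1
    exact hx (Prod.ext (hΔ.add_eq_zero h3) hx2)

/-- The linear section of the restriction to the central fibre with values in the span of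
the `z^b`. -/
def sec (hΔ : Δ.IsProjective) : o.FiberRing →ₗ[ℂ] o.TotalRing where
  toFun := QuotientAddGroup.lift o.totalIdeal.toAddSubgroup
    (o.coneProj : o.TotalRing →+ o.TotalRing)
    fun _ ha => o.coneProj_eq_zero hΔ ha
  map_add' := map_add _
  map_smul' c s := by
    obtain ⟨a, rfl⟩ := Ideal.Quotient.mk_surjective s
    exact o.coneProj.map_smul c a

theorem sec_fiberE (hΔ : Δ.IsProjective) (b : Fin d → ℤ) :
    o.sec hΔ (o.fiberE b) = o.coneE b := by
  change o.coneProj (o.coneE b) = _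
  by_cases h : Δ.IsConeVector b
  · rw [coneE_of _ _ h, coneProj, monomialMap_single, if_pos ⟨h, rfl⟩, one_mul]
    rfl
  · rw [coneE_of_not _ _ h, map_zero]

theorem mk_sec (hΔ : Δ.IsProjective) (s : o.FiberRing) :
    Ideal.Quotient.mk _ (o.sec hΔ s) = s := by
  induction s using fiberRing_induction with
  | h0 => rw [map_zero, map_zero]
  | hadd s t hs ht => rw [map_add, map_add, hs, ht]
  | he b c hb =>
    rw [map_smul, sec_fiberE]
    rfl

section Extension

variable {B : Type*} [CommRing B] (f : o.BaseRing →+* B)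

/-- The extension of a linear map on the central fibre to a map linear over the base. -/
def ext [Algebra ℂ B] (g : o.FiberRing →ₗ[ℂ] B) : o.TotalRing →ₗ[ℂ] B :=
  (Finsupp.lsum ℂ fun x : Δ.totalMonoid × (o.BigIndex →₀ ℕ) => LinearMap.toSpanSingleton ℂ B
    (f (AddMonoidAlgebra.single (Δ.curvePart x.1, x.2) 1) * g (o.fiberE (Δ.conePart x.1)))).comp
    (AddMonoidAlgebra.coeffLinearEquiv ℂ).toLinearMap

theorem ext_single [Algebra ℂ B] (g : o.FiberRing →ₗ[ℂ] B)
    (x : Δ.totalMonoid × (o.BigIndex →₀ ℕ)) (c : ℂ) :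
    o.ext f g (AddMonoidAlgebra.single x c) =
      c • (f (AddMonoidAlgebra.single (Δ.curvePart x.1, x.2) 1) *
        g (o.fiberE (Δ.conePart x.1))) := by
  simp [ext, AddMonoidAlgebra.coeffLinearEquiv]

theorem ext_coneE [Algebra ℂ B] (g : o.FiberRing →ₗ[ℂ] B) (b : Fin d → ℤ) :
    o.ext f g (o.coneE b) = g (o.fiberE b) := by
  by_cases h : Δ.IsConeVector b
  · have h1 : (AddMonoidAlgebra.single (Δ.curvePart ⟨b, h.mem⟩, 0) 1 : o.BaseRing) = 1 := by
      rw [Δ.curvePart_of_isConeVector h]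
      rfl
    rw [coneE_of _ _ h, ext_single]
    dsimp only
    rw [h1, map_one, one_mul, one_smul, Δ.conePart_of_isConeVector h]
  · rw [coneE_of_not _ _ h, fiberE_of_not _ _ h, map_zero, map_zero]

theorem ext_mul [Algebra ℂ B] (hf : ∀ (c : ℂ) a, f (c • a) = c • f a) (g : o.FiberRing →ₗ[ℂ] B)
    (a : o.BaseRing) (x : o.TotalRing) : o.ext f g (o.structureMap a * x) = f a * o.ext f g x := by
  induction x using AddMonoidAlgebra.induction_linear with
  | zero => simp
  | add x y hx hy => rw [mul_add, map_add, map_add, mul_add, hx, hy]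
  | single x c =>
    induction a using AddMonoidAlgebra.induction_linear with
    | zero => simp
    | add a b ha hb => rw [map_add, add_mul, map_add, map_add, add_mul, ha, hb]
    | single y c' =>
      have h1 : ∀ (z : Δ.curveMonoid × (o.BigIndex →₀ ℕ)) (c : ℂ),
          f (AddMonoidAlgebra.single z c) = c • f (AddMonoidAlgebra.single z 1) := fun z c => by
        rw [← hf, AddMonoidAlgebra.smul_single, smul_eq_mul, mul_one]
      have h2 : (AddMonoidAlgebra.single (y.1 + Δ.curvePart x.1, y.2 + x.2) 1 : o.BaseRing) =
          AddMonoidAlgebra.single y 1 * AddMonoidAlgebra.single (Δ.curvePart x.1, x.2) 1 := by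
        rw [AddMonoidAlgebra.single_mul_single, mul_one]
        rfl
      rw [structureMap_single, AddMonoidAlgebra.single_mul_single, ext_single, ext_single,
        h1 y c', Prod.fst_add, Prod.snd_add, Δ.curvePart_add, Δ.conePart_add, h2, map_mul, mul_smul,
        smul_mul_assoc, mul_smul_comm, mul_assoc]

/-- Maps linear over the base are determined by their values on the `z^b`. -/
theorem eq_of_coneE {T T' : o.TotalRing →+ B}
    (hT : ∀ a x, T (o.structureMap a * x) = f a * T x)
    (hT' : ∀ a x, T' (o.structureMap a * x) = f a * T' x)
    (h : ∀ b, Δ.IsConeVector b → T (o.coneE b) = T' (o.coneE b)) (x : o.TotalRing) :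
    T x = T' x := by
  induction x using AddMonoidAlgebra.induction_linear with
  | zero => simp
  | add x y hx hy => rw [map_add, map_add, hx, hy]
  | single x c => rw [single_eq, hT, hT', h _ (Δ.isConeVector_conePart _)]

/-- Since `𝓘^k 𝒪` is generated by `𝓘^k`, the image of a map linear over the base is controlled by
its image on all functions. With `J₁` the whole ring the map respects the filtration; with `J₁` the
ideal itself it raises it by one. -/
theorem map_mem_of_linear {T : o.TotalRing →+ B} (hT : ∀ a x, T (o.structureMap a * x) = f a * T x)
    {J' J₁ : Ideal B} (hJ : o.baseIdeal.map f ≤ J') (h₁ : ∀ x, T x ∈ J₁) (k : ℕ) {x : o.TotalRing}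
    (hx : x ∈ o.totalIdeal ^ k) : T x ∈ J' ^ k * J₁ := by
  rw [totalIdeal, ← Ideal.map_pow] at hx
  refine Submodule.closure_induction (p := fun x _ => T x ∈ J' ^ k * J₁) (by simp)
    (fun x y _ _ hx hy => by rw [map_add]; exact add_mem hx hy) ?_ hx
  rintro y _ ⟨a, ha, rfl⟩
  rw [smul_eq_mul, mul_comm y, hT]
  refine Ideal.mul_mem_mul (Ideal.pow_right_mono hJ k ?_) (h₁ _)
  rw [← Ideal.map_pow]
  exact Ideal.mem_map_of_mem _ ha

theorem filtered_of_linear {T : o.TotalRing →+ B}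
    (hT : ∀ a x, T (o.structureMap a * x) = f a * T x) {J' : Ideal B}
    (hJ : o.baseIdeal.map f ≤ J') : Filtered o.totalIdeal J' T := fun k x hx => by
  have := o.map_mem_of_linear f hT hJ (J₁ := ⊤) (fun _ => Submodule.mem_top) k hx
  rwa [Ideal.mul_top] at this

end Extension

end ConeOrder

end SmoothCompleteFan

namespace SmoothCompleteFan.ConeOrder

open laurentTower

variable {n d r : ℕ} {Δ : SmoothCompleteFan n d} (o : Δ.ConeOrder r)

/-! ### The ring of the central fibre is free over the polynomial ring in the linear forms -/

/-- The support of a vector. -/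
def vsupp (b : Fin d → ℤ) : Finset (Fin d) := Finset.univ.filter fun i => b i ≠ 0

theorem mem_vsupp {b : Fin d → ℤ} {i : Fin d} : i ∈ vsupp b ↔ b i ≠ 0 := by simp [vsupp]

theorem vsupp_exponent (S : Finset (Fin d)) : vsupp (exponent S) = S := by
  ext i
  simp [mem_vsupp, exponent]

theorem exists_cone_of_isConeVector {b : Fin d → ℤ} (hb : Δ.IsConeVector b) :
    ∃ j, vsupp b ⊆ (o.cone j).1 := by
  obtain ⟨-, σ, hσ, hs⟩ := hb
  refine ⟨o.cone.symm ⟨σ, hσ⟩, fun i hi => ?_⟩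
  rw [Equiv.apply_symm_apply]
  by_contra h
  exact mem_vsupp.1 hi (hs i h)

/-- The linear form `θ̃_i(f)` on the central fibre. -/
def lin (i : Fin n) : o.FiberRing := o.fiberThetaRel i o.fiberf

theorem thetaRel_z (i : Fin n) (j : Fin d) :
    o.thetaRel i (o.z j) = (Δ.ray j i : ℂ) • o.z j := by
  have h : Δ.rayMap (exponent {j}) = Δ.ray j := by
    rw [Δ.rayMap_apply]
    simp [exponent]
  rw [z, coneMonomial, thetaRel, logDerivation_single, AddMonoidAlgebra.smul_single]
  congr 1
  change ((Δ.rayMap (exponent {j}) i : ℤ) : ℂ) * 1 = _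
  rw [h]
  rfl

theorem lin_eq (i : Fin n) :
    o.lin i = ∑ j, (Δ.ray j i : ℂ) • Ideal.Quotient.mk o.totalIdeal (o.z j) := by
  change Ideal.Quotient.mk _ (o.thetaRel i o.f) = _
  rw [f, map_sum, map_sum]
  refine Finset.sum_congr rfl fun j _ => ?_
  rw [thetaRel_z]
  rfl

theorem sum_smul_lin (m : Fin n → ℤ) : ∑ i, (m i : ℂ) • o.lin i =
    ∑ j, ((m ⬝ᵥ Δ.ray j : ℤ) : ℂ) • Ideal.Quotient.mk o.totalIdeal (o.z j) := by
  simp only [lin_eq, Finset.smul_sum, smul_smul]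
  rw [Finset.sum_comm]
  refine Finset.sum_congr rfl fun j _ => ?_
  rw [← Finset.sum_smul]
  congr 1
  simp [dotProduct]

/-- On the monomials of a maximal cone, multiplication by `z_j` is a linear form up to monomials
outside of the cone. -/
theorem fiberE_add_single {σ : Finset (Fin d)} (hσ : σ ∈ Δ.maxCones) {j : Fin d} (hj : j ∈ σ)
    {b : Fin d → ℤ} (hb : Δ.IsConeVector b) : o.fiberE (b + exponent {j}) =
      ∑ i, (Δ.dual hσ j i : ℂ) • (o.lin i * o.fiberE b) -
        ∑ k ∈ σᶜ, ((Δ.dual hσ j ⬝ᵥ Δ.ray k : ℤ) : ℂ) • o.fiberE (b + exponent {k}) := by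
  have h1 := congrArg (· * o.fiberE b) (o.sum_smul_lin (Δ.dual hσ j))
  simp only [Finset.sum_mul, smul_mul_assoc, o.mk_z_mul _ hb] at h1
  rw [h1, ← Finset.sum_add_sum_compl σ, add_sub_cancel_right, Finset.sum_eq_single j]
  · rw [Δ.dual_ray hσ hj hj, if_pos rfl, Int.cast_one, one_smul]
  · intro k hk hkj
    rw [Δ.dual_ray hσ hj hk, if_neg hkj, Int.cast_zero, zero_smul]
  · exact fun h => absurd hj h

open MvPolynomial in
/-- The linear form dual to a generator of a maximal cone. -/
def dualForm {σ : Finset (Fin d)} (hσ : σ ∈ Δ.maxCones) (k : Fin d) : MvPolynomial (Fin n) ℂ :=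
  ∑ i, C (Δ.dual hσ k i : ℂ) * X i

/-- Its value at the ray generator it is dual to is `1`. -/
theorem dualForm_ne_zero {σ : Finset (Fin d)} (hσ : σ ∈ Δ.maxCones) {k : Fin d} (hk : k ∈ σ) :
    dualForm hσ k ≠ 0 := by
  intro h
  have h1 := congrArg (MvPolynomial.eval fun i => (Δ.ray k i : ℂ)) h
  simp only [dualForm, map_sum, map_mul, MvPolynomial.eval_C, MvPolynomial.eval_X, map_zero] at h1
  have h2 := Δ.dual_ray hσ hk hk
  rw [if_pos rfl] at h2
  have h3 : ((Δ.dual hσ k ⬝ᵥ Δ.ray k : ℤ) : ℂ) = 0 := by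
    rw [← h1]
    simp [dotProduct]
  rw [h2] at h3
  norm_num at h3

/-- Expansion of a basis vector of the lattice in the basis of the cone. It says that `θ̃_i(f)`
restricts to the `i`-th variable on the component of `σ`. -/
theorem sum_ray_dualForm {σ : Finset (Fin d)} (hσ : σ ∈ Δ.maxCones) (i : Fin n) :
    ∑ j ∈ σ, (Δ.ray j i : ℂ) • dualForm hσ j = MvPolynomial.X i := by
  simp only [dualForm, Finset.smul_sum]
  rw [Finset.sum_comm, Finset.sum_eq_single i]
  · have h := congrFun (Δ.sum_dual hσ (Pi.single i 1)) i
    simp only [dotProduct_single, mul_one, Finset.sum_apply, Pi.smul_apply, smul_eq_mul,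
      Pi.single_eq_same] at h
    have h' : ∑ j ∈ σ, (Δ.ray j i : ℂ) * (Δ.dual hσ j i : ℂ) = 1 := by
      have := congrArg (Int.cast : ℤ → ℂ) h
      push_cast at this
      rw [← this]
      exact Finset.sum_congr rfl fun j _ => mul_comm _ _
    simp only [MvPolynomial.smul_eq_C_mul, ← mul_assoc, ← MvPolynomial.C_mul]
    rw [← Finset.sum_mul, ← map_sum, h', MvPolynomial.C_1, one_mul]
  · intro i' _ hi'
    have h := congrFun (Δ.sum_dual hσ (Pi.single i' 1)) i
    simp only [dotProduct_single, mul_one, Finset.sum_apply, Pi.smul_apply, smul_eq_mul,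
      Pi.single_eq_of_ne (Ne.symm hi')] at h
    have h' : ∑ j ∈ σ, (Δ.ray j i : ℂ) * (Δ.dual hσ j i' : ℂ) = 0 := by
      have := congrArg (Int.cast : ℤ → ℂ) h
      push_cast at this
      rw [← this]
      exact Finset.sum_congr rfl fun j _ => mul_comm _ _
    simp only [MvPolynomial.smul_eq_C_mul, ← mul_assoc, ← MvPolynomial.C_mul]
    rw [← Finset.sum_mul, ← map_sum, h', MvPolynomial.C_0, zero_mul]
  · simp

/-- A maximal cone cuts out a face of the monoid `P_φ`. -/
theorem exists_face (hΔ : Δ.IsProjective) {σ : Finset (Fin d)} (hσ : σ ∈ Δ.maxCones) :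
    ∃ H : (Fin d → ℤ) →+ ℤ, (∀ a ∈ Δ.totalMonoid, 0 ≤ H a) ∧
      ∀ a ∈ Δ.totalMonoid, H a = 0 ↔ (∀ i, 0 ≤ a i) ∧ ∀ i ∉ σ, a i = 0 := by
  obtain ⟨h, hh⟩ := hΔ
  obtain ⟨m, hm, hlt⟩ := hh σ hσ
  -- The difference between the strictly convex function and its linear piece on `σ`: zero on the
  -- generators of `σ`, positive on the other rays.
  let w : Fin d → ℤ := fun k => h k - m ⬝ᵥ Δ.ray k
  have hw0 : ∀ k ∈ σ, w k = 0 := fun k hk => sub_eq_zero.2 (hm k hk).symm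
  have hw1 : ∀ k ∉ σ, 0 < w k := fun k hk => sub_pos.2 (hlt k hk)
  have hw : ∀ k, 0 ≤ w k := fun k => by
    by_cases hk : k ∈ σ
    exacts [(hw0 k hk).ge, (hw1 k hk).le]
  let H : (Fin d → ℤ) →+ ℤ :=
    { toFun := fun a => ∑ k, w k * a k
      map_zero' := by simp
      map_add' := fun a b => by simp [mul_add, Finset.sum_add_distrib] }
  have hHd : ∀ a, H a = ∑ k, w k * a k := fun _ => rfl
  -- The linear piece drops out on curve classes, so positivity there is that of the strictly convex
  -- function.
  have hP : ∀ p ∈ Δ.curveMonoid, H p = ∑ k, h k * p k := by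
    intro p hp
    have h0 : m ⬝ᵥ Δ.rayMap p = 0 := by rw [show Δ.rayMap p = 0 from hp.1, dotProduct_zero]
    rw [Δ.dotProduct_rayMap] at h0
    rw [hHd, ← sub_zero (∑ k, h k * p k), ← h0, ← Finset.sum_sub_distrib]
    exact Finset.sum_congr rfl fun k _ => by simp only [w]; ring
  have hP0 : ∀ p ∈ Δ.curveMonoid, 0 ≤ H p ∧ (H p = 0 → p = 0) := by
    intro p hp
    by_cases hp0 : p = 0
    · subst hp0; simp
    · have := hh.pos Δ hp hp0
      rw [hP p hp]
      exact ⟨this.le, fun h => absurd h this.ne'⟩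
  have hB : ∀ b, Δ.IsConeVector b → 0 ≤ H b := fun b hb => by
    rw [hHd]
    exact Finset.sum_nonneg fun k _ => mul_nonneg (hw k) (hb.1 k)
  refine ⟨H, ?_, ?_⟩
  · rintro _ ⟨b, p, hb, hp, rfl⟩
    rw [map_add]
    exact add_nonneg (hB b hb) (hP0 p hp).1
  · rintro _ ⟨b, p, hb, hp, rfl⟩
    constructor
    · intro h0
      rw [map_add] at h0
      have h1 := hB b hb
      have h2 := hP0 p hp
      obtain rfl : p = 0 := h2.2 (by omega)
      rw [map_zero, add_zero, hHd] at h0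
      rw [add_zero]
      refine ⟨hb.1, fun i hi => ?_⟩
      have := (Finset.sum_eq_zero_iff_of_nonneg
        fun k _ => mul_nonneg (hw k) (hb.1 k)).1 h0 i (Finset.mem_univ i)
      exact (mul_eq_zero.1 this).resolve_left (hw1 i hi).ne'
    · rintro ⟨-, h2⟩
      rw [hHd]
      refine Finset.sum_eq_zero fun k _ => ?_
      by_cases hk : k ∈ σ
      · rw [hw0 k hk, zero_mul]
      · rw [h2 k hk, mul_zero]

open Classical in
/-- Restriction of functions to the component of the central fibre of a maximal cone. -/
theorem exists_restriction (hΔ : Δ.IsProjective) {σ : Finset (Fin d)} (hσ : σ ∈ Δ.maxCones) :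
    ∃ ψ : o.FiberRing →ₐ[ℂ] MvPolynomial (Fin n) ℂ, ∀ b, Δ.IsConeVector b →
      ψ (o.fiberE b) = if vsupp b ⊆ σ then ∏ k ∈ σ, dualForm hσ k ^ (b k).toNat else 0 := by
  obtain ⟨H, hH0, hH⟩ := exists_face hΔ hσ
  -- On the face, `z_k` is the linear form dual to `ρ_k`; off the face, monomials go to zero. This
  -- is multiplicative because a sum lies on the face only if both terms do.
  let val : Δ.totalMonoid × (o.BigIndex →₀ ℕ) → MvPolynomial (Fin n) ℂ := fun x =>
    if H x.1.1 = 0 ∧ x.2 = 0 then ∏ k ∈ σ, dualForm hσ k ^ (x.1.1 k).toNat else 0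
  have hval : ∀ x y, val (x + y) = val x * val y := by
    intro x y
    have hadd : H (x + y).1.1 = H x.1.1 + H y.1.1 := map_add H _ _
    have hx := hH0 _ x.1.2
    have hy := hH0 _ y.1.2
    by_cases h : (H x.1.1 = 0 ∧ x.2 = 0) ∧ (H y.1.1 = 0 ∧ y.2 = 0)
    · have h1 : H (x + y).1.1 = 0 ∧ (x + y).2 = 0 :=
        ⟨by rw [hadd, h.1.1, h.2.1, add_zero], by rw [Prod.snd_add, h.1.2, h.2.2, add_zero]⟩
      simp only [val]
      rw [if_pos h1, if_pos h.1, if_pos h.2, ← Finset.prod_mul_distrib]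
      refine Finset.prod_congr rfl fun k _ => ?_
      rw [← pow_add]
      congr 1
      exact Int.toNat_add (((hH _ x.1.2).1 h.1.1).1 k) (((hH _ y.1.2).1 h.2.1).1 k)
    · have h1 : ¬ (H (x + y).1.1 = 0 ∧ (x + y).2 = 0) := by
        rintro ⟨h1, h2⟩
        rw [Prod.snd_add, add_eq_zero] at h2
        exact h ⟨⟨by omega, h2.1⟩, ⟨by omega, h2.2⟩⟩
      simp only [val]
      rw [if_neg h1]
      by_cases hx' : H x.1.1 = 0 ∧ x.2 = 0
      · rw [if_neg fun h' => h ⟨hx', h'⟩, mul_zero]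
      · rw [if_neg hx', zero_mul]
  let F : Multiplicative (Δ.totalMonoid × (o.BigIndex →₀ ℕ)) →* MvPolynomial (Fin n) ℂ :=
    { toFun := fun x => val x.toAdd
      map_one' := by
        change val 0 = 1
        have : H (0 : Δ.totalMonoid × (o.BigIndex →₀ ℕ)).1.1 = 0 := map_zero H
        simp only [val]
        rw [if_pos ⟨this, rfl⟩]
        exact Finset.prod_eq_one fun k _ => pow_zero _
      map_mul' := fun x y => hval x.toAdd y.toAdd }
  let Ψ := AddMonoidAlgebra.lift ℂ (MvPolynomial (Fin n) ℂ) (Δ.totalMonoid × (o.BigIndex →₀ ℕ)) F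
  have hΨ : ∀ x c, Ψ (AddMonoidAlgebra.single x c) = c • val x := fun x c =>
    AddMonoidAlgebra.lift_single F x c
  -- A curve class on the face would be a cone vector with image zero in the lattice, hence zero; so
  -- nontrivial monomials of the base are killed.
  have hker : ∀ a ∈ o.totalIdeal, Ψ a = 0 := by
    change o.totalIdeal ≤ RingHom.ker Ψ
    rw [totalIdeal, Ideal.map_le_iff_le_comap, baseIdeal, Ideal.span_le]
    rintro _ ⟨x, hx, rfl⟩
    change Ψ (o.structureMap _) = 0
    rw [structureMap_single, hΨ, one_smul]
    refine if_neg ?_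
    rintro ⟨h1, h2⟩
    have h3 := (hH _ (Δ.curveMonoid_le_totalMonoid x.1.2)).1 h1
    have h4 : Δ.IsConeVector x.1.1 := ⟨h3.1, σ, hσ, h3.2⟩
    have h5 : x.1.1 = 0 := by
      have h6 := Δ.coneVec_rayMap h4
      rw [show Δ.rayMap x.1.1 = 0 from x.1.2.1] at h6
      have h7 := Δ.coneVec_rayMap (b := 0) ⟨fun _ => le_rfl, σ, hσ, fun _ _ => rfl⟩
      rw [map_zero] at h7
      rw [← h6, h7]
    exact hx (Prod.ext (Subtype.ext h5) h2)
  refine ⟨Ideal.Quotient.liftₐ o.totalIdeal Ψ hker, fun b hb => ?_⟩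
  change Ψ (o.coneE b) = _
  rw [coneE_of _ _ hb, hΨ, one_smul]
  have hiff : (H b = 0 ∧ (0 : o.BigIndex →₀ ℕ) = 0) ↔ vsupp b ⊆ σ := by
    rw [hH b hb.mem]
    constructor
    · rintro ⟨⟨-, h⟩, -⟩ i hi
      by_contra hiσ
      exact mem_vsupp.1 hi (h i hiσ)
    · intro h
      refine ⟨⟨hb.1, fun i hi => ?_⟩, rfl⟩
      by_contra hne
      exact hi (h (mem_vsupp.2 hne))
  exact if_congr hiff rfl rfl

/-- The map from the free module over the polynomial ring on the `φ_i` to the ring of the central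
fibre. -/
def polyMap : (Fin (r + 1) → MvPolynomial (Fin n) ℂ) →ₗ[ℂ] o.FiberRing where
  toFun g := ∑ i, MvPolynomial.aeval o.lin (g i) * o.fiberE (exponent (o.tau i))
  map_add' g g' := by simp [add_mul, Finset.sum_add_distrib]
  map_smul' c g := by simp [Finset.smul_sum, smul_mul_assoc]

theorem polyMap_apply (g : Fin (r + 1) → MvPolynomial (Fin n) ℂ) :
    o.polyMap g = ∑ i, MvPolynomial.aeval o.lin (g i) * o.fiberE (exponent (o.tau i)) := rfl

theorem isConeVector_tau (i : Fin (r + 1)) : Δ.IsConeVector (exponent (o.tau i)) :=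
  isConeVector_exponent (o.cone i).2 (o.tau_subset i)

/-- The system is triangular. Let `j` be the first index with `g j ≠ 0` and restrict to the
component of `σ_j`: the terms before `j` vanish by choice, those after `j` because `τ_i ⊆ σ_j` only
for `i ≤ j`, and the term at `j` becomes `g j` times a product of nonzero linear forms. -/
theorem polyMap_injective (hΔ : Δ.IsProjective) : Function.Injective o.polyMap := by
  rw [← LinearMap.ker_eq_bot, LinearMap.ker_eq_bot']
  intro g hg
  by_contra hne
  obtain ⟨j, hj, hmin⟩ : ∃ j, g j ≠ 0 ∧ ∀ i < j, g i = 0 := by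
    obtain ⟨i, hi⟩ := Function.ne_iff.1 hne
    obtain ⟨j, hj⟩ := WellFounded.has_min (wellFounded_lt (α := Fin (r + 1))) {i | g i ≠ 0} ⟨i, hi⟩
    exact ⟨j, hj.1, fun i hi => by
      by_contra h
      exact hj.2 i h hi⟩
  obtain ⟨ψ, hψ⟩ := o.exists_restriction hΔ (o.cone j).2
  have hlin : ∀ i, ψ (o.lin i) = MvPolynomial.X i := by
    intro i
    rw [lin_eq, map_sum, ← sum_ray_dualForm (o.cone j).2 i]
    rw [← Finset.sum_subset (Finset.subset_univ (o.cone j).1)]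
    · refine Finset.sum_congr rfl fun k hk => ?_
      rw [map_smul, mk_z, hψ _ (isConeVector_singleton k), vsupp_exponent,
        if_pos (Finset.singleton_subset_iff.2 hk), Finset.prod_eq_single k]
      · simp [exponent]
      · intro l _ hl
        simp [exponent, hl]
      · exact fun h => absurd hk h
    · intro k _ hk
      rw [map_smul, mk_z, hψ _ (isConeVector_singleton k), vsupp_exponent,
        if_neg fun h => hk (Finset.singleton_subset_iff.1 h), smul_zero]
  have haeval : ∀ p, ψ (MvPolynomial.aeval o.lin p) = p := by
    intro p
    have : (ψ.comp (MvPolynomial.aeval o.lin)) = AlgHom.id ℂ _ :=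
      MvPolynomial.algHom_ext fun i => by simp [hlin]
    exact AlgHom.congr_fun this p
  have h1 := congrArg ψ hg
  rw [polyMap_apply, map_sum, map_zero, Finset.sum_eq_single j] at h1
  · rw [map_mul, haeval, hψ _ (o.isConeVector_tau j), vsupp_exponent,
      if_pos (o.tau_subset j)] at h1
    refine mul_ne_zero hj (Finset.prod_ne_zero_iff.2 fun k hk => ?_) h1
    exact pow_ne_zero _ (dualForm_ne_zero _ hk)
  · intro i _ hij
    rw [map_mul]
    rcases lt_or_gt_of_ne hij with h | h
    · rw [hmin i h, map_zero, map_zero, zero_mul]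
    · rw [hψ _ (o.isConeVector_tau i), vsupp_exponent, if_neg, mul_zero]
      exact fun hs => absurd (o.le_of_tau_subset hs) (not_le.2 h)
  · simp

theorem lin_mul_polyMap (i : Fin n) (g : Fin (r + 1) → MvPolynomial (Fin n) ℂ) :
    o.lin i * o.polyMap g = o.polyMap fun j => MvPolynomial.X i * g j := by
  simp [polyMap_apply, Finset.mul_sum, mul_assoc]

/-- Descending induction on the interval `[τ_i, σ_i]` containing the support of `b`, and inside it
induction on the degree. If `z^b` is not `φ_i`, a factor `z_j` with `j ∈ σ_i` is traded, by a linear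
relation, for linear forms applied to a monomial of smaller degree and for factors `z_k` with `k`
outside `σ_i`, which lead to later intervals. -/
theorem polyMap_surjective : Function.Surjective o.polyMap := by
  rw [← LinearMap.range_eq_top, eq_top_iff]
  have key : ∀ i, ∀ N : ℕ, ∀ b, Δ.IsConeVector b → o.tau i ⊆ vsupp b → vsupp b ⊆ (o.cone i).1 →
      (∑ k, b k).toNat = N → o.fiberE b ∈ LinearMap.range o.polyMap := by
    intro i
    induction i using WellFoundedGT.induction with
    | _ i ihi =>
    intro N
    induction N with
    | zero =>
      intro b hb hτ _ hN
      have hb0 : b = 0 := by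
        have h1 : 0 ≤ ∑ k, b k := Finset.sum_nonneg fun k _ => hb.1 k
        have h2 : ∑ k, b k = 0 := by omega
        funext k
        exact (Finset.sum_eq_zero_iff_of_nonneg fun k _ => hb.1 k).1 h2 k (Finset.mem_univ k)
      have hτ0 : o.tau i = ∅ := by
        rw [hb0] at hτ
        exact Finset.subset_empty.1 fun k hk => absurd rfl (mem_vsupp.1 (hτ hk))
      refine ⟨Pi.single i 1, ?_⟩
      rw [polyMap_apply, Finset.sum_eq_single i]
      · rw [Pi.single_eq_same, map_one, one_mul, hτ0, hb0]
        congr 1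
      · intro j _ hj
        rw [Pi.single_eq_of_ne hj, map_zero, zero_mul]
      · simp
    | succ N ihN =>
      intro b hb hτ hσ hN
      by_cases hbτ : b = exponent (o.tau i)
      · refine ⟨Pi.single i 1, ?_⟩
        rw [polyMap_apply, Finset.sum_eq_single i]
        · rw [Pi.single_eq_same, map_one, one_mul, hbτ]
        · intro j _ hj
          rw [Pi.single_eq_of_ne hj, map_zero, zero_mul]
        · simp
      -- Such a factor can be removed without leaving the interval: the support still contains
      -- `τ_i`.
      obtain ⟨j, hj⟩ : ∃ j, exponent (o.tau i) j < b j := by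
        by_contra hall
        push Not at hall
        refine hbτ (funext fun k => le_antisymm (hall k) ?_)
        by_cases hk : k ∈ o.tau i
        · have h1 : exponent (o.tau i) k = 1 := if_pos hk
          have h2 := mem_vsupp.1 (hτ hk)
          have h3 := hb.1 k
          omega
        · have h1 : exponent (o.tau i) k = 0 := if_neg hk
          rw [h1]
          exact hb.1 k
      have hjσ : j ∈ (o.cone i).1 := by
        refine hσ (mem_vsupp.2 ?_)
        have : 0 ≤ exponent (o.tau i) j := by unfold exponent; split_ifs <;> norm_num
        omega
      let b' := b - exponent {j}
      have hb'j : ∀ k, b' k = if k = j then b k - 1 else b k := fun k => by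
        simp only [b', Pi.sub_apply, exponent, Finset.mem_singleton]
        split_ifs <;> simp
      have h0j : 0 ≤ exponent (o.tau i) j := by unfold exponent; split_ifs <;> norm_num
      have hb' : Δ.IsConeVector b' := hb.sub (fun k => by
        rw [hb'j]
        have := hb.1 k
        split_ifs with h
        · subst h; omega
        · exact this) fun k => by
        rw [hb'j]
        split_ifs <;> omega
      have hτb' : o.tau i ⊆ vsupp b' := by
        intro k hk
        rw [mem_vsupp, hb'j]
        split_ifs with h
        · subst h
          have h1 : exponent (o.tau i) k = 1 := if_pos hk
          omega
        · exact mem_vsupp.1 (hτ hk)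
      have hb'σ : vsupp b' ⊆ (o.cone i).1 := by
        intro k hk
        by_cases h : k = j
        · rwa [h]
        · rw [mem_vsupp, hb'j, if_neg h] at hk
          exact hσ (mem_vsupp.2 hk)
      have hbb' : b = b' + exponent {j} := (sub_add_cancel _ _).symm
      have hsum : (∑ k, b' k).toNat = N := by
        have h1 : ∑ k, b k = ∑ k, b' k + 1 := by
          conv_lhs => rw [hbb']
          simp [Finset.sum_add_distrib, exponent]
        omega
      rw [hbb', o.fiberE_add_single (o.cone i).2 hjσ hb']
      refine sub_mem (Submodule.sum_mem _ fun l _ => Submodule.smul_mem _ _ ?_)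
        (Submodule.sum_mem _ fun k hk => Submodule.smul_mem _ _ ?_)
      · obtain ⟨g, hg⟩ := ihN b' hb' hτb' hb'σ hsum
        exact ⟨_, by rw [← hg]; exact (o.lin_mul_polyMap l g).symm⟩
      · by_cases hcv : Δ.IsConeVector (b' + exponent {k})
        · obtain ⟨j', hj'⟩ := o.exists_cone_of_isConeVector hcv
          obtain ⟨l, hl1, hl2⟩ := o.exists_interval hj'
          have hsub : vsupp b' ⊆ vsupp (b' + exponent {k}) := fun x hx => by
            rw [mem_vsupp] at hx ⊢
            have h1 := hb'.1 x
            have h2 : 0 ≤ exponent ({k} : Finset (Fin d)) x :=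
              (isConeVector_singleton (Δ := Δ) k).1 x
            rw [Pi.add_apply]
            omega
          have hkl : k ∈ (o.cone l).1 := hl2 (mem_vsupp.2 (by
            have h1 := hb'.1 k
            have h2 : exponent ({k} : Finset (Fin d)) k = 1 := if_pos (Finset.mem_singleton_self k)
            rw [Pi.add_apply]
            omega))
          -- The new support still contains `τ_i`, so its interval is not earlier; it contains `k ∉
          -- σ_i`, so the interval is a different one.
          have hil : i ≤ l := o.le_of_tau_subset ((hτb'.trans hsub).trans hl2)
          have hne : i ≠ l := by
            rintro rfl
            exact (Finset.mem_compl.1 hk) hkl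
          exact ihi l (lt_of_le_of_ne hil hne) _ _ hcv hl1 hl2 rfl
        · rw [o.fiberE_of_not _ hcv]
          exact zero_mem _
  rintro s -
  induction s using fiberRing_induction with
  | h0 => exact zero_mem _
  | hadd s t hs ht => exact add_mem hs ht
  | he b c hb =>
    obtain ⟨j, hj⟩ := o.exists_cone_of_isConeVector hb
    obtain ⟨i, hi1, hi2⟩ := o.exists_interval hj
    exact Submodule.smul_mem _ _ (key i _ b hb hi1 hi2 rfl)

end SmoothCompleteFan.ConeOrder

/-! ### Regularity of the variables of a polynomial ring -/

namespace MvPolynomial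

/-- The variables form a regular sequence. -/
theorem exists_eq_sum_X_mul {n : ℕ} {m : Fin n} {a : MvPolynomial (Fin n) ℂ}
    (b : Fin n → MvPolynomial (Fin n) ℂ) (h : X m * a = ∑ i with i < m, X i * b i) :
    ∃ b' : Fin n → MvPolynomial (Fin n) ℂ, a = ∑ i with i < m, X i * b' i := by
  have h1 : X m * a ∈ Ideal.span (X '' {i | i < m} : Set (MvPolynomial (Fin n) ℂ)) := by
    rw [h]
    refine Ideal.sum_mem _ fun i hi => Ideal.mul_mem_right _ _ (Ideal.subset_span ⟨i, ?_, rfl⟩)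
    exact (Finset.mem_filter.1 hi).2
  have h2 : a ∈ Ideal.span (X '' {i | i < m} : Set (MvPolynomial (Fin n) ℂ)) := by
    rw [mem_ideal_span_X_image] at h1 ⊢
    intro e he
    obtain ⟨i, hi, hne⟩ := h1 (Finsupp.single m 1 + e) (by
      rw [mem_support_iff, coeff_X_mul]
      exact mem_support_iff.1 he)
    refine ⟨i, hi, ?_⟩
    rwa [Finsupp.add_apply, Finsupp.single_apply, if_neg (ne_of_gt hi), zero_add] at hne
  have h3 : ({i | i < m} : Set (Fin n)) =
      ((Finset.univ.filter (· < m) : Finset (Fin n)) : Set _) := by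
    ext i
    simp
  rw [h3] at h2
  obtain ⟨c, hc⟩ := (Submodule.mem_span_image_finset_iff_exists_fun _).1 h2
  refine ⟨fun i => if hi : i ∈ Finset.univ.filter (· < m) then c ⟨i, hi⟩ else 0, ?_⟩
  rw [← hc, ← Finset.sum_coe_sort (Finset.univ.filter (· < m))]
  refine Finset.sum_congr rfl fun i _ => ?_
  dsimp only
  rw [dif_pos i.2, smul_eq_mul, mul_comm]

theorem exists_eq_sum_X_mul_of_constantCoeff {n : ℕ} {a : MvPolynomial (Fin n) ℂ}
    (h : constantCoeff a = 0) : ∃ b : Fin n → MvPolynomial (Fin n) ℂ, a = ∑ i, X i * b i := by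
  have h2 : a ∈ Ideal.span (X '' ((Finset.univ : Finset (Fin n)) : Set (Fin n)) :
      Set (MvPolynomial (Fin n) ℂ)) := by
    rw [mem_ideal_span_X_image]
    intro e he
    by_contra hall
    push Not at hall
    have he0 : e = 0 := Finsupp.ext fun i => hall i (by simp)
    rw [he0, mem_support_iff, ← constantCoeff_eq] at he
    exact he h
  obtain ⟨c, hc⟩ := (Submodule.mem_span_image_finset_iff_exists_fun _).1 h2
  refine ⟨fun i => c ⟨i, Finset.mem_univ i⟩, ?_⟩
  rw [← hc, ← Finset.sum_coe_sort (Finset.univ : Finset (Fin n))]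
  refine Finset.sum_congr rfl fun i _ => ?_
  rw [smul_eq_mul, mul_comm]

end MvPolynomial

namespace SmoothCompleteFan.ConeOrder

open laurentTower

variable {n d r : ℕ} {Δ : SmoothCompleteFan n d} (o : Δ.ConeOrder r) (hΔ : Δ.IsProjective)

/-! ### The Koszul complex of the central fibre -/

/-- The ring of the central fibre as a free module over the polynomial ring in the linear forms. -/
def polyEquiv : (Fin (r + 1) → MvPolynomial (Fin n) ℂ) ≃ₗ[ℂ] o.FiberRing :=
  LinearEquiv.ofBijective o.polyMap ⟨o.polyMap_injective hΔ, o.polyMap_surjective⟩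

theorem lin_mul_polyEquiv (i : Fin n) (g : Fin (r + 1) → MvPolynomial (Fin n) ℂ) :
    o.lin i * o.polyEquiv hΔ g = o.polyEquiv hΔ fun j => MvPolynomial.X i * g j :=
  o.lin_mul_polyMap i g

/-- The coordinates modulo the linear forms. -/
def proj : o.FiberRing →ₗ[ℂ] (Fin (r + 1) → ℂ) :=
  LinearMap.pi fun j => (MvPolynomial.lcoeff ℂ 0).comp
    ((LinearMap.proj j).comp (o.polyEquiv hΔ).symm.toLinearMap)

theorem proj_polyEquiv (g : Fin (r + 1) → MvPolynomial (Fin n) ℂ) (j : Fin (r + 1)) :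
    o.proj hΔ (o.polyEquiv hΔ g) j = MvPolynomial.constantCoeff (g j) := by
  simp [proj, MvPolynomial.constantCoeff_eq]

theorem proj_lin_mul (i : Fin n) (s : o.FiberRing) : o.proj hΔ (o.lin i * s) = 0 := by
  obtain ⟨g, rfl⟩ := (o.polyEquiv hΔ).surjective s
  funext j
  rw [lin_mul_polyEquiv, proj_polyEquiv]
  simp

theorem proj_tau (i : Fin (r + 1)) :
    o.proj hΔ (o.fiberE (exponent (o.tau i))) = Pi.single i 1 := by
  have h : o.fiberE (exponent (o.tau i)) = o.polyEquiv hΔ (Pi.single i 1) := by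
    change _ = o.polyMap _
    rw [polyMap_apply, Finset.sum_eq_single i]
    · rw [Pi.single_eq_same, map_one, one_mul]
    · intro j _ hj
      rw [Pi.single_eq_of_ne hj, map_zero, zero_mul]
    · simp
  funext j
  rw [h, proj_polyEquiv]
  by_cases hij : j = i
  · subst hij; simp
  · rw [Pi.single_eq_of_ne hij, Pi.single_eq_of_ne hij, map_zero]

theorem exists_eq_sum_lin_mul {s : o.FiberRing} (hs : o.proj hΔ s = 0) :
    ∃ c : Fin n → o.FiberRing, s = ∑ i, o.lin i * c i := by
  obtain ⟨g, rfl⟩ := (o.polyEquiv hΔ).surjective s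
  have h : ∀ j, ∃ b : Fin n → MvPolynomial (Fin n) ℂ, g j = ∑ i, MvPolynomial.X i * b i :=
    fun j => MvPolynomial.exists_eq_sum_X_mul_of_constantCoeff (by
      rw [← o.proj_polyEquiv hΔ, hs]
      rfl)
  choose b hb using h
  refine ⟨fun i => o.polyEquiv hΔ fun j => b j i, ?_⟩
  simp only [lin_mul_polyEquiv, ← map_sum]
  congr 1
  funext j
  rw [hb, Finset.sum_apply]

/-- Multiplication by the linear forms. -/
def linMul (i : Fin n) : o.FiberRing →ₗ[ℂ] o.FiberRing := LinearMap.mulLeft ℂ (o.lin i)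

theorem linMul_apply (i : Fin n) (s : o.FiberRing) : o.linMul i s = o.lin i * s := rfl

/-- On the free module `polyEquiv` the linear forms act as the variables, which are regular in each
coordinate. -/
theorem koszulRegular_linMul (hΔ : Δ.IsProjective) : KoszulRegular o.linMul := by
  intro m a b h
  obtain ⟨a, rfl⟩ := (o.polyEquiv hΔ).surjective a
  choose b' hb' using fun i => (o.polyEquiv hΔ).surjective (b i)
  simp only [linMul_apply, ← hb', lin_mul_polyEquiv, ← map_sum] at h
  have h1 := (o.polyEquiv hΔ).injective h
  have h2 : ∀ j, ∃ c : Fin n → MvPolynomial (Fin n) ℂ,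
      a j = ∑ i with i < m, MvPolynomial.X i * c i :=
    fun j => MvPolynomial.exists_eq_sum_X_mul (fun i => b' i j) (by
      have := congrFun h1 j
      rwa [Finset.sum_apply] at this)
  choose c hc using h2
  refine ⟨fun i => o.polyEquiv hΔ fun j => c j i, ?_⟩
  simp only [linMul_apply, lin_mul_polyEquiv, ← map_sum]
  congr 1
  funext j
  rw [hc, Finset.sum_apply]

/-- The coordinates of the degree zero part of a polyvector field. -/
def fiberP : (Finset (Fin n) → o.FiberRing) →ₗ[ℂ] (Fin (r + 1) → ℂ) :=
  (o.proj hΔ).comp (LinearMap.proj ∅)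

/-- The combinations of the `φ_i`, in degree zero. -/
def fiberι : (Fin (r + 1) → ℂ) →ₗ[ℂ] (Finset (Fin n) → o.FiberRing) :=
  (LinearMap.single ℂ (fun _ => o.FiberRing) ∅).comp
    (Fintype.linearCombination ℂ fun i => o.fiberE (exponent (o.tau i)))

theorem fiberι_apply (v : Fin (r + 1) → ℂ) :
    o.fiberι v = Pi.single ∅ (∑ i, v i • o.fiberE (exponent (o.tau i))) := rfl

theorem koszul_single_empty {S M : Type*} [CommRing S] [AddCommGroup M] [Module S M]
    (q : Fin n → M →ₗ[S] M) (x : M) : koszul q (Pi.single ∅ x) = 0 := by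
  have : (Pi.single ∅ x : Finset (Fin n) → M) = degreeZero n x := by
    funext I
    rw [Pi.single_apply]
    rfl
  rw [this, koszul_degreeZero]

/-- The contraction of the Koszul complex of the central fibre onto the span of the `φ_i`. -/
theorem exists_fiber_contraction : ∃ h : (Finset (Fin n) → o.FiberRing) →ₗ[ℂ]
      (Finset (Fin n) → o.FiberRing),
    (∀ x, koszul o.linMul (h x) + h (koszul o.linMul x) = x - o.fiberι (o.fiberP hΔ x)) ∧
      ∀ v, h (o.fiberι v) = 0 := by
  have hcomm : ∀ i j x, o.linMul i (o.linMul j x) = o.linMul j (o.linMul i x) := fun i j x =>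
    mul_left_comm _ _ _
  refine exists_contraction (koszul o.linMul) (o.fiberP hΔ) o.fiberι
    (fun x => koszul_koszul _ hcomm x) (fun v => ?_) (fun x => ?_)
    (fun v => koszul_single_empty _ _) fun x hx hpx => ?_
  · change o.proj hΔ (o.fiberι v ∅) = v
    rw [fiberι_apply, Pi.single_eq_same, map_sum]
    funext j
    simp only [map_smul, proj_tau, Finset.sum_apply, Pi.smul_apply, smul_eq_mul]
    rw [Finset.sum_eq_single j]
    · simp
    · intro i _ hi
      rw [Pi.single_eq_of_ne (Ne.symm hi), mul_zero]
    · simp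
  · change o.proj hΔ (koszul o.linMul x ∅) = 0
    rw [koszul_empty, map_sum]
    exact Finset.sum_eq_zero fun i _ => o.proj_lin_mul hΔ i _
  -- Exactness: regularity makes the cocycle a coboundary in positive degree. What remains in degree
  -- zero has vanishing coordinates, so it is a combination of multiples of the linear forms.
  · obtain ⟨β, hβ⟩ := exists_koszul_of_regular o.linMul hcomm (o.koszulRegular_linMul hΔ) x hx
    have h1 : o.proj hΔ (x ∅ - koszul o.linMul β ∅) = 0 := by
      rw [map_sub, show o.proj hΔ (x ∅) = 0 from hpx, zero_sub, neg_eq_zero, koszul_empty, map_sum]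
      exact Finset.sum_eq_zero fun i _ => o.proj_lin_mul hΔ i _
    obtain ⟨c, hc⟩ := o.exists_eq_sum_lin_mul hΔ h1
    -- The added vector field is `∑ c_i θ_i`, whose coboundary is the remaining function.
    refine ⟨β + fun I => ∑ i, if I = {i} then c i else 0, ?_⟩
    rw [map_add]
    funext I
    rw [Pi.add_apply]
    by_cases hI : I = ∅
    · subst hI
      rw [koszul_empty _ (fun I : Finset (Fin n) => ∑ i, if I = {i} then c i else 0)]
      have : ∀ i, o.linMul i (∑ j, if ({i} : Finset (Fin n)) = {j} then c j else 0) =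
          o.lin i * c i := by
        intro i
        rw [linMul_apply, Finset.sum_eq_single i]
        · rw [if_pos rfl]
        · intro j _ hj
          rw [if_neg]
          exact fun h => hj (Finset.singleton_injective h).symm
        · simp
      rw [Finset.sum_congr rfl fun i _ => this i, ← hc]
      abel
    · rw [← hβ I hI, koszul_apply _ (fun I : Finset (Fin n) => ∑ i, if I = {i} then c i else 0)]
      rw [Finset.sum_eq_zero, add_zero]
      intro i _
      split_ifs with hi
      · rfl
      · rw [Finset.sum_eq_zero, map_zero, smul_zero]
        intro j _
        rw [if_neg]
        intro h
        obtain ⟨l, hl⟩ := Finset.nonempty_iff_ne_empty.2 hI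
        have h1 : i = j := Finset.mem_singleton.1 (h ▸ Finset.mem_insert_self i I)
        have h2 : l = j := Finset.mem_singleton.1 (h ▸ Finset.mem_insert_of_mem hl)
        exact hi (h1.trans h2.symm ▸ hl)

end SmoothCompleteFan.ConeOrder

/-! ### Perturbation of contractions -/

section Perturbation

variable {X V : Type*} [AddCommGroup X] [AddCommGroup V] {Q Q₀ h : AddMonoid.End X} {P : X →+ V}
  {ι : V →+ X}

/-- The cohomology of a perturbed differential, relative to subgroups: existence of
representatives. -/
theorem perturbation_exists (hQ : ∀ x, Q (Q x) = 0) (hQ₀ : ∀ x, Q₀ (Q₀ x) = 0)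
    (hh : ∀ x, Q₀ (h x) + h (Q₀ x) = x - ι (P x)) (hQι : ∀ v, Q (ι v) = 0)
    (hQ₀ι : ∀ v, Q₀ (ι v) = 0) (hhι : ∀ v, h (ι v) = 0) {X' X'' : AddSubgroup X}
    (h1 : ∀ x ∈ X'', ∃ y ∈ X'', y + (Q (h y) - Q₀ (h y)) = x)
    (h2 : ∀ y ∈ X'', y + (Q (h y) - Q₀ (h y)) ∈ X'') (h3 : ∀ y ∈ X'', h y ∈ X'')
    (h4 : ∀ y, y + (Q (h y) - Q₀ (h y)) ∈ X' → y ∈ X')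
    (h5 : ∀ y ∈ X', y + (Q (h y) - Q₀ (h y)) ∈ X') (h6 : ∀ y ∈ X', h y ∈ X')
    {x : X} (hx : x ∈ X'') (hQx : Q x ∈ X') :
    ∃ y ∈ X'', ∃ w ∈ X'', x - ι (P y) - Q w ∈ X' := by
  -- Let `E = 1 + (Q - Q₀) h`, so that `Q E = E Q₀` and `x = E y`. Then `E (Q₀ y) = Q x` lies in
  -- `X'`, and so does `Q₀ y`.
  obtain ⟨y, hy, rfl⟩ := h1 x hx
  have hcomm := perturbation_comm Q Q₀ h (ι.comp P) hQ hQ₀ hh (fun x => hQι _) fun x => hQ₀ι _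
  rw [hcomm] at hQx
  have h7 := h4 _ hQx
  refine ⟨y, hy, _, h2 _ (h3 y hy), ?_⟩
  -- Applying `E` to `h (Q₀ y) = y - ι P y - Q₀ (h y)` and using `E ι = ι` gives `x - ι P y - Q (E
  -- (h y))`, which exhibits the primitive `E (h y)`.
  have h8 := h5 _ (h6 _ h7)
  have h9 : h (Q₀ y) = y - ι (P y) - Q₀ (h y) := by rw [← hh y]; abel
  rw [hcomm]
  convert h8 using 1
  rw [h9]
  simp only [map_sub, hhι, map_zero]
  abel

/-- The cohomology of a perturbed differential, relative to a subgroup: uniqueness of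
coordinates. -/
theorem perturbation_unique (hQ : ∀ x, Q (Q x) = 0) (hQ₀ : ∀ x, Q₀ (Q₀ x) = 0)
    (hh : ∀ x, Q₀ (h x) + h (Q₀ x) = x - ι (P x)) (hQι : ∀ v, Q (ι v) = 0)
    (hQ₀ι : ∀ v, Q₀ (ι v) = 0) (hhι : ∀ v, h (ι v) = 0) (hPι : ∀ v, P (ι v) = v)
    (hPQ₀ : ∀ x, P (Q₀ x) = 0) {X' : AddSubgroup X}
    (h1 : ∀ x, ∃ y, y + (Q (h y) - Q₀ (h y)) = x)
    (h4 : ∀ y, y + (Q (h y) - Q₀ (h y)) ∈ X' → y ∈ X')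
    {v : V} {w : X} (hw : ι v - Q w ∈ X') : ∃ y ∈ X', P y = v := by
  obtain ⟨y, rfl⟩ := h1 w
  have hcomm := perturbation_comm Q Q₀ h (ι.comp P) hQ hQ₀ hh (fun x => hQι _) fun x => hQ₀ι _
  rw [hcomm] at hw
  -- With the same `E`, the hypothesis says that `E (ι v - Q₀ y)` lies in `X'`. The map `P` kills
  -- `Q₀ y` and returns `v`.
  refine ⟨ι v - Q₀ y, h4 _ ?_, by rw [map_sub, hPι, hPQ₀, sub_zero]⟩
  convert hw using 1
  simp only [map_sub, hhι, map_zero]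
  abel

end Perturbation

/-! ### Extension of matrices of operators -/

section MatrixExtension

variable {k S R T ι : Type*} [CommRing k] [AddCommGroup S] [Module k S] [CommRing R]
  [AddCommGroup T] [Module R T] [DecidableEq ι]

/-- The matrix entries of an operator. -/
def opEntry (A : (ι → S) →ₗ[k] (ι → S)) (I J : ι) : Module.End k S :=
  (LinearMap.proj I).comp (A.comp (LinearMap.single k (fun _ => S) J))

theorem opEntry_apply (A : (ι → S) →ₗ[k] (ι → S)) (I J : ι) (s : S) :
    opEntry A I J s = A (Pi.single J s) I := rfl

variable [Fintype ι] (Φ : Module.End k S →+* Module.End R T)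

/-- The operator obtained by applying a ring homomorphism to the matrix entries. -/
def mapEntries (A : (ι → S) →ₗ[k] (ι → S)) : (ι → T) →ₗ[R] (ι → T) :=
  LinearMap.pi fun I => ∑ J, (Φ (opEntry A I J)).comp (LinearMap.proj J)

theorem mapEntries_apply (A : (ι → S) →ₗ[k] (ι → S)) (α : ι → T) (I : ι) :
    mapEntries Φ A α I = ∑ J, Φ (opEntry A I J) (α J) := by
  simp only [mapEntries, LinearMap.pi_apply, LinearMap.sum_apply]
  rfl

theorem mapEntries_comp (A B : (ι → S) →ₗ[k] (ι → S)) (α : ι → T) :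
    mapEntries Φ A (mapEntries Φ B α) = mapEntries Φ (A.comp B) α := by
  funext I
  have h : ∀ L, opEntry (A.comp B) I L = ∑ J, opEntry A I J * opEntry B J L := by
    intro L
    refine LinearMap.ext fun s => ?_
    rw [LinearMap.sum_apply]
    simp only [Module.End.mul_apply, opEntry_apply]
    rw [LinearMap.comp_apply]
    conv_lhs => rw [← Finset.univ_sum_single (B (Pi.single L s)), map_sum, Finset.sum_apply]
  simp only [mapEntries_apply, h, map_sum, map_mul, LinearMap.sum_apply]
  rw [Finset.sum_comm]
  rfl

theorem mapEntries_add (A B : (ι → S) →ₗ[k] (ι → S)) (α : ι → T) :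
    mapEntries Φ (A + B) α = mapEntries Φ A α + mapEntries Φ B α := by
  funext I
  have h : ∀ L, opEntry (A + B) I L = opEntry A I L + opEntry B I L := fun L => rfl
  simp only [mapEntries_apply, h, map_add, LinearMap.add_apply, Finset.sum_add_distrib,
    Pi.add_apply]

theorem mapEntries_id (α : ι → T) :
    mapEntries Φ (LinearMap.id : (ι → S) →ₗ[k] (ι → S)) α = α := by
  funext I
  rw [mapEntries_apply, Finset.sum_eq_single I]
  · have : opEntry (LinearMap.id : (ι → S) →ₗ[k] (ι → S)) I I = 1 := by
      refine LinearMap.ext fun s => ?_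
      rw [opEntry_apply, LinearMap.id_apply, Pi.single_eq_same]
      rfl
    rw [this, map_one]
    rfl
  · intro J _ hJ
    have : opEntry (LinearMap.id : (ι → S) →ₗ[k] (ι → S)) I J = 0 := by
      refine LinearMap.ext fun s => ?_
      rw [opEntry_apply, LinearMap.id_apply, Pi.single_eq_of_ne (Ne.symm hJ)]
      rfl
    rw [this, map_zero]
    rfl
  · simp

theorem mapEntries_koszul {n : ℕ} (q : Fin n → S →ₗ[k] S) :
    mapEntries Φ (koszul q) = koszul fun i => Φ (q i) := by
  refine LinearMap.ext fun α => funext fun I => ?_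
  have h : ∀ J, opEntry (koszul q) I J = ∑ i, if i ∈ I then 0 else
      ((-1 : ℤ) ^ (I.filter (· < i)).card) • if insert i I = J then q i else 0 := by
    intro J
    refine LinearMap.ext fun s => ?_
    rw [opEntry_apply, koszul_apply, LinearMap.sum_apply]
    refine Finset.sum_congr rfl fun i _ => ?_
    split_ifs with hi hJ
    · rfl
    · rw [hJ, Pi.single_eq_same]
      rfl
    · rw [Pi.single_eq_of_ne hJ, map_zero, smul_zero, smul_zero]
      rfl
  rw [mapEntries_apply, koszul_apply]
  simp only [h, map_sum, LinearMap.sum_apply]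
  rw [Finset.sum_comm]
  refine Finset.sum_congr rfl fun i _ => ?_
  split_ifs with hi
  · simp
  · simp only [map_zsmul]
    rw [Finset.sum_eq_single (insert i I)]
    · rw [if_pos rfl]
      rfl
    · intro J _ hJ
      rw [if_neg (Ne.symm hJ), map_zero, smul_zero]
      rfl
    · simp

theorem mapEntries_single (J₀ : ι) (g : Module.End k S) (α : ι → T) :
    mapEntries Φ ((LinearMap.single k (fun _ => S) J₀).comp (g.comp (LinearMap.proj J₀))) α =
      Pi.single J₀ (Φ g (α J₀)) := by
  funext I
  rw [mapEntries_apply]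
  by_cases hI : I = J₀
  · subst hI
    rw [Pi.single_eq_same, Finset.sum_eq_single I]
    · congr 2
      refine LinearMap.ext fun s => ?_
      rw [opEntry_apply]
      simp
    · intro J _ hJ
      have : opEntry ((LinearMap.single k (fun _ => S) I).comp
          (g.comp (LinearMap.proj I))) I J = 0 := by
        refine LinearMap.ext fun s => ?_
        rw [opEntry_apply]
        simp [Pi.single_eq_of_ne (Ne.symm hJ)]
      rw [this, map_zero]
      rfl
    · simp
  · rw [Pi.single_eq_of_ne hI]
    refine Finset.sum_eq_zero fun J _ => ?_
    have : opEntry ((LinearMap.single k (fun _ => S) J₀).comp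
        (g.comp (LinearMap.proj J₀))) I J = 0 := by
      refine LinearMap.ext fun s => ?_
      rw [opEntry_apply]
      simp [Pi.single_eq_of_ne hI]
    rw [this, map_zero]
    rfl

end MatrixExtension

namespace laurentTower

variable {A : Type*} [CommRing A] {J : Ideal A}

/-- A map that raises the `J`-adic order by one. -/
theorem cf_tmap_of_raise (g : A →+ A) (hg : Filtered J J g)
    (hr : ∀ k, ∀ a ∈ J ^ k, g a ∈ J ^ (k + 1))
    {x : laurentTower A J} {k : ℕ} {j : ℤ} (hx : ∀ k', k' + 1 = k → cf k' j x = 0) :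
    cf k j (tmap g hg x) = 0 := by
  obtain ⟨a, ha⟩ := Ideal.Quotient.mk_surjective (cf k j x)
  rw [cf_tmap g hg x k j ha, Ideal.Quotient.eq_zero_iff_mem]
  refine hr k a ?_
  cases k with
  | zero => simp
  | succ k =>
    have h1 := hx k rfl
    rw [← factor_cf, ← ha, Ideal.Quotient.factor_mk] at h1
    exact Ideal.Quotient.eq_zero_iff_mem.1 h1

end laurentTower

namespace SmoothCompleteFan.ConeOrder

open laurentTower

variable {n d r : ℕ} {Δ : SmoothCompleteFan n d} (o : Δ.ConeOrder r) (hΔ : Δ.IsProjective)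

/-! ### Extension of operators from the central fibre -/

theorem structureMap_smul (c : ℂ) (a : o.BaseRing) :
    o.structureMap (c • a) = c • o.structureMap a := by
  induction a using AddMonoidAlgebra.induction_linear with
  | zero => simp
  | add a b ha hb => rw [smul_add, map_add, map_add, smul_add, ha, hb]
  | single x c' =>
    rw [AddMonoidAlgebra.smul_single, structureMap_single, structureMap_single,
      AddMonoidAlgebra.smul_single]

/-- The `𝓡`-linear extension of an operator on functions on the central fibre. -/
def opO (g : o.FiberRing →ₗ[ℂ] o.FiberRing) : o.TotalRing →+ o.TotalRing :=
  (o.ext o.structureMap ((o.sec hΔ).comp g)).toAddMonoidHom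

theorem opO_mul (g : o.FiberRing →ₗ[ℂ] o.FiberRing) (a : o.BaseRing) (x : o.TotalRing) :
    o.opO hΔ g (o.structureMap a * x) = o.structureMap a * o.opO hΔ g x :=
  o.ext_mul _ o.structureMap_smul _ a x

theorem opO_coneE (g : o.FiberRing →ₗ[ℂ] o.FiberRing) (b : Fin d → ℤ) :
    o.opO hΔ g (o.coneE b) = o.sec hΔ (g (o.fiberE b)) :=
  o.ext_coneE _ _ b

theorem opO_sec (g : o.FiberRing →ₗ[ℂ] o.FiberRing) (s : o.FiberRing) :
    o.opO hΔ g (o.sec hΔ s) = o.sec hΔ (g s) := by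
  induction s using fiberRing_induction with
  | h0 => simp
  | hadd s t hs ht => simp only [map_add, hs, ht]
  | he b c hb =>
    rw [LinearMap.map_smul, sec_fiberE, LinearMap.map_smul, LinearMap.map_smul, ← opO_coneE]
    exact (o.ext o.structureMap ((o.sec hΔ).comp g)).map_smul c _

theorem filtered_opO (g : o.FiberRing →ₗ[ℂ] o.FiberRing) :
    Filtered o.totalIdeal o.totalIdeal (o.opO hΔ g) :=
  o.filtered_of_linear o.structureMap (o.opO_mul hΔ g) le_rfl

theorem mk_opO (g : o.FiberRing →ₗ[ℂ] o.FiberRing) (x : o.TotalRing) :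
    Ideal.Quotient.mk o.totalIdeal (o.opO hΔ g x) = g (Ideal.Quotient.mk o.totalIdeal x) := by
  induction x using AddMonoidAlgebra.induction_linear with
  | zero => simp
  | add a b ha hb => simp only [map_add, ha, hb]
  | single x c =>
    rw [single_eq, opO_mul, opO_coneE, map_mul, map_mul, mk_sec]
    by_cases hx : (Δ.curvePart x.1, x.2) = 0
    · rw [hx]
      have : Ideal.Quotient.mk o.totalIdeal (o.structureMap (AddMonoidAlgebra.single 0 c)) =
          algebraMap ℂ o.FiberRing c := by
        rw [structureMap_single]
        rfl
      rw [this, ← Algebra.smul_def, ← Algebra.smul_def, map_smul]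
      rfl
    · have : Ideal.Quotient.mk o.totalIdeal (o.structureMap
          (AddMonoidAlgebra.single (Δ.curvePart x.1, x.2) c)) = 0 :=
        Ideal.Quotient.eq_zero_iff_mem.2 (o.structureMap_mem (o.single_mem_baseIdeal hx c))
      rw [this, zero_mul, zero_mul, map_zero]

/-- The extension of an operator on functions on the central fibre to the family. -/
def TW (g : o.FiberRing →ₗ[ℂ] o.FiberRing) : o.OPM →ₗ[o.RPM] o.OPM where
  toFun := tmap (o.opO hΔ g) (o.filtered_opO hΔ g)
  map_add' := map_add _
  map_smul' a x := tmap_mapHom_mul o.structureMap le_rfl o.structureMap le_rfl _ _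
    (o.opO_mul hΔ g) a x

theorem TW_comp (g g' : o.FiberRing →ₗ[ℂ] o.FiberRing) (x : o.OPM) :
    o.TW hΔ g (o.TW hΔ g' x) = o.TW hΔ (g.comp g') x := by
  refine tmap_comp _ (o.filtered_opO hΔ g') _ (o.filtered_opO hΔ g) _ (o.filtered_opO hΔ _)
    (fun a => ?_) x
  refine o.eq_of_coneE (T := (o.opO hΔ g).comp (o.opO hΔ g')) (T' := o.opO hΔ (g.comp g'))
    o.structureMap (fun a x => ?_) (o.opO_mul hΔ _) (fun b _ => ?_) a
  · rw [AddMonoidHom.comp_apply, opO_mul, opO_mul]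
    rfl
  · rw [AddMonoidHom.comp_apply, opO_coneE, opO_coneE, opO_sec]
    rfl

theorem TW_add (g g' : o.FiberRing →ₗ[ℂ] o.FiberRing) :
    o.TW hΔ (g + g') = o.TW hΔ g + o.TW hΔ g' := by
  refine LinearMap.ext fun x => (tmap_add _ _ (o.filtered_opO hΔ g) (o.filtered_opO hΔ g') _
    (o.filtered_opO hΔ _) (fun a => ?_) x).symm
  refine o.eq_of_coneE (T := o.opO hΔ g + o.opO hΔ g') (T' := o.opO hΔ (g + g'))
    o.structureMap (fun a x => ?_) (o.opO_mul hΔ _) (fun b _ => ?_) a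
  · rw [AddMonoidHom.add_apply, opO_mul, opO_mul, ← mul_add]
    rfl
  · rw [AddMonoidHom.add_apply, opO_coneE, opO_coneE, opO_coneE, LinearMap.add_apply, map_add]

theorem TW_id (x : o.OPM) : o.TW hΔ LinearMap.id x = x := by
  refine tmap_id _ (o.filtered_opO hΔ _) (fun a => ?_) x
  refine o.eq_of_coneE (T := o.opO hΔ LinearMap.id) (T' := AddMonoidHom.id _)
    o.structureMap (o.opO_mul hΔ _) (fun a x => rfl) (fun b _ => ?_) a
  rw [opO_coneE, LinearMap.id_apply, sec_fiberE]
  rfl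

/-- Extension of operators from the central fibre to the family, as a ring homomorphism. -/
def TWHom : Module.End ℂ o.FiberRing →+* Module.End o.RPM o.OPM :=
  { AddMonoidHom.mk' (o.TW hΔ) (o.TW_add hΔ) with
    map_one' := LinearMap.ext fun x => o.TW_id hΔ x
    map_mul' := fun g g' => LinearMap.ext fun x => (o.TW_comp hΔ g g' x).symm }

theorem TWHom_apply (g : Module.End ℂ o.FiberRing) (x : o.OPM) :
    o.TWHom hΔ g x = tmap (o.opO hΔ g) (o.filtered_opO hΔ g) x := rfl

/-- The extension of the `j`-th coordinate functional. -/
def pO (j : Fin (r + 1)) : o.TotalRing →+ o.BaseRing :=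
  (o.ext (RingHom.id o.BaseRing)
    ((Algebra.linearMap ℂ o.BaseRing).comp ((LinearMap.proj j).comp (o.proj hΔ)))).toAddMonoidHom

theorem pO_mul (j : Fin (r + 1)) (a : o.BaseRing) (x : o.TotalRing) :
    o.pO hΔ j (o.structureMap a * x) = a * o.pO hΔ j x :=
  o.ext_mul _ (fun _ _ => rfl) _ a x

theorem pO_coneE (j : Fin (r + 1)) (b : Fin d → ℤ) :
    o.pO hΔ j (o.coneE b) = algebraMap ℂ o.BaseRing (o.proj hΔ (o.fiberE b) j) :=
  o.ext_coneE _ _ b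

theorem pO_sec (j : Fin (r + 1)) (s : o.FiberRing) :
    o.pO hΔ j (o.sec hΔ s) = algebraMap ℂ o.BaseRing (o.proj hΔ s j) := by
  induction s using fiberRing_induction with
  | h0 => simp
  | hadd s t hs ht => simp only [map_add, hs, ht, Pi.add_apply]
  | he b c hb =>
    have : o.pO hΔ j (c • o.coneE b) = c • o.pO hΔ j (o.coneE b) :=
      (o.ext (RingHom.id o.BaseRing) ((Algebra.linearMap ℂ o.BaseRing).comp
        ((LinearMap.proj j).comp (o.proj hΔ)))).map_smul c _
    rw [LinearMap.map_smul, sec_fiberE, this, pO_coneE, LinearMap.map_smul, Pi.smul_apply,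
      smul_eq_mul, map_mul,
      Algebra.smul_def]

theorem filtered_pO (j : Fin (r + 1)) : Filtered o.totalIdeal o.baseIdeal (o.pO hΔ j) :=
  o.filtered_of_linear (RingHom.id _) (o.pO_mul hΔ j) (Ideal.map_id _).le

/-- The coordinates of functions, on the family. -/
def PR (j : Fin (r + 1)) : o.OPM →+ o.RPM := tmap (o.pO hΔ j) (o.filtered_pO hΔ j)

theorem mapHom_id (a : o.RPM) :
    mapHom (RingHom.id o.BaseRing) (Ideal.map_id o.baseIdeal).le a = a := by
  refine ext_cf fun k j => ?_
  obtain ⟨b, hb⟩ := Ideal.Quotient.mk_surjective (cf k j a)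
  rw [cf_mapHom _ _ a k j hb, ← hb]
  rfl

theorem PR_mul (j : Fin (r + 1)) (a : o.RPM) (x : o.OPM) :
    o.PR hΔ j (o.towerMap a * x) = a * o.PR hΔ j x := by
  refine (tmap_mapHom_mul o.structureMap le_rfl (RingHom.id _) (Ideal.map_id o.baseIdeal).le _
    (o.filtered_pO hΔ j) (o.pO_mul hΔ j) a x).trans ?_
  rw [mapHom_id]
  rfl

theorem phi_eq_coneE (i : Fin (r + 1)) : o.phi i = o.coneE (exponent (o.tau i)) :=
  (o.coneE_of _ (o.isConeVector_tau i)).symm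

theorem PR_phi (j i : Fin (r + 1)) : o.PR hΔ j (const (o.phi i)) = if j = i then 1 else 0 := by
  rw [PR, const, tmap_monomial, phi_eq_coneE, pO_coneE, proj_tau, Pi.single_apply]
  split_ifs
  · rw [map_one]
    rfl
  · rw [map_zero]
    refine ext_cf fun k j => ?_
    rw [cf_monomial, map_zero, map_zero, ite_self]

theorem PR_TW_linMul (j : Fin (r + 1)) (i : Fin n) (x : o.OPM) :
    o.PR hΔ j (o.TW hΔ (o.linMul i) x) = 0 := by
  have h : Filtered o.totalIdeal o.baseIdeal (0 : o.TotalRing →+ o.BaseRing) :=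
    fun k a _ => zero_mem _
  have h1 : o.PR hΔ j (o.TW hΔ (o.linMul i) x) = tmap 0 h x := by
    refine tmap_comp _ (o.filtered_opO hΔ _) _ (o.filtered_pO hΔ j) _ h (fun a => ?_) x
    refine o.eq_of_coneE (T := (o.pO hΔ j).comp (o.opO hΔ (o.linMul i))) (T' := 0)
      (RingHom.id _) (fun a x => ?_) (fun a x => ?_) (fun b _ => ?_) a
    · rw [AddMonoidHom.comp_apply, opO_mul, pO_mul]
      rfl
    · rw [AddMonoidHom.zero_apply, AddMonoidHom.zero_apply, mul_zero]
    · rw [AddMonoidHom.comp_apply, opO_coneE, pO_sec, linMul_apply, proj_lin_mul]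
      simp
  rw [h1]
  refine ext_cf fun k l => ?_
  obtain ⟨a, ha⟩ := Ideal.Quotient.mk_surjective (cf k l x)
  rw [cf_tmap _ _ x k l ha, AddMonoidHom.zero_apply, map_zero, map_zero]

/-- The coordinates of polyvector fields. -/
def PK : o.PolyPM →+ (Fin (r + 1) → o.RPM) where
  toFun α j := o.PR hΔ j (α ∅)
  map_zero' := funext fun _ => map_zero _
  map_add' _ _ := funext fun _ => map_add _ _ _

/-- The combinations of the `φ_j`, as polyvector fields. -/
def ιK : (Fin (r + 1) → o.RPM) →ₗ[o.RPM] o.PolyPM :=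
  (LinearMap.single o.RPM (fun _ => o.OPM) ∅).comp
    (Fintype.linearCombination o.RPM fun i => const (o.phi i))

theorem ιK_apply (v : Fin (r + 1) → o.RPM) :
    o.ιK v = Pi.single ∅ (∑ i, o.towerMap (v i) * const (o.phi i)) := rfl

theorem PK_ιK (v : Fin (r + 1) → o.RPM) : o.PK hΔ (o.ιK v) = v := by
  funext j
  change o.PR hΔ j (o.ιK v ∅) = v j
  rw [ιK_apply, Pi.single_eq_same, map_sum, Finset.sum_eq_single j]
  · rw [PR_mul, PR_phi, if_pos rfl, mul_one]
  · intro i _ hi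
    rw [PR_mul, PR_phi, if_neg (Ne.symm hi), mul_zero]
  · simp

/-- The projection of the central fibre onto the span of the `φ_i`. -/
def fiberProj (i : Fin (r + 1)) : Module.End ℂ o.FiberRing :=
  (LinearMap.toSpanSingleton ℂ o.FiberRing (o.fiberE (exponent (o.tau i)))).comp
    ((LinearMap.proj i).comp (o.proj hΔ))

theorem fiberProj_apply (i : Fin (r + 1)) (s : o.FiberRing) :
    o.fiberProj hΔ i s = o.proj hΔ s i • o.fiberE (exponent (o.tau i)) := rfl

theorem TWHom_fiberProj (i : Fin (r + 1)) (x : o.OPM) :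
    o.TWHom hΔ (o.fiberProj hΔ i) x = o.towerMap (o.PR hΔ i x) * const (o.phi i) := by
  have hm : Filtered o.totalIdeal o.totalIdeal (AddMonoidHom.mulLeft (o.phi i)) :=
    fun k a ha => Ideal.mul_mem_left _ _ ha
  have hs : Filtered o.baseIdeal o.totalIdeal (o.structureMap : o.BaseRing →+ o.TotalRing) :=
    fun k a ha => by
      rw [totalIdeal, ← Ideal.map_pow]
      exact Ideal.mem_map_of_mem _ ha
  have hcomp : Filtered o.totalIdeal o.totalIdeal
      ((o.structureMap : o.BaseRing →+ o.TotalRing).comp (o.pO hΔ i)) := fun k a ha =>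
    hs k _ (o.filtered_pO hΔ i k a ha)
  have h1 : ∀ x, tmap _ hm x = const (o.phi i) * x := tmap_mul_left (o.phi i) _ _ fun _ => rfl
  have h2 : o.towerMap (o.PR hΔ i x) = tmap _ hcomp x :=
    tmap_comp _ (o.filtered_pO hΔ i) _ hs _ hcomp (fun _ => rfl) x
  rw [mul_comm, ← h1, h2, TWHom_apply]
  symm
  refine tmap_comp _ hcomp _ hm _ (o.filtered_opO hΔ _) (fun a => ?_) _
  refine o.eq_of_coneE (T := (AddMonoidHom.mulLeft (o.phi i)).comp
      ((o.structureMap : o.BaseRing →+ o.TotalRing).comp (o.pO hΔ i)))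
    (T' := o.opO hΔ (o.fiberProj hΔ i)) o.structureMap (fun a x => ?_) (o.opO_mul hΔ _)
    (fun b _ => ?_) a
  · change o.phi i * o.structureMap (o.pO hΔ i _) = _ * (o.phi i * o.structureMap (o.pO hΔ i _))
    rw [pO_mul, map_mul]
    ring
  · change o.phi i * o.structureMap (o.pO hΔ i _) = _
    rw [pO_coneE, opO_coneE, fiberProj_apply, LinearMap.map_smul, sec_fiberE, phi_eq_coneE,
      Algebra.algebraMap_eq_smul_one, structureMap_smul, map_one, mul_smul_comm, mul_one]

theorem fiberι_fiberP : o.fiberι.comp (o.fiberP hΔ) =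
    (LinearMap.single ℂ (fun _ : Finset (Fin n) => o.FiberRing) ∅).comp
      ((∑ i, o.fiberProj hΔ i).comp (LinearMap.proj ∅)) := by
  refine LinearMap.ext fun x => ?_
  have h : (∑ i, o.fiberProj hΔ i) (x ∅) =
      ∑ i, o.fiberP hΔ x i • o.fiberE (exponent (o.tau i)) := by
    rw [LinearMap.sum_apply]
    rfl
  change o.fiberι (o.fiberP hΔ x) = Pi.single ∅ ((∑ i, o.fiberProj hΔ i) (x ∅))
  rw [h, fiberι_apply]

theorem mapEntries_fiberι (α : o.PolyPM) :
    mapEntries (o.TWHom hΔ) (o.fiberι.comp (o.fiberP hΔ)) α = o.ιK (o.PK hΔ α) := by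
  rw [fiberι_fiberP, mapEntries_single, ιK_apply, map_sum, LinearMap.sum_apply]
  congr 1
  exact Finset.sum_congr rfl fun i _ => o.TWHom_fiberProj hΔ i (α ∅)

end SmoothCompleteFan.ConeOrder

/-! ### Representatives of cohomology classes -/

namespace Coh

variable {S K : Type*} [CommRing S] [AddCommGroup K] [Module S K] {Q : K →ₗ[S] K}
  {W : Submodule S K}

theorem exists_rep (x : Coh Q W) : ∃ z hz hW, x = Coh.mk Q W z hz hW := by
  obtain ⟨⟨z, hz, hW⟩, rfl⟩ := Submodule.Quotient.mk_surjective _ x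
  exact ⟨z, hz, hW, rfl⟩

theorem mk_eq_zero_iff {z : K} (hz : Q z = 0) (hW : z ∈ W) :
    Coh.mk Q W z hz hW = 0 ↔ ∃ w ∈ W, Q w = z := by
  unfold Coh.mk
  refine (Submodule.Quotient.mk_eq_zero _).trans ?_
  rfl

theorem mk_eq_mk_iff {z z' : K} (hz : Q z = 0) (hW : z ∈ W) (hz' : Q z' = 0) (hW' : z' ∈ W) :
    Coh.mk Q W z hz hW = Coh.mk Q W z' hz' hW' ↔ ∃ w ∈ W, Q w = z - z' := by
  unfold Coh.mk
  refine (Submodule.Quotient.eq _).trans ?_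
  rfl

theorem mk_congr {z z' : K} (hz : Q z = 0) (hW : z ∈ W) (h : z = z') :
    Coh.mk Q W z hz hW = Coh.mk Q W z' (h ▸ hz) (h ▸ hW) := by
  subst h
  rfl

end Coh

namespace SmoothCompleteFan.ConeOrder

open laurentTower

variable {n d r : ℕ} {Δ : SmoothCompleteFan n d} (o : Δ.ConeOrder r) (hΔ : Δ.IsProjective)

/-! ### The perturbation argument -/

/-- Multiplication by the linear forms, extended from the central fibre. -/
def linTW (i : Fin n) : o.OPM →ₗ[o.RPM] o.OPM := o.TWHom hΔ (o.linMul i)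

/-- The polyvector fields whose coefficients at the given orders vanish. -/
def van (T : ℕ → ℤ → Prop) : AddSubgroup o.PolyPM where
  carrier := {α | ∀ k j, T k j → ∀ I, cf k j (α I) = 0}
  zero_mem' _ _ _ _ := map_zero _
  add_mem' hα hβ k j h I := by rw [Pi.add_apply, map_add, hα k j h, hβ k j h, add_zero]
  neg_mem' hα k j h I := by rw [Pi.neg_apply, map_neg, hα k j h, neg_zero]

theorem mk_thetaRel_F (i : Fin n) :
    Ideal.Quotient.mk o.totalIdeal (o.thetaRel i o.F) = o.lin i := by
  change _ = Ideal.Quotient.mk o.totalIdeal (o.thetaRel i o.f)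
  rw [Ideal.Quotient.eq, ← map_sub]
  exact o.logDerivation_mem_totalIdeal _ o.F_sub_f_mem

theorem thetaRel_mul (i : Fin n) (a : o.BaseRing) (x : o.TotalRing) :
    (o.thetaRel i : o.TotalRing →+ o.TotalRing) (o.structureMap a * x) =
      o.structureMap a * (o.thetaRel i : o.TotalRing →+ o.TotalRing) x := by
  change o.thetaRel i _ = _ * o.thetaRel i x
  rw [Derivation.leibniz, thetaRel_structureMap, smul_zero, add_zero, smul_eq_mul]

/-- `q_i` is multiplication by `θ̃_i(F)` plus `u θ̃_i`. The first summand agrees with the extended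
linear form on the central fibre, so their difference is linear over the base with values in the
ideal and raises the order in `𝓘`; the second raises the exponent of `u`. -/
theorem cf_qOp_sub (i : Fin n) {x : o.OPM} {k : ℕ} {j : ℤ} (h1 : ∀ k', k' + 1 = k → cf k' j x = 0)
    (h2 : cf k (j - 1) x = 0) : cf k j (o.qOp i x - o.linTW hΔ i x) = 0 := by
  -- The discrepancy of order zero in `u`; it takes values in the ideal.
  let g : o.TotalRing →+ o.TotalRing :=
    AddMonoidHom.mulLeft (o.thetaRel i o.F) - o.opO hΔ (o.linMul i)
  have hlin : ∀ a x, g (o.structureMap a * x) = o.structureMap a * g x := by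
    intro a x
    change o.thetaRel i o.F * (o.structureMap a * x) -
      o.opO hΔ (o.linMul i) (o.structureMap a * x) =
      o.structureMap a * (o.thetaRel i o.F * x - o.opO hΔ (o.linMul i) x)
    rw [opO_mul]
    ring
  have hmem : ∀ x, g x ∈ o.totalIdeal := by
    intro x
    rw [← Ideal.Quotient.eq_zero_iff_mem]
    change Ideal.Quotient.mk o.totalIdeal (o.thetaRel i o.F * x - o.opO hΔ (o.linMul i) x) = 0
    rw [map_sub, map_mul, mk_opO, mk_thetaRel_F, linMul_apply, sub_self]
  have hg : Filtered o.totalIdeal o.totalIdeal g := o.filtered_of_linear o.structureMap hlin le_rfl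
  have hr : ∀ k, ∀ a ∈ o.totalIdeal ^ k, g a ∈ o.totalIdeal ^ (k + 1) := fun k a ha => by
    rw [pow_succ]
    exact o.map_mem_of_linear o.structureMap hlin le_rfl hmem k ha
  have hmul : Filtered o.totalIdeal o.totalIdeal (AddMonoidHom.mulLeft (o.thetaRel i o.F)) :=
    fun k a ha => Ideal.mul_mem_left _ _ ha
  have hD : Filtered o.totalIdeal o.totalIdeal (o.thetaRel i : o.TotalRing →+ o.TotalRing) :=
    o.filtered_of_linear o.structureMap (o.thetaRel_mul i) le_rfl
  have e1 : const (o.thetaRel i o.F) * x = tmap g hg x + o.linTW hΔ i x := by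
    rw [← tmap_mul_left (o.thetaRel i o.F) _ hmul fun _ => rfl]
    refine (tmap_add _ _ hg (o.filtered_opO hΔ _) _ hmul (fun a => ?_) x).symm
    change o.thetaRel i o.F * a - o.opO hΔ (o.linMul i) a + o.opO hΔ (o.linMul i) a = _
    rw [sub_add_cancel]
    rfl
  have e2 : o.qOp i x - o.linTW hΔ i x = tmap g hg x + u * deriv (o.thetaRel i) x := by
    change const (o.thetaRel i o.F) * x + u * deriv (o.thetaRel i) x - _ = _
    rw [e1]
    abel
  rw [e2, map_add, cf_u_mul, deriv_eq_tmap _ hD, cf_tmap_eq_zero _ _ h2,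
    cf_tmap_of_raise g hg hr h1, add_zero]

/-- The fibre contraction is carried over entry by entry along the ring homomorphism `TWHom`, which
preserves the homotopy identities. The entries act on coefficients of each order and exponent
separately, whence the last clause. -/
theorem exists_contraction_PM : ∃ H : o.PolyPM →ₗ[o.RPM] o.PolyPM,
    (∀ x, koszul (o.linTW hΔ) (H x) + H (koszul (o.linTW hΔ) x) = x - o.ιK (o.PK hΔ x)) ∧
    (∀ v, H (o.ιK v) = 0) ∧
    ∀ α k j, (∀ I, cf k j (α I) = 0) → ∀ I, cf k j (H α I) = 0 := by
  obtain ⟨h, hh, hι⟩ := o.exists_fiber_contraction hΔ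
  have hk : koszul (o.linTW hΔ) = mapEntries (o.TWHom hΔ) (koszul o.linMul) :=
    (mapEntries_koszul (o.TWHom hΔ) o.linMul).symm
  refine ⟨mapEntries (o.TWHom hΔ) h, fun x => ?_, fun v => ?_, fun α k j hα I => ?_⟩
  · rw [hk, mapEntries_comp, mapEntries_comp, ← mapEntries_add, eq_sub_iff_add_eq,
      ← mapEntries_fiberι, ← mapEntries_add]
    have e : (koszul o.linMul).comp h + h.comp (koszul o.linMul) +
        o.fiberι.comp (o.fiberP hΔ) = LinearMap.id := LinearMap.ext fun s => by
      change koszul o.linMul (h s) + h (koszul o.linMul s) + o.fiberι (o.fiberP hΔ s) = s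
      rw [hh, sub_add_cancel]
    rw [e, mapEntries_id]
  · have h1 : o.ιK v = mapEntries (o.TWHom hΔ) (o.fiberι.comp (o.fiberP hΔ)) (o.ιK v) := by
      rw [mapEntries_fiberι, PK_ιK]
    rw [h1, mapEntries_comp]
    have h2 : h.comp (o.fiberι.comp (o.fiberP hΔ)) = 0 := LinearMap.ext fun s => hι _
    rw [h2]
    have h3 := mapEntries_add (o.TWHom hΔ) (0 : (Finset (Fin n) → o.FiberRing) →ₗ[ℂ] _) 0 (o.ιK v)
    rwa [add_zero, left_eq_add] at h3
  · rw [mapEntries_apply, map_sum]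
    exact Finset.sum_eq_zero fun J _ => cf_tmap_eq_zero _ (o.filtered_opO hΔ _) (hα J)

/-- `q_i` is the twist `u D + D(F)` for `D = θ̃_i`, and the `θ̃_i` commute with each other. -/
theorem qOp_comm (i j : Fin n) (x : o.OPM) : o.qOp i (o.qOp j x) = o.qOp j (o.qOp i x) := by
  have h : ∀ x, o.twist (o.thetaRel i) x = o.qOp i x := fun x => add_comm _ _
  have := o.twist_qOp (o.thetaRel i) (fun i' a => logDerivation_comm _ _ a) j x
  rwa [h, h] at this

theorem QF_QF (α : o.PolyPM) : o.QF (o.QF α) = 0 := koszul_koszul _ o.qOp_comm α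

theorem QF_ιK (v : Fin (r + 1) → o.RPM) : o.QF (o.ιK v) = 0 := koszul_single_empty _ _

theorem cf_QF_sub {α : o.PolyPM} {k : ℕ} {j : ℤ} (h1 : ∀ k', k' + 1 = k → ∀ I, cf k' j (α I) = 0)
    (h2 : ∀ I, cf k (j - 1) (α I) = 0) (I : Finset (Fin n)) :
    cf k j ((o.QF α - koszul (o.linTW hΔ) α) I) = 0 := by
  rw [QF, Pi.sub_apply, koszul_apply, koszul_apply, ← Finset.sum_sub_distrib, map_sum]
  refine Finset.sum_eq_zero fun i _ => ?_
  split_ifs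
  · rw [sub_zero, map_zero]
  · rw [← smul_sub, map_zsmul, o.cf_qOp_sub hΔ i (fun k' hk' => h1 k' hk' _) (h2 _), smul_zero]

/-- Conditions stable under lowering the exponent of `u` survive the terms with a factor `u`;
vanishing at lower orders in `𝓘` is automatic. -/
theorem koszul_van {T : ℕ → ℤ → Prop} (hT : ∀ k j, T k j → T k (j - 1))
    {α : o.PolyPM} (hα : α ∈ o.van T) : o.QF α - koszul (o.linTW hΔ) α ∈ o.van T :=
  fun k j h I => o.cf_QF_sub hΔ (fun k' hk' I' => cf_eq_zero_of_le (by omega) (hα k j h I'))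
    (fun I' => hα k _ (hT k j h) I') I

theorem PK_koszul (α : o.PolyPM) : o.PK hΔ (koszul (o.linTW hΔ) α) = 0 := by
  funext j
  change o.PR hΔ j (koszul (o.linTW hΔ) α ∅) = 0
  rw [koszul_empty, map_sum]
  exact Finset.sum_eq_zero fun i _ => o.PR_TW_linMul hΔ j i _

/-- The cohomology of `Q_F`, relative to vanishing conditions: representatives by combinations of
the `φ_j`, and uniqueness of the coordinates. -/
theorem cohomology_QF (T' : ℕ → ℤ → Prop) (hT' : ∀ k j, T' k j → T' k (j - 1)) :
    (∀ T : ℕ → ℤ → Prop, (∀ k j, T k j → T k (j - 1)) → ∀ x ∈ o.van T, o.QF x ∈ o.van T' →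
      ∃ y ∈ o.van T, ∃ w ∈ o.van T, x - o.ιK (o.PK hΔ y) - o.QF w ∈ o.van T') ∧
    ∀ v w, o.ιK v - o.QF w ∈ o.van T' → ∃ y ∈ o.van T', o.PK hΔ y = v := by
  obtain ⟨H, hH, hHι, hHcf⟩ := o.exists_contraction_PM hΔ
  let Q : AddMonoid.End o.PolyPM := o.QF.toAddMonoidHom
  let Q₀ : AddMonoid.End o.PolyPM := (koszul (o.linTW hΔ)).toAddMonoidHom
  let h : AddMonoid.End o.PolyPM := H.toAddMonoidHom
  -- `1 - ν` is the operator that conjugates the extended Koszul differential to `Q_F`.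
  let ν : AddMonoid.End o.PolyPM := (Q₀ - Q) * h
  have hνd : ∀ x, ν x = Q₀ (h x) - Q (h x) := fun _ => rfl
  have hνE : ∀ x, x - ν x = x + (Q (h x) - Q₀ (h x)) := fun x => by rw [hνd]; abel
  have hsub : ∀ x, Q x - Q₀ x = o.QF x - koszul (o.linTW hΔ) x := fun _ => rfl
  have hHvan : ∀ (T : ℕ → ℤ → Prop), ∀ x ∈ o.van T, h x ∈ o.van T := fun T x hx k j hT I =>
    hHcf x k j (hx k j hT) I
  have hδ : ∀ (T : ℕ → ℤ → Prop), (∀ k j, T k j → T k (j - 1)) → ∀ x ∈ o.van T,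
      Q (h x) - Q₀ (h x) ∈ o.van T := fun T hT x hx => by
    rw [hsub]
    exact o.koszul_van hΔ hT (hHvan T x hx)
  have hEvan : ∀ (T : ℕ → ℤ → Prop), (∀ k j, T k j → T k (j - 1)) → ∀ x ∈ o.van T,
      x + (Q (h x) - Q₀ (h x)) ∈ o.van T := fun T hT x hx => add_mem hx (hδ T hT x hx)
  -- `h` acts coefficientwise, and the difference of the differentials raises the order in `𝓘` or in
  -- `u`: exactly the hypothesis for the geometric series.
  obtain ⟨hinj, hsurj⟩ := geom_bijective ν fun x k j h1 h2 I => by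
    have : ν x = -(o.QF (h x) - koszul (o.linTW hΔ) (h x)) := by
      rw [hνd, ← hsub]
      abel
    rw [this, Pi.neg_apply, map_neg, neg_eq_zero]
    exact o.cf_QF_sub hΔ (fun k' hk' => hHcf x k' j (h1 k' hk')) (hHcf x k (j - 1) h2) I
  have hEsurj : ∀ (T : ℕ → ℤ → Prop), (∀ k j, T k j → T k (j - 1)) → ∀ x ∈ o.van T,
      ∃ y ∈ o.van T, y + (Q (h y) - Q₀ (h y)) = x := by
    intro T hT x hx
    obtain ⟨y, hy, hcf⟩ := hsurj x
    refine ⟨y, fun k j hkj I => ?_, by rw [← hνE, hy]⟩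
    obtain ⟨S, hS⟩ := hcf k j
    rw [hS]
    have hpow : ∀ s, (ν ^ s) x ∈ o.van T := by
      intro s
      induction s with
      | zero => exact hx
      | succ s ih =>
        rw [pow_succ' ν s]
        change ν ((ν ^ s) x) ∈ _
        have := neg_mem (hδ T hT _ ih)
        rwa [neg_sub] at this
    exact sum_mem (fun s _ => hpow s) k j hkj I
  -- Solving inside the subgroup and comparing with the unique solution outside it.
  have hEinj : ∀ y, y + (Q (h y) - Q₀ (h y)) ∈ o.van T' → y ∈ o.van T' := by
    intro y hy
    obtain ⟨y', hy', he⟩ := hEsurj T' hT' _ hy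
    have h0 : y - y' = 0 := hinj _ (by
      rw [← hνE, ← hνE, sub_eq_sub_iff_add_eq_add] at he
      rw [map_sub, sub_eq_sub_iff_add_eq_add]
      rw [add_comm (ν y), he])
    rwa [sub_eq_zero.1 h0]
  have hQQ : ∀ x, Q (Q x) = 0 := o.QF_QF
  have hQ₀Q₀ : ∀ x, Q₀ (Q₀ x) = 0 := fun x => by
    refine koszul_koszul _ (fun i j x => ?_) x
    change (o.TWHom hΔ (o.linMul i) * o.TWHom hΔ (o.linMul j)) x =
      (o.TWHom hΔ (o.linMul j) * o.TWHom hΔ (o.linMul i)) x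
    have e : o.linMul i * o.linMul j = o.linMul j * o.linMul i :=
      LinearMap.ext fun s => mul_left_comm (o.lin i) (o.lin j) s
    rw [← map_mul, ← map_mul, e]
  have hQι : ∀ v, Q (o.ιK.toAddMonoidHom v) = 0 := o.QF_ιK
  have hQ₀ι : ∀ v, Q₀ (o.ιK.toAddMonoidHom v) = 0 := fun v => koszul_single_empty _ _
  refine ⟨fun T hT x hx hQx => ?_, fun v w hw => ?_⟩
  · exact perturbation_exists (P := o.PK hΔ) (ι := o.ιK.toAddMonoidHom) hQQ hQ₀Q₀ hH hQι hQ₀ι hHι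
      (hEsurj T hT) (hEvan T hT) (hHvan T) hEinj (hEvan T' hT') (hHvan T') hx hQx
  · exact perturbation_unique (P := o.PK hΔ) (ι := o.ιK.toAddMonoidHom) hQQ hQ₀Q₀ hH hQι hQ₀ι hHι
      (o.PK_ιK hΔ) (o.PK_koszul hΔ)
      (fun x => by
        obtain ⟨y, hy, -⟩ := hsurj x
        exact ⟨y, by rw [← hνE, hy]⟩)
      hEinj hw

end SmoothCompleteFan.ConeOrder

namespace SmoothCompleteFan.ConeOrder

open laurentTower

variable {n d r : ℕ} {Δ : SmoothCompleteFan n d} (o : Δ.ConeOrder r) (hΔ : Δ.IsProjective)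

/-! ### The frame of `ℋ_{F,±}` and of `ℋ_F` -/

/-- The class of a combination of the `φ_j` in `ℋ_{F,±}`. -/
def comb : (Fin (r + 1) → o.RPM) →ₗ[o.RPM] o.HPM where
  toFun v := Coh.mk o.QF ⊤ (o.ιK v) (o.QF_ιK v) Submodule.mem_top
  map_add' v w := Coh.mk_congr _ _ (map_add o.ιK v w)
  map_smul' a v := Coh.mk_congr _ _ (map_smul o.ιK a v)

theorem comb_single (j : Fin (r + 1)) : o.comb (Pi.single j 1) = o.incl (o.phiHF j) := by
  refine Coh.mk_congr (o.QF_ιK _) Submodule.mem_top ?_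
  change o.ιK (Pi.single j 1) = degreeZero n (const (o.phi j))
  rw [ιK_apply, Finset.sum_eq_single j]
  · rw [Pi.single_eq_same, map_one, one_mul]
    funext I
    rw [Pi.single_apply]
    rfl
  · intro i _ hi
    rw [Pi.single_eq_of_ne hi, map_zero, zero_mul]
  · simp

theorem comb_apply (v : Fin (r + 1) → o.RPM) : o.comb v = ∑ j, v j • o.incl (o.phiHF j) := by
  rw [LinearMap.pi_apply_eq_sum_univ o.comb v]
  refine Finset.sum_congr rfl fun j _ => ?_
  rw [← comb_single]
  congr 2
  funext i
  rw [Pi.single_apply]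
  simp only [eq_comm]

theorem mem_van_true {α : o.PolyPM} (h : α ∈ o.van fun _ _ => True) : α = 0 :=
  funext fun I => ext_cf fun k j => by
    rw [h k j trivial I]
    rfl

/-- With vanishing imposed at all orders and exponents, the subgroup of the relative statement is
zero and coordinates are unique. -/
theorem comb_injective (hΔ : Δ.IsProjective) : Function.Injective o.comb := by
  rw [← LinearMap.ker_eq_bot, LinearMap.ker_eq_bot']
  intro v hv
  obtain ⟨w, -, hw⟩ := (Coh.mk_eq_zero_iff (o.QF_ιK v) Submodule.mem_top).1 hv
  obtain ⟨y, hy, rfl⟩ := (o.cohomology_QF hΔ (fun _ _ => True) fun _ _ h => h).2 v w (by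
    rw [hw, sub_self]
    exact zero_mem _)
  rw [o.mem_van_true hy, map_zero]

theorem comb_surjective (hΔ : Δ.IsProjective) : Function.Surjective o.comb := by
  intro x
  obtain ⟨z, hz, hW, rfl⟩ := Coh.exists_rep x
  obtain ⟨y, -, w, -, h⟩ := (o.cohomology_QF hΔ (fun _ _ => True) fun _ _ h => h).1
    (fun _ _ => False) (fun _ _ h => h) z (fun _ _ h => h.elim) (by
      rw [hz]
      exact zero_mem _)
  refine ⟨o.PK hΔ y, ?_⟩
  refine ((Coh.mk_eq_mk_iff hz hW (o.QF_ιK _) Submodule.mem_top).2 ⟨w, Submodule.mem_top, ?_⟩).symm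
  exact (sub_eq_zero.1 (o.mem_van_true h)).symm

/-- The coordinates of `ℋ_{F,±}` in the frame `φ_j`. -/
def frame : (Fin (r + 1) → o.RPM) ≃ₗ[o.RPM] o.HPM :=
  LinearEquiv.ofBijective o.comb ⟨o.comb_injective hΔ, o.comb_surjective hΔ⟩

theorem frame_apply (v : Fin (r + 1) → o.RPM) : o.frame hΔ v = o.comb v := rfl

theorem incl_smul (a : o.RPlus) (x : o.HF) : o.incl (a • x) = (a : o.RPM) • o.incl x := by
  obtain ⟨z, hz, hW, rfl⟩ := Coh.exists_rep x
  rfl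

theorem ιK_mem_polyPlus (v : Fin (r + 1) → o.RPlus) :
    o.ιK (fun j => (v j : o.RPM)) ∈ o.polyPlus := fun I => by
  rw [ιK_apply, Pi.single_apply]
  split_ifs
  · exact sum_mem fun i _ => mul_mem (mapHom_mem _ _ _ (v i).2) (monomial_mem _ _ (zero_mem _) _)
  · exact zero_mem _

/-- The class of a combination of the `φ_j` in `ℋ_F`. -/
def combHF : (Fin (r + 1) → o.RPlus) →ₗ[o.RPlus] o.HF where
  toFun v := Coh.mk _ _ (o.ιK fun j => (v j : o.RPM)) (o.QF_ιK _) (o.ιK_mem_polyPlus v)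
  map_add' v w := Coh.mk_congr _ _
    (map_add o.ιK (fun j => (v j : o.RPM)) fun j => w j)
  map_smul' a v := Coh.mk_congr _ _
    (map_smul o.ιK (a : o.RPM) fun j => (v j : o.RPM))

/-- Having no negative powers of `u` is a condition stable under lowering the exponent, so the
representative and its primitive can be taken with power series coefficients. -/
theorem combHF_surjective (hΔ : Δ.IsProjective) : Function.Surjective o.combHF := by
  intro x
  obtain ⟨z, hz, hW, rfl⟩ := Coh.exists_rep x
  obtain ⟨y, hy, w, hw, h⟩ := (o.cohomology_QF hΔ (fun _ _ => True) fun _ _ h => h).1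
    (fun _ j => j < 0) (fun _ _ h => by omega) z
    (fun k j h I => mem_plus.1 (hW I) k j h) (by
      rw [show o.QF z = 0 from hz]
      exact zero_mem _)
  have hPK : ∀ j, o.PK hΔ y j ∈ o.RPlus := fun j =>
    tmap_mem_supportedIn _ (o.filtered_pO hΔ j) (mem_plus.2 fun k i h => hy k i h ∅)
  refine ⟨fun j => ⟨o.PK hΔ y j, hPK j⟩, ?_⟩
  have hz' : z = o.ιK (o.PK hΔ y) + o.QF w := by
    have := o.mem_van_true h
    rw [sub_sub, sub_eq_zero] at this
    exact this
  refine ((Coh.mk_eq_mk_iff hz hW (o.QF_ιK _) (o.ιK_mem_polyPlus _)).2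
    ⟨w, fun I => mem_plus.2 fun k j h => hw k j h I, ?_⟩).symm
  change o.QF w = z - o.ιK (o.PK hΔ y)
  rw [hz', add_sub_cancel_left]

theorem incl_combHF (v : Fin (r + 1) → o.RPlus) :
    o.incl (o.combHF v) = o.comb fun j => (v j : o.RPM) := rfl

/-- Classes of `ℋ_F` are combinations of the `φ_j`, and these stay independent in `ℋ_{F,±}`. -/
theorem incl_injective (hΔ : Δ.IsProjective) : Function.Injective o.incl := by
  rw [injective_iff_map_eq_zero]
  intro x hx
  obtain ⟨v, rfl⟩ := o.combHF_surjective hΔ x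
  rw [incl_combHF] at hx
  have h := o.comb_injective hΔ (hx.trans (map_zero o.comb).symm)
  have : v = 0 := funext fun j => Subtype.ext (congrFun h j)
  rw [this, map_zero]

theorem cf_towerMap (x : o.RPM) (k : ℕ) (j : ℤ) {a : o.BaseRing}
    (ha : Ideal.Quotient.mk _ a = cf k j x) :
    cf k j (o.towerMap x) = Ideal.Quotient.mk _ (o.structureMap a) :=
  cf_mapHom _ le_rfl x k j ha

/-! ### Reduction to the central fibre -/

theorem restrictFun_eq_zero_iff {x : o.OPM} : o.restrictFun x = 0 ↔ ∀ j, cf 0 j x = 0 := by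
  have h : ∀ j, HahnSeries.coeff (o.restrictFun x : LaurentSeries o.FiberRing) j = 0 ↔
      cf 0 j x = 0 := by
    intro j
    obtain ⟨a, ha⟩ := Ideal.Quotient.mk_surjective (cf 0 j x)
    change Ideal.Quotient.factor _ (cf 0 j x) = 0 ↔ _
    rw [← ha, Ideal.Quotient.factor_mk, Ideal.Quotient.eq_zero_iff_mem,
      Ideal.Quotient.eq_zero_iff_mem, zero_add, pow_one]
  constructor
  · intro h0 j
    rw [← h, h0]
    rfl
  · intro h0
    exact HahnSeries.ext (funext fun j => (h j).2 (h0 j))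

theorem restrictFun_surjective (hΔ : Δ.IsProjective) : Function.Surjective o.restrictFun := by
  intro s
  refine ⟨ofCoeff (fun k j => Ideal.Quotient.mk _
    (o.sec hΔ (HahnSeries.coeff (s : LaurentSeries o.FiberRing) j))) (fun k => ?_)
    (fun k j => rfl), ?_⟩
  · refine ⟨HahnSeries.order (s : LaurentSeries o.FiberRing), fun j hj => ?_⟩
    rw [HahnSeries.coeff_eq_zero_of_lt_order hj, map_zero, map_zero]
  · refine HahnSeries.ext (funext fun j => ?_)
    exact o.mk_sec hΔ _

theorem onCoeffs_restrictFun_eq_zero_iff {α : o.PolyPM} :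
    onCoeffs n o.restrictFun α = 0 ↔ α ∈ o.van fun k _ => k = 0 := by
  constructor
  · rintro h k j rfl I
    exact o.restrictFun_eq_zero_iff.1 (congrFun h I) j
  · intro h
    exact funext fun I => o.restrictFun_eq_zero_iff.2 fun j => h 0 j rfl I

theorem restrictFun_QF (α : o.PolyPM) :
    onCoeffs n o.restrictFun (o.QF α) = o.Qf (onCoeffs n o.restrictFun α) :=
  onCoeffs_koszul o.restrictFun o.qOp o.fiberQOp o.restrictFun_qOp α

theorem Qf_restrictFun {α : o.PolyPM} (h : o.QF α = 0) : o.Qf (onCoeffs n o.restrictFun α) = 0 := by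
  rw [← restrictFun_QF, h, map_zero]

theorem reduce_mk {α : o.PolyPM} (h : o.QF α = 0) : o.reduce (Coh.mk o.QF ⊤ α h Submodule.mem_top) =
    Coh.mk o.Qf ⊤ (onCoeffs n o.restrictFun α) (o.Qf_restrictFun h) Submodule.mem_top := rfl

theorem onCoeffs_restrictFun_surjective (hΔ : Δ.IsProjective) (β : Finset (Fin n) → o.FiberPM) :
    ∃ α : o.PolyPM, onCoeffs n o.restrictFun α = β := by
  choose α hα using fun I => o.restrictFun_surjective hΔ (β I)
  exact ⟨α, funext hα⟩

/-- The relative statement for vanishing at order zero: a polyvector field restricts to zero on the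
central fibre exactly when its coefficients vanish modulo `𝓘`. Thus reduction is reduction of
coordinates. -/
theorem reduce_comb_eq_zero_iff (hΔ : Δ.IsProjective) (v : Fin (r + 1) → o.RPM) :
    o.reduce (o.comb v) = 0 ↔ ∀ j, v j ∈ fil o.BaseRing o.baseIdeal 1 := by
  have h0 : o.reduce (o.comb v) = 0 ↔
      ∃ w ∈ (⊤ : Submodule (LaurentSeries ℂ) (Finset (Fin n) → o.FiberPM)),
        o.Qf w = onCoeffs n o.restrictFun (o.ιK v) :=
    Coh.mk_eq_zero_iff (o.Qf_restrictFun (o.QF_ιK v)) Submodule.mem_top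
  rw [h0]
  constructor
  · rintro ⟨w, -, hw⟩
    obtain ⟨w, rfl⟩ := o.onCoeffs_restrictFun_surjective hΔ w
    rw [← restrictFun_QF, eq_comm, ← sub_eq_zero, ← map_sub, onCoeffs_restrictFun_eq_zero_iff] at hw
    obtain ⟨y, hy, rfl⟩ := (o.cohomology_QF hΔ (fun k _ => k = 0) fun _ _ h => h).2 v w hw
    exact fun j => mem_fil_succ.2 fun i => cf_tmap_eq_zero _ (o.filtered_pO hΔ j) (hy 0 i rfl ∅)
  · intro h
    refine ⟨0, trivial, ?_⟩
    rw [map_zero, eq_comm, onCoeffs_restrictFun_eq_zero_iff]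
    rintro k j rfl I
    rw [ιK_apply, Pi.single_apply]
    split_ifs
    · rw [map_sum]
      refine Finset.sum_eq_zero fun i _ => ?_
      rw [mul_comm]
      refine mul_mem_fil_right (k := 1) _ ?_ 0 zero_lt_one j
      refine mem_fil_succ.2 fun l => ?_
      rw [o.cf_towerMap _ 0 l (a := 0) (by rw [h i 0 zero_lt_one, map_zero]), map_zero, map_zero]
    · exact map_zero _

/-- A cocycle on the central fibre lifts to a polyvector field that is closed only modulo `𝓘`; the
relative statement still brings it to a combination of the `φ_j`. -/
theorem exists_reduce_comb (hΔ : Δ.IsProjective) (x : o.HfPM) : ∃ v, o.reduce (o.comb v) = x := by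
  obtain ⟨z, hz, hW, rfl⟩ := Coh.exists_rep x
  obtain ⟨α, rfl⟩ := o.onCoeffs_restrictFun_surjective hΔ z
  have hz' := hz
  rw [← restrictFun_QF, onCoeffs_restrictFun_eq_zero_iff] at hz
  obtain ⟨y, -, w, -, h⟩ := (o.cohomology_QF hΔ (fun k _ => k = 0) fun _ _ h => h).1
    (fun _ _ => False) (fun _ _ h => h) α (fun _ _ h => h.elim) hz
  rw [← onCoeffs_restrictFun_eq_zero_iff, map_sub, map_sub, restrictFun_QF] at h
  refine ⟨o.PK hΔ y, ?_⟩
  refine ((Coh.mk_eq_mk_iff hz' hW (o.Qf_restrictFun (o.QF_ιK _)) Submodule.mem_top).2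
    ⟨onCoeffs n o.restrictFun w, Submodule.mem_top, ?_⟩).symm
  exact (sub_eq_zero.1 h).symm

theorem reduce_surjective (hΔ : Δ.IsProjective) : Function.Surjective o.reduce := fun x =>
  ⟨_, (o.exists_reduce_comb hΔ x).choose_spec⟩

theorem reduce_incl_phiHF (j : Fin (r + 1)) : o.reduce (o.incl (o.phiHF j)) = o.phiHf j := by
  refine Coh.mk_congr (o.Qf_restrictFun (koszul_degreeZero o.qOp _)) Submodule.mem_top ?_
  funext I
  change o.restrictFun (degreeZero n (const (o.phi j)) I) = degreeZero n _ I
  unfold degreeZero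
  split_ifs
  · have h := o.restrictFun_monomial_mul 0 (o.phi j) 1
    rw [mul_one] at h
    refine h.trans ?_
    refine HahnSeries.ext (funext fun i => ?_)
    refine (HahnSeries.coeff_single_mul (R := o.FiberRing)).trans ?_
    change _ * Ideal.Quotient.factor _ ((HahnSeries.single 0 1).coeff (i - 0)) =
      (HahnSeries.single (0 : ℤ) (Ideal.Quotient.mk o.totalIdeal (o.phi j))).coeff i
    rw [sub_zero, HahnSeries.coeff_single, HahnSeries.coeff_single]
    split_ifs
    · rw [map_one, mul_one]
    · rw [map_zero, mul_zero]
  · exact map_zero _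

/-- Restriction to the central fibre is multiplicative. -/
theorem restrictFun_mul (x y : o.OPM) :
    o.restrictFun (x * y) = o.restrictFun x * o.restrictFun y :=
  HahnSeries.map_mul (Ideal.Quotient.factor (Ideal.pow_le_self (I := o.totalIdeal)
    (Nat.succ_ne_zero 0))).toNonUnitalRingHom

theorem reduce_ofLaurent_smul (g : LaurentSeries ℂ) (x : o.HPM) :
    o.reduce ((ofLaurent g : o.RPM) • x) = g • o.reduce x := by
  obtain ⟨z, hz, hW, rfl⟩ := Coh.exists_rep x
  refine Coh.mk_congr (o.Qf_restrictFun (α := (ofLaurent g : o.RPM) • z)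
    (by rw [map_smul, hz, smul_zero])) Submodule.mem_top ?_
  funext I
  change o.restrictFun (o.towerMap (ofLaurent g) * z I) = o.fiberScalar g * o.restrictFun (z I)
  rw [restrictFun_mul]
  congr 1
  refine HahnSeries.ext (funext fun j => ?_)
  change Ideal.Quotient.factor _ (cf 0 j (o.towerMap (ofLaurent g))) =
    algebraMap ℂ o.FiberRing (g.coeff j)
  rw [o.cf_towerMap _ 0 j (a := algebraMap ℂ o.BaseRing (g.coeff j)) rfl,
    Algebra.algebraMap_eq_smul_one, structureMap_smul, map_one,
    Ideal.Quotient.factor_mk, ← Algebra.algebraMap_eq_smul_one]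
  rfl

/-- Modulo `𝓘` the base consists of constants. -/
theorem exists_ofLaurent (a : o.RPM) :
    ∃ g : LaurentSeries ℂ, a - ofLaurent g ∈ fil o.BaseRing o.baseIdeal 1 := by
  have h : ∀ b : o.BaseRing, ∃ c : ℂ, b - algebraMap ℂ o.BaseRing c ∈ o.baseIdeal := by
    intro b
    induction b using AddMonoidAlgebra.induction_linear with
    | zero => exact ⟨0, by simp⟩
    | add b b' hb hb' =>
      obtain ⟨c, hc⟩ := hb
      obtain ⟨c', hc'⟩ := hb'
      refine ⟨c + c', ?_⟩
      rw [map_add, add_sub_add_comm]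
      exact add_mem hc hc'
    | single x c =>
      by_cases hx : x = 0
      · subst hx
        refine ⟨c, ?_⟩
        have : algebraMap ℂ o.BaseRing c = AddMonoidAlgebra.single 0 c := rfl
        rw [this, sub_self]
        exact zero_mem _
      · refine ⟨0, ?_⟩
        rw [map_zero, sub_zero]
        exact o.single_mem_baseIdeal hx c
  choose c hc using h
  have hc₁ : ∀ b, b - algebraMap ℂ o.BaseRing (c b) ∈ o.baseIdeal ^ (0 + 1) := fun b => by
    rw [zero_add, pow_one]
    exact hc b
  classical
  -- The class zero is sent to zero on purpose: otherwise the chosen constants need not form a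
  -- series with support bounded below.
  let c' : o.BaseRing ⧸ o.baseIdeal ^ (0 + 1) → ℂ := fun q => if q = 0 then 0 else c q.out
  have hc' : ∀ q, algebraMap ℂ (o.BaseRing ⧸ o.baseIdeal ^ (0 + 1)) (c' q) = q := by
    intro q
    by_cases hq : q = 0
    · simp only [c']
      rw [if_pos hq, map_zero, hq]
    · simp only [c']
      rw [if_neg hq]
      have h1 := hc₁ q.out
      have h2 : Ideal.Quotient.mk (o.baseIdeal ^ (0 + 1)) q.out = q := Quotient.out_eq' q
      have h3 := Ideal.Quotient.eq.2 h1
      exact h3.symm.trans h2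
  refine ⟨⟨fun j => c' (cf 0 j a), isPWO_of_lt ?_⟩, mem_fil_succ.2 fun j => ?_⟩
  · obtain ⟨N, hN⟩ := exists_cf_lt a 0
    refine ⟨N, fun j hj => ?_⟩
    rw [hN j hj]
    exact if_pos rfl
  · rw [map_sub, sub_eq_zero]
    exact (hc' _).symm

/-- The augmentation of the base ring. -/
theorem exists_augmentation (hΔ : Δ.IsProjective) :
    ∃ ε : o.BaseRing →ₐ[ℂ] ℂ, ∀ a ∈ o.baseIdeal, ε a = 0 := by
  classical
  -- The constant coefficient is multiplicative because the exponents have no nontrivial units.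
  let F : Multiplicative (Δ.curveMonoid × (o.BigIndex →₀ ℕ)) →* ℂ :=
    { toFun := fun x => if x.toAdd = 0 then 1 else 0
      map_one' := if_pos rfl
      map_mul' := fun x y => by
        rw [toAdd_mul]
        by_cases hx : x.toAdd = 0
        · rw [if_pos hx, one_mul, hx, zero_add]
        · rw [if_neg hx, zero_mul, if_neg]
          intro h
          rw [Prod.ext_iff] at h
          refine hx (Prod.ext (hΔ.add_eq_zero h.1) (add_eq_zero.1 h.2).1) }
  refine ⟨AddMonoidAlgebra.lift ℂ ℂ _ F, ?_⟩
  change o.baseIdeal ≤ RingHom.ker _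
  rw [baseIdeal, Ideal.span_le]
  rintro _ ⟨x, hx, rfl⟩
  change AddMonoidAlgebra.lift ℂ ℂ _ F _ = 0
  rw [AddMonoidAlgebra.lift_single]
  exact (one_smul _ _).trans (if_neg hx)

theorem ofLaurent_eq_zero (hΔ : Δ.IsProjective) {g : LaurentSeries ℂ}
    (hg : (ofLaurent g : o.RPM) ∈ fil o.BaseRing o.baseIdeal 1) : g = 0 := by
  obtain ⟨ε, hε⟩ := o.exists_augmentation hΔ
  refine HahnSeries.ext (funext fun j => ?_)
  have h : Ideal.Quotient.mk (o.baseIdeal ^ (0 + 1)) (algebraMap ℂ o.BaseRing (g.coeff j)) = 0 :=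
    hg 0 zero_lt_one j
  rw [Ideal.Quotient.eq_zero_iff_mem, zero_add, pow_one] at h
  have := hε _ h
  rwa [AlgHom.commutes] at this

end SmoothCompleteFan.ConeOrder

theorem koszul_single {n : ℕ} {S M : Type*} [CommRing S] [AddCommGroup M] [Module S M]
    (q : Fin n → M →ₗ[S] M) (i : Fin n) (x : M) :
    koszul q (Pi.single {i} x) = SmoothCompleteFan.ConeOrder.degreeZero n (q i x) := by
  funext I
  unfold SmoothCompleteFan.ConeOrder.degreeZero
  by_cases hI : I = ∅
  · subst hI
    rw [if_pos rfl, koszul_empty, Finset.sum_eq_single i]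
    · rw [Pi.single_eq_same]
    · intro j _ hj
      rw [Pi.single_eq_of_ne (fun h => hj (Finset.singleton_injective h)), map_zero]
    · simp
  · rw [if_neg hI, koszul_apply]
    refine Finset.sum_eq_zero fun j _ => ?_
    split_ifs with hj
    · rfl
    · rw [Pi.single_eq_of_ne, map_zero, smul_zero]
      intro h
      obtain ⟨l, hl⟩ := Finset.nonempty_iff_ne_empty.2 hI
      have h1 : j = i := Finset.mem_singleton.1 (h ▸ Finset.mem_insert_self j I)
      have h2 : l = i := Finset.mem_singleton.1 (h ▸ Finset.mem_insert_of_mem hl)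
      exact hj (h1.trans h2.symm ▸ hl)

namespace SmoothCompleteFan.ConeOrder

open laurentTower

variable {n d r : ℕ} {Δ : SmoothCompleteFan n d} (o : Δ.ConeOrder r)

/-! ### The cohomology of the central fibre -/

theorem exists_coords_HfPM (hΔ : Δ.IsProjective) (x : o.HfPM) :
    ∃ g : Fin (r + 1) → LaurentSeries ℂ, x = ∑ j, g j • o.phiHf j := by
  obtain ⟨v, rfl⟩ := o.exists_reduce_comb hΔ x
  choose g hg using fun j => o.exists_ofLaurent (v j)
  refine ⟨g, ?_⟩
  have h := (o.reduce_comb_eq_zero_iff hΔ (v - fun j => ofLaurent (g j))).2 hg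
  rw [map_sub, map_sub, sub_eq_zero] at h
  rw [h, comb_apply, map_sum]
  refine Finset.sum_congr rfl fun j _ => ?_
  rw [reduce_ofLaurent_smul, reduce_incl_phiHF]

theorem coords_HfPM_eq_zero (hΔ : Δ.IsProjective) {g : Fin (r + 1) → LaurentSeries ℂ}
    (h : ∑ j, g j • o.phiHf j = 0) : g = 0 := by
  have h1 : o.reduce (o.comb fun j => ofLaurent (g j)) = 0 := by
    rw [← h, comb_apply, map_sum]
    refine Finset.sum_congr rfl fun j _ => ?_
    rw [reduce_ofLaurent_smul, reduce_incl_phiHF]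
  exact funext fun j => o.ofLaurent_eq_zero hΔ ((o.reduce_comb_eq_zero_iff hΔ _).1 h1 j)

/-- The class of a function in `ℋ_{f,±}`. -/
def clsF : o.FiberPM →+ o.HfPM where
  toFun s := Coh.mk o.Qf ⊤ (degreeZero n s) (koszul_degreeZero o.fiberQOp s) Submodule.mem_top
  map_zero' := Coh.mk_congr _ _ (funext fun I => by simp [degreeZero])
  map_add' s t := Coh.mk_congr _ _ (funext fun I => by
    by_cases h : I = ∅ <;> simp [degreeZero, h])

theorem onCoeffs_degreeZero {M M' : Type*} [AddCommGroup M] [AddCommGroup M'] (T : M →+ M')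
    (x : M) :
    onCoeffs n T (degreeZero n x) = degreeZero n (T x) := by
  funext I
  change T (degreeZero n x I) = _
  unfold degreeZero
  split_ifs
  · rfl
  · exact map_zero T

theorem twistHf_clsF (j : Fin d) (s : o.FiberPM) :
    o.twistHf j (o.clsF s) = o.clsF (o.fiberTwist j s) := by
  refine Coh.mk_congr ?_ Submodule.mem_top (onCoeffs_degreeZero (o.fiberTwist j) s)
  change o.Qf (onCoeffs n (o.fiberTwist j) (degreeZero n s)) = 0
  rw [onCoeffs_degreeZero]
  exact koszul_degreeZero _ _

theorem clsF_fiberQOp (i : Fin n) (s : o.FiberPM) : o.clsF (o.fiberQOp i s) = 0 :=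
  (Coh.mk_eq_zero_iff (koszul_degreeZero o.fiberQOp _) Submodule.mem_top).2
    ⟨Pi.single {i} s, Submodule.mem_top, koszul_single o.fiberQOp i s⟩

theorem thetaRel_eq_sum (i : Fin n) (a : o.TotalRing) :
    o.thetaRel i a = ∑ j, (Δ.ray j i) • o.theta j a := by
  induction a using AddMonoidAlgebra.induction_linear with
  | zero => simp
  | add a b ha hb => simp only [map_add, smul_add, Finset.sum_add_distrib, ha, hb]
  | single x c =>
    have h : Δ.rayMap x.1.1 i = ∑ j, x.1.1 j * Δ.ray j i := by
      rw [Δ.rayMap_apply, Finset.sum_apply]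
      rfl
    rw [thetaRel, logDerivation_single]
    simp only [theta, logDerivation_single, AddMonoidAlgebra.smul_single]
    refine Eq.trans ?_ (map_sum (AddMonoidAlgebra.lsingle (R := ℂ) (S := ℂ) x) _ _)
    change AddMonoidAlgebra.single x _ = AddMonoidAlgebra.single x _
    congr 1
    change ((Δ.rayMap x.1.1 i : ℤ) : ℂ) * c = ∑ j, Δ.ray j i • (((x.1.1 j : ℤ) : ℂ) * c)
    rw [h, Int.cast_sum, Finset.sum_mul]
    refine Finset.sum_congr rfl fun j _ => ?_
    rw [zsmul_eq_mul, Int.cast_mul]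
    ring

theorem fiberThetaRel_eq_sum (i : Fin n) (a : o.FiberRing) :
    o.fiberThetaRel i a = ∑ j, (Δ.ray j i) • o.fiberTheta j a := by
  obtain ⟨a, rfl⟩ := Ideal.Quotient.mk_surjective a
  change Ideal.Quotient.mk _ (o.thetaRel i a) = _
  rw [thetaRel_eq_sum, map_sum]
  refine Finset.sum_congr rfl fun j _ => ?_
  rw [map_zsmul]
  rfl

theorem fiberQOp_eq_sum (i : Fin n) (s : o.FiberPM) :
    o.fiberQOp i s = ∑ j, (Δ.ray j i) • o.fiberTwist j s := by
  have h1 : o.fiberDeriv (o.fiberThetaRel i) s =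
      ∑ j, (Δ.ray j i) • o.fiberDeriv (o.fiberTheta j) s := by
    refine HahnSeries.ext (funext fun k => ?_)
    let c : o.FiberPM →+ o.FiberRing :=
      { toFun := fun s => HahnSeries.coeff (s : LaurentSeries o.FiberRing) k
        map_zero' := rfl
        map_add' := fun _ _ => rfl }
    change c (o.fiberDeriv (o.fiberThetaRel i) s) =
      c (∑ j, (Δ.ray j i) • o.fiberDeriv (o.fiberTheta j) s)
    rw [map_sum]
    refine (o.fiberThetaRel_eq_sum i _).trans (Finset.sum_congr rfl fun j _ => ?_)
    rw [map_zsmul]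
    rfl
  have h2 : o.fiberMonomial 0 (o.fiberThetaRel i o.fiberf) =
      ∑ j, (Δ.ray j i) • o.fiberMonomial 0 (o.fiberTheta j o.fiberf) := by
    let c : o.FiberRing →+ o.FiberPM :=
      (HahnSeries.single.addMonoidHom (R := o.FiberRing) (0 : ℤ))
    change c _ = ∑ j, (Δ.ray j i) • c _
    rw [fiberThetaRel_eq_sum, map_sum]
    exact Finset.sum_congr rfl fun j _ => map_zsmul c _ _
  change o.fiberMonomial 0 (o.fiberThetaRel i o.fiberf) * s +
    o.fiberMonomial 1 1 * o.fiberDeriv (o.fiberThetaRel i) s = _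
  rw [h1, h2, Finset.sum_mul, Finset.mul_sum, ← Finset.sum_add_distrib]
  refine Finset.sum_congr rfl fun j _ => ?_
  rw [smul_mul_assoc, mul_smul_comm, ← smul_add, add_comm]
  rfl

/-- The combination with coefficients `⟨m, ρ_j⟩` is the differential of a vector field with constant
direction `m`. These are the linear equivalences among the toric divisors, acting on cohomology. -/
theorem sum_smul_twistHf (m : Fin n → ℤ) (s : o.FiberPM) :
    ∑ j, (m ⬝ᵥ Δ.ray j) • o.twistHf j (o.clsF s) = 0 := by
  have h : ∑ i, m i • o.clsF (o.fiberQOp i s) = 0 :=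
    Finset.sum_eq_zero fun i _ => by rw [clsF_fiberQOp, smul_zero]
  rw [← h]
  simp only [fiberQOp_eq_sum, map_sum, map_zsmul, Finset.smul_sum, smul_smul, twistHf_clsF]
  rw [Finset.sum_comm]
  refine Finset.sum_congr rfl fun j _ => ?_
  rw [← Finset.sum_smul]
  rfl

/-- The class of a squarefree monomial. -/
def sq (γ : Finset (Fin d)) : o.HfPM := o.clsF (o.fiberMonomial 0 (o.fiberE (exponent γ)))

theorem phiHf_eq_sq (i : Fin (r + 1)) : o.phiHf i = o.sq (o.tau i) := by
  exact Coh.mk_congr (koszul_degreeZero o.fiberQOp _) Submodule.mem_top (by rw [mk_phi])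

theorem fiberTheta_fiberE (j : Fin d) (b : Fin d → ℤ) :
    o.fiberTheta j (o.fiberE b) = (b j) • o.fiberE b := by
  by_cases hb : Δ.IsConeVector b
  · change Ideal.Quotient.mk _ (o.theta j (o.coneE b)) = _
    rw [fiberE, coneE_of _ _ hb, theta, logDerivation_single, ← map_zsmul,
      AddMonoidAlgebra.smul_single]
    congr 2
    change ((b j : ℤ) : ℂ) * 1 = b j • (1 : ℂ)
    rw [zsmul_eq_mul]
  · rw [fiberE_of_not _ _ hb, map_zero, smul_zero]

theorem theta_z (k j : Fin d) : o.theta j (o.z k) = if k = j then o.z k else 0 := by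
  rw [z, coneMonomial, theta, logDerivation_single]
  change AddMonoidAlgebra.single _ (((exponent {k} j : ℤ) : ℂ) * 1) = _
  split_ifs with h
  · subst h
    simp [exponent]
  · simp [exponent, Ne.symm h]

theorem fiberTheta_fiberf (j : Fin d) :
    o.fiberTheta j o.fiberf = Ideal.Quotient.mk o.totalIdeal (o.z j) := by
  change Ideal.Quotient.mk _ (o.theta j o.f) = _
  rw [f, map_sum, Finset.sum_eq_single j]
  · rw [theta_z, if_pos rfl]
  · intro k _ hk
    rw [theta_z, if_neg hk]
  · simp

theorem exponent_insert {γ : Finset (Fin d)} {k : Fin d} (hk : k ∉ γ) :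
    exponent γ + exponent {k} = exponent (insert k γ) := by
  funext i
  by_cases h : i = k
  · subst h
    simp [exponent, hk]
  · simp [exponent, h]

/-- The faces of the fan. -/
def IsFace (_ : Δ.ConeOrder r) (γ : Finset (Fin d)) : Prop := ∃ σ ∈ Δ.maxCones, γ ⊆ σ

theorem sq_of_not_isFace {γ : Finset (Fin d)} (h : ¬ o.IsFace γ) : o.sq γ = 0 := by
  have h1 : ¬ Δ.IsConeVector (exponent γ) := by
    rintro ⟨-, σ, hσ, h0⟩
    refine h ⟨σ, hσ, fun i hi => ?_⟩
    by_contra hiσ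
    have := h0 i hiσ
    rw [exponent, if_pos hi] at this
    exact one_ne_zero this
  have h0 : o.fiberMonomial 0 0 = 0 := HahnSeries.single_eq_zero (R := o.FiberRing)
  rw [sq, fiberE_of_not _ _ h1, h0, map_zero]

theorem fiberMonomial_mul (i j : ℤ) (a b : o.FiberRing) :
    o.fiberMonomial i a * o.fiberMonomial j b = o.fiberMonomial (i + j) (a * b) :=
  HahnSeries.single_mul_single

theorem fiberDeriv_fiberMonomial (D : Derivation ℂ o.FiberRing o.FiberRing) (i : ℤ)
    (b : o.FiberRing) : o.fiberDeriv D (o.fiberMonomial i b) = o.fiberMonomial i (D b) := by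
  refine HahnSeries.ext (funext fun k => ?_)
  change D ((HahnSeries.single i b).coeff k) = (HahnSeries.single i (D b)).coeff k
  rw [HahnSeries.coeff_single, HahnSeries.coeff_single]
  split_ifs
  · rfl
  · exact map_zero D

/-- The part `u θ_k` kills a monomial not involving `z_k`, so the operator is plain multiplication
by `z_k` and produces no power of `u`. -/
theorem twistHf_sq {γ : Finset (Fin d)} (hγ : o.IsFace γ) {k : Fin d} (hk : k ∉ γ) :
    o.twistHf k (o.sq γ) = o.sq (insert k γ) := by
  obtain ⟨σ, hσ, hγσ⟩ := hγ
  rw [sq, twistHf_clsF, sq]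
  congr 1
  change o.fiberMonomial 1 1 * o.fiberDeriv (o.fiberTheta k) _ +
    o.fiberMonomial 0 (o.fiberTheta k o.fiberf) * _ = _
  have h0 : o.fiberMonomial 0 0 = 0 := HahnSeries.single_eq_zero (R := o.FiberRing)
  have h1 : exponent γ k = 0 := if_neg hk
  rw [fiberDeriv_fiberMonomial, fiberTheta_fiberE, h1, zero_smul, h0, mul_zero, zero_add,
    fiberMonomial_mul, fiberTheta_fiberf, o.mk_z_mul k (isConeVector_exponent hσ hγσ),
    exponent_insert hk, zero_add]

/-- The linear relations, solved for a generator of a maximal cone. -/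
theorem twistHf_eq_of_mem {σ : Finset (Fin d)} (hσ : σ ∈ Δ.maxCones) {j : Fin d} (hj : j ∈ σ)
    (γ : Finset (Fin d)) : o.twistHf j (o.sq γ) =
      -∑ k ∈ σᶜ, (Δ.dual hσ j ⬝ᵥ Δ.ray k) • o.twistHf k (o.sq γ) := by
  have h := o.sum_smul_twistHf (Δ.dual hσ j) (o.fiberMonomial 0 (o.fiberE (exponent γ)))
  rw [← Finset.sum_add_sum_compl σ, Finset.sum_eq_single j] at h
  · rw [Δ.dual_ray hσ hj hj, if_pos rfl, one_smul] at h
    exact eq_neg_of_add_eq_zero_left h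
  · intro k hk hkj
    rw [Δ.dual_ray hσ hj hk, if_neg hkj, zero_smul]
  · exact fun h => absurd hj h

/-- The group spanned by the classes of the squarefree monomials of a given degree. -/
def sqSpan (k : ℕ) : AddSubgroup o.HfPM :=
  AddSubgroup.closure {x | ∃ γ, o.IsFace γ ∧ γ.card = k ∧ x = o.sq γ}

/-- If `j` already occurs in the monomial, a linear equivalence moves the divisor to rays outside a
maximal cone containing the monomial. Coefficients stay integral and no power of `u` appears,
although `u θ_j` does not vanish here. -/
theorem twistHf_mem_sqSpan (j : Fin d) {k : ℕ} {x : o.HfPM} (hx : x ∈ o.sqSpan k) :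
    o.twistHf j x ∈ o.sqSpan (k + 1) := by
  have key : ∀ γ, o.IsFace γ → γ.card = k → ∀ l ∉ γ, o.twistHf l (o.sq γ) ∈ o.sqSpan (k + 1) := by
    intro γ hγ hk l hl
    rw [o.twistHf_sq hγ hl]
    by_cases hf : o.IsFace (insert l γ)
    · exact AddSubgroup.subset_closure ⟨_, hf, by rw [Finset.card_insert_of_notMem hl, hk], rfl⟩
    · rw [o.sq_of_not_isFace hf]
      exact zero_mem _
  refine AddSubgroup.closure_induction
    (p := fun x _ => o.twistHf j x ∈ o.sqSpan (k + 1)) ?_ ?_ ?_ ?_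
    hx
  · rintro _ ⟨γ, hγ, hk, rfl⟩
    by_cases hj : j ∈ γ
    · obtain ⟨σ, hσ, hγσ⟩ := id hγ
      rw [o.twistHf_eq_of_mem hσ (hγσ hj)]
      refine neg_mem (sum_mem fun l hl => zsmul_mem (key γ hγ hk l fun h => ?_) _)
      exact (Finset.mem_compl.1 hl) (hγσ h)
    · exact key γ hγ hk j hj
  · rw [map_zero]
    exact zero_mem _
  · intro x y _ _ hx hy
    rw [map_add]
    exact add_mem hx hy
  · intro x _ hx
    rw [map_neg]
    exact neg_mem hx

theorem sqSpan_eq_bot {k : ℕ} (hk : n < k) {x : o.HfPM} (hx : x ∈ o.sqSpan k) : x = 0 := by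
  have : o.sqSpan k ≤ ⊥ := by
    rw [sqSpan, AddSubgroup.closure_le]
    rintro _ ⟨γ, ⟨σ, hσ, hγσ⟩, hk', rfl⟩
    have := Finset.card_le_card hγσ
    rw [Δ.card_cone hσ] at this
    omega
  exact AddSubgroup.mem_bot.1 (this hx)

/-- The group spanned by the classes of the `φ_i`. -/
def phiSpan : AddSubgroup o.HfPM := AddSubgroup.closure (Set.range o.phiHf)

/-- Descending induction over the intervals `[τ_i, σ_i]`: a factor `z_j` with `j ∉ τ_i` is moved off
`σ_i`, and the resulting faces still contain `τ_i`, hence lie in later intervals. -/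
theorem sq_mem_phiSpan (γ : Finset (Fin d)) : o.sq γ ∈ o.phiSpan := by
  have key : ∀ i, ∀ γ, o.tau i ⊆ γ → γ ⊆ (o.cone i).1 → o.sq γ ∈ o.phiSpan := by
    intro i
    induction i using WellFoundedGT.induction with
    | _ i ihi =>
    intro γ hτ hσ
    by_cases hγ : γ ⊆ o.tau i
    · rw [Finset.Subset.antisymm hγ hτ, ← phiHf_eq_sq]
      exact AddSubgroup.subset_closure ⟨i, rfl⟩
    obtain ⟨j, hjγ, hjτ⟩ := Finset.not_subset.1 hγ
    have hτ' : o.tau i ⊆ γ.erase j := fun k hk =>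
      Finset.mem_erase.2 ⟨fun h => hjτ (h ▸ hk), hτ hk⟩
    have hface : o.IsFace (γ.erase j) := ⟨_, (o.cone i).2, (Finset.erase_subset _ _).trans hσ⟩
    have h1 := o.twistHf_sq hface (Finset.notMem_erase j γ)
    rw [Finset.insert_erase hjγ] at h1
    rw [← h1, o.twistHf_eq_of_mem (o.cone i).2 (hσ hjγ)]
    refine neg_mem (sum_mem fun l hl => zsmul_mem ?_ _)
    have hlσ := Finset.mem_compl.1 hl
    rw [o.twistHf_sq hface fun h => hlσ (hσ (Finset.mem_of_mem_erase h))]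
    by_cases hf : o.IsFace (insert l (γ.erase j))
    · obtain ⟨σ, hσ', hsub⟩ := hf
      obtain ⟨i', hi'1, hi'2⟩ := o.exists_interval (γ := insert l (γ.erase j))
        (j := o.cone.symm ⟨σ, hσ'⟩) (by rwa [Equiv.apply_symm_apply])
      have hil : i ≤ i' := o.le_of_tau_subset
        ((hτ'.trans (Finset.subset_insert _ _)).trans hi'2)
      have hne : i ≠ i' := by
        rintro rfl
        exact hlσ (hi'2 (Finset.mem_insert_self _ _))
      exact ihi i' (lt_of_le_of_ne hil hne) _ hi'1 hi'2
    · rw [o.sq_of_not_isFace hf]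
      exact zero_mem _
  by_cases hf : o.IsFace γ
  · obtain ⟨σ, hσ', hsub⟩ := hf
    obtain ⟨i', hi'1, hi'2⟩ := o.exists_interval (γ := γ)
      (j := o.cone.symm ⟨σ, hσ'⟩) (by rwa [Equiv.apply_symm_apply])
    exact key i' γ hi'1 hi'2
  · rw [o.sq_of_not_isFace hf]
    exact zero_mem _

theorem phiHf_mem_sqSpan (i : Fin (r + 1)) : o.phiHf i ∈ o.sqSpan (o.tau i).card :=
  AddSubgroup.subset_closure ⟨_, ⟨_, (o.cone i).2, o.tau_subset i⟩, rfl, o.phiHf_eq_sq i⟩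

theorem twistHf_phiHf_mem (j : Fin d) (i : Fin (r + 1)) : o.twistHf j (o.phiHf i) ∈ o.phiSpan := by
  have h : o.sqSpan ((o.tau i).card + 1) ≤ o.phiSpan := by
    rw [sqSpan, AddSubgroup.closure_le]
    rintro _ ⟨γ, -, -, rfl⟩
    exact o.sq_mem_phiSpan γ
  exact h (o.twistHf_mem_sqSpan j (o.phiHf_mem_sqSpan i))

theorem twistHf_smul (j : Fin d) (g : LaurentSeries ℂ) (x : o.HfPM) :
    o.twistHf j (g • x) = g • o.twistHf j x := by
  obtain ⟨z, hz, hW, rfl⟩ := Coh.exists_rep x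
  refine Coh.mk_congr ?_ Submodule.mem_top ?_
  · change o.Qf (onCoeffs n (o.fiberTwist j) (g • z)) = 0
    have := onCoeffs_koszul (o.fiberTwist j) o.fiberQOp o.fiberQOp (o.fiberTwist_qOp j) (g • z)
    refine this.symm.trans ?_
    change onCoeffs n (o.fiberTwist j) (o.Qf (g • z)) = 0
    rw [map_smul, hz, smul_zero, map_zero]
  · funext I
    change o.fiberTwist j (o.fiberScalar g * z I) = o.fiberScalar g * o.fiberTwist j (z I)
    change o.fiberMonomial 1 1 * o.fiberDeriv (o.fiberTheta j) (o.fiberScalar g * z I) +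
      o.fiberMonomial 0 (o.fiberTheta j o.fiberf) * (o.fiberScalar g * z I) =
      o.fiberScalar g * (o.fiberMonomial 1 1 * o.fiberDeriv (o.fiberTheta j) (z I) +
      o.fiberMonomial 0 (o.fiberTheta j o.fiberf) * z I)
    have h : o.fiberDeriv (o.fiberTheta j) (o.fiberScalar g * z I) =
      o.fiberScalar g * o.fiberDeriv (o.fiberTheta j) (z I) := laurentDeriv_map_mul _ g (z I)
    rw [h]
    ring

/-- An integral combination of the `u θ_j + θ_j(f)`, on `ℋ_{f,±}`. -/
def twistSum (h : Fin d → ℤ) : o.HfPM →ₗ[LaurentSeries ℂ] o.HfPM where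
  toFun x := ∑ j, h j • o.twistHf j x
  map_add' x y := by simp only [map_add, smul_add, Finset.sum_add_distrib]
  map_smul' g x := by
    simp only [twistHf_smul, RingHom.id_apply, Finset.smul_sum]
    exact Finset.sum_congr rfl fun j _ => smul_comm _ _ _

theorem twistSum_apply (h : Fin d → ℤ) (x : o.HfPM) :
    o.twistSum h x = ∑ j, h j • o.twistHf j x := rfl

/-- Each application raises the degree of squarefree monomials, no face has more than `n`
generators, and the `φ_i` generate over `ℂ((u))`. -/
theorem twistSum_pow (hΔ : Δ.IsProjective) (h : Fin d → ℤ) (x : o.HfPM) :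
    (o.twistSum h ^ (n + 1)) x = 0 := by
  have key : ∀ (m k : ℕ) (x : o.HfPM), x ∈ o.sqSpan k →
      (o.twistSum h ^ m) x ∈ o.sqSpan (k + m) := by
    intro m k x hx
    induction m with
    | zero => exact hx
    | succ m ih =>
      rw [pow_succ', Module.End.mul_apply, twistSum_apply]
      exact sum_mem fun j _ => zsmul_mem (o.twistHf_mem_sqSpan j ih) _
  obtain ⟨g, rfl⟩ := o.exists_coords_HfPM hΔ x
  rw [map_sum]
  refine Finset.sum_eq_zero fun i _ => ?_
  rw [LinearMap.map_smul,
    o.sqSpan_eq_bot (by omega) (key (n + 1) _ _ (o.phiHf_mem_sqSpan i)), smul_zero]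

end SmoothCompleteFan.ConeOrder

/-! ### Complex Laurent series as constants of the tower -/

namespace laurentTower

variable {A : Type*} [CommRing A] [Algebra ℂ A] {J : Ideal A}

theorem cf_ofLaurent (g : LaurentSeries ℂ) (k : ℕ) (j : ℤ) :
    cf k j (ofLaurent g : laurentTower A J) = Ideal.Quotient.mk _ (algebraMap ℂ A (g.coeff j)) :=
  rfl

theorem deriv_ofLaurent (D : Derivation ℂ A A) (g : LaurentSeries ℂ) :
    deriv D (ofLaurent g : laurentTower A J) = 0 :=
  ext_coeff fun k j => by
    rw [coeff_deriv D (ofLaurent g) k j (algebraMap ℂ A (g.coeff j)) rfl,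
      Derivation.map_algebraMap, map_zero]
    rfl

theorem ofLaurent_single (j : ℤ) (c : ℂ) :
    (ofLaurent (HahnSeries.single j c) : laurentTower A J) = monomial j (algebraMap ℂ A c) :=
  ext_cf fun k i => by
    rw [cf_ofLaurent, cf_monomial]
    split_ifs with h
    · rw [h, HahnSeries.coeff_single_same]
    · rw [HahnSeries.coeff_single_of_ne h, map_zero, map_zero]

theorem ofLaurent_uInv : (ofLaurent (HahnSeries.single (-1) 1) : laurentTower A J) = uInv := by
  rw [ofLaurent_single, map_one, uInv]

end laurentTower

namespace SmoothCompleteFan.ConeOrder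

open laurentTower

variable {n d r : ℕ} {Δ : SmoothCompleteFan n d} (o : Δ.ConeOrder r)

/-! ### Operators on the cohomology -/

/-- The inclusion of the exponents of the base into those of the total space. -/
def expIncl : Δ.curveMonoid × (o.BigIndex →₀ ℕ) →+ Δ.totalMonoid × (o.BigIndex →₀ ℕ) :=
  (AddSubmonoid.inclusion Δ.curveMonoid_le_totalMonoid).prodMap
    (AddMonoidHom.id (o.BigIndex →₀ ℕ))

theorem logDerivation_structureMap (ℓ : Δ.totalMonoid × (o.BigIndex →₀ ℕ) →+ ℂ) (a : o.BaseRing) :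
    logDerivation ℓ (o.structureMap a) = o.structureMap (logDerivation (ℓ.comp o.expIncl) a) := by
  induction a using AddMonoidAlgebra.induction_linear with
  | zero => simp
  | add a b h h' => simp only [map_add, h, h']
  | single x c =>
    rw [logDerivation_single, structureMap_single, structureMap_single, logDerivation_single]
    rfl

theorem partialT_structureMap (i : o.BigIndex) (a : o.BaseRing) :
    o.partialT i (o.structureMap a) = o.structureMap (tDerivation i a) := by
  induction a using AddMonoidAlgebra.induction_linear with
  | zero => simp
  | add a b h h' => simp only [map_add, h, h']
  | single x c =>
    rw [tDerivation_single, structureMap_single, structureMap_single, partialT, tDerivation_single]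

variable (D : Derivation ℂ o.TotalRing o.TotalRing)
  (hD : ∀ i a, D (o.thetaRel i a) = o.thetaRel i (D a))

theorem twistHPM_mk {α : o.PolyPM} (h : o.QF α = 0) :
    o.twistHPM D hD (Coh.mk o.QF ⊤ α h Submodule.mem_top) =
      Coh.mk o.QF ⊤ (onCoeffs n (o.twist D) α)
        (by
          have e : onCoeffs n (o.twist D) (o.QF α) = o.QF (onCoeffs n (o.twist D) α) :=
            onCoeffs_koszul (o.twist D) o.qOp o.qOp (o.twist_qOp D hD) α
          rw [← e, h, map_zero]) Submodule.mem_top := rfl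

theorem deriv_towerMap (D₀ : Derivation ℂ o.BaseRing o.BaseRing)
    (h₀ : ∀ a, D (o.structureMap a) = o.structureMap (D₀ a)) (a : o.RPM) :
    deriv D (o.towerMap a) = o.towerMap (deriv D₀ a) :=
  deriv_mapHom o.structureMap le_rfl D₀ D h₀ a

theorem towerMap_u : o.towerMap u = u := by
  have h := mapHom_monomial o.structureMap (J := o.baseIdeal) (J' := o.totalIdeal) le_rfl 1 1
  rw [map_one] at h
  exact h

theorem twistHPM_smul (D₀ : Derivation ℂ o.BaseRing o.BaseRing)
    (h₀ : ∀ a, D (o.structureMap a) = o.structureMap (D₀ a)) (a : o.RPM) (x : o.HPM) :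
    o.twistHPM D hD (a • x) = (u * deriv D₀ a) • x + a • o.twistHPM D hD x := by
  obtain ⟨α, hα, -, rfl⟩ := Coh.exists_rep x
  have h1 : o.QF (a • α) = 0 := by rw [LinearMap.map_smul, hα, smul_zero]
  change o.twistHPM D hD (Coh.mk o.QF ⊤ (a • α) h1 Submodule.mem_top) = _
  rw [twistHPM_mk]
  refine Coh.mk_congr _ Submodule.mem_top (funext fun I => ?_)
  change u * deriv D (o.towerMap a * α I) + const (D o.F) * (o.towerMap a * α I) =
    o.towerMap (u * deriv D₀ a) * α I +
      o.towerMap a * (u * deriv D (α I) + const (D o.F) * α I)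
  rw [laurentTower.deriv_mul, map_mul, towerMap_u, o.deriv_towerMap D D₀ h₀]
  ring

theorem twistHPM_ofLaurent_smul (D₀ : Derivation ℂ o.BaseRing o.BaseRing)
    (h₀ : ∀ a, D (o.structureMap a) = o.structureMap (D₀ a)) (g : LaurentSeries ℂ) (x : o.HPM) :
    o.twistHPM D hD ((ofLaurent g : o.RPM) • x) = (ofLaurent g : o.RPM) • o.twistHPM D hD x := by
  rw [o.twistHPM_smul D hD D₀ h₀, deriv_ofLaurent, mul_zero, zero_smul, zero_add]

/-- The commutator of `u D + D(F)` and `u D' + D'(F)` is `u` times the twist of `[D, D']`. -/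
theorem twistHPM_comm (D' : Derivation ℂ o.TotalRing o.TotalRing)
    (hD' : ∀ i a, D' (o.thetaRel i a) = o.thetaRel i (D' a)) (c : ℤ)
    (hc : ∀ a, D (D' a) = D' (D a) + c • D' a) (x : o.HPM) :
    o.twistHPM D hD (o.twistHPM D' hD' x) =
      o.twistHPM D' hD' (o.twistHPM D hD x) + c • (u : o.RPM) • o.twistHPM D' hD' x := by
  obtain ⟨α, hα, -, rfl⟩ := Coh.exists_rep x
  rw [twistHPM_mk, twistHPM_mk, twistHPM_mk, twistHPM_mk]
  refine Coh.mk_congr _ Submodule.mem_top (funext fun I => ?_)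
  change u * deriv D (u * deriv D' (α I) + const (D' o.F) * α I) +
      const (D o.F) * (u * deriv D' (α I) + const (D' o.F) * α I) =
    (u * deriv D' (u * deriv D (α I) + const (D o.F) * α I) +
      const (D' o.F) * (u * deriv D (α I) + const (D o.F) * α I)) +
    c • (o.towerMap u * (u * deriv D' (α I) + const (D' o.F) * α I))
  have h1 : deriv D (deriv D' (α I)) = deriv D' (deriv D (α I)) + c • deriv D' (α I) := by
    refine ext_cf fun k i => ?_
    obtain ⟨a, ha⟩ := Ideal.Quotient.mk_surjective (cf (k + 1 + 1) i (α I))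
    have h2 : Ideal.Quotient.mk _ a = cf (k + 1) i (α I) := by
      rw [← factor_cf, ← ha]
      rfl
    rw [map_add, map_zsmul]
    refine (coeff_deriv D _ k i (D' a) (coeff_deriv D' _ (k + 1) i a ha).symm).trans ?_
    rw [hc, map_add, map_zsmul]
    exact (congrArg₂ (· + ·)
      (coeff_deriv D' _ k i (D a) (coeff_deriv D _ (k + 1) i a ha).symm)
      (congrArg (c • ·) (coeff_deriv D' _ k i a h2))).symm
  have h3 : (const (D (D' o.F)) : o.OPM) = const (D' (D o.F)) + c • const (D' o.F) := by
    rw [hc]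
    refine ext_cf fun k i => ?_
    simp only [const, cf_monomial, map_add, map_zsmul]
    split_ifs
    · rfl
    · rw [smul_zero, add_zero]
  have h4 : ∀ (D : Derivation ℂ o.TotalRing o.TotalRing) b (y : o.OPM),
      deriv D (const b * y) = const (D b) * y + const b * deriv D y :=
    fun D b y => deriv_monomial_mul D 0 b y
  rw [map_add, map_add, deriv_u_mul, deriv_u_mul, h4, h4, h1, h3, towerMap_u]
  simp only [mul_add, add_mul, mul_smul_comm, smul_mul_assoc, smul_add]
  ring

/-! ### The grading operator -/

theorem eulerHPM_mk {α : o.PolyPM} (h : o.QF α = 0) :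
    o.eulerHPM (Coh.mk o.QF ⊤ α h Submodule.mem_top) =
      Coh.mk o.QF ⊤ (polyEuler n o.eulerFun α)
        (by
          have e : polyEuler n o.eulerFun (o.QF α) = o.QF (polyEuler n o.eulerFun α) :=
            polyEuler_koszul o.eulerFun o.qOp o.eulerFun_qOp α
          rw [← e, h, map_zero]) Submodule.mem_top := rfl

/-- The weight derivation on the base. -/
def baseWeight : Derivation ℂ o.BaseRing o.BaseRing := logDerivation (o.weight.comp o.expIncl)

/-- The grading operator on scalars. -/
def baseEuler : o.RPM →+ o.RPM where
  toFun a := (2 : ℤ) • uDeriv a + deriv o.baseWeight a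
  map_zero' := by simp
  map_add' x y := by
    rw [map_add, map_add, smul_add]
    abel

theorem eulerHPM_smul (a : o.RPM) (x : o.HPM) :
    o.eulerHPM (a • x) = o.baseEuler a • x + a • o.eulerHPM x := by
  obtain ⟨α, hα, -, rfl⟩ := Coh.exists_rep x
  have h1 : o.QF (a • α) = 0 := by rw [LinearMap.map_smul, hα, smul_zero]
  change o.eulerHPM (Coh.mk o.QF ⊤ (a • α) h1 Submodule.mem_top) = _
  rw [eulerHPM_mk]
  refine Coh.mk_congr _ Submodule.mem_top (funext fun I => ?_)
  change (2 : ℤ) • uDeriv (o.towerMap a * α I) + deriv o.weightDerivation (o.towerMap a * α I) +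
      (2 * (I.card : ℤ)) • (o.towerMap a * α I) =
    o.towerMap ((2 : ℤ) • uDeriv a + deriv o.baseWeight a) * α I +
      o.towerMap a * ((2 : ℤ) • uDeriv (α I) + deriv o.weightDerivation (α I) +
        (2 * (I.card : ℤ)) • α I)
  have h2 : uDeriv (o.towerMap a) = o.towerMap (uDeriv a) := uDeriv_mapHom _ _ a
  rw [laurentTower.deriv_mul, uDeriv_mul, map_add, map_zsmul, h2,
    o.deriv_towerMap o.weightDerivation o.baseWeight (o.logDerivation_structureMap o.weight)]
  simp only [mul_add, add_mul, mul_smul_comm, smul_mul_assoc, smul_add]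
  abel

/-- Both `u` and `F` have degree `2`. -/
theorem eulerHPM_twistHPM (hw : ∀ a, o.weightDerivation (D a) = D (o.weightDerivation a))
    (x : o.HPM) : o.eulerHPM (o.twistHPM D hD x) =
      o.twistHPM D hD (o.eulerHPM x) + (2 : ℤ) • o.twistHPM D hD x := by
  obtain ⟨α, hα, -, rfl⟩ := Coh.exists_rep x
  rw [twistHPM_mk, eulerHPM_mk, eulerHPM_mk, twistHPM_mk]
  refine Coh.mk_congr _ Submodule.mem_top (funext fun I => ?_)
  change o.eulerFun (monomial 1 1 * deriv D (α I) + monomial 0 (D o.F) * α I) +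
      (2 * (I.card : ℤ)) • (monomial 1 1 * deriv D (α I) + monomial 0 (D o.F) * α I) =
    (monomial 1 1 * deriv D (o.eulerFun (α I) + (2 * (I.card : ℤ)) • α I) +
      monomial 0 (D o.F) * (o.eulerFun (α I) + (2 * (I.card : ℤ)) • α I)) +
    (2 : ℤ) • (monomial 1 1 * deriv D (α I) + monomial 0 (D o.F) * α I)
  have hc : deriv D (o.eulerFun (α I)) = o.eulerFun (deriv D (α I)) := by
    change deriv D ((2 : ℤ) • uDeriv (α I) + deriv o.weightDerivation (α I)) =
      (2 : ℤ) • uDeriv (deriv D (α I)) + deriv o.weightDerivation (deriv D (α I))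
    rw [map_add, map_zsmul, deriv_uDeriv, deriv_comm _ _ hw]
  rw [map_add, o.eulerFun_monomial_mul 0 _ 2 (by
      rw [hw, weight_F, map_zsmul]), o.eulerFun_monomial_mul 1 1 0 (by
      rw [Derivation.map_one_eq_zero, zero_smul]), map_add (deriv D), hc, map_zsmul]
  simp only [mul_add, smul_add, mul_smul_comm]
  norm_num
  abel

/-! ### Reduction to the central fibre -/

theorem reduce_twistHPM_theta (j : Fin d) (x : o.HPM) :
    o.reduce (o.twistHPM (o.theta j) (fun i => o.thetaRel_comm_theta i j) x) =
      o.twistHf j (o.reduce x) := by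
  obtain ⟨α, hα, -, rfl⟩ := Coh.exists_rep x
  rw [twistHPM_mk, reduce_mk, reduce_mk]
  refine Coh.mk_congr _ Submodule.mem_top (funext fun I => ?_)
  change o.restrictFun (monomial 1 1 * deriv (o.theta j) (α I) +
    monomial 0 (o.theta j o.F) * α I) = _
  rw [map_add, restrictFun_monomial_mul, restrictFun_monomial_mul,
    o.restrictFun_deriv (o.theta j) fun _ ha => o.logDerivation_mem_totalIdeal _ ha]
  have h : Ideal.Quotient.mk o.totalIdeal (o.theta j o.F) =
      Ideal.Quotient.mk o.totalIdeal (o.theta j o.f) := by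
    rw [Ideal.Quotient.eq, ← map_sub]
    exact o.logDerivation_mem_totalIdeal _ o.F_sub_f_mem
  rw [h]
  rfl

theorem reduce_eulerHPM (x : o.HPM) : o.reduce (o.eulerHPM x) = o.eulerHf (o.reduce x) := by
  obtain ⟨α, hα, -, rfl⟩ := Coh.exists_rep x
  rw [eulerHPM_mk, reduce_mk, reduce_mk]
  refine Coh.mk_congr _ Submodule.mem_top (funext fun I => ?_)
  change o.restrictFun ((2 : ℤ) • uDeriv (α I) + deriv o.weightDerivation (α I) +
    (2 * (I.card : ℤ)) • α I) = _
  have h1 : o.restrictFun (uDeriv (α I)) = o.fiberUDeriv (o.restrictFun (α I)) := by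
    refine HahnSeries.ext (funext fun i => ?_)
    exact map_zsmul (Ideal.Quotient.factor (Ideal.pow_le_self (I := o.totalIdeal)
      (Nat.succ_ne_zero 0))) i _
  rw [map_add, map_add, map_zsmul, map_zsmul, h1,
    o.restrictFun_deriv o.weightDerivation fun _ ha => o.logDerivation_mem_totalIdeal _ ha]
  rfl

end SmoothCompleteFan.ConeOrder

/-! ### Endomorphisms nilpotent up to terms of higher order -/

namespace FiltComplete

variable {X : Type*} [AddCommGroup X] {F : ℕ → AddSubgroup X}

/-- Every word in the expansion of the power other than `a ^ m` contains a factor `b`, which raises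
the filtration. -/
theorem add_pow_sub_pow_mem (hF : FiltComplete F) {a b : AddMonoid.End X}
    (ha : ∀ k, ∀ x ∈ F k, a x ∈ F k) (hb : ∀ k, ∀ x ∈ F k, b x ∈ F (k + 1)) (m k : ℕ) {x : X}
    (hx : x ∈ F k) : ((a + b) ^ m) x - (a ^ m) x ∈ F (k + 1) := by
  induction m generalizing k x with
  | zero => rw [pow_zero, pow_zero, sub_self]; exact zero_mem _
  | succ m ih =>
    have ham : ∀ (m k : ℕ), ∀ x ∈ F k, (a ^ m) x ∈ F k := fun m k => by
      induction m with
      | zero => exact fun x hx => hx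
      | succ m ih' => exact fun x hx => by rw [pow_succ' a m]; exact ha _ _ (ih' _ hx)
    have h : ((a + b) ^ (m + 1)) x - (a ^ (m + 1)) x =
        (((a + b) ^ m) (a x + b x) - (a ^ m) (a x + b x)) + (a ^ m) (b x) := by
      rw [pow_succ (a + b) m, pow_succ a m]
      change ((a + b) ^ m) (a x + b x) - (a ^ m) (a x) = _
      rw [map_add (a ^ m)]
      abel
    rw [h]
    exact add_mem (ih k (add_mem (ha _ _ hx) (hF.anti (Nat.le_succ k) (hb _ _ hx))))
      (ham _ _ _ (hb _ _ hx))

end FiltComplete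

namespace laurentTower

section Vectors

variable {A : Type*} [CommRing A] {J : Ideal A}

/-- The filtration of vectors with entries in a tower. -/
def filPi (ι A : Type*) [CommRing A] (J : Ideal A) (k : ℕ) : AddSubgroup (ι → laurentTower A J) :=
  AddSubgroup.pi Set.univ fun _ => fil A J k

theorem mem_filPi {ι : Type*} {k : ℕ} {v : ι → laurentTower A J} :
    v ∈ filPi ι A J k ↔ ∀ i, v i ∈ fil A J k :=
  ⟨fun h i => h i trivial, fun h i _ => h i⟩

theorem filtComplete_filPi (ι : Type*) : FiltComplete (filPi ι A J) := filtComplete.pi ι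

variable {ι : Type*} [Fintype ι]

/-- The action of a matrix on vectors, as an additive map. -/
def mulVecEnd (M : Matrix ι ι (laurentTower A J)) : AddMonoid.End (ι → laurentTower A J) :=
  M.mulVecLin.toAddMonoidHom

theorem mulVecEnd_apply (M : Matrix ι ι (laurentTower A J)) (v : ι → laurentTower A J) (i : ι) :
    mulVecEnd M v i = ∑ j, M i j * v j := rfl

theorem mulVecEnd_mem {M : Matrix ι ι (laurentTower A J)} {l : ℕ} (hM : ∀ i j, M i j ∈ fil A J l)
    (k : ℕ) {v : ι → laurentTower A J} (hv : v ∈ filPi ι A J k) :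
    mulVecEnd M v ∈ filPi ι A J (k + l) :=
  mem_filPi.2 fun i => by
    rw [mulVecEnd_apply]
    refine sum_mem fun j _ => ?_
    rw [add_comm]
    exact mul_mem_fil (hM i j) (mem_filPi.1 hv j)

end Vectors

variable {A : Type*} [CommRing A] [Algebra ℂ A] {J : Ideal A}

theorem tmap_ofLaurent_mul (k : A →ₗ[ℂ] A) (hk : Filtered J J (k : A →+ A)) (g : LaurentSeries ℂ)
    (x : laurentTower A J) : tmap (k : A →+ A) hk (ofLaurent g * x) =
      ofLaurent g * tmap (k : A →+ A) hk x := by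
  refine ext_cf fun l i => ?_
  have hs := g.isPWO_support
  have ht := (x.1 l).isPWO_support
  have hg : ((ofLaurent g : laurentTower A J).1 l).support ⊆ g.support := fun j hj h0 =>
    hj (by
      change algebraMap ℂ (A ⧸ J ^ (l + 1)) (g.coeff j) = 0
      rw [h0, map_zero])
  change qmap (k : A →+ A) _ _ (hk (l + 1)) (cf l i _) = _
  rw [cf_mul_eq_sum _ _ l i hs ht hg subset_rfl,
    cf_mul_eq_sum _ _ l i hs ht hg (support_tmap _ hk x l), map_sum]
  refine Finset.sum_congr rfl fun p _ => ?_
  obtain ⟨a, ha⟩ := Ideal.Quotient.mk_surjective (cf l p.2 x)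
  rw [cf_tmap _ hk x l _ ha, ← ha, cf_ofLaurent, ← map_mul, ← map_mul, qmap_mk]
  congr 1
  change k (algebraMap ℂ A _ * a) = algebraMap ℂ A _ * k a
  rw [← Algebra.smul_def, ← Algebra.smul_def, LinearMap.map_smul]

variable {ι : Type*} [Fintype ι]

/-- If the matrix `M` is nilpotent modulo `J`, then `1 + κ M` is bijective for all linear maps
`κ` that respect the filtration. -/
theorem bijective_one_add_of_nilpotent [DecidableEq ι] {M : Matrix ι ι (laurentTower A J)}
    {g : Matrix ι ι (LaurentSeries ℂ)} (hM : ∀ i j, M i j - ofLaurent (g i j) ∈ fil A J 1) {m : ℕ}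
    (hg : g ^ m = 0) (k : A →ₗ[ℂ] A) (hk : Filtered J J (k : A →+ A)) :
    (∀ v, v + (fun i => tmap (k : A →+ A) hk (mulVecEnd M v i)) = 0 → v = 0) ∧
      ∀ w, ∃ v, v + (fun i => tmap (k : A →+ A) hk (mulVecEnd M v i)) = w := by
  -- `κ` on vectors. Being linear over `ℂ`, it commutes with the constant matrix `G`, so that the
  -- product stays nilpotent.
  let K : AddMonoid.End (ι → laurentTower A J) :=
    { toFun := fun v i => tmap (k : A →+ A) hk (v i)
      map_zero' := funext fun _ => map_zero _
      map_add' := fun _ _ => funext fun _ => map_add _ _ _ }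
  let G : Matrix ι ι (laurentTower A J) := g.map ofLaurent
  have hG : G ^ m = 0 := by
    have h1 : G ^ m = (g ^ m).map ofLaurent :=
      (map_pow (RingHom.mapMatrix (m := ι) (ofLaurent : LaurentSeries ℂ →+* laurentTower A J))
        g m).symm
    rw [h1, hg]
    ext i j
    exact map_zero (ofLaurent : LaurentSeries ℂ →+* laurentTower A J)
  have hGm : (mulVecEnd G) ^ m = 0 := by
    have h2 : ∀ s v, ((mulVecEnd G) ^ s) v = mulVecEnd (G ^ s) v := by
      intro s
      induction s with
      | zero => exact fun v => (Matrix.one_mulVec v).symm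
      | succ s ih =>
        intro v
        rw [pow_succ' (mulVecEnd G) s, pow_succ' G s]
        change mulVecEnd G (((mulVecEnd G) ^ s) v) = _
        rw [ih]
        exact Matrix.mulVec_mulVec v G (G ^ s)
    refine AddMonoidHom.ext fun v => ?_
    refine (h2 m v).trans ?_
    rw [hG]
    exact Matrix.zero_mulVec v
  have hKG : Commute K (mulVecEnd G) := AddMonoidHom.ext fun v => funext fun i => by
    change tmap (k : A →+ A) hk (∑ j, ofLaurent (g i j) * v j) =
      ∑ j, ofLaurent (g i j) * tmap (k : A →+ A) hk (v j)
    rw [map_sum]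
    exact Finset.sum_congr rfl fun j _ => tmap_ofLaurent_mul k hk _ _
  have hK : ∀ l, ∀ v ∈ filPi ι A J l, K v ∈ filPi ι A J l := fun l v hv =>
    mem_filPi.2 fun i => tmap_mem_fil _ hk (mem_filPi.1 hv i)
  -- The operator splits into a nilpotent part `a` from the constant matrix and a part `b` from the
  -- remainder, which raises the order; hence the `m`-th power of `a + b` raises the order.
  let a : AddMonoid.End (ι → laurentTower A J) := -(K * mulVecEnd G)
  let b : AddMonoid.End (ι → laurentTower A J) := -(K * mulVecEnd (M - G))
  have hab : ∀ v, (a + b) v = -fun i => tmap (k : A →+ A) hk (mulVecEnd M v i) := by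
    intro v
    have h3 : mulVecEnd M v = mulVecEnd G v + mulVecEnd (M - G) v := by
      rw [← sub_eq_iff_eq_add']
      exact (Matrix.sub_mulVec M G v).symm
    change -K (mulVecEnd G v) + -K (mulVecEnd (M - G) v) = -K (mulVecEnd M v)
    rw [h3, map_add]
    abel
  have ha : ∀ l, ∀ v ∈ filPi ι A J l, a v ∈ filPi ι A J l := fun l v hv =>
    neg_mem (hK l _ (mulVecEnd_mem (l := 0) (fun i j => by
      rw [filtComplete.zero]; trivial) l hv))
  have hb : ∀ l, ∀ v ∈ filPi ι A J l, b v ∈ filPi ι A J (l + 1) := fun l v hv =>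
    neg_mem (hK _ _ (mulVecEnd_mem (M := M - G) hM l hv))
  have ham : a ^ m = 0 := by
    refine (neg_pow (K * mulVecEnd G) m).trans ?_
    rw [hKG.mul_pow, hGm, mul_zero, mul_zero]
  obtain ⟨h1, h2⟩ := (filtComplete_filPi ι).bijective_of_pow (F := filPi ι A J) (ν := a + b)
    (m := m) fun l v hv => by
      have := (filtComplete_filPi ι).add_pow_sub_pow_mem ha hb m l hv
      rw [ham] at this
      simpa using this
  refine ⟨fun v hv => h1 v ?_, fun w => ?_⟩
  · rw [hab, eq_comm, eq_neg_iff_add_eq_zero]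
    exact hv
  · obtain ⟨v, hv⟩ := h2 w
    rw [hab, sub_neg_eq_add] at hv
    exact ⟨v, hv⟩

end laurentTower

namespace SmoothCompleteFan.ConeOrder

open laurentTower

variable {n d r : ℕ} {Δ : SmoothCompleteFan n d} (o : Δ.ConeOrder r)

/-! ### Diagonal operators on the base -/

-- The powers of `𝓘` are spanned by monomials, and a diagonal operator rescales monomials. No order
-- in `𝓘` is lost, even for operators that are not derivations, such as division by the weight.
open scoped Pointwise in
theorem monomialMap_mem_pow (c : Δ.curveMonoid × (o.BigIndex →₀ ℕ) → ℂ) (k : ℕ) {a : o.BaseRing}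
    (ha : a ∈ o.baseIdeal ^ k) : monomialMap c (fun x => x) a ∈ o.baseIdeal ^ k := by
  have hS : o.baseIdeal ^ k =
      Ideal.span ({a : o.BaseRing | ∃ x, x ≠ 0 ∧ a = AddMonoidAlgebra.single x 1} ^ k) :=
    Submodule.span_pow _ k
  have hmono : ∀ k, ∀ a ∈ ({a : o.BaseRing | ∃ x, x ≠ 0 ∧ a = AddMonoidAlgebra.single x 1} ^ k),
      ∃ x, a = AddMonoidAlgebra.single x 1 := by
    intro k
    induction k with
    | zero => exact fun a ha => ⟨0, by rw [pow_zero] at ha; exact ha⟩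
    | succ k ih =>
      intro a ha
      rw [pow_succ] at ha
      obtain ⟨b, hb, c, ⟨y, -, rfl⟩, rfl⟩ := ha
      obtain ⟨x, rfl⟩ := ih b hb
      exact ⟨x + y, by simp [AddMonoidAlgebra.single_mul_single]⟩
  rw [hS] at ha ⊢
  -- The operator is not linear over the ring, so membership is proved for all multiples at once.
  have key : ∀ b : o.BaseRing, monomialMap c (fun x => x) (b * a) ∈ Ideal.span
      ({a : o.BaseRing | ∃ x, x ≠ 0 ∧ a = AddMonoidAlgebra.single x 1} ^ k) := by
    refine Submodule.span_induction ?_ ?_ ?_ ?_ ha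
    · intro a ha b
      obtain ⟨y, hy⟩ := hmono k a ha
      induction b using AddMonoidAlgebra.induction_linear with
      | zero => rw [zero_mul, map_zero]; exact zero_mem _
      | add b b' h h' => rw [add_mul, map_add]; exact add_mem h h'
      | single x s =>
        have e : monomialMap c (fun x => x) (AddMonoidAlgebra.single x s * a) =
            AddMonoidAlgebra.single x (c (x + y) * s) * a := by
          rw [hy, AddMonoidAlgebra.single_mul_single, AddMonoidAlgebra.single_mul_single,
            monomialMap_single, mul_one, mul_one]
        rw [e]
        exact Ideal.mul_mem_left _ _ (Ideal.subset_span ha)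
    · intro b
      rw [mul_zero, map_zero]
      exact zero_mem _
    · intro x y _ _ hx hy b
      rw [mul_add, map_add]
      exact add_mem (hx b) (hy b)
    · intro b' x _ hx b
      rw [smul_eq_mul, ← mul_assoc]
      exact hx _
  simpa using key 1

theorem filtered_monomialMap (c : Δ.curveMonoid × (o.BigIndex →₀ ℕ) → ℂ) :
    Filtered o.baseIdeal o.baseIdeal
      (monomialMap c (fun x => x) : o.BaseRing →+ o.BaseRing) :=
  fun k _ ha => o.monomialMap_mem_pow c k ha

theorem deriv_logDerivation_eq_tmap (ℓ : Δ.curveMonoid × (o.BigIndex →₀ ℕ) →+ ℂ) (x : o.RPM) :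
    deriv (logDerivation ℓ) x = tmap (monomialMap (fun x => ℓ x) (fun x => x) :
      o.BaseRing →+ o.BaseRing) (o.filtered_monomialMap _) x :=
  deriv_eq_tmap _ (o.filtered_monomialMap _) x

theorem monomialMap_monomialMap {M : Type*} (c c' : M → ℂ) (a : AddMonoidAlgebra ℂ M) :
    monomialMap c (fun x => x) (monomialMap c' (fun x => x) a) =
      monomialMap (fun x => c x * c' x) (fun x => x) a := by
  induction a using AddMonoidAlgebra.induction_linear with
  | zero => simp
  | add a b h h' => simp only [map_add, h, h']
  | single x s => simp only [monomialMap_single, mul_assoc]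

theorem tmap_monomialMap_monomialMap (c c' : Δ.curveMonoid × (o.BigIndex →₀ ℕ) → ℂ) (x : o.RPM) :
    tmap (monomialMap c (fun x => x) : o.BaseRing →+ o.BaseRing) (o.filtered_monomialMap _)
      (tmap (monomialMap c' (fun x => x) : o.BaseRing →+ o.BaseRing) (o.filtered_monomialMap _) x) =
      tmap (monomialMap (fun x => c x * c' x) (fun x => x) : o.BaseRing →+ o.BaseRing)
        (o.filtered_monomialMap _) x :=
  tmap_comp _ _ _ _ _ _ (monomialMap_monomialMap c c') x

theorem monomialMap_one {M : Type*} (c : M → ℂ) (hc : ∀ x, c x = 1) (a : AddMonoidAlgebra ℂ M) :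
    monomialMap c (fun x => x) a = a := by
  induction a using AddMonoidAlgebra.induction_linear with
  | zero => simp
  | add a b h h' => simp only [map_add, h, h']
  | single x s => rw [monomialMap_single, hc, one_mul]

/-- A diagonal operator that fixes the nonconstant monomials is the identity on the elements of
positive order. -/
theorem tmap_monomialMap_of_mem_fil (hΔ : Δ.IsProjective)
    {c : Δ.curveMonoid × (o.BigIndex →₀ ℕ) → ℂ} (hc : ∀ x, x ≠ 0 → c x = 1) {x : o.RPM}
    (hx : x ∈ fil o.BaseRing o.baseIdeal 1) :
    tmap (monomialMap c (fun x => x) : o.BaseRing →+ o.BaseRing) (o.filtered_monomialMap _) x =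
      x := by
  obtain ⟨ε, hε⟩ := o.exists_augmentation hΔ
  -- The operator differs from the identity only in the constant term, which the augmentation
  -- detects.
  have key : ∀ a : o.BaseRing, monomialMap c (fun x => x) a =
      a + AddMonoidAlgebra.single 0 ((c 0 - 1) * ε a) := by
    intro a
    induction a using AddMonoidAlgebra.induction_linear with
    | zero => simp
    | add a b h h' => rw [map_add, h, h', map_add, mul_add, AddMonoidAlgebra.single_add]; abel
    | single x s =>
      rw [monomialMap_single]
      by_cases h : x = 0
      · subst h
        have h1 : ε (AddMonoidAlgebra.single 0 s) = s := ε.commutes s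
        rw [h1, ← AddMonoidAlgebra.single_add]
        congr 1
        ring
      · rw [hε _ (o.single_mem_baseIdeal h s), hc x h]
        simp
  refine ext_cf fun k j => ?_
  obtain ⟨a, ha⟩ := Ideal.Quotient.mk_surjective (cf k j x)
  rw [cf_tmap _ _ x k j ha, ← ha]
  have h0 : cf 0 j x = 0 := mem_fil_succ.1 hx j
  have haI : a ∈ o.baseIdeal := by
    have h2 : ∀ k, ∀ a, Ideal.Quotient.mk (o.baseIdeal ^ (k + 1)) a = cf k j x →
        a ∈ o.baseIdeal := by
      intro k
      induction k with
      | zero =>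
        intro a ha
        rw [h0, Ideal.Quotient.eq_zero_iff_mem, zero_add, pow_one] at ha
        exact ha
      | succ k ih =>
        intro a ha
        refine ih a ?_
        rw [← factor_cf, ← ha]
        rfl
    exact h2 k a ha
  congr 1
  exact (key a).trans (by rw [hε a haI, mul_zero, AddMonoidAlgebra.single_zero, add_zero])

/-- The constant terms are killed and every other monomial lies in `𝓘`. -/
theorem tmap_monomialMap_mem_fil {c : Δ.curveMonoid × (o.BigIndex →₀ ℕ) → ℂ} (hc : c 0 = 0)
    (x : o.RPM) :
    tmap (monomialMap c (fun x => x) : o.BaseRing →+ o.BaseRing) (o.filtered_monomialMap _) x ∈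
      fil o.BaseRing o.baseIdeal 1 := by
  refine mem_fil_succ.2 fun j => ?_
  obtain ⟨a, ha⟩ := Ideal.Quotient.mk_surjective (cf 0 j x)
  rw [cf_tmap _ _ x 0 j ha, Ideal.Quotient.eq_zero_iff_mem, zero_add, pow_one]
  change monomialMap c (fun x => x) a ∈ _
  clear ha
  induction a using AddMonoidAlgebra.induction_linear with
  | zero => rw [map_zero]; exact zero_mem _
  | add a b h h' => rw [map_add]; exact add_mem h h'
  | single x s =>
    rw [monomialMap_single]
    by_cases h : x = 0
    · rw [h, hc, zero_mul, AddMonoidAlgebra.single_zero]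
      exact zero_mem _
    · exact o.single_mem_baseIdeal h _

end SmoothCompleteFan.ConeOrder

theorem Coh.sum_zsmul_mk {S K ι : Type*} [CommRing S] [AddCommGroup K] [Module S K] {Q : K →ₗ[S] K}
    {W : Submodule S K} [Fintype ι] (c : ι → ℤ) (z : ι → K) (hz : ∀ j, Q (z j) = 0)
    (hW : ∀ j, z j ∈ W) : ∑ j, c j • Coh.mk Q W (z j) (hz j) (hW j) =
      Coh.mk Q W (∑ j, c j • z j) (by simp [hz]) (sum_mem fun j _ => zsmul_mem (hW j) _) := by
  let q : ↥(LinearMap.ker Q ⊓ W) →+ Coh Q W :=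
    ((W.map Q).submoduleOf (LinearMap.ker Q ⊓ W)).mkQ.toAddMonoidHom
  change ∑ j, c j • q ⟨z j, hz j, hW j⟩ = q _
  simp only [← map_zsmul, ← map_sum]
  congr 1
  refine Subtype.ext ?_
  simp

namespace SmoothCompleteFan.ConeOrder

open laurentTower

variable {n d r : ℕ} {Δ : SmoothCompleteFan n d} (o : Δ.ConeOrder r) (h : Fin d → ℤ)

/-! ### The logarithmic operator of a strictly convex function -/

/-- The linear form `z^a t^l ↦ ⟨h, a⟩ + |l|` on exponents. -/
def hWeight : Δ.totalMonoid × (o.BigIndex →₀ ℕ) →+ ℂ where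
  toFun x := ((∑ j, h j * x.1.1 j + ∑ i, (x.2 i : ℤ) : ℤ) : ℂ)
  map_zero' := by simp
  map_add' x y := by
    rw [← Int.cast_add]
    congr 1
    simp only [Prod.fst_add, Prod.snd_add, AddSubmonoid.coe_add, Pi.add_apply, Finsupp.add_apply,
      Nat.cast_add, Finset.sum_add_distrib, mul_add]
    ring

/-- The restriction of `hWeight` to the exponents of the base. -/
def baseHWeight : Δ.curveMonoid × (o.BigIndex →₀ ℕ) →+ ℂ := (o.hWeight h).comp o.expIncl

/-- Strict convexity makes the first summand positive on nonzero curve classes, and `|l|` counts the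
`t_i`. The weight can thus be inverted off the constants, and one plus the weight everywhere. -/
theorem baseHWeight_eq {h : Fin d → ℤ} (hh : Δ.IsStrictlyConvex h)
    (x : Δ.curveMonoid × (o.BigIndex →₀ ℕ)) :
    ∃ m : ℤ, o.baseHWeight h x = m ∧ 0 ≤ m ∧ (x ≠ 0 → 0 < m) := by
  refine ⟨∑ j, h j * x.1.1 j + ∑ i, (x.2 i : ℤ), rfl, ?_⟩
  have h1 : 0 ≤ ∑ j, h j * x.1.1 j := by
    by_cases hx : x.1.1 = 0
    · simp [hx]
    · exact (hh.pos Δ x.1.2 hx).le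
  have h2 : 0 ≤ ∑ i, (x.2 i : ℤ) := Finset.sum_nonneg fun i _ => Int.natCast_nonneg _
  refine ⟨add_nonneg h1 h2, fun hx => ?_⟩
  by_cases hx1 : x.1.1 = 0
  · have hx2 : x.2 ≠ 0 := fun h0 => hx (Prod.ext (Subtype.ext hx1) h0)
    obtain ⟨i, hi⟩ := Finsupp.ne_iff.1 hx2
    refine add_pos_of_nonneg_of_pos h1 (Finset.sum_pos' (fun i _ => Int.natCast_nonneg _)
      ⟨i, Finset.mem_univ _, ?_⟩)
    exact_mod_cast Nat.pos_of_ne_zero hi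
  · exact add_pos_of_pos_of_nonneg (hh.pos Δ x.1.2 hx1) h2

/-- The logarithmic derivation of weight `hWeight`. -/
def logD : Derivation ℂ o.TotalRing o.TotalRing := logDerivation (o.hWeight h)

/-- Its restriction to the base. -/
def baseLogD : Derivation ℂ o.BaseRing o.BaseRing := logDerivation (o.baseHWeight h)

theorem logD_structureMap (a : o.BaseRing) :
    o.logD h (o.structureMap a) = o.structureMap (o.baseLogD h a) :=
  o.logDerivation_structureMap _ a

theorem logD_thetaRel (i : Fin n) (a : o.TotalRing) :
    o.logD h (o.thetaRel i a) = o.thetaRel i (o.logD h a) := logDerivation_comm _ _ a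

/-- `t_i` has weight `1`, so `∂/∂t_i` lowers the weight by one. -/
theorem logD_partialT (i : o.BigIndex) (a : o.TotalRing) :
    o.logD h (o.partialT i a) = o.partialT i (o.logD h a) + (-1 : ℤ) • o.partialT i a := by
  induction a using AddMonoidAlgebra.induction_linear with
  | zero => simp
  | add a b ha hb => simp only [map_add, ha, hb, smul_add]; abel
  | single x c =>
    simp only [logD, partialT, tDerivation_single, logDerivation_single,
      AddMonoidAlgebra.smul_single]
    rw [← AddMonoidAlgebra.single_add]
    congr 1
    by_cases hx : x.2 i = 0
    · simp [hx]
    · have h1 : o.hWeight h x = o.hWeight h (x.1, x.2 - Finsupp.single i 1) + 1 := by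
        have h2 : x = (x.1, x.2 - Finsupp.single i 1) + (0, Finsupp.single i 1) := by
          refine Prod.ext (add_zero _).symm ?_
          change x.2 = x.2 - Finsupp.single i 1 + Finsupp.single i 1
          rw [tsub_add_cancel_of_le (Finsupp.single_le_iff.2 (Nat.one_le_iff_ne_zero.2 hx))]
        conv_lhs => rw [h2]
        rw [map_add]
        congr 1
        simp [hWeight, Finsupp.single_apply]
      rw [h1]
      simp
      ring

/-- Monomials with a positive power of some `t_i` vanish on the central fibre, so only the part `⟨h,
a⟩` of the weight survives. -/
theorem mk_logD (a : o.TotalRing) : Ideal.Quotient.mk o.totalIdeal (o.logD h a) =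
    ∑ j, h j • Ideal.Quotient.mk o.totalIdeal (o.theta j a) := by
  induction a using AddMonoidAlgebra.induction_linear with
  | zero => simp
  | add a b ha hb => simp only [map_add, ha, hb, smul_add, Finset.sum_add_distrib]
  | single x c =>
    obtain ⟨a, l⟩ := x
    simp only [logD, theta, logDerivation_single]
    by_cases hl : l = 0
    · subst hl
      simp only [mk_single, ← smul_assoc]
      rw [← Finset.sum_smul]
      congr 1
      change ((∑ j, h j * a.1 j + ∑ i : o.BigIndex, ((0 : ℕ) : ℤ) : ℤ) : ℂ) * c =
        ∑ j, h j • (((a.1 j : ℤ) : ℂ) * c)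
      simp only [Nat.cast_zero, Finset.sum_const_zero, add_zero, Int.cast_sum, Int.cast_mul,
        Finset.sum_mul, zsmul_eq_mul, mul_assoc]
    · simp only [o.mk_single_of_ne _ hl, smul_zero, Finset.sum_const_zero]

theorem reduce_twistHPM_logD (x : o.HPM) :
    o.reduce (o.twistHPM (o.logD h) (o.logD_thetaRel h) x) = o.twistSum h (o.reduce x) := by
  obtain ⟨α, hα, -, rfl⟩ := Coh.exists_rep x
  have key : ∀ s : o.OPM, o.restrictFun (o.twist (o.logD h) s) =
      ∑ j, h j • o.fiberTwist j (o.restrictFun s) := by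
    intro s
    have hD : ∀ a ∈ o.totalIdeal, o.logD h a ∈ o.totalIdeal :=
      fun _ ha => o.logDerivation_mem_totalIdeal _ ha
    have h0 : ∀ a, quotDerivation (o.logD h) o.totalIdeal hD a = ∑ j, h j • o.fiberTheta j a := by
      intro a
      obtain ⟨a, rfl⟩ := Ideal.Quotient.mk_surjective a
      exact o.mk_logD h a
    have h1 : o.fiberDeriv (quotDerivation (o.logD h) o.totalIdeal hD) (o.restrictFun s) =
        ∑ j, h j • o.fiberDeriv (o.fiberTheta j) (o.restrictFun s) := by
      refine HahnSeries.ext (funext fun k => ?_)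
      let c : o.FiberPM →+ o.FiberRing :=
        { toFun := fun s => HahnSeries.coeff (s : LaurentSeries o.FiberRing) k
          map_zero' := rfl
          map_add' := fun _ _ => rfl }
      change c (o.fiberDeriv (quotDerivation (o.logD h) o.totalIdeal hD) (o.restrictFun s)) =
        c (∑ j, h j • o.fiberDeriv (o.fiberTheta j) (o.restrictFun s))
      rw [map_sum]
      refine (h0 _).trans (Finset.sum_congr rfl fun j _ => ?_)
      rw [map_zsmul]
      rfl
    have h2 : o.fiberMonomial 0 (Ideal.Quotient.mk o.totalIdeal (o.logD h o.F)) =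
        ∑ j, h j • o.fiberMonomial 0 (o.fiberTheta j o.fiberf) := by
      let c : o.FiberRing →+ o.FiberPM :=
        (HahnSeries.single.addMonoidHom (R := o.FiberRing) (0 : ℤ))
      have e : Ideal.Quotient.mk o.totalIdeal (o.logD h o.F) =
          ∑ j, h j • o.fiberTheta j o.fiberf := by
        rw [← h0]
        change _ = Ideal.Quotient.mk o.totalIdeal (o.logD h o.f)
        rw [Ideal.Quotient.eq, ← map_sub]
        exact hD _ o.F_sub_f_mem
      change c _ = ∑ j, h j • c _
      rw [e, map_sum]
      exact Finset.sum_congr rfl fun j _ => map_zsmul c _ _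
    change o.restrictFun (monomial 1 1 * deriv (o.logD h) s +
      monomial 0 (o.logD h o.F) * s) = _
    rw [map_add, restrictFun_monomial_mul, restrictFun_monomial_mul,
      o.restrictFun_deriv (o.logD h) hD, h1, h2, Finset.sum_mul, Finset.mul_sum,
      ← Finset.sum_add_distrib]
    refine Finset.sum_congr rfl fun j _ => ?_
    rw [smul_mul_assoc, mul_smul_comm, ← smul_add]
    rfl
  rw [twistHPM_mk, reduce_mk, reduce_mk, twistSum_apply]
  have e : ∀ j, o.Qf (onCoeffs n (o.fiberTwist j) (onCoeffs n o.restrictFun α)) = 0 := fun j => by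
    have e' : onCoeffs n (o.fiberTwist j) (o.Qf (onCoeffs n o.restrictFun α)) =
        o.Qf (onCoeffs n (o.fiberTwist j) (onCoeffs n o.restrictFun α)) :=
      onCoeffs_koszul (o.fiberTwist j) o.fiberQOp o.fiberQOp (o.fiberTwist_qOp j) _
    rw [← e', o.Qf_restrictFun hα, map_zero]
  refine Eq.trans ?_ (Coh.sum_zsmul_mk h (fun j => onCoeffs n (o.fiberTwist j)
    (onCoeffs n o.restrictFun α)) e fun _ => Submodule.mem_top).symm
  refine Coh.mk_congr _ Submodule.mem_top (funext fun I => ?_)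
  rw [Finset.sum_apply]
  exact key (α I)

/-- The operator `∇` in the direction of `logD`. -/
def logOp : AddMonoid.End o.HPM where
  toFun x := (uInv : o.RPM) • o.twistHPM (o.logD h) (o.logD_thetaRel h) x
  map_zero' := by rw [map_zero, smul_zero]
  map_add' x y := by rw [map_add, smul_add]

theorem logOp_apply (x : o.HPM) :
    o.logOp h x = (uInv : o.RPM) • o.twistHPM (o.logD h) (o.logD_thetaRel h) x := rfl

theorem logOp_smul (a : o.RPM) (x : o.HPM) :
    o.logOp h (a • x) = deriv (o.baseLogD h) a • x + a • o.logOp h x := by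
  rw [logOp_apply, o.twistHPM_smul _ _ _ (o.logD_structureMap h), smul_add, smul_smul,
    ← mul_assoc, uInv_mul_u, one_mul, smul_comm]
  rfl

theorem logOp_ofLaurent_smul (g : LaurentSeries ℂ) (x : o.HPM) :
    o.logOp h ((ofLaurent g : o.RPM) • x) = (ofLaurent g : o.RPM) • o.logOp h x := by
  rw [logOp_smul, deriv_ofLaurent, zero_smul, zero_add]

/-- The residue of `logOp`. -/
def logResidue : Module.End (LaurentSeries ℂ) o.HfPM :=
  (HahnSeries.single (-1) 1 : LaurentSeries ℂ) • o.twistSum h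

theorem reduce_logOp (x : o.HPM) : o.reduce (o.logOp h x) = o.logResidue h (o.reduce x) := by
  rw [logOp_apply, ← ofLaurent_uInv, reduce_ofLaurent_smul, reduce_twistHPM_logD]
  rfl

theorem logResidue_pow (hΔ : Δ.IsProjective) (x : o.HfPM) : (o.logResidue h ^ (n + 1)) x = 0 := by
  have key : ∀ s, (o.logResidue h ^ s) x =
      (HahnSeries.single (-1) 1 : LaurentSeries ℂ) ^ s • (o.twistSum h ^ s) x := by
    intro s
    induction s with
    | zero => rw [pow_zero, pow_zero, pow_zero, one_smul]
    | succ s ih =>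
      rw [pow_succ' (o.logResidue h) s, pow_succ' (o.twistSum h) s, Module.End.mul_apply, ih,
        LinearMap.map_smul, pow_succ, mul_smul]
      rfl
  rw [key, o.twistSum_pow hΔ, smul_zero]

theorem reduce_logOp_pow (s : ℕ) (x : o.HPM) :
    o.reduce ((o.logOp h ^ s) x) = (o.logResidue h ^ s) (o.reduce x) := by
  induction s with
  | zero => rfl
  | succ s ih =>
    rw [pow_succ' (o.logOp h) s, pow_succ' (o.logResidue h) s]
    change o.reduce (o.logOp h ((o.logOp h ^ s) x)) = _
    rw [reduce_logOp, ih]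
    rfl

/-- The matrix of `logOp` in the frame of the `φ_j`. -/
def logMatrix (hΔ : Δ.IsProjective) : Matrix (Fin (r + 1)) (Fin (r + 1)) o.RPM :=
  fun i j => (o.frame hΔ).symm (o.logOp h (o.incl (o.phiHF j))) i

theorem logOp_incl_phiHF (hΔ : Δ.IsProjective) (j : Fin (r + 1)) :
    o.logOp h (o.incl (o.phiHF j)) = o.comb fun i => o.logMatrix h hΔ i j :=
  ((o.frame hΔ).apply_symm_apply _).symm

theorem logOp_comb (hΔ : Δ.IsProjective) (v : Fin (r + 1) → o.RPM) :
    o.logOp h (o.comb v) =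
      o.comb fun i => deriv (o.baseLogD h) (v i) + mulVecEnd (o.logMatrix h hΔ) v i := by
  have e : (fun i => deriv (o.baseLogD h) (v i) + mulVecEnd (o.logMatrix h hΔ) v i) =
      (fun i => deriv (o.baseLogD h) (v i)) + ∑ j, v j • fun i => o.logMatrix h hΔ i j := by
    funext i
    rw [Pi.add_apply, Finset.sum_apply, mulVecEnd_apply]
    congr 1
    exact Finset.sum_congr rfl fun j _ => mul_comm _ _
  rw [e, map_add, map_sum, comb_apply, map_sum, comb_apply, ← Finset.sum_add_distrib]
  refine Finset.sum_congr rfl fun j _ => ?_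
  rw [logOp_smul, o.logOp_incl_phiHF h hΔ, LinearMap.map_smul]

/-- Modulo `𝓘` the matrix of the connection is that of the residue in the basis `φ_j` of `ℋ_{f,±}`,
which is nilpotent; independence of the `φ_j` turns this into a matrix identity. -/
theorem exists_logMatrix_sub (hΔ : Δ.IsProjective) :
    ∃ g : Matrix (Fin (r + 1)) (Fin (r + 1)) (LaurentSeries ℂ), g ^ (n + 1) = 0 ∧
      ∀ i j, o.logMatrix h hΔ i j - ofLaurent (g i j) ∈ fil o.BaseRing o.baseIdeal 1 := by
  obtain ⟨g, hg⟩ : ∃ g : Matrix (Fin (r + 1)) (Fin (r + 1)) (LaurentSeries ℂ),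
      ∀ i j, o.logMatrix h hΔ i j - ofLaurent (g i j) ∈ fil o.BaseRing o.baseIdeal 1 := by
    choose g hg using fun i j => o.exists_ofLaurent (o.logMatrix h hΔ i j)
    exact ⟨g, hg⟩
  refine ⟨g, ?_, hg⟩
  have h1 : ∀ j, o.logResidue h (o.phiHf j) = ∑ i, g i j • o.phiHf i := by
    intro j
    rw [← reduce_incl_phiHF, ← reduce_logOp, o.logOp_incl_phiHF h hΔ]
    have e : (fun i => o.logMatrix h hΔ i j) = (fun i => ofLaurent (g i j)) +
        fun i => o.logMatrix h hΔ i j - ofLaurent (g i j) := by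
      funext i
      rw [Pi.add_apply, add_sub_cancel]
    rw [e, map_add, map_add, (o.reduce_comb_eq_zero_iff hΔ _).2 fun i => hg i j, add_zero,
      comb_apply, map_sum]
    exact Finset.sum_congr rfl fun i _ => by rw [reduce_ofLaurent_smul, reduce_incl_phiHF]
  have h2 : ∀ c : Fin (r + 1) → LaurentSeries ℂ, o.logResidue h (∑ j, c j • o.phiHf j) =
      ∑ i, (Matrix.mulVec g c) i • o.phiHf i := by
    intro c
    rw [map_sum]
    simp only [LinearMap.map_smul, h1, Finset.smul_sum, smul_smul]
    rw [Finset.sum_comm]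
    refine Finset.sum_congr rfl fun i _ => ?_
    rw [← Finset.sum_smul]
    congr 1
    exact Finset.sum_congr rfl fun j _ => mul_comm _ _
  have h3 : ∀ s (c : Fin (r + 1) → LaurentSeries ℂ),
      (o.logResidue h ^ s) (∑ j, c j • o.phiHf j) =
        ∑ i, (Matrix.mulVec (g ^ s) c) i • o.phiHf i := by
    intro s
    induction s with
    | zero => exact fun c => by rw [pow_zero, pow_zero, Matrix.one_mulVec]; rfl
    | succ s ih =>
      intro c
      rw [pow_succ', pow_succ' g, Module.End.mul_apply, ih, h2, Matrix.mulVec_mulVec]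
  refine Matrix.ext fun i j => ?_
  have h4 := h3 (n + 1) (Pi.single j 1)
  rw [o.logResidue_pow h hΔ] at h4
  have h5 := congrFun (o.coords_HfPM_eq_zero hΔ h4.symm) i
  rwa [Matrix.mulVec_single_one] at h5

section

variable {h}

/-- `logOp` has no kernel on the classes vanishing on the central fibre. -/
theorem eq_zero_of_logOp_eq_zero (hΔ : Δ.IsProjective) (hh : Δ.IsStrictlyConvex h) {x : o.HPM}
    (hx : o.reduce x = 0) (hL : o.logOp h x = 0) : x = 0 := by
  obtain ⟨v, rfl⟩ := o.comb_surjective hΔ x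
  obtain ⟨g, hg, hM⟩ := o.exists_logMatrix_sub h hΔ
  rw [o.logOp_comb h hΔ] at hL
  have hL := (injective_iff_map_eq_zero o.comb).1 (o.comb_injective hΔ) _ hL
  have hv := (o.reduce_comb_eq_zero_iff hΔ v).1 hx
  obtain ⟨h1, -⟩ := bijective_one_add_of_nilpotent hM hg
    (monomialMap (fun x => (o.baseHWeight h x)⁻¹) fun x => x) (o.filtered_monomialMap _)
  rw [h1 v, map_zero]
  funext i
  -- The coordinates have no constant term, so dividing by the weight undoes the derivation and the
  -- equation becomes `v + κ (M v) = 0`.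
  have h2 : v i = tmap (monomialMap (fun x => (o.baseHWeight h x)⁻¹) (fun x => x) :
      o.BaseRing →+ o.BaseRing) (o.filtered_monomialMap _) (deriv (o.baseLogD h) (v i)) := by
    rw [baseLogD, deriv_logDerivation_eq_tmap, tmap_monomialMap_monomialMap,
      o.tmap_monomialMap_of_mem_fil hΔ _ (hv i)]
    intro x hx
    obtain ⟨m, hm, -, hm'⟩ := o.baseHWeight_eq hh x
    refine inv_mul_cancel₀ ?_
    rw [hm]
    exact_mod_cast (hm' hx).ne'
  rw [Pi.add_apply, h2, ← map_add]
  have h3 := congrFun hL i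
  refine Eq.trans ?_ (map_zero (tmap (monomialMap (fun x => (o.baseHWeight h x)⁻¹) (fun x => x) :
      o.BaseRing →+ o.BaseRing) (o.filtered_monomialMap _)))
  exact congrArg _ h3

/-- `logOp` is onto on the classes vanishing on the central fibre. -/
theorem exists_logOp_eq (hΔ : Δ.IsProjective) (hh : Δ.IsStrictlyConvex h) {y : o.HPM}
    (hy : o.reduce y = 0) : ∃ x, o.reduce x = 0 ∧ o.logOp h x = y := by
  obtain ⟨w, rfl⟩ := o.comb_surjective hΔ y
  obtain ⟨g, hg, hM⟩ := o.exists_logMatrix_sub h hΔ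
  have hw := (o.reduce_comb_eq_zero_iff hΔ w).1 hy
  -- Division by the weight. The constant monomial has weight zero and `0⁻¹ = 0`, so constants are
  -- killed and the image has positive order.
  let κ : o.RPM →+ o.RPM := tmap (monomialMap (fun x => (o.baseHWeight h x)⁻¹) (fun x => x) :
      o.BaseRing →+ o.BaseRing) (o.filtered_monomialMap _)
  have hκ : ∀ x, κ x ∈ fil o.BaseRing o.baseIdeal 1 := fun x =>
    o.tmap_monomialMap_mem_fil (by rw [map_zero, inv_zero]) x
  have hDκ : ∀ x ∈ fil o.BaseRing o.baseIdeal 1, deriv (o.baseLogD h) (κ x) = x := by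
    intro x hx
    rw [baseLogD, deriv_logDerivation_eq_tmap, tmap_monomialMap_monomialMap,
      o.tmap_monomialMap_of_mem_fil hΔ _ hx]
    intro x hx
    obtain ⟨m, hm, -, hm'⟩ := o.baseHWeight_eq hh x
    refine mul_inv_cancel₀ ?_
    rw [hm]
    exact_mod_cast (hm' hx).ne'
  obtain ⟨-, h2⟩ := bijective_one_add_of_nilpotent hM hg
    (monomialMap (fun x => (o.baseHWeight h x)⁻¹) fun x => x) (o.filtered_monomialMap _)
  obtain ⟨v, hv⟩ := h2 fun i => κ (w i)
  -- The solution lies in the image of `κ`, hence vanishes on the central fibre, where the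
  -- derivation inverts `κ`.
  have hv' : ∀ i, v i = κ (w i - mulVecEnd (o.logMatrix h hΔ) v i) := fun i => by
    rw [map_sub, eq_sub_iff_add_eq]
    exact congrFun hv i
  have hvf : ∀ i, v i ∈ fil o.BaseRing o.baseIdeal 1 := fun i => by rw [hv' i]; exact hκ _
  refine ⟨o.comb v, (o.reduce_comb_eq_zero_iff hΔ v).2 hvf, ?_⟩
  rw [o.logOp_comb h hΔ]
  congr 1
  funext i
  have h3 : mulVecEnd (o.logMatrix h hΔ) v i ∈ fil o.BaseRing o.baseIdeal 1 := by
    rw [mulVecEnd_apply]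
    exact sum_mem fun j _ => mul_mem_fil_right _ (hvf j)
  have h4 := hDκ _ (sub_mem (hw i) h3)
  rw [← hv' i] at h4
  rw [h4, sub_add_cancel]

/-- All eigenvalues of the derivation plus one are positive integers, so here the constant terms
need no separate treatment. -/
theorem eq_zero_of_logOp_add_eq_zero (hΔ : Δ.IsProjective) (hh : Δ.IsStrictlyConvex h) {x : o.HPM}
    (hL : o.logOp h x + x = 0) : x = 0 := by
  obtain ⟨v, rfl⟩ := o.comb_surjective hΔ x
  obtain ⟨g, hg, hM⟩ := o.exists_logMatrix_sub h hΔ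
  rw [o.logOp_comb h hΔ, ← map_add] at hL
  have hL := (injective_iff_map_eq_zero o.comb).1 (o.comb_injective hΔ) _ hL
  let κ : o.RPM →+ o.RPM := tmap (monomialMap (fun x => (o.baseHWeight h x + 1)⁻¹) (fun x => x) :
      o.BaseRing →+ o.BaseRing) (o.filtered_monomialMap _)
  have hκ : ∀ x, κ (deriv (o.baseLogD h) x + x) = x := by
    intro x
    rw [baseLogD, deriv_logDerivation_eq_tmap, map_add, tmap_monomialMap_monomialMap,
      tmap_add _ _ _ _ (monomialMap (fun x => (o.baseHWeight h x + 1)⁻¹ * (o.baseHWeight h x + 1))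
        (fun x => x) : o.BaseRing →+ o.BaseRing) (o.filtered_monomialMap _),
      tmap_id]
    · intro a
      refine monomialMap_one _ (fun x => ?_) a
      obtain ⟨m, hm, hm', -⟩ := o.baseHWeight_eq hh x
      refine inv_mul_cancel₀ ?_
      rw [hm]
      exact_mod_cast (by omega : m + 1 ≠ 0)
    · intro a
      change monomialMap _ _ a + monomialMap _ _ a = monomialMap _ _ a
      induction a using AddMonoidAlgebra.induction_linear with
      | zero => simp
      | add a b ha hb => rw [map_add, map_add, map_add, ← ha, ← hb]; abel
      | single x s =>
        simp only [monomialMap_single]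
        rw [← AddMonoidAlgebra.single_add]
        congr 1
        ring
  obtain ⟨h1, -⟩ := bijective_one_add_of_nilpotent hM hg
    (monomialMap (fun x => (o.baseHWeight h x + 1)⁻¹) fun x => x) (o.filtered_monomialMap _)
  rw [h1 v, map_zero]
  funext i
  change v i + κ (mulVecEnd (o.logMatrix h hΔ) v i) = 0
  have h3 : deriv (o.baseLogD h) (v i) + mulVecEnd (o.logMatrix h hΔ) v i + v i = 0 :=
    congrFun hL i
  conv_lhs => rw [← hκ (v i)]
  rw [← map_add, add_right_comm, h3, map_zero]

end

end SmoothCompleteFan.ConeOrder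

namespace SmoothCompleteFan.ConeOrder

open laurentTower

variable {n d r : ℕ} {Δ : SmoothCompleteFan n d} (o : Δ.ConeOrder r) {h : Fin d → ℤ}

/-! ### Existence of the Deligne extension -/

theorem eq_zero_of_logOp_pow_eq_zero (hΔ : Δ.IsProjective) (hh : Δ.IsStrictlyConvex h) (s : ℕ)
    {x : o.HPM} (hx : o.reduce x = 0) (hL : (o.logOp h ^ s) x = 0) : x = 0 := by
  induction s with
  | zero => exact hL
  | succ s ih =>
    refine ih (o.eq_zero_of_logOp_eq_zero hΔ hh ?_ ?_)
    · rw [reduce_logOp_pow, hx, map_zero]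
    · rw [pow_succ' (o.logOp h) s] at hL
      exact hL

theorem exists_logOp_pow_eq (hΔ : Δ.IsProjective) (hh : Δ.IsStrictlyConvex h) (s : ℕ)
    {y : o.HPM} (hy : o.reduce y = 0) : ∃ x, o.reduce x = 0 ∧ (o.logOp h ^ s) x = y := by
  induction s generalizing y with
  | zero => exact ⟨y, hy, rfl⟩
  | succ s ih =>
    obtain ⟨w, hw, rfl⟩ := o.exists_logOp_eq hΔ hh hy
    obtain ⟨x, hx, rfl⟩ := ih hw
    exact ⟨x, hx, by rw [pow_succ' (o.logOp h) s]; rfl⟩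

/-- For any lift `y`, the class `L^(n+1) y` vanishes on the central fibre by nilpotency of the
residue. As `L` is bijective on such classes, `y` has exactly one correction there that makes it
killed by `L^(n+1)`. -/
theorem existsUnique_logOp_pow (hΔ : Δ.IsProjective) (hh : Δ.IsStrictlyConvex h) (x : o.HfPM) :
    ∃! y, o.reduce y = x ∧ (o.logOp h ^ (n + 1)) y = 0 := by
  obtain ⟨y, hy⟩ := o.reduce_surjective hΔ x
  obtain ⟨w, hw, hw'⟩ := o.exists_logOp_pow_eq hΔ hh (n + 1)
    (y := (o.logOp h ^ (n + 1)) y) (by rw [reduce_logOp_pow, o.logResidue_pow h hΔ])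
  refine ⟨y - w, ⟨by rw [map_sub, hy, hw, sub_zero], by rw [map_sub, hw', sub_self]⟩, ?_⟩
  rintro z ⟨hz, hz'⟩
  rw [← sub_eq_zero]
  refine o.eq_zero_of_logOp_pow_eq_zero hΔ hh (n + 1) ?_ ?_
  · rw [map_sub, map_sub, hz, hy, hw, sub_zero, sub_self]
  · rw [map_sub, map_sub, hz', hw', sub_self, sub_zero]

theorem logOp_pow_comm {T : o.HPM → o.HPM} (hT : ∀ x, o.logOp h (T x) = T (o.logOp h x)) (s : ℕ)
    (x : o.HPM) : (o.logOp h ^ s) (T x) = T ((o.logOp h ^ s) x) := by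
  induction s with
  | zero => rfl
  | succ s ih =>
    rw [pow_succ' (o.logOp h) s]
    change o.logOp h ((o.logOp h ^ s) (T x)) = T (o.logOp h ((o.logOp h ^ s) x))
    rw [ih, hT]

theorem twistHPM_theta_ofLaurent_smul (j : Fin d) (g : LaurentSeries ℂ) (x : o.HPM) :
    o.twistHPM (o.theta j) (fun i => o.thetaRel_comm_theta i j) ((ofLaurent g : o.RPM) • x) =
      (ofLaurent g : o.RPM) •
        o.twistHPM (o.theta j) (fun i => o.thetaRel_comm_theta i j) x :=
  o.twistHPM_ofLaurent_smul (o.theta j) _ _ (o.logDerivation_structureMap _) g x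

theorem logOp_twistHPM_theta (j : Fin d) (x : o.HPM) :
    o.logOp h (o.twistHPM (o.theta j) (fun i => o.thetaRel_comm_theta i j) x) =
      o.twistHPM (o.theta j) (fun i => o.thetaRel_comm_theta i j) (o.logOp h x) := by
  rw [logOp_apply, logOp_apply, ← ofLaurent_uInv, twistHPM_theta_ofLaurent_smul,
    o.twistHPM_comm (o.logD h) (o.logD_thetaRel h) (o.theta j) _ 0, zero_smul, add_zero]
  intro a
  rw [zero_smul, add_zero]
  exact logDerivation_comm _ _ a

/-- The twist raises the degree by `2` and `u⁻¹` lowers it by `2`. -/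
theorem logOp_eulerHPM (x : o.HPM) : o.logOp h (o.eulerHPM x) = o.eulerHPM (o.logOp h x) := by
  have h1 : o.baseEuler (uInv : o.RPM) = (-2 : ℤ) • uInv := by
    have h2 : deriv o.baseWeight (uInv : o.RPM) = 0 := by
      rw [← ofLaurent_uInv, deriv_ofLaurent]
    have h3 : uDeriv (uInv : o.RPM) = (-1 : ℤ) • uInv := by
      have := uDeriv_monomial_mul (-1) (1 : o.BaseRing) (1 : o.RPM)
      rw [mul_one, uDeriv_one, mul_zero, add_zero] at this
      exact this
    change (2 : ℤ) • uDeriv (uInv : o.RPM) + deriv o.baseWeight (uInv : o.RPM) = _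
    rw [h2, h3, add_zero, smul_smul]
    rfl
  rw [logOp_apply, logOp_apply, eulerHPM_smul, o.eulerHPM_twistHPM, h1, smul_add, smul_assoc,
    neg_smul, smul_comm (uInv : o.RPM) (2 : ℤ)]
  · abel
  · exact fun a => logDerivation_comm _ _ a

theorem logOp_twistHPM_partialT (i : o.BigIndex) (x : o.HPM) :
    o.logOp h (o.twistHPM (o.partialT i) (fun k => o.thetaRel_comm_partialT k i) x) +
        o.twistHPM (o.partialT i) (fun k => o.thetaRel_comm_partialT k i) x =
      o.twistHPM (o.partialT i) (fun k => o.thetaRel_comm_partialT k i) (o.logOp h x) := by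
  rw [logOp_apply, logOp_apply, ← ofLaurent_uInv,
    o.twistHPM_ofLaurent_smul (o.partialT i) _ _ (o.partialT_structureMap i), ofLaurent_uInv,
    o.twistHPM_comm (o.logD h) (o.logD_thetaRel h) (o.partialT i) _ (-1) (o.logD_partialT h i),
    smul_add, smul_comm (uInv : o.RPM) (-1 : ℤ), smul_smul uInv u, uInv_mul_u, one_smul,
    neg_smul, one_smul, neg_add_cancel_right]

/-- Since `(L + 1) ∂ = ∂ L`, induction on the power of `L` killing `x` gives `(L + 1) ∂ x = 0`, and
`L + 1` is injective. -/
theorem twistHPM_partialT_eq_zero (hΔ : Δ.IsProjective) (hh : Δ.IsStrictlyConvex h) (i : o.BigIndex)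
    (s : ℕ) {x : o.HPM} (hx : (o.logOp h ^ s) x = 0) :
    o.twistHPM (o.partialT i) (fun k => o.thetaRel_comm_partialT k i) x = 0 := by
  induction s generalizing x with
  | zero =>
    have hx : x = 0 := hx
    rw [hx, map_zero]
  | succ s ih =>
    refine o.eq_zero_of_logOp_add_eq_zero hΔ hh ?_
    rw [logOp_twistHPM_partialT]
    refine ih ?_
    rw [pow_succ (o.logOp h) s] at hx
    exact hx

theorem nabla_constField (π : (Fin d → ℤ) →+ Δ.curveLattice) (ν : Δ.curveLattice →+ ℂ)
    (x : o.HPM) : o.nabla π (o.constField ν) x =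
      (ofLaurent (HahnSeries.single (-1) 1) : o.RPM) • ∑ j,
        (ofLaurent (HahnSeries.single 0 (ν (π (Pi.single j 1)))) : o.RPM) •
          o.twistHPM (o.theta j) (fun i => o.thetaRel_comm_theta i j) x := by
  rw [ofLaurent_uInv]
  simp only [ofLaurent_single]
  change (uInv : o.RPM) • (∑ j, (monomial 0 (algebraMap ℂ o.BaseRing (ν (π (Pi.single j 1)))) :
      o.RPM) • o.twistHPM (o.theta j) (fun i => o.thetaRel_comm_theta i j) x +
    ∑ j, (0 : o.RPM) • o.twistHPM (o.partialT j) (fun i => o.thetaRel_comm_partialT i j) x) = _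
  simp only [zero_smul, Finset.sum_const_zero, add_zero]

theorem nabla_tField (π : (Fin d → ℤ) →+ Δ.curveLattice) (i : o.BigIndex) (x : o.HPM) :
    o.nabla π (o.tField i) x = (uInv : o.RPM) •
      o.twistHPM (o.partialT i) (fun k => o.thetaRel_comm_partialT k i) x := by
  change (uInv : o.RPM) • (∑ j, (0 : o.RPM) • o.twistHPM (o.theta j)
      (fun i => o.thetaRel_comm_theta i j) x +
    ∑ j, (((Pi.single i 1 : o.BigIndex → o.RHat) j : o.RPlus) : o.RPM) •
      o.twistHPM (o.partialT j) (fun i => o.thetaRel_comm_partialT i j) x) = _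
  simp only [zero_smul, Finset.sum_const_zero, zero_add]
  rw [Finset.sum_eq_single i]
  · rw [Pi.single_eq_same]
    change _ • (1 : o.RPM) • _ = _
    rw [one_smul]
  · intro j _ hj
    rw [Pi.single_eq_of_ne hj]
    exact zero_smul _ _
  · exact fun hi => absurd (Finset.mem_univ i) hi

theorem reduce_nabla_constField (π : (Fin d → ℤ) →+ Δ.curveLattice) (ν : Δ.curveLattice →+ ℂ)
    (x : o.HPM) : o.reduce (o.nabla π (o.constField ν) x) = o.residue π ν (o.reduce x) := by
  rw [nabla_constField, reduce_ofLaurent_smul, map_sum]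
  simp only [reduce_ofLaurent_smul, reduce_twistHPM_theta]
  rfl

theorem logOp_nabla_constField (π : (Fin d → ℤ) →+ Δ.curveLattice) (ν : Δ.curveLattice →+ ℂ)
    (x : o.HPM) : o.logOp h (o.nabla π (o.constField ν) x) =
      o.nabla π (o.constField ν) (o.logOp h x) := by
  rw [nabla_constField, nabla_constField, logOp_ofLaurent_smul, map_sum]
  simp only [logOp_ofLaurent_smul, logOp_twistHPM_theta]

/-- The extension is the unique lift killed by `L^(n+1)`. Linearity over `ℂ((u))` and compatibility
with the connection and the grading follow by uniqueness, since the operators concerned commute with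
`L`. -/
theorem exists_isDeligneExtension (hΔ : Δ.IsProjective) (π : (Fin d → ℤ) →+ Δ.curveLattice) :
    ∃ DE, o.IsDeligneExtension π DE := by
  obtain ⟨h, hh⟩ := id hΔ
  choose D hD hD' using o.existsUnique_logOp_pow hΔ hh
  have huniq : ∀ {x y}, o.reduce y = x → (o.logOp h ^ (n + 1)) y = 0 → y = D x :=
    fun hx hy => hD' _ _ ⟨hx, hy⟩
  let DE : o.HfPM →ₛₗ[(ofLaurent : LaurentSeries ℂ →+* o.RPM)] o.HPM :=
    { toFun := D
      map_add' := fun x y => (huniq (by rw [map_add, (hD x).1, (hD y).1])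
        (by rw [map_add, (hD x).2, (hD y).2, add_zero])).symm
      map_smul' := fun g x => (huniq (by rw [reduce_ofLaurent_smul, (hD x).1]) (by
        rw [o.logOp_pow_comm (T := fun y => (ofLaurent g : o.RPM) • y)
          (o.logOp_ofLaurent_smul h g), (hD x).2, smul_zero])).symm }
  refine ⟨DE, ⟨fun x => (hD x).1, fun ν x => huniq ?_ ?_, fun i x => ?_, fun x => huniq ?_ ?_⟩⟩
  · rw [reduce_nabla_constField]
    exact congrArg _ (hD x).1
  · rw [o.logOp_pow_comm (o.logOp_nabla_constField π ν)]
    change o.nabla π (o.constField ν) ((o.logOp h ^ (n + 1)) (D x)) = 0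
    rw [(hD x).2, nabla_constField]
    simp only [map_zero, smul_zero, Finset.sum_const_zero]
  · rw [nabla_tField]
    exact (congrArg ((uInv : o.RPM) • ·)
      (o.twistHPM_partialT_eq_zero hΔ hh i (n + 1) (hD x).2)).trans (smul_zero _)
  · rw [reduce_eulerHPM]
    exact congrArg _ (hD x).1
  · rw [o.logOp_pow_comm o.logOp_eulerHPM]
    change o.eulerHPM ((o.logOp h ^ (n + 1)) (D x)) = 0
    rw [(hD x).2, map_zero]

end SmoothCompleteFan.ConeOrder

/-! ### Splitting off negative powers of `u` from matrices congruent to the identity -/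

namespace laurentTower

variable {A : Type*} [CommRing A] {J : Ideal A}

theorem negPart_negPart (x : laurentTower A J) : negPart (negPart x) = negPart x :=
  ext_cf fun k j => by
    rw [cf_negPart, cf_negPart]
    split_ifs <;> rfl

variable {ι : Type*} [Fintype ι]

/-- The map `v ↦ -(M v)_-` on vectors. -/
def negMul (M : Matrix ι ι (laurentTower A J)) : AddMonoid.End (ι → laurentTower A J) where
  toFun v i := -negPart (mulVecEnd M v i)
  map_zero' := funext fun i => by rw [map_zero, Pi.zero_apply, map_zero, neg_zero]
  map_add' v w := funext fun i => by
    rw [map_add, Pi.add_apply, map_add, neg_add]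
    rfl

theorem negMul_apply (M : Matrix ι ι (laurentTower A J)) (v : ι → laurentTower A J) (i : ι) :
    negMul M v i = -negPart (mulVecEnd M v i) := rfl


theorem negMul_mem {M : Matrix ι ι (laurentTower A J)} (hM : ∀ i j, M i j ∈ fil A J 1) (k : ℕ)
    (v : ι → laurentTower A J) (hv : v ∈ filPi ι A J k) :
    negMul M v ∈ filPi ι A J (k + 1) :=
  mem_filPi.2 fun i => neg_mem (negPart_fil (mem_filPi.1 (mulVecEnd_mem hM k hv) i))

/-- Vectors with purely negative exponents are determined by the negative part of `(1 + M) v`. -/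
theorem eq_zero_of_add_mem_plus {M : Matrix ι ι (laurentTower A J)}
    (hM : ∀ i j, M i j ∈ fil A J 1) {v : ι → laurentTower A J} (hv : ∀ i, negPart (v i) = v i)
    (h : ∀ i, v i + mulVecEnd M v i ∈ plus A J) : v = 0 := by
  refine (filtComplete_filPi ι).eq_zero_of_fixed (negMul_mem hM) (funext fun i => ?_)
  have := negPart_eq_zero_iff.2 (h i)
  rw [map_add, hv] at this
  rw [negMul_apply, eq_comm]
  exact eq_neg_of_add_eq_zero_left this

/-- Taking negative parts gives `v = -(M (e + v))_-`, and `M` has positive order. -/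
theorem mem_fil_of_add_mem_plus {M : Matrix ι ι (laurentTower A J)}
    (hM : ∀ i j, M i j ∈ fil A J 1) {e v : ι → laurentTower A J} (hv : ∀ i, negPart (v i) = v i)
    (he : ∀ i, e i ∈ plus A J) (h : ∀ i, (e + v) i + mulVecEnd M (e + v) i ∈ plus A J) (i : ι) :
    v i ∈ fil A J 1 := by
  have h1 := negPart_eq_zero_iff.2 (h i)
  rw [map_add, Pi.add_apply, map_add, hv, negPart_eq_zero_iff.2 (he i), zero_add] at h1
  rw [eq_neg_of_add_eq_zero_left h1]
  exact neg_mem (negPart_fil (mem_filPi.1 (mulVecEnd_mem hM 0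
    (by rw [(filtComplete_filPi ι).zero]; trivial)) i))

/-- The equation `v = -(M (e + v))_-` is solved by a geometric series in the `J`-adic topology; its
solution is a negative part, hence purely negative. -/
theorem exists_add_mem_plus {M : Matrix ι ι (laurentTower A J)}
    (hM : ∀ i j, M i j ∈ fil A J 1) {e : ι → laurentTower A J} (he : ∀ i, e i ∈ plus A J) :
    ∃ v, (∀ i, negPart (v i) = v i) ∧ ∀ i, (e + v) i + mulVecEnd M (e + v) i ∈ plus A J := by
  obtain ⟨v, hv, -⟩ := (filtComplete_filPi ι).exists_sub_eq (negMul_mem hM) (negMul M e)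
  have h1 : ∀ i, v i = negPart (-(mulVecEnd M (e + v) i)) := fun i => by
    have := congrFun hv i
    rw [Pi.sub_apply, sub_eq_iff_eq_add, negMul_apply, negMul_apply] at this
    rw [this, map_neg, map_add, Pi.add_apply, map_add, neg_add]
  refine ⟨v, fun i => ?_, fun i => ?_⟩
  · rw [h1 i, negPart_negPart]
  · rw [← negPart_eq_zero_iff, map_add, Pi.add_apply, map_add, negPart_eq_zero_iff.2 (he i),
      h1 i, negPart_negPart, map_neg, zero_add, neg_add_cancel]

end laurentTower

namespace SmoothCompleteFan.ConeOrder

open laurentTower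

variable {n d r : ℕ} {Δ : SmoothCompleteFan n d} (o : Δ.ConeOrder r)
  (hΔ : Δ.IsProjective) {π : (Fin d → ℤ) →+ Δ.curveLattice}
  {DE : o.HfPM →ₛₗ[(ofLaurent : LaurentSeries ℂ →+* o.RPM)] o.HPM}

/-! ### Birkhoff factorization -/

/-- The deviation from the identity of the matrix expressing `DE(φ_k)` in the frame of the
`φ_j`. -/
def deMatrix (DE : o.HfPM →ₛₗ[(ofLaurent : LaurentSeries ℂ →+* o.RPM)] o.HPM) :
    Matrix (Fin (r + 1)) (Fin (r + 1)) o.RPM :=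
  fun i k => (o.frame hΔ).symm (DE (o.phiHf k)) i - if i = k then 1 else 0

theorem DE_phiHf (k : Fin (r + 1)) : DE (o.phiHf k) =
    o.comb fun i => (if i = k then 1 else 0) + o.deMatrix hΔ DE i k := by
  have e : (fun i => (if i = k then 1 else 0) + o.deMatrix hΔ DE i k) =
      (o.frame hΔ).symm (DE (o.phiHf k)) := by
    funext i
    rw [deMatrix, add_sub_cancel]
  rw [e]
  exact ((o.frame hΔ).apply_symm_apply _).symm

theorem deMatrix_mem (hDE : o.IsDeligneExtension π DE) (i k : Fin (r + 1)) :
    o.deMatrix hΔ DE i k ∈ fil o.BaseRing o.baseIdeal 1 := by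
  refine (o.reduce_comb_eq_zero_iff hΔ fun i => o.deMatrix hΔ DE i k).1 ?_ i
  have e : (fun i => o.deMatrix hΔ DE i k) =
      (fun i => (if i = k then 1 else 0) + o.deMatrix hΔ DE i k) - Pi.single k 1 := by
    funext i
    rw [Pi.sub_apply, Pi.single_apply, add_sub_cancel_left]
  rw [e, map_sub, ← o.DE_phiHf hΔ, map_sub, hDE.reduce_eq, comb_single, reduce_incl_phiHF, sub_self]

theorem sum_smul_DE (b : Fin (r + 1) → o.RPM) : ∑ i, b i • DE (o.phiHf i) =
    o.comb fun i => b i + mulVecEnd (o.deMatrix hΔ DE) b i := by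
  have e : (fun i => b i + mulVecEnd (o.deMatrix hΔ DE) b i) =
      ∑ k, b k • fun i => (if i = k then 1 else 0) + o.deMatrix hΔ DE i k := by
    funext i
    rw [Finset.sum_apply, mulVecEnd_apply]
    simp only [Pi.smul_apply, smul_eq_mul, mul_add, Finset.sum_add_distrib]
    congr 1
    · simp
    · exact Finset.sum_congr rfl fun k _ => mul_comm _ _
  rw [e, map_sum]
  exact Finset.sum_congr rfl fun k _ => by rw [LinearMap.map_smul, ← o.DE_phiHf hΔ]

/-- The factorization problem is solved column by column: for the column `e_k` one finds a purely
negative correction after which the coordinates in the `φ_i` are power series. -/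
theorem exists_isBirkhoff (hΔ : Δ.IsProjective) (hDE : o.IsDeligneExtension π DE) :
    ∃ B C, o.IsBirkhoff DE B C := by
  have h1 : ∀ k i : Fin (r + 1), (Pi.single k 1 : Fin (r + 1) → o.RPM) i ∈ o.RPlus := by
    intro k i
    rw [Pi.single_apply]
    split_ifs
    exacts [one_mem _, zero_mem _]
  choose x hx hx' using fun k => exists_add_mem_plus (o.deMatrix_mem hΔ hDE) (h1 k)
  refine ⟨fun i k => ((Pi.single k 1 : Fin (r + 1) → o.RPM) + x k) i, fun i k => ⟨_, hx' k i⟩,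
    fun i k => ?_, fun k => ?_⟩
  · obtain ⟨y, hy, e⟩ := negPart_eq_self_iff.1 (hx k i)
    refine ⟨y, hy, ?_⟩
    rw [Pi.add_apply, e, Pi.single_apply, Matrix.one_apply]
  · rw [o.sum_smul_DE hΔ, comb_apply]

/-! ### Birkhoff factorizations give primitive forms -/

variable {B : Matrix (Fin (r + 1)) (Fin (r + 1)) o.RPM}
  {C : Matrix (Fin (r + 1)) (Fin (r + 1)) o.RPlus}

/-- The first member of the factorized basis, as a class in `ℋ_F`. -/
def zeta (C : Matrix (Fin (r + 1)) (Fin (r + 1)) o.RPlus) : o.HF := o.combHF fun i => C i 0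

theorem incl_zeta (hB : o.IsBirkhoff DE B C) : o.incl (o.zeta C) = o.phiTilde DE B 0 := by
  rw [zeta, incl_combHF, comb_apply, phiTilde, hB.eq]

theorem exists_entry (hB : o.IsBirkhoff DE B C) (i : Fin (r + 1)) :
    ∃ y ∈ o.RMinus, B i 0 = (if i = 0 then 1 else 0) + uInv * y := by
  obtain ⟨y, hy, e⟩ := hB.minus i 0
  exact ⟨y, hy, by rw [e, Matrix.one_apply]⟩

theorem uInv_mem_minus : (uInv : o.RPM) ∈ o.RMinus :=
  monomial_mem _ _ (by simp) _

theorem entry_mem_minus (hB : o.IsBirkhoff DE B C) (i : Fin (r + 1)) : B i 0 ∈ o.RMinus := by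
  obtain ⟨y, hy, e⟩ := o.exists_entry hB i
  rw [e]
  refine add_mem ?_ (mul_mem o.uInv_mem_minus hy)
  split_ifs
  exacts [one_mem _, zero_mem _]

theorem uInv_smul_DE_mem (i : Fin (r + 1)) : (uInv : o.RPM) • DE (o.phiHf i) ∈ o.HMinus DE :=
  Submodule.subset_span ⟨i, rfl⟩

theorem smul_mem_HMinus {a : o.RPM} (ha : a ∈ o.RMinus) {x : o.HPM} (hx : x ∈ o.HMinus DE) :
    a • x ∈ o.HMinus DE := (o.HMinus DE).smul_mem ⟨a, ha⟩ hx

theorem zeta_mem (hB : o.IsBirkhoff DE B C) :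
    ∃ y ∈ o.HMinus DE, o.incl (o.zeta C) = (u : o.RPM) • y := by
  refine ⟨∑ i, B i 0 • (uInv : o.RPM) • DE (o.phiHf i), sum_mem fun i _ =>
    o.smul_mem_HMinus (o.entry_mem_minus hB i) (o.uInv_smul_DE_mem i), ?_⟩
  rw [o.incl_zeta hB, phiTilde, Finset.smul_sum]
  refine Finset.sum_congr rfl fun i _ => ?_
  rw [smul_smul, smul_smul, mul_right_comm, u_mul_uInv, one_mul]

theorem uInv_smul_DE_mem_of_mem_phiSpan {x : o.HfPM} (hx : x ∈ o.phiSpan) :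
    (uInv : o.RPM) • DE x ∈ o.HMinus DE := by
  refine AddSubgroup.closure_induction (p := fun x _ => (uInv : o.RPM) • DE x ∈ o.HMinus DE)
    ?_ ?_ ?_ ?_ hx
  · rintro _ ⟨i, rfl⟩
    exact o.uInv_smul_DE_mem i
  · rw [map_zero, smul_zero]
    exact zero_mem _
  · intro x y _ _ hx hy
    rw [map_add, smul_add]
    exact add_mem hx hy
  · intro x _ hx
    rw [map_neg, smul_neg]
    exact neg_mem hx

/-- The residue of `φ_i` is `u⁻¹` times a complex combination of elements of the integral span of
the `φ_k`. The absence of positive powers of `u` in these combinations is essential. -/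
theorem DE_residue_mem (ν : Δ.curveLattice →+ ℂ) (i : Fin (r + 1)) :
    DE (o.residue π ν (o.phiHf i)) ∈ o.HMinus DE := by
  rw [residue, map_smulₛₗ, ofLaurent_uInv, map_sum, Finset.smul_sum]
  refine sum_mem fun j _ => ?_
  rw [map_smulₛₗ, smul_comm, ofLaurent_single]
  exact o.smul_mem_HMinus (monomial_mem _ _ (by simp) _)
    (o.uInv_smul_DE_mem_of_mem_phiSpan (o.twistHf_phiHf_mem j i))

/-- The part of the entry of order zero in `u` is `0` or `1`, which derivations kill. -/
theorem deriv_entry (hB : o.IsBirkhoff DE B C) (D : Derivation ℂ o.BaseRing o.BaseRing)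
    (i : Fin (r + 1)) : ∃ y ∈ o.RMinus, deriv D (B i 0) = uInv * y := by
  obtain ⟨y, hy, e⟩ := o.exists_entry hB i
  refine ⟨deriv D y, deriv_mem _ D hy, ?_⟩
  have h1 : deriv D (if i = 0 then 1 else 0 : o.RPM) = 0 := by
    split_ifs
    · rw [← map_one (ofLaurent : LaurentSeries ℂ →+* o.RPM), deriv_ofLaurent]
    · exact map_zero _
  rw [e, map_add, h1, zero_add, laurentTower.deriv_mul, ← ofLaurent_uInv, deriv_ofLaurent,
    zero_mul, zero_add]

theorem deriv_entry_smul_mem (hB : o.IsBirkhoff DE B C) (D : Derivation ℂ o.BaseRing o.BaseRing)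
    (i : Fin (r + 1)) : deriv D (B i 0) • DE (o.phiHf i) ∈ o.HMinus DE := by
  obtain ⟨y, hy, e⟩ := o.deriv_entry hB D i
  rw [e, mul_comm, mul_smul]
  exact o.smul_mem_HMinus hy (o.uInv_smul_DE_mem i)

theorem uInv_smul_twistHPM_smul (D : Derivation ℂ o.TotalRing o.TotalRing)
    (hD : ∀ i a, D (o.thetaRel i a) = o.thetaRel i (D a))
    (D₀ : Derivation ℂ o.BaseRing o.BaseRing)
    (h₀ : ∀ a, D (o.structureMap a) = o.structureMap (D₀ a)) (a : o.RPM) (x : o.HPM) :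
    (uInv : o.RPM) • o.twistHPM D hD (a • x) =
      deriv D₀ a • x + a • (uInv : o.RPM) • o.twistHPM D hD x := by
  rw [o.twistHPM_smul D hD D₀ h₀, smul_add, smul_smul, ← mul_assoc, uInv_mul_u, one_mul, smul_comm]

/-- The derivation `θ_j` on the base. -/
def baseTheta (j : Fin d) : Derivation ℂ o.BaseRing o.BaseRing :=
  logDerivation ((((Int.castAddHom ℂ).comp ((Pi.evalAddMonoidHom (fun _ : Fin d => ℤ) j).comp
    Δ.totalMonoid.subtype)).comp (AddMonoidHom.fst _ _)).comp o.expIncl)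

theorem theta_structureMap (j : Fin d) (a : o.BaseRing) :
    o.theta j (o.structureMap a) = o.structureMap (o.baseTheta j a) :=
  o.logDerivation_structureMap _ a

/-- By the Leibniz rule each term `b_i DE(φ_i)` contributes a derivative of `b_i`, which is a
multiple of `u⁻¹`, and `b_i` times the extension of the residue of `φ_i`. -/
theorem nabla_constField_mem (hDE : o.IsDeligneExtension π DE) (hB : o.IsBirkhoff DE B C)
    (ν : Δ.curveLattice →+ ℂ) :
    o.nabla π (o.constField ν) (o.incl (o.zeta C)) ∈ o.HMinus DE := by
  have h0 : ∀ j, (ofLaurent (HahnSeries.single 0 (ν (π (Pi.single j 1)))) : o.RPM) ∈ o.RMinus :=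
    fun j => by
      rw [ofLaurent_single]
      exact monomial_mem _ _ (by simp) _
  have h1 : ∀ (a : o.RPM) (x : o.HPM), o.nabla π (o.constField ν) (a • x) =
      ∑ j, (ofLaurent (HahnSeries.single 0 (ν (π (Pi.single j 1)))) : o.RPM) •
        deriv (o.baseTheta j) a • x +
      a • o.nabla π (o.constField ν) x := by
    intro a x
    rw [nabla_constField, nabla_constField, Finset.smul_sum, Finset.smul_sum, Finset.smul_sum,
      ← Finset.sum_add_distrib]
    refine Finset.sum_congr rfl fun j _ => ?_
    rw [smul_comm, ofLaurent_uInv, o.uInv_smul_twistHPM_smul (o.theta j) _ _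
      (o.theta_structureMap j), smul_add]
    congr 1
    simp only [smul_smul]
    congr 1
    ring
  have h2 : ∀ x y, o.nabla π (o.constField ν) (x + y) =
      o.nabla π (o.constField ν) x + o.nabla π (o.constField ν) y := by
    intro x y
    simp only [nabla_constField, map_add, smul_add, Finset.sum_add_distrib]
  have h3 : o.nabla π (o.constField ν) (∑ i, B i 0 • DE (o.phiHf i)) =
      ∑ i, o.nabla π (o.constField ν) (B i 0 • DE (o.phiHf i)) :=
    map_sum (AddMonoidHom.mk' _ h2) _ _
  rw [o.incl_zeta hB, phiTilde, h3]
  refine sum_mem fun i _ => ?_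
  rw [h1, hDE.nabla_const]
  exact add_mem (sum_mem fun j _ => o.smul_mem_HMinus (h0 j) (o.deriv_entry_smul_mem hB _ i))
    (o.smul_mem_HMinus (o.entry_mem_minus hB i) (o.DE_residue_mem ν i))

/-- The sections `DE(φ_i)` are flat in the direction `t_l`, so only the derivatives of the
coefficients remain. -/
theorem nabla_tField_mem (hDE : o.IsDeligneExtension π DE) (hB : o.IsBirkhoff DE B C)
    (l : o.BigIndex) : o.nabla π (o.tField l) (o.incl (o.zeta C)) ∈ o.HMinus DE := by
  rw [nabla_tField, o.incl_zeta hB, phiTilde, map_sum, Finset.smul_sum]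
  refine sum_mem fun i _ => ?_
  rw [o.uInv_smul_twistHPM_smul (o.partialT l) _ _ (o.partialT_structureMap l), ← o.nabla_tField π,
    hDE.nabla_t, smul_zero, add_zero]
  exact o.deriv_entry_smul_mem hB _ i

/-- The `k`-th coordinate of a curve class. -/
def coordField (Δ : SmoothCompleteFan n d) (k : Fin d) : Δ.curveLattice →+ ℂ :=
  (Int.castAddHom ℂ).comp ((Pi.evalAddMonoidHom (fun _ : Fin d => ℤ) k).comp
    Δ.curveLattice.subtype)

/-- As `π` is the identity on curve classes, `π x` may be expanded in coordinates and projected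
again. -/
theorem map_splitting {M : Type*} [AddCommGroup M] (hπ : ∀ p : Δ.curveLattice, π p = p)
    (ν : Δ.curveLattice →+ M) (x : Fin d → ℤ) :
    ν (π x) = ∑ k, (π x).1 k • ν (π (Pi.single k 1)) := by
  have h1 : (π x).1 = ∑ k, (π x).1 k • (Pi.single k 1 : Fin d → ℤ) := by
    conv_lhs => rw [pi_eq_sum_univ' (π x).1]
  conv_lhs => rw [← hπ (π x), h1, map_sum, map_sum]
  exact Finset.sum_congr rfl fun k _ => by rw [map_zsmul, map_zsmul]

theorem coe_zsmul_hat (c : ℤ) (a : o.RHat) :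
    (((c • a : o.RHat) : o.RPlus) : o.RPM) = ofLaurent (HahnSeries.single 0 (c : ℂ)) *
      ((a : o.RPlus) : o.RPM) := by
  have h1 : (HahnSeries.single 0 (c : ℂ) : LaurentSeries ℂ) = ((c : ℤ) : LaurentSeries ℂ) := by
    rw [← map_intCast (HahnSeries.C : ℂ →+* LaurentSeries ℂ) c]
    rfl
  rw [h1, map_intCast, ← zsmul_eq_mul]
  rfl

/-- The connection is linear in the field, and the splitting writes every `ν` as a combination of
the restricted coordinate functions. Constant fields and the `∂/∂t_i` therefore suffice. -/
theorem nabla_eq_sum (hπ : ∀ p : Δ.curveLattice, π p = p) (v : o.LogFields) (x : o.HPM) :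
    o.nabla π v x =
      ∑ k, ((v.1 (π (Pi.single k 1)) : o.RPlus) : o.RPM) •
        o.nabla π (o.constField (coordField Δ k)) x +
      ∑ i, ((v.2 i : o.RPlus) : o.RPM) • o.nabla π (o.tField i) x := by
  simp only [nabla_tField, nabla_constField]
  rw [nabla, smul_add, Finset.smul_sum, Finset.smul_sum]
  congr 1
  · have h1 : ∀ j, ((v.1 (π (Pi.single j 1)) : o.RPlus) : o.RPM) =
        ∑ k, ofLaurent (HahnSeries.single 0 (((π (Pi.single j 1)).1 k : ℤ) : ℂ)) *
          ((v.1 (π (Pi.single k 1)) : o.RPlus) : o.RPM) := by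
      intro j
      conv_lhs => rw [map_splitting hπ v.1 (Pi.single j 1)]
      rw [AddSubmonoidClass.coe_finsetSum, AddSubmonoidClass.coe_finsetSum]
      exact Finset.sum_congr rfl fun k _ => o.coe_zsmul_hat _ _
    simp only [Finset.smul_sum, ofLaurent_uInv]
    rw [Finset.sum_comm]
    refine Finset.sum_congr rfl fun j _ => ?_
    rw [h1 j, Finset.sum_smul, Finset.smul_sum]
    refine Finset.sum_congr rfl fun k _ => ?_
    rw [smul_comm _ (uInv : o.RPM), smul_smul _ (ofLaurent _), mul_comm]
    rfl
  · exact Finset.sum_congr rfl fun i _ => smul_comm _ _ _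

theorem coe_hat_mem_minus (a : o.RHat) : ((a : o.RPlus) : o.RPM) ∈ o.RMinus := by
  intro k j hj
  refine a.2 k j fun h0 => hj ?_
  rw [AddSubmonoid.mem_bot.1 h0]
  exact zero_mem _

theorem nabla_zeta_mem (hπ : ∀ p : Δ.curveLattice, π p = p) (hDE : o.IsDeligneExtension π DE)
    (hB : o.IsBirkhoff DE B C) (v : o.LogFields) :
    o.nabla π v (o.incl (o.zeta C)) ∈ o.HMinus DE := by
  rw [o.nabla_eq_sum hπ]
  exact add_mem
    (sum_mem fun k _ => o.smul_mem_HMinus (o.coe_hat_mem_minus _) (o.nabla_constField_mem hDE hB _))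
    (sum_mem fun i _ => o.smul_mem_HMinus (o.coe_hat_mem_minus _) (o.nabla_tField_mem hDE hB i))

end SmoothCompleteFan.ConeOrder

/-! ### Negative parts under derivations, and constant coefficients in `u` -/

namespace laurentTower

variable {A : Type*} [CommRing A] {J : Ideal A}

theorem negPart_uDeriv (x : laurentTower A J) : negPart (uDeriv x) = uDeriv (negPart x) :=
  ext_cf fun k j => by
    rw [cf_negPart, cf_uDeriv, cf_uDeriv, cf_negPart]
    split_ifs
    · rfl
    · rw [smul_zero]

theorem negPart_deriv [Algebra ℂ A] (D : Derivation ℂ A A) (x : laurentTower A J) :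
    negPart (deriv D x) = deriv D (negPart x) :=
  ext_cf fun k j => by
    have h : ∀ a ∈ J ^ (k + 1 + 1), (D : A →+ A) a ∈ J ^ (k + 1) := fun _ ha => deriv_mem_pow D _ ha
    change (if j < 0 then quotMap (D : A →+ A) _ _ h (cf (k + 1) j x) else 0) =
      quotMap (D : A →+ A) _ _ h (if j < 0 then cf (k + 1) j x else 0)
    split_ifs
    · rfl
    · rw [map_zero]

/-- The constant coefficient of a series in `u`. -/
def zeroPart : laurentTower A J →+ laurentTower A J where
  toFun x := ofCoeff (fun k j => if j = 0 then cf k j x else 0)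
    (fun k => ⟨0, fun j hj => if_neg hj.ne⟩)
    fun k j => by split_ifs; exacts [factor_cf x k j, map_zero _]
  map_zero' := ext_cf fun k j => by simp
  map_add' x y := ext_cf fun k j => by
    rw [map_add, cf_ofCoeff, cf_ofCoeff, cf_ofCoeff]
    split_ifs <;> simp

theorem cf_zeroPart (x : laurentTower A J) (k : ℕ) (j : ℤ) :
    cf k j (zeroPart x) = if j = 0 then cf k j x else 0 := rfl

theorem zeroPart_mem (x : laurentTower A J) : zeroPart x ∈ supportedIn A J ⊥ := fun k j hj => by
  change cf k j (zeroPart x) = 0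
  rw [cf_zeroPart, if_neg fun h : j = 0 => hj (h ▸ zero_mem _)]

theorem zeroPart_fil {k : ℕ} {x : laurentTower A J} (hx : x ∈ fil A J k) :
    zeroPart x ∈ fil A J k := fun i hi j => by
  rw [cf_zeroPart, hx i hi, ite_self]

theorem zeroPart_of_mem {x : laurentTower A J} (hx : x ∈ supportedIn A J ⊥) : zeroPart x = x :=
  ext_cf fun k j => by
    rw [cf_zeroPart]
    split_ifs with hj
    · rfl
    · exact (hx k j fun h => hj (AddSubmonoid.mem_bot.1 h)).symm

theorem zeroPart_mul {a : laurentTower A J} (ha : a ∈ supportedIn A J ⊥) (x : laurentTower A J) :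
    zeroPart (a * x) = a * zeroPart x := by
  refine ext_cf fun k j => ?_
  have hs : (a.1 k).support ⊆ {0} := fun i hi => by
    by_contra h
    exact hi (ha k i fun h' => h (AddSubmonoid.mem_bot.1 h'))
  have h0 : ({0} : Set ℤ).IsPWO := (Set.finite_singleton 0).isPWO
  have hx := (x.1 k).isPWO_support
  have hz : ((zeroPart x).1 k).support ⊆ (x.1 k).support := fun i hi h => hi (by
    change cf k i (zeroPart x) = 0
    have h : cf k i x = 0 := h
    rw [cf_zeroPart, h, ite_self])
  rw [cf_zeroPart, cf_mul_eq_sum _ _ k j h0 hx hs subset_rfl, cf_mul_eq_sum _ _ k j h0 hx hs hz]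
  split_ifs with hj
  · refine Finset.sum_congr rfl fun p hp => ?_
    obtain ⟨h1, -, h2⟩ := Finset.mem_antidiagonal.1 hp
    rw [Set.mem_singleton_iff.1 h1, zero_add, hj] at h2
    rw [cf_zeroPart, if_pos h2]
  · refine (Finset.sum_eq_zero fun p hp => ?_).symm
    obtain ⟨h1, -, h2⟩ := Finset.mem_antidiagonal.1 hp
    rw [Set.mem_singleton_iff.1 h1, zero_add] at h2
    rw [cf_zeroPart, if_neg (h2 ▸ hj), mul_zero]

theorem zeroPart_eq_zero_iff {x : laurentTower A J} (hx : x ∈ plus A J) :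
    zeroPart x = 0 ↔ ∃ y ∈ plus A J, x = u * y := by
  constructor
  · intro h
    refine ⟨uInv * x, mem_plus.2 fun k j hj => ?_, by rw [← mul_assoc, u_mul_uInv, one_mul]⟩
    rw [uInv, cf_monomial_mul]
    rcases lt_or_eq_of_le (show j - -1 ≤ 0 by omega) with h1 | h1
    · rw [mem_plus.1 hx k _ h1, mul_zero]
    · have := congrArg (cf k 0) h
      rw [cf_zeroPart, if_pos rfl, map_zero] at this
      rw [h1, this, mul_zero]
  · rintro ⟨y, hy, rfl⟩
    refine ext_cf fun k j => ?_
    rw [cf_zeroPart, map_zero]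
    split_ifs with hj
    · rw [cf_u_mul, hj, mem_plus.1 hy k _ (by omega)]
    · rfl

end laurentTower

namespace SmoothCompleteFan.ConeOrder

open laurentTower

variable {n d r : ℕ} {Δ : SmoothCompleteFan n d} (o : Δ.ConeOrder r)
  {π : (Fin d → ℤ) →+ Δ.curveLattice}
  {DE : o.HfPM →ₛₗ[(ofLaurent : LaurentSeries ℂ →+* o.RPM)] o.HPM}
  {B : Matrix (Fin (r + 1)) (Fin (r + 1)) o.RPM}
  {C : Matrix (Fin (r + 1)) (Fin (r + 1)) o.RPlus}

/-! ### Homogeneity -/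

theorem phiDeg_zero : o.phiDeg 0 = 0 := by
  rw [phiDeg, tau_zero, Finset.card_empty]
  rfl

theorem negPart_baseEuler (x : o.RPM) : negPart (o.baseEuler x) = o.baseEuler (negPart x) := by
  change negPart ((2 : ℤ) • uDeriv x + deriv o.baseWeight x) =
    (2 : ℤ) • uDeriv (negPart x) + deriv o.baseWeight (negPart x)
  rw [map_add, map_zsmul, negPart_uDeriv, negPart_deriv]

theorem baseEuler_one : o.baseEuler 1 = 0 := by
  change (2 : ℤ) • uDeriv (1 : o.RPM) + deriv o.baseWeight (1 : o.RPM) = 0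
  rw [uDeriv_one, ← map_one (ofLaurent : LaurentSeries ℂ →+* o.RPM), deriv_ofLaurent, smul_zero,
    add_zero]

theorem eulerHf_phiHf (i : Fin (r + 1)) : o.eulerHf (o.phiHf i) = o.phiDeg i • o.phiHf i := by
  have h1 : o.fiberWeight (Ideal.Quotient.mk _ (o.phi i)) =
      o.phiDeg i • Ideal.Quotient.mk o.totalIdeal (o.phi i) := by
    refine Eq.trans ?_ (map_zsmul (Ideal.Quotient.mk o.totalIdeal) _ _)
    exact congrArg (Ideal.Quotient.mk o.totalIdeal) (o.weight_coneMonomial _ _)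
  have h2 : o.fiberEulerFun (o.fiberMonomial 0 (Ideal.Quotient.mk _ (o.phi i))) =
      o.phiDeg i • o.fiberMonomial 0 (Ideal.Quotient.mk _ (o.phi i)) := by
    have h3 : o.fiberUDeriv (o.fiberMonomial 0 (Ideal.Quotient.mk _ (o.phi i))) = 0 := by
      refine HahnSeries.ext (funext fun k => ?_)
      change k • (HahnSeries.single (0 : ℤ) (Ideal.Quotient.mk o.totalIdeal (o.phi i))).coeff k = 0
      rw [HahnSeries.coeff_single]
      split_ifs with hk
      · rw [hk, zero_smul]
      · rw [smul_zero]
    change (2 : ℤ) • o.fiberUDeriv _ + o.fiberDeriv o.fiberWeight _ = _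
    rw [h3, smul_zero, zero_add, fiberDeriv_fiberMonomial, h1]
    exact map_zsmul (HahnSeries.single.addMonoidHom (R := o.FiberRing) (0 : ℤ)) _ _
  refine Coh.mk_congr ?_ Submodule.mem_top (funext fun I => ?_)
  · have e : polyEuler n o.fiberEulerFun (o.Qf (degreeZero n
        (o.fiberMonomial 0 (Ideal.Quotient.mk _ (o.phi i))))) = _ :=
      polyEuler_koszul o.fiberEulerFun o.fiberQOp o.fiberEulerFun_qOp _
    have e' : o.Qf (degreeZero n (o.fiberMonomial 0 (Ideal.Quotient.mk _ (o.phi i)))) = 0 :=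
      koszul_degreeZero o.fiberQOp _
    rw [e', map_zero] at e
    exact e.symm
  · change o.fiberEulerFun (degreeZero n _ I) + (2 * (I.card : ℤ)) • degreeZero n _ I =
      o.phiDeg i • degreeZero n _ I
    unfold degreeZero
    split_ifs with hI
    · rw [hI, Finset.card_empty, Nat.cast_zero, mul_zero, zero_smul, add_zero, h2]
    · rw [map_zero, smul_zero, smul_zero, add_zero]

theorem incl_eulerHF (x : o.HF) : o.incl (o.eulerHF x) = o.eulerHPM (o.incl x) := by
  obtain ⟨α, hα, hα', rfl⟩ := Coh.exists_rep x
  rfl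

theorem exists_incl_eq_comb (hΔ : Δ.IsProjective) (x : o.HF) :
    ∃ c : Fin (r + 1) → o.RPlus, o.incl x = o.comb fun i => (c i : o.RPM) := by
  obtain ⟨c, rfl⟩ := o.combHF_surjective hΔ x
  exact ⟨c, o.incl_combHF c⟩

/-- In terms of the `DE(φ_i)` the coefficients of `E_F ζ` are purely negative, because the constant
`1` at `φ_0` has degree zero and `deg φ_0 = 0`. Since `E_F ζ` also lies in `ℋ_F`, uniqueness in the
factorization makes it zero. -/
theorem eulerHF_zeta (hΔ : Δ.IsProjective) (hDE : o.IsDeligneExtension π DE)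
    (hB : o.IsBirkhoff DE B C) : o.eulerHF (o.zeta C) = 0 := by
  apply o.incl_injective hΔ
  rw [map_zero, incl_eulerHF, o.incl_zeta hB, phiTilde, map_sum]
  have h1 : ∀ i, o.eulerHPM (B i 0 • DE (o.phiHf i)) =
      (o.baseEuler (B i 0) + o.phiDeg i • B i 0) • DE (o.phiHf i) := by
    intro i
    rw [eulerHPM_smul, hDE.euler, eulerHf_phiHf, map_zsmul, add_smul, smul_comm, smul_assoc]
  have h2 : (fun i => o.baseEuler (B i 0) + o.phiDeg i • B i 0) = 0 := by
    refine eq_zero_of_add_mem_plus (o.deMatrix_mem hΔ hDE) (fun i => ?_) fun i => ?_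
    · obtain ⟨y, hy, e⟩ := o.exists_entry hB i
      have h3 : laurentTower.negPart (uInv * y) = uInv * y := negPart_eq_self_iff.2 ⟨y, hy, rfl⟩
      have h4 : o.baseEuler (B i 0) + o.phiDeg i • B i 0 =
          o.baseEuler (uInv * y) + o.phiDeg i • (uInv * y) := by
        rw [e, map_add, smul_add]
        split_ifs with hi
        · rw [hi, phiDeg_zero, baseEuler_one, zero_smul, zero_smul, zero_add, zero_add]
        · rw [map_zero, smul_zero, zero_add, zero_add]
      change negPart (o.baseEuler (B i 0) + o.phiDeg i • B i 0) =
        o.baseEuler (B i 0) + o.phiDeg i • B i 0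
      rw [h4, map_add, map_zsmul, negPart_baseEuler, h3]
    · obtain ⟨c, hc⟩ := o.exists_incl_eq_comb hΔ (o.eulerHF (o.zeta C))
      rw [incl_eulerHF, o.incl_zeta hB, phiTilde, map_sum, Finset.sum_congr rfl fun i _ => h1 i,
        o.sum_smul_DE hΔ] at hc
      have := congrFun (o.comb_injective hΔ hc) i
      rw [this]
      exact (c i).2
  refine Finset.sum_eq_zero fun i _ => ?_
  rw [h1, congrFun h2 i]
  exact zero_smul _ _

/-! ### The lattice of curve classes -/

theorem rayMap_single (k : Fin d) : Δ.rayMap (Pi.single k 1) = Δ.ray k := by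
  rw [Δ.rayMap_apply, Finset.sum_eq_single k]
  · rw [Pi.single_eq_same, one_smul]
  · intro i _ hi
    rw [Pi.single_eq_of_ne hi, zero_smul]
  · exact fun h => absurd (Finset.mem_univ k) h

/-- The splitting of `ℤ^d → N` defined by the basis of a maximal cone. -/
def coneSplitting {σ : Finset (Fin d)} (hσ : σ ∈ Δ.maxCones) : (Fin d → ℤ) →+ Δ.curveLattice where
  toFun x := ⟨x - ∑ k ∈ σ, (Δ.dual hσ k ⬝ᵥ Δ.rayMap x) • Pi.single k 1, by
    change Δ.rayMap _ = 0
    rw [map_sub, map_sum]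
    simp only [map_zsmul, rayMap_single]
    rw [Δ.sum_dual hσ, sub_self]⟩
  map_zero' := Subtype.ext (by simp)
  map_add' x y := Subtype.ext (by
    simp only [map_add, dotProduct_add, add_smul, Finset.sum_add_distrib]
    change _ = (_ - _) + (_ - _)
    abel)

theorem coneSplitting_coe {σ : Finset (Fin d)} (hσ : σ ∈ Δ.maxCones) (x : Fin d → ℤ) :
    (coneSplitting hσ x).1 = x - ∑ k ∈ σ, (Δ.dual hσ k ⬝ᵥ Δ.rayMap x) • Pi.single k 1 := rfl

theorem coneSplitting_self {σ : Finset (Fin d)} (hσ : σ ∈ Δ.maxCones) (p : Δ.curveLattice) :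
    coneSplitting hσ p = p := by
  refine Subtype.ext ?_
  have h : Δ.rayMap p.1 = 0 := p.2
  rw [coneSplitting_coe, h]
  simp

theorem coneSplitting_single {σ : Finset (Fin d)} (hσ : σ ∈ Δ.maxCones) {k : Fin d} (hk : k ∈ σ) :
    coneSplitting hσ (Pi.single k 1) = 0 := by
  refine Subtype.ext ?_
  rw [coneSplitting_coe, rayMap_single, Finset.sum_eq_single k]
  · rw [Δ.dual_ray hσ hk hk, if_pos rfl, one_smul, sub_self]
    rfl
  · intro j hj hjk
    rw [Δ.dual_ray hσ hj hk, if_neg hjk.symm, zero_smul]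
  · exact fun h => absurd hk h

/-- A functional on `ℤ^d` vanishing on the curve classes comes from `N`. -/
theorem exists_dotProduct_eq {σ : Finset (Fin d)} (hσ : σ ∈ Δ.maxCones) (f : (Fin d → ℤ) →+ ℤ)
    (hf : ∀ p : Δ.curveLattice, f p = 0) :
    ∃ m : Fin n → ℤ, ∀ j, f (Pi.single j 1) = m ⬝ᵥ Δ.ray j := by
  refine ⟨∑ k ∈ σ, f (Pi.single k 1) • Δ.dual hσ k, fun j => ?_⟩
  have h1 := hf (coneSplitting hσ (Pi.single j 1))
  rw [coneSplitting_coe, map_sub, map_sum, sub_eq_zero, rayMap_single] at h1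
  rw [h1, sum_dotProduct]
  refine Finset.sum_congr rfl fun k _ => ?_
  rw [map_zsmul, smul_dotProduct, smul_eq_mul, smul_eq_mul, mul_comm]

/-- The splitting attached to `σ` kills the `e_k` with `k ∈ σ`; the coordinates at the rays outside
`σ` are thus a basis of the dual of `A_1(Y, ℤ)`. -/
theorem map_curveLattice {M : Type*} [AddCommGroup M] {σ : Finset (Fin d)} (hσ : σ ∈ Δ.maxCones)
    (ν : Δ.curveLattice →+ M) (p : Δ.curveLattice) :
    ν p = ∑ k : {k // k ∉ σ}, p.1 k • ν (coneSplitting hσ (Pi.single k.1 1)) := by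
  have h1 := map_splitting (coneSplitting_self hσ) ν p.1
  rw [coneSplitting_self] at h1
  rw [h1, ← Fintype.sum_subtype_add_sum_subtype (· ∈ σ)]
  convert zero_add _ using 2
  refine Finset.sum_eq_zero fun k _ => ?_
  rw [coneSplitting_single hσ k.2, map_zero, smul_zero]

/-! ### The classes of degree two -/

/-- The ray spanning the cone `τ_i`, if `deg φ_i = 2`. -/
theorem exists_tau_eq (i : {i // o.phiDeg i = 2}) : ∃ l, o.tau i = {l} := by
  refine Finset.card_eq_one.1 ?_
  have h := i.2
  rw [phiDeg] at h
  omega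

/-- The ray spanning the cone `τ_i`, if `deg φ_i = 2`. -/
def tauRay (i : {i // o.phiDeg i = 2}) : Fin d := (o.exists_tau_eq i).choose

theorem tau_eq (i : {i // o.phiDeg i = 2}) : o.tau i = {o.tauRay i} :=
  (o.exists_tau_eq i).choose_spec

/-- If `τ_i ⊆ σ_0` then `i = 0`, but `τ_0` is empty. -/
theorem tauRay_notMem (i : {i // o.phiDeg i = 2}) : o.tauRay i ∉ (o.cone 0).1 := by
  intro h
  have h1 : i.1 ≤ 0 := o.le_of_tau_subset (by
    rw [o.tau_eq i]
    exact Finset.singleton_subset_iff.2 h)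
  have h2 := i.2
  rw [Fin.le_zero_iff.1 h1, phiDeg_zero] at h2
  omega

/-- A face `τ_i` determines `i`, as equality of two of them gives both inequalities. Conversely the
face of a ray outside `σ_0` lies in an interval `[τ_i, σ_i]`, where `τ_i` cannot be empty because
that would mean `i = 0`. The degree two classes thus match a basis of the dual of `A_1(Y, ℤ)`. -/
theorem tauRay_bijective : Function.Bijective
    (fun i : {i // o.phiDeg i = 2} => (⟨o.tauRay i, o.tauRay_notMem i⟩ :
      {l // l ∉ (o.cone 0).1})) := by
  constructor
  · intro i j hij
    have hij : o.tauRay i = o.tauRay j := congrArg Subtype.val hij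
    have h1 : o.tau i = o.tau j := by rw [o.tau_eq i, o.tau_eq j, hij]
    refine Subtype.ext (le_antisymm ?_ ?_)
    · exact o.le_of_tau_subset (h1 ▸ o.tau_subset j)
    · exact o.le_of_tau_subset (h1 ▸ o.tau_subset i)
  · rintro ⟨l, hl⟩
    obtain ⟨σ, hσ, hlσ⟩ := Δ.ray_mem l
    obtain ⟨i, h1, h2⟩ := o.exists_interval (γ := {l}) (j := o.cone.symm ⟨σ, hσ⟩) (by
      rw [Equiv.apply_symm_apply]
      exact Finset.singleton_subset_iff.2 hlσ)
    have h3 : o.tau i = {l} := by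
      rcases Finset.subset_singleton_iff.1 h1 with h0 | h0
      · have h4 : i ≤ 0 := o.le_of_tau_subset (by rw [h0]; exact Finset.empty_subset _)
        rw [Fin.le_zero_iff.1 h4] at h2
        exact absurd (Finset.singleton_subset_iff.1 h2) hl
      · exact h0
    refine ⟨⟨i, by rw [phiDeg, h3, Finset.card_singleton]; rfl⟩, Subtype.ext ?_⟩
    have h5 := o.tau_eq ⟨i, by rw [phiDeg, h3, Finset.card_singleton]; rfl⟩
    exact (Finset.singleton_injective (h3.symm.trans h5)).symm

end SmoothCompleteFan.ConeOrder

/-! ### Inverting matrices congruent to the identity -/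

namespace laurentTower

variable {A : Type*} [CommRing A] {J : Ideal A} {ι : Type*} [Fintype ι]

theorem eq_zero_of_add_mulVecEnd {M : Matrix ι ι (laurentTower A J)}
    (hM : ∀ i j, M i j ∈ fil A J 1) {v : ι → laurentTower A J} (h : v + mulVecEnd M v = 0) :
    v = 0 := by
  refine (filtComplete_filPi ι).eq_zero_of_fixed (ν := -mulVecEnd M)
    (fun k x hx => neg_mem (mulVecEnd_mem hM k hx)) ?_
  exact (eq_neg_of_add_eq_zero_left h).symm

/-- The terms of the geometric series keep the exponents of `u` in `S`, and this condition passes to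
the limit. -/
theorem exists_add_mulVecEnd {M : Matrix ι ι (laurentTower A J)}
    (hM : ∀ i j, M i j ∈ fil A J 1) {S : AddSubmonoid ℤ} (hS : ∀ i j, M i j ∈ supportedIn A J S)
    {w : ι → laurentTower A J} (hw : ∀ i, w i ∈ supportedIn A J S) :
    ∃ v, (∀ i, v i ∈ supportedIn A J S) ∧ v + mulVecEnd M v = w := by
  obtain ⟨v, hv, hv'⟩ := (filtComplete_filPi ι).exists_sub_eq (ν := -mulVecEnd M)
    (fun k x hx => neg_mem (mulVecEnd_mem hM k hx)) w
  refine ⟨v, fun i => fil_closed_supportedIn fun k => ⟨_, ?_, mem_filPi.1 (hv' k) i⟩, ?_⟩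
  · rw [Finset.sum_apply]
    refine sum_mem fun s hs => ?_
    clear hs
    induction s generalizing i with
    | zero => exact hw i
    | succ s ih =>
      rw [pow_succ' (-mulVecEnd M) s]
      change -(mulVecEnd M (((-mulVecEnd M) ^ s) w)) i ∈ _
      rw [mulVecEnd_apply]
      exact neg_mem (sum_mem fun j _ => mul_mem (hS i j) (ih j))
  · rw [← hv]
    exact (sub_neg_eq_add _ _).symm

end laurentTower

namespace SmoothCompleteFan.ConeOrder

open laurentTower

variable {n d r : ℕ} {Δ : SmoothCompleteFan n d} (o : Δ.ConeOrder r) (hΔ : Δ.IsProjective)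

/-! ### The quotient of `ℋ_F` by `u` -/

/-- The constant coefficient of the `i`-th coordinate of a class in the frame of the `φ_j`. -/
def zcoord (i : Fin (r + 1)) : o.HPM →+ o.RPM :=
  zeroPart.comp ((Pi.evalAddMonoidHom (fun _ : Fin (r + 1) => o.RPM) i).comp
    (o.frame hΔ).symm.toLinearMap.toAddMonoidHom)

theorem zcoord_apply (i : Fin (r + 1)) (x : o.HPM) :
    o.zcoord hΔ i x = zeroPart ((o.frame hΔ).symm x i) := rfl

theorem zcoord_comb (i : Fin (r + 1)) (v : Fin (r + 1) → o.RPM) :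
    o.zcoord hΔ i (o.comb v) = zeroPart (v i) := by
  rw [zcoord_apply, ← o.frame_apply hΔ, LinearEquiv.symm_apply_apply]

theorem zcoord_smul (i : Fin (r + 1)) (a : o.RHat) (x : o.HPM) :
    o.zcoord hΔ i (((a : o.RPlus) : o.RPM) • x) = ((a : o.RPlus) : o.RPM) * o.zcoord hΔ i x := by
  have ha : ((a : o.RPlus) : o.RPM) ∈ supportedIn o.BaseRing o.baseIdeal ⊥ := a.2
  rw [zcoord_apply, map_smul, Pi.smul_apply, smul_eq_mul, zeroPart_mul ha]
  rfl

theorem zcoord_smul_mem (i : Fin (r + 1)) {a : o.RPM} (ha : a ∈ fil o.BaseRing o.baseIdeal 1)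
    (x : o.HPM) : o.zcoord hΔ i (a • x) ∈ fil o.BaseRing o.baseIdeal 1 := by
  rw [zcoord_apply, map_smul, Pi.smul_apply, smul_eq_mul, mul_comm]
  exact zeroPart_fil (mul_mem_fil_right _ ha)

theorem zcoord_incl_phiHF (i k : Fin (r + 1)) :
    o.zcoord hΔ i (o.incl (o.phiHF k)) = if i = k then 1 else 0 := by
  rw [← comb_single, zcoord_comb, Pi.single_apply]
  split_ifs
  · exact zeroPart_of_mem (one_mem _)
  · exact map_zero _

/-- The `φ_j` form a frame of `ℋ_F` over power series in `u`, so divisibility by `u` is read off the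
constant coefficients of the coordinates. -/
theorem mem_uHF_iff (x : o.HF) : x ∈ o.uHF ↔ ∀ i, o.zcoord hΔ i (o.incl x) = 0 := by
  constructor
  · rintro ⟨y, rfl⟩ i
    obtain ⟨c, hc⟩ := o.exists_incl_eq_comb hΔ y
    change o.zcoord hΔ i (o.incl (o.uPlus • y)) = 0
    rw [incl_smul, hc, ← LinearMap.map_smul, zcoord_comb, zeroPart_eq_zero_iff]
    · exact ⟨_, (c i).2, rfl⟩
    · exact mul_mem o.uPlus.2 (c i).2
  · intro h
    obtain ⟨c, rfl⟩ := o.combHF_surjective hΔ x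
    simp only [incl_combHF, zcoord_comb] at h
    choose y hy hy' using fun i => (zeroPart_eq_zero_iff (c i).2).1 (h i)
    refine ⟨o.combHF fun i => ⟨y i, hy i⟩, ?_⟩
    change o.uPlus • o.combHF _ = _
    rw [← LinearMap.map_smul]
    congr 1
    funext i
    exact Subtype.ext (hy' i).symm

/-! ### The Kodaira-Spencer map -/

variable {π : (Fin d → ℤ) →+ Δ.curveLattice}
  {DE : o.HfPM →ₛₗ[(ofLaurent : LaurentSeries ℂ →+* o.RPM)] o.HPM}
  {B : Matrix (Fin (r + 1)) (Fin (r + 1)) o.RPM}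
  {C : Matrix (Fin (r + 1)) (Fin (r + 1)) o.RPlus}

/-- Both the purely negative correction in the column of `B` and the matrix of `DE` minus the
identity have positive order; hence `ζ` is `φ_0` modulo `𝓘`. -/
theorem entry_sub_mem (hΔ : Δ.IsProjective) (hDE : o.IsDeligneExtension π DE)
    (hB : o.IsBirkhoff DE B C) (i : Fin (r + 1)) :
    (C i 0 : o.RPM) - (if i = 0 then 1 else 0) ∈ fil o.BaseRing o.baseIdeal 1 := by
  choose y hy e using o.exists_entry hB
  have h1 : o.comb (fun i => B i 0 + mulVecEnd (o.deMatrix hΔ DE) (fun i => B i 0) i) =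
      o.comb fun i => (C i 0 : o.RPM) := by
    rw [← o.sum_smul_DE hΔ, hB.eq, comb_apply]
  have h2 : ∀ i, B i 0 + mulVecEnd (o.deMatrix hΔ DE) (fun i => B i 0) i = (C i 0 : o.RPM) :=
    congrFun (o.comb_injective hΔ h1)
  have h3 : (fun i => B i 0) = (fun i => if i = 0 then 1 else 0) + fun i => uInv * y i :=
    funext e
  have h4 := mem_fil_of_add_mem_plus (o.deMatrix_mem hΔ hDE) (e := fun i => if i = 0 then 1 else 0)
    (v := fun i => uInv * y i) (fun i => negPart_eq_self_iff.2 ⟨y i, hy i, rfl⟩)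
    (fun i => by
      change (if i = 0 then 1 else 0 : o.RPM) ∈ _
      split_ifs
      exacts [one_mem _, zero_mem _])
    (fun i => by
      rw [← h3]
      exact (h2 i).symm ▸ (C i 0).2) i
  rw [← h2 i, e i, add_assoc, add_sub_cancel_left]
  exact add_mem h4 (mem_filPi.1 (mulVecEnd_mem (o.deMatrix_mem hΔ hDE) 0
    (by rw [(filtComplete_filPi _).zero]; trivial)) i)

/-- In the Leibniz rule the derivative of a coefficient comes with a factor `u` and is invisible to
the constant coefficient. What remains is multiplied by coefficients in `𝓘`. -/
theorem zcoord_twistHPM_zeta (hDE : o.IsDeligneExtension π DE) (hB : o.IsBirkhoff DE B C)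
    (D : Derivation ℂ o.TotalRing o.TotalRing)
    (hD : ∀ i a, D (o.thetaRel i a) = o.thetaRel i (D a))
    (D₀ : Derivation ℂ o.BaseRing o.BaseRing)
    (h₀ : ∀ a, D (o.structureMap a) = o.structureMap (D₀ a)) (i : Fin (r + 1)) :
    o.zcoord hΔ i (o.twistHPM D hD (o.incl (o.zeta C))) -
      o.zcoord hΔ i (o.twistHPM D hD (o.incl (o.phiHF 0))) ∈ fil o.BaseRing o.baseIdeal 1 := by
  have h1 : o.twistHPM D hD (o.incl (o.zeta C)) - o.twistHPM D hD (o.incl (o.phiHF 0)) =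
      o.comb (fun j => u * deriv D₀ (C j 0 : o.RPM)) +
        ∑ j, ((C j 0 : o.RPM) - if j = 0 then 1 else 0) • o.twistHPM D hD (o.incl (o.phiHF j)) := by
    rw [zeta, incl_combHF, comb_apply, comb_apply, map_sum]
    simp only [sub_smul, Finset.sum_sub_distrib, ite_smul, one_smul, zero_smul, Finset.sum_ite_eq',
      Finset.mem_univ, if_true]
    rw [← add_sub_assoc, ← Finset.sum_add_distrib]
    congr 1
    exact Finset.sum_congr rfl fun j _ => o.twistHPM_smul D hD D₀ h₀ _ _
  rw [← map_sub, h1, map_add, zcoord_comb, map_sum]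
  have h2 : deriv D₀ (C i 0 : o.RPM) ∈ o.RPlus := deriv_mem _ D₀ (C i 0).2
  have h3 : zeroPart (u * deriv D₀ (C i 0 : o.RPM)) = 0 :=
    (zeroPart_eq_zero_iff (mul_mem o.uPlus.2 h2)).2 ⟨_, h2, rfl⟩
  rw [h3, zero_add]
  exact sum_mem fun j _ => o.zcoord_smul_mem hΔ i (o.entry_sub_mem hΔ hDE hB j) _

theorem phi_zero : o.phi 0 = 1 := by
  have h : o.tau 0 = ∅ := o.tau_zero
  rw [phi_eq_coneE, h]
  have h1 : (exponent (∅ : Finset (Fin d)) : Fin d → ℤ) = 0 := funext fun i => by simp [exponent]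
  rw [h1, o.coneE_of 0 ⟨fun _ => le_rfl, (o.cone 0).1, (o.cone 0).2, fun _ _ => rfl⟩]
  rfl

theorem partialT_coneMonomial (i : o.BigIndex) {S σ : Finset (Fin d)} (hσ : σ ∈ Δ.maxCones)
    (h : S ⊆ σ) : o.partialT i (o.coneMonomial hσ h) = 0 := by
  rw [coneMonomial, partialT, tDerivation_single]
  simp

theorem partialT_F (i : o.BigIndex) : o.partialT i o.F = o.phi i := by
  have h1 : ∀ k : o.BigIndex, o.partialT i (o.structureMap (o.t k)) = if k = i then 1 else 0 := by
    intro k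
    rw [partialT_structureMap, t, tDerivation_single]
    split_ifs with hk
    · subst hk
      simp only [Finsupp.single_eq_same, Nat.cast_one, mul_one, tsub_self]
      exact map_one o.structureMap
    · simp [hk]
  rw [F, map_add, f, map_sum, map_sum, Finset.sum_eq_zero, zero_add, Finset.sum_eq_single i]
  · rw [Derivation.leibniz, h1, if_pos rfl, phi, partialT_coneMonomial, smul_zero, zero_add,
      smul_eq_mul, mul_one]
  · intro k _ hk
    rw [Derivation.leibniz, h1, if_neg hk, phi, partialT_coneMonomial, smul_zero, smul_zero,
      add_zero]
  · exact fun h => absurd (Finset.mem_univ i) h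
  · exact fun j _ => o.partialT_coneMonomial i _ _

/-- Here `φ_0 = 1` and `∂F/∂t_i = φ_i`. -/
theorem twistHPM_partialT_phi_zero (i : o.BigIndex) :
    o.twistHPM (o.partialT i) (fun k => o.thetaRel_comm_partialT k i) (o.incl (o.phiHF 0)) =
      o.incl (o.phiHF i) := by
  have hQ : ∀ x, o.QF (degreeZero n x) = 0 := fun x => koszul_degreeZero o.qOp x
  have h1 : o.incl (o.phiHF 0) = Coh.mk o.QF ⊤ (degreeZero n (const (o.phi 0)))
      (hQ _) Submodule.mem_top := rfl
  have h2 : o.incl (o.phiHF i) = Coh.mk o.QF ⊤ (degreeZero n (const (o.phi i)))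
      (hQ _) Submodule.mem_top := rfl
  rw [h1, h2]
  refine (o.twistHPM_mk _ _ (hQ _)).trans (Coh.mk_congr _ Submodule.mem_top ?_)
  rw [onCoeffs_degreeZero]
  congr 1
  change u * deriv (o.partialT i) (const (o.phi 0)) +
    const (o.partialT i o.F) * const (o.phi 0) = const (o.phi i)
  rw [partialT_F, phi_zero, const_one, mul_one]
  have h3 : deriv (o.partialT i) (1 : o.OPM) = 0 := by
    rw [← map_one (ofLaurent : LaurentSeries ℂ →+* o.OPM), deriv_ofLaurent]
  rw [h3, mul_zero, zero_add]

/-- The images of the frame of logarithmic vector fields dual to the `φ_k`. -/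
def ksVector (π : (Fin d → ℤ) →+ Δ.curveLattice) (x : o.HPM) (k : Fin (r + 1)) : o.HPM :=
  if h : o.phiDeg k = 2 then
    ∑ j, (π (Pi.single j 1)).1 (o.tauRay ⟨k, h⟩) •
      o.twistHPM (o.theta j) (fun i => o.thetaRel_comm_theta i j) x
  else o.twistHPM (o.partialT ⟨k, h⟩) (fun i => o.thetaRel_comm_partialT i _) x

/-- Modulo `𝓘` the form `ζ` may be replaced by `φ_0 = 1`. For a parameter `t_k` the result is `φ_k`.
For a ray `l`, linear equivalence reduces the combination of the `u θ_j + z_j` to `u θ_l + z_l`,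
which sends `1` to `z_l = φ_k`. -/
theorem zcoord_ksVector (hπ : ∀ p : Δ.curveLattice, π p = p) (hDE : o.IsDeligneExtension π DE)
    (hB : o.IsBirkhoff DE B C) (i k : Fin (r + 1)) :
    o.zcoord hΔ i (o.ksVector π (o.incl (o.zeta C)) k) - (if i = k then 1 else 0) ∈
      fil o.BaseRing o.baseIdeal 1 := by
  by_cases hk : o.phiDeg k = 2
  · rw [ksVector, dif_pos hk]
    have h1 : o.reduce (∑ j, (π (Pi.single j 1)).1 (o.tauRay ⟨k, hk⟩) •
        o.twistHPM (o.theta j) (fun i => o.thetaRel_comm_theta i j) (o.incl (o.phiHF 0))) =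
        o.reduce (o.incl (o.phiHF k)) := by
      set l := o.tauRay ⟨k, hk⟩ with hl
      have h2 : o.phiHf 0 = o.sq ∅ := by rw [phiHf_eq_sq, tau_zero]
      have h3 : o.phiHf k = o.twistHf l (o.sq ∅) := by
        rw [o.twistHf_sq ⟨(o.cone 0).1, (o.cone 0).2, Finset.empty_subset _⟩
          (Finset.notMem_empty l), phiHf_eq_sq]
        congr 1
        exact o.tau_eq ⟨k, hk⟩
      simp only [map_sum, map_zsmul, reduce_twistHPM_theta, reduce_incl_phiHF]
      rw [h2, h3]
      -- The functional `x ↦ (π x)_l - x_l` vanishes on curve classes, so it comes from the dual of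
      -- `N` and yields a relation among the twists.
      let f : (Fin d → ℤ) →+ ℤ := (Pi.evalAddMonoidHom (fun _ : Fin d => ℤ) l).comp
        (Δ.curveLattice.subtype.comp π - AddMonoidHom.id _)
      obtain ⟨m, hm⟩ := exists_dotProduct_eq (o.cone 0).2 f (fun p => by
        change (π p).1 l - p.1 l = 0
        rw [hπ, sub_self])
      have h4 := o.sum_smul_twistHf m (o.fiberMonomial 0 (o.fiberE (exponent ∅)))
      have h5 : ∀ j, m ⬝ᵥ Δ.ray j = (π (Pi.single j 1)).1 l - (Pi.single j 1 : Fin d → ℤ) l :=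
        fun j => (hm j).symm
      simp only [h5, sub_smul, Finset.sum_sub_distrib] at h4
      rw [sub_eq_zero] at h4
      refine h4.trans ?_
      rw [Finset.sum_eq_single l]
      · rw [Pi.single_eq_same, one_smul]
        rfl
      · intro j _ hj
        rw [Pi.single_eq_of_ne hj.symm, zero_smul]
      · exact fun h => absurd (Finset.mem_univ l) h
    rw [← sub_eq_zero, ← map_sub] at h1
    obtain ⟨v, hv⟩ := o.comb_surjective hΔ ((∑ j, (π (Pi.single j 1)).1 (o.tauRay ⟨k, hk⟩) •
        o.twistHPM (o.theta j) (fun i => o.thetaRel_comm_theta i j) (o.incl (o.phiHF 0))) -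
        o.incl (o.phiHF k))
    rw [← hv, o.reduce_comb_eq_zero_iff hΔ] at h1
    have h6 := zeroPart_fil (h1 i)
    rw [← o.zcoord_comb hΔ, hv, map_sub, zcoord_incl_phiHF] at h6
    -- The deviation is split into that between `ζ` and `φ_0` and that between the image of `φ_0`
    -- and `φ_k`.
    refine (sub_add_sub_cancel _ _ _ : _ = (_ : o.RPM)) ▸ add_mem ?_ h6
    rw [map_sum, map_sum, ← Finset.sum_sub_distrib]
    refine sum_mem fun j _ => ?_
    rw [map_zsmul, map_zsmul, ← smul_sub]
    exact zsmul_mem (o.zcoord_twistHPM_zeta hΔ hDE hB _ _ _ (o.theta_structureMap j) i) _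
  · have h1 := o.zcoord_twistHPM_zeta hΔ hDE hB (o.partialT ⟨k, hk⟩)
      (fun i => o.thetaRel_comm_partialT i _) _ (o.partialT_structureMap _) i
    rw [twistHPM_partialT_phi_zero, zcoord_incl_phiHF] at h1
    rw [ksVector, dif_neg hk]
    exact h1

/-- The logarithmic vector field with coordinates `w` in the frame dual to the `φ_k`. -/
def ksField (w : Fin (r + 1) → o.RHat) : o.LogFields :=
  (∑ i : {i // o.phiDeg i = 2}, (AddMonoidHom.mulLeft (w i)).comp ((Int.castAddHom o.RHat).comp
    ((Pi.evalAddMonoidHom (fun _ : Fin d => ℤ) (o.tauRay i)).comp Δ.curveLattice.subtype)),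
    fun i => w i)

theorem ksField_fst (w : Fin (r + 1) → o.RHat) (p : Δ.curveLattice) :
    (o.ksField w).1 p = ∑ i : {i // o.phiDeg i = 2}, p.1 (o.tauRay i) • w i := by
  change (∑ i : {i // o.phiDeg i = 2}, (AddMonoidHom.mulLeft (w i)).comp
    ((Int.castAddHom o.RHat).comp ((Pi.evalAddMonoidHom (fun _ : Fin d => ℤ)
      (o.tauRay i)).comp Δ.curveLattice.subtype))) p = _
  rw [AddMonoidHom.finsetSum_apply]
  refine Finset.sum_congr rfl fun i _ => ?_
  rw [zsmul_eq_mul, mul_comm]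
  rfl

/-- The rays `τ_i` of degree two run through all rays outside `σ_0`, and these give coordinates on
the curve lattice. -/
theorem ksField_surjective : Function.Surjective o.ksField := by
  rintro ⟨ν, τ⟩
  refine ⟨fun i => if h : o.phiDeg i = 2 then
    ν (coneSplitting (o.cone 0).2 (Pi.single (o.tauRay ⟨i, h⟩) 1)) else τ ⟨i, h⟩, ?_⟩
  refine Prod.ext (AddMonoidHom.ext fun p => ?_) (funext fun i => dif_neg i.2)
  rw [ksField_fst]
  refine Eq.trans ?_ (map_curveLattice (o.cone 0).2 ν p).symm
  refine Eq.trans ?_ (o.tauRay_bijective.sum_comp fun k : {l // l ∉ (o.cone 0).1} =>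
    p.1 k • ν (coneSplitting (o.cone 0).2 (Pi.single k.1 1)))
  refine Finset.sum_congr rfl fun i _ => ?_
  rw [dif_pos i.2]

theorem incl_uNablaHF (v : o.LogFields) (x : o.HF) : o.incl (o.uNablaHF π v x) =
    ∑ j, ((v.1 (π (Pi.single j 1)) : o.RPlus) : o.RPM) •
      o.twistHPM (o.theta j) (fun i => o.thetaRel_comm_theta i j) (o.incl x) +
    ∑ j, ((v.2 j : o.RPlus) : o.RPM) •
      o.twistHPM (o.partialT j) (fun i => o.thetaRel_comm_partialT i j) (o.incl x) := by
  have h : ∀ (D : Derivation ℂ o.TotalRing o.TotalRing)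
      (hD : ∀ i a, D (o.thetaRel i a) = o.thetaRel i (D a)),
      o.incl (o.twistHF D hD x) = o.twistHPM D hD (o.incl x) := by
    intro D hD
    obtain ⟨α, hα, hα', rfl⟩ := Coh.exists_rep x
    rfl
  rw [uNablaHF, map_add, map_sum, map_sum]
  congr 1
  · exact Finset.sum_congr rfl fun j _ => (o.incl_smul _ _).trans (by rw [h])
  · exact Finset.sum_congr rfl fun j _ => (o.incl_smul _ _).trans (by rw [h])

theorem incl_uNablaHF_ksField (w : Fin (r + 1) → o.RHat) (x : o.HF) :
    o.incl (o.uNablaHF π (o.ksField w) x) =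
      ∑ k, ((w k : o.RPlus) : o.RPM) • o.ksVector π (o.incl x) k := by
  rw [incl_uNablaHF, ← Fintype.sum_subtype_add_sum_subtype (fun k => o.phiDeg k = 2)]
  congr 1
  · have h1 : ∀ j, (((o.ksField w).1 (π (Pi.single j 1)) : o.RPlus) : o.RPM) =
        ∑ i : {i // o.phiDeg i = 2}, (π (Pi.single j 1)).1 (o.tauRay i) •
          ((w i : o.RPlus) : o.RPM) := by
      intro j
      rw [ksField_fst, AddSubmonoidClass.coe_finsetSum, AddSubmonoidClass.coe_finsetSum]
      rfl
    simp only [h1, Finset.sum_smul]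
    rw [Finset.sum_comm]
    refine Finset.sum_congr rfl fun i _ => ?_
    rw [ksVector, dif_pos i.2, Finset.smul_sum]
    refine Finset.sum_congr rfl fun j _ => ?_
    rw [smul_assoc, smul_comm]
  · refine Finset.sum_congr rfl fun i _ => ?_
    rw [ksVector, dif_neg i.2]
    rfl

/-- In the frame of fields indexed by the `φ_k` and the frame `φ_i` of `ℋ_F / u ℋ_F` the map has
matrix `1 + N` with `N` divisible by `𝓘`. -/
theorem exists_kodairaSpencer (hΔ : Δ.IsProjective) (hπ : ∀ p : Δ.curveLattice, π p = p)
    (hDE : o.IsDeligneExtension π DE) (hB : o.IsBirkhoff DE B C) :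
    ∃ KS : o.LogFields ≃ₗ[o.RHat] (o.HF ⧸ o.uHF),
      ∀ v, KS v = Submodule.Quotient.mk (o.uNablaHF π v (o.zeta C)) := by
  let N : Matrix (Fin (r + 1)) (Fin (r + 1)) o.RPM := fun i k =>
    o.zcoord hΔ i (o.ksVector π (o.incl (o.zeta C)) k) - if i = k then 1 else 0
  have hN : ∀ i k, N i k ∈ fil o.BaseRing o.baseIdeal 1 := o.zcoord_ksVector hΔ hπ hDE hB
  -- The entries are constant in `u`, so the inverse is defined over `𝓡^` itself.
  have hN' : ∀ i k, N i k ∈ supportedIn o.BaseRing o.baseIdeal ⊥ := fun i k =>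
    sub_mem (zeroPart_mem _) (by
      split_ifs
      exacts [one_mem _, zero_mem _])
  have key : ∀ (w : Fin (r + 1) → o.RHat) i,
      o.zcoord hΔ i (o.incl (o.uNablaHF π (o.ksField w) (o.zeta C))) =
        ((fun i => ((w i : o.RPlus) : o.RPM)) +
          mulVecEnd N fun i => ((w i : o.RPlus) : o.RPM)) i := by
    intro w i
    rw [incl_uNablaHF_ksField, map_sum, Pi.add_apply, mulVecEnd_apply]
    simp only [zcoord_smul]
    have h1 : ∀ k, ((w k : o.RPlus) : o.RPM) *
        o.zcoord hΔ i (o.ksVector π (o.incl (o.zeta C)) k) =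
        (if i = k then ((w k : o.RPlus) : o.RPM) else 0) + N i k * ((w k : o.RPlus) : o.RPM) := by
      intro k
      simp only [N]
      split_ifs <;> ring
    rw [Finset.sum_congr rfl fun k _ => h1 k, Finset.sum_add_distrib, Finset.sum_ite_eq,
      if_pos (Finset.mem_univ i)]
  let Ψ : o.LogFields →ₗ[o.RHat] (o.HF ⧸ o.uHF) :=
    { toFun := fun v => Submodule.Quotient.mk (o.uNablaHF π v (o.zeta C))
      map_add' := fun v w => by
        rw [← Submodule.Quotient.mk_add]
        congr 1
        simp only [uNablaHF, Prod.fst_add, Prod.snd_add, AddMonoidHom.add_apply, Pi.add_apply,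
          add_smul, Finset.sum_add_distrib]
        abel
      map_smul' := fun a v => by
        rw [RingHom.id_apply, ← Submodule.Quotient.mk_smul]
        congr 1
        simp only [uNablaHF, smul_add, Finset.smul_sum, smul_smul]
        rfl }
  refine ⟨LinearEquiv.ofBijective Ψ ⟨?_, ?_⟩, fun v => rfl⟩
  · refine (injective_iff_map_eq_zero Ψ).2 fun v hv => ?_
    obtain ⟨w, rfl⟩ := o.ksField_surjective v
    have h1 := (o.mem_uHF_iff hΔ _).1 ((Submodule.Quotient.mk_eq_zero _).1 hv)
    have h2 := eq_zero_of_add_mulVecEnd hN (v := fun i => ((w i : o.RPlus) : o.RPM))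
      (funext fun i => by rw [← key, h1]; rfl)
    have h3 : w = 0 := funext fun i => Subtype.ext (Subtype.ext (congrFun h2 i))
    rw [h3]
    refine Prod.ext (AddMonoidHom.ext fun p => ?_) rfl
    rw [ksField_fst]
    exact Finset.sum_eq_zero fun i _ => smul_zero _
  · intro y
    obtain ⟨x, rfl⟩ := Submodule.Quotient.mk_surjective _ y
    obtain ⟨v, hv, hv'⟩ := exists_add_mulVecEnd hN hN' (w := fun i => o.zcoord hΔ i (o.incl x))
      fun i => zeroPart_mem _
    have hp : ∀ i, v i ∈ o.RPlus := fun i k j hj => hv i k j fun h => hj (by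
      rw [AddSubmonoid.mem_bot.1 h]
      exact zero_mem _)
    refine ⟨o.ksField fun i => ⟨⟨v i, hp i⟩, hv i⟩, ?_⟩
    refine (Submodule.Quotient.eq _).2 ((o.mem_uHF_iff hΔ _).2 fun i => ?_)
    rw [map_sub, map_sub, key, sub_eq_zero]
    exact congrFun hv' i

end SmoothCompleteFan.ConeOrder

/-! ### Existence of the primitive form -/

theorem mainTheorem5 {n d r : ℕ} (Δ : SmoothCompleteFan n d) (hΔ : Δ.IsProjective)
    (o : Δ.ConeOrder r) (π : (Fin d → ℤ) →+ Δ.curveLattice)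
    (hπ : ∀ p : Δ.curveLattice, π p = p) :
    Function.Injective o.incl ∧
    (∃ DE, o.IsDeligneExtension π DE) ∧
    ∀ DE, o.IsDeligneExtension π DE →
      (∃ B C, o.IsBirkhoff DE B C) ∧
      ∀ B C, o.IsBirkhoff DE B C →
        ∃ ζ : o.HF, o.incl ζ = o.phiTilde DE B 0 ∧ o.IsPrimitiveForm π DE ζ :=
  ⟨o.incl_injective hΔ, o.exists_isDeligneExtension hΔ π, fun _ hDE =>
    ⟨o.exists_isBirkhoff hΔ hDE, fun _ C hB => ⟨o.zeta C, o.incl_zeta hB,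
      { mem := o.zeta_mem hB
        nabla_mem := o.nabla_zeta_mem hπ hDE hB
        -- The weight is that of `φ_0 = 1`.
        homogeneous := ⟨0, by rw [o.eulerHF_zeta hΔ hDE hB, zero_smul]⟩
        kodairaSpencer := o.exists_kodairaSpencer hΔ hπ hDE hB }⟩⟩⟩

end
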